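/- Let $k$ be a field, $V$ a finite dimensional $k$-vector space, $R\subseteq V\otimes V$ a subspace, and $A=T(V)/(R)$ the quadratic algebra, augmented by $A\to A_0=k$. Let $A^{¡}=\bigoplus_n A^{¡}_n$ be its Koszul dual coalgebra, $A^{¡}_n=\bigcap_{i+2+j=n}V^{\otimes i}\otimes R\otimes V^{\otimes j}\subseteq V^{\otimes n}$ (so $A^{¡}_0=k$, $A^{¡}_1=V$), with the deconcatenation coproduct $\Delta c=\sum c'\otimes c''$; let $\varepsilon$ be its counit (also used for augmentations) and $|c|=n$ for $c\in A^{¡}_n$. Assume that $A$ is Koszul, i.e. that the complex $\cdots\to A\otimes A^{¡}_2\to A\otimes A^{¡}_1\to A\to k\to 0$ with differential $a\otimes v_1\cdots v_n\mapsto av_1\otimes v_2\cdots v_n$ is exact. Let $\sigma$ be a degree-preserving algebra automorphism of $A$ which is semisimple (diagonalizable). It induces automorphisms, also denoted $\sigma$, of $A^{¡}$ and of the cobar construction $\Omega=\Omega(A^{¡})$, the tensor algebra on the letters $s^{-1}c$, $c\in\ker\varepsilon$, with $|s^{-1}c|=|c|-1$ and the differential with $d(s^{-1}c)=\sum(-1)^{|c'|}s^{-1}c'\,s^{-1}c''$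 (put $s^{-1}1=0$). Let $q:\Omega\to A$ be the algebra map induced by the projection $A^{¡}\to V\subseteq A$. For an augmented dg algebra $E$ ($E=\Omega$, or $E=A$ in degree $0$ with $d=0$) with automorphism $\sigma$ and augmentation ideal $\bar E$, let $\mathrm{CH}_\bullet(E;E_\sigma)=\bigoplus_{n\ge0}E\otimes\bar E^{\otimes n}$; $(a_0,\dots,a_n)$ has degree $|a_0|+\dots+|a_n|+n$. With $e_i=|a_0|+\dots+|a_i|+i$, put $$b(a_0,\dots,a_n)=(da_0,\dots)-\sum_{i=1}^n(-1)^{e_{i-1}}(\dots,da_i,\dots)+(-1)^{|a_0|}(a_0\sigma(a_1),a_2,\dots)+\sum_{i=1}^{n-1}(-1)^{e_i}(\dots,a_ia_{i+1},\dots)-(-1)^{(|a_n|+1)e_{n-1}}(a_na_0,a_1,\dots,a_{n-1})$$ (the last three kinds of terms are absent for $n=0$), and $$B(a_0,\dots,a_n)=\sum_{i=1}^{n+1}\pm(1,a_i,\dots,a_n,a_0,\sigma(a_1),\dots,\sigma(a_{i-1})),$$ where entries equal to a multiple of $1$ in a position other than the first give $0$, and the sign is the Koszul sign of moving $a_i,\dots,a_n$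 in front of $a_0,\dots,a_{i-1}$, each $a$ having degree $|a|+1$. Let $\mathrm{CH}_\bullet(A^{¡};{}_\sigma A^{¡})=\Omega\otimes A^{¡}$, with $u\otimes c$ in degree $|u|+|c|$, and $$b(u\otimes c)=du\otimes c+\sum(-1)^{|u|}u\,s^{-1}\sigma(c')\otimes c''-\sum(-1)^{|c''|(|u|+|c'|)}s^{-1}c''\,u\otimes c',\qquad B(u\otimes c)=\varepsilon(c)\,\mathrm{rot}(1,u).$$ Here, for $u\in\Omega$ and a word $v=v_1\cdots v_m$ of letters $v_i=s^{-1}c_i$, $$\mathrm{rot}(u,v)=\sum_{i=1}^m(-1)^{|v'|+|v''|(|u|+|v'|+|c_i|)}\,v''\,u\,\sigma(v')\otimes c_i,\qquad v'=v_1\cdots v_{i-1},\ v''=v_{i+1}\cdots v_m .$$ In each case let $\mathrm{CH}^1_\bullet$ be the span of the tensors whose entries (in $\Omega\otimes A^{¡}$: the letters of $u$, and $c$) are eigenvectors of $\sigma$ with product of eigenvalues $1$. Define * $p_1:\mathrm{CH}(\Omega;\Omega_\sigma)\to\mathrm{CH}(A;A_\sigma)$, $(a_0,\dots,a_n)\mapsto(q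 a_0,\dots,q a_n)$; * $q_2:\mathrm{CH}(\Omega;\Omega_\sigma)\to\mathrm{CH}(A^{¡};{}_\sigma A^{¡})$, $(u)\mapsto u\otimes1$, $(u,v)\mapsto\mathrm{rot}(u,v)$, and $(u,a_1,\dots,a_r)\mapsto0$ for $r\ge2$; * $p_2:\mathrm{CH}(A^{¡};{}_\sigma A^{¡})\to\mathrm{CH}(\Omega;\Omega_\sigma)$, $p_2(u\otimes1)=(u)$ and $p_2(u\otimes c)=\sum_{j\ge1}\sum(u,s^{-1}c^{(1)},\dots,s^{-1}c^{(j)})$ for $\varepsilon(c)=0$, with the iterated reduced coproducts of $c$; * $h:\mathrm{CH}(\Omega;\Omega_\sigma)\to\mathrm{CH}(\Omega;\Omega_\sigma)$, $h(a_0)=0$ and, for $n\ge0$ and $v=v_1\cdots v_m$, $v_i=s^{-1}c_i$ as above, with $e=|a_0|+\sum_{l=1}^n(|a_l|+1)$, $$h(a_0,\dots,a_n,v)=\sum_{i=2}^m\sum_{j\ge1}\sum(-1)^{1+|v''|+e+|v'|+|v''|(e+|v'|+|c_i|)}\,(v''a_0,a_1,\dots,a_n,v',s^{-1}c_i^{(1)},\dots,s^{-1}c_i^{(j)}).$$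 Then $\mathrm{CH}^1_\bullet(\Omega;\Omega_\sigma)$, $\mathrm{CH}^1_\bullet(A;A_\sigma)$ and $\mathrm{CH}^1_\bullet(A^{¡};{}_\sigma A^{¡})$, with $b$ and $B$, are mixed complexes ($b$ of degree $-1$, $B$ of degree $1$, $b^2=B^2=bB+Bb=0$), and $$\mathrm{CH}^1_\bullet(A;A_\sigma)\xleftarrow{\;p_1\;}\mathrm{CH}^1_\bullet(\Omega;\Omega_\sigma)\xrightarrow{\;q_2\;}\mathrm{CH}^1_\bullet(A^{¡};{}_\sigma A^{¡})$$ are quasi-isomorphisms of mixed complexes: they preserve the degree, commute with $b$ and $B$, and induce isomorphisms on $b$-homology. Moreover $q_2$ is a homotopy inverse of $p_2$ with homotopy $h$: $p_2$ preserves $\mathrm{CH}^1$ and the degree and commutes with $b$; $h$ preserves $\mathrm{CH}^1$ and raises the degree by $1$; and $$q_2p_2=\mathrm{id},\qquad hb+bh=\mathrm{id}-p_2q_2 .$$ -/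

import Mathlib

open scoped TensorProduct

noncomputable section

namespace KoszulHH

universe u v w

/-! ### Words: linear maps out of a tensor algebra -/

section Words

variable {k : Type u} [Field k]
variable {M : Type v} [AddCommGroup M] [Module k M]

/-- The recursion step of `split`: it sends `(w, s)` to `(m w, 1 ⊗ m ⊗ w + m s)`. -/
def splitStep : M →ₗ[k] Module.End k
    (TensorAlgebra k M × (TensorAlgebra k M ⊗[k] (M ⊗[k] TensorAlgebra k M))) :=
  LinearMap.mk₂ k
    (fun m p => (TensorAlgebra.ι k m * p.1, (1 : TensorAlgebra k M) ⊗ₜ[k] (m ⊗ₜ[k] p.1) +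
      (LinearMap.mulLeft k (TensorAlgebra.ι k m)).rTensor _ p.2))
    (by
      intro m m' p
      have h : LinearMap.mulLeft k (TensorAlgebra.ι k m + TensorAlgebra.ι k m') =
        LinearMap.mulLeft k (TensorAlgebra.ι k m) + LinearMap.mulLeft k (TensorAlgebra.ι k m') := by
        ext; simp [add_mul]
      simp only [map_add, add_mul, TensorProduct.add_tmul, TensorProduct.tmul_add, h,
        LinearMap.rTensor_add, LinearMap.add_apply, Prod.mk_add_mk]
      congr 1
      abel)
    (by
      intro c m p
      have h : LinearMap.mulLeft k (c • TensorAlgebra.ι k m) =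
        c • LinearMap.mulLeft k (TensorAlgebra.ι k m) := by
        ext; simp
      simp only [map_smul, smul_mul_assoc, h, ← TensorProduct.smul_tmul', TensorProduct.tmul_smul,
        LinearMap.rTensor_smul, LinearMap.smul_apply, Prod.smul_mk, smul_add])
    (by
      intro m p q
      simp only [Prod.fst_add, Prod.snd_add, mul_add, TensorProduct.tmul_add, map_add,
        Prod.mk_add_mk]
      congr 1
      abel)
    (by
      intro c m p
      simp only [Prod.smul_fst, Prod.smul_snd, mul_smul_comm, TensorProduct.tmul_smul, map_smul,
        Prod.smul_mk, smul_add])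

/-- All ways to single out a letter of a word:
`x₁ ⋯ xₙ ↦ ∑ i, x₁ ⋯ xᵢ₋₁ ⊗ xᵢ ⊗ xᵢ₊₁ ⋯ xₙ`. -/
def split : TensorAlgebra k M →ₗ[k] TensorAlgebra k M ⊗[k] (M ⊗[k] TensorAlgebra k M) :=
  LinearMap.snd k _ _ ∘ₗ LinearMap.applyₗ (1, 0) ∘ₗ
    (TensorAlgebra.lift k (splitStep (k := k) (M := M))).toLinearMap

theorem lift_splitStep_fst (w : TensorAlgebra k M)
    (p : TensorAlgebra k M × (TensorAlgebra k M ⊗[k] (M ⊗[k] TensorAlgebra k M))) :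
    (TensorAlgebra.lift k (splitStep (k := k) (M := M)) w p).1 = w * p.1 := by
  induction w using TensorAlgebra.induction generalizing p with
  | algebraMap r => simp [Algebra.smul_def]
  | ι m => simp [splitStep]
  | mul a b ha hb => simp [ha, hb, mul_assoc]
  | add a b ha hb => simp [ha, hb, add_mul]

theorem split_one : split (1 : TensorAlgebra k M) = 0 := by
  simp [split]

theorem split_ι_mul (m : M) (w : TensorAlgebra k M) :
    split (TensorAlgebra.ι k m * w) = 1 ⊗ₜ[k] (m ⊗ₜ[k] w) +
      (LinearMap.mulLeft k (TensorAlgebra.ι k m)).rTensor _ (split w) := by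
  have h := lift_splitStep_fst w (1, 0)
  simp only [split, LinearMap.comp_apply, AlgHom.toLinearMap_apply, map_mul,
    TensorAlgebra.lift_ι_apply, LinearMap.applyₗ_apply_apply, Module.End.mul_apply,
    LinearMap.snd_apply]
  rw [mul_one] at h
  change 1 ⊗ₜ[k] (m ⊗ₜ[k] (TensorAlgebra.lift k splitStep w (1, 0)).1) + _ = _
  rw [h]

/-- The first letter: `x₁ ⋯ xₙ ↦ x₁ ⊗ x₂ ⋯ xₙ`, and `1 ↦ 0`. -/
def firstLetter : TensorAlgebra k M →ₗ[k] M ⊗[k] TensorAlgebra k M :=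
  (TensorProduct.lid k _).toLinearMap ∘ₗ
    (TensorAlgebra.algebraMapInv (R := k) (M := M)).toLinearMap.rTensor _ ∘ₗ split

/-- The last letter: `x₁ ⋯ xₙ ↦ x₁ ⋯ xₙ₋₁ ⊗ xₙ`, and `1 ↦ 0`. -/
def lastLetter : TensorAlgebra k M →ₗ[k] TensorAlgebra k M ⊗[k] M :=
  ((TensorProduct.rid k M).toLinearMap ∘ₗ
    (TensorAlgebra.algebraMapInv (R := k) (M := M)).toLinearMap.lTensor M).lTensor _ ∘ₗ split

/-- Deconcatenation: `x₁ ⋯ xₙ ↦ ∑ 0 ≤ i ≤ n, x₁ ⋯ xᵢ ⊗ xᵢ₊₁ ⋯ xₙ`. -/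
def deconc : TensorAlgebra k M →ₗ[k] TensorAlgebra k M ⊗[k] TensorAlgebra k M :=
  (TensorProduct.mk k _ _).flip 1 +
    (LinearMap.mul' k (TensorAlgebra k M) ∘ₗ (TensorAlgebra.ι k).rTensor _).lTensor _ ∘ₗ split

theorem deconc_one : deconc (1 : TensorAlgebra k M) = 1 ⊗ₜ[k] 1 := by
  simp [deconc, split_one]

theorem deconc_ι_mul (m : M) (w : TensorAlgebra k M) :
    deconc (TensorAlgebra.ι k m * w) = 1 ⊗ₜ[k] (TensorAlgebra.ι k m * w) +
      (LinearMap.mulLeft k (TensorAlgebra.ι k m)).rTensor _ (deconc w) := by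
  have h : ∀ s : TensorAlgebra k M ⊗[k] (M ⊗[k] TensorAlgebra k M),
      (LinearMap.mul' k (TensorAlgebra k M) ∘ₗ (TensorAlgebra.ι k).rTensor _).lTensor
        (TensorAlgebra k M) ((LinearMap.mulLeft k (TensorAlgebra.ι k m)).rTensor _ s) =
      (LinearMap.mulLeft k (TensorAlgebra.ι k m)).rTensor _
        ((LinearMap.mul' k (TensorAlgebra k M) ∘ₗ (TensorAlgebra.ι k).rTensor _).lTensor
          (TensorAlgebra k M) s) := by
    intro s
    simp only [← LinearMap.comp_apply, LinearMap.lTensor_comp_rTensor,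
      LinearMap.rTensor_comp_lTensor]
  simp only [deconc, LinearMap.add_apply, LinearMap.comp_apply, split_ι_mul, map_add]
  rw [h]
  simp
  abel

/-! ### Gradings and signs

A grading of a `k`-module `M` by natural numbers is recorded by the map
`c : M →ₗ[k] ℕ →₀ M` which sends an element to its family of homogeneous components;
so `x` is homogeneous of degree `n` iff `c x = Finsupp.single n x`. -/

/-- `x ↦ (-1) ^ |x| x` for homogeneous `x`. -/
def signOp (c : M →ₗ[k] ℕ →₀ M) : M →ₗ[k] M :=
  Finsupp.lsum k (fun n : ℕ => ((-1 : k) ^ n) • LinearMap.id) ∘ₗ c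

/-- The algebra map which sends a word of homogeneous letters of total degree `n` to that word
placed in degree `n`. -/
def tensorCompHom (c : M →ₗ[k] ℕ →₀ M) :
    TensorAlgebra k M →ₐ[k] AddMonoidAlgebra (TensorAlgebra k M) ℕ :=
  TensorAlgebra.lift k ((AddMonoidAlgebra.coeffLinearEquiv k).symm.toLinearMap ∘ₗ
    Finsupp.mapRange.linearMap (TensorAlgebra.ι k) ∘ₗ c)

/-- If `M` is graded by `c`, then the tensor algebra is graded so that a word of homogeneous
letters has the sum of the degrees of its letters as degree. -/
def tensorComp (c : M →ₗ[k] ℕ →₀ M) :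
    TensorAlgebra k M →ₗ[k] ℕ →₀ TensorAlgebra k M :=
  (AddMonoidAlgebra.coeffLinearEquiv k).toLinearMap ∘ₗ (tensorCompHom c).toLinearMap

/-- Regrading: elements of degree `n` get degree `f n`. -/
def regrade (f : ℕ → ℕ) (c : M →ₗ[k] ℕ →₀ M) : M →ₗ[k] ℕ →₀ M :=
  Finsupp.lmapDomain M k f ∘ₗ c

end Words

section Move

variable {k : Type u} [Field k]

/-- Moving a tensor factor `M` from the right end to the left end: `n ⊗ m ↦ m ⊗ s ^ |m| n`,
where `M` is graded by `c`. If `s` is the sign operator of `N`, this is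
`(-1) ^ (|m| |n|) m ⊗ n`. -/
def koszulMove {M : Type v} [AddCommMonoid M] [Module k M] {N : Type w} [AddCommMonoid N]
    [Module k N] (s : N →ₗ[k] N) (c : M →ₗ[k] ℕ →₀ M) : N ⊗[k] M →ₗ[k] M ⊗[k] N :=
  TensorProduct.lift
    ((Finsupp.lsum k (fun i : ℕ => (TensorProduct.mk k M N).compl₂ (s ^ i)) ∘ₗ c).flip)

end Move

/-! ### The reduced Hochschild complex of an augmented differential graded algebra -/

section Hochschild

variable {k : Type u} [Field k] {Ω : Type v} [Ring Ω] [Algebra k Ω]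

/-- The augmentation ideal. -/
def AugIdeal (ε : Ω →ₐ[k] k) : Type v := ↥(LinearMap.ker ε.toLinearMap)

instance (ε : Ω →ₐ[k] k) : AddCommGroup (AugIdeal ε) :=
  inferInstanceAs (AddCommGroup ↥(LinearMap.ker ε.toLinearMap))

instance (ε : Ω →ₐ[k] k) : Module k (AugIdeal ε) :=
  inferInstanceAs (Module k ↥(LinearMap.ker ε.toLinearMap))

/-- The inclusion of the augmentation ideal. -/
def augIncl (ε : Ω →ₐ[k] k) : AugIdeal ε →ₗ[k] Ω := (LinearMap.ker ε.toLinearMap).subtype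

/-- The projection `a ↦ a - ε(a) 1` onto the augmentation ideal. -/
def toAug (ε : Ω →ₐ[k] k) : Ω →ₗ[k] AugIdeal ε :=
  (LinearMap.id - Algebra.linearMap k Ω ∘ₗ ε.toLinearMap).codRestrict
    (LinearMap.ker ε.toLinearMap) (by intro x; simp)

/-- Bar words `[a₁|⋯|aₙ]` with letters in the augmentation ideal. -/
abbrev Bar (ε : Ω →ₐ[k] k) := TensorAlgebra k (AugIdeal ε)

/-- The underlying space of the reduced Hochschild complex, `⨁ n, Ω ⊗ Ω̄^{⊗ n}`; its element
`(a₀, a₁, …, aₙ)` is `a₀ ⊗ [a₁|⋯|aₙ]`. -/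
abbrev CH (ε : Ω →ₐ[k] k) := Ω ⊗[k] Bar ε

/-- The bar letter `[a]`. -/
def barLetter (ε : Ω →ₐ[k] k) : Ω →ₗ[k] Bar ε := TensorAlgebra.ι k ∘ₗ toAug ε

/-- The grading of the augmentation ideal. -/
def augComp (c : Ω →ₗ[k] ℕ →₀ Ω) (ε : Ω →ₐ[k] k) : AugIdeal ε →ₗ[k] ℕ →₀ AugIdeal ε :=
  Finsupp.mapRange.linearMap (toAug ε) ∘ₗ c ∘ₗ augIncl ε

/-- The grading of the bar words: the letter `[a]` has degree `|a| + 1`. -/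
def barComp (c : Ω →ₗ[k] ℕ →₀ Ω) (ε : Ω →ₐ[k] k) : Bar ε →ₗ[k] ℕ →₀ Bar ε :=
  tensorComp (regrade (· + 1) (augComp c ε))

/-- The map `[a₁|⋯|aₙ] ↦ [σ a₁|⋯|σ aₙ]` on bar words. -/
def barMap {Ω' : Type w} [Ring Ω'] [Algebra k Ω'] (ε : Ω →ₐ[k] k) (ε' : Ω' →ₐ[k] k)
    (f : Ω →ₐ[k] Ω') : Bar ε →ₗ[k] Bar ε' :=
  (TensorAlgebra.lift k
    (barLetter ε' ∘ₗ f.toLinearMap ∘ₗ augIncl ε)).toLinearMap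

/-- The map `(a₀, a₁, …, aₙ) ↦ (f a₀, f a₁, …, f aₙ)` induced by an algebra map. -/
def chMap {Ω' : Type w} [Ring Ω'] [Algebra k Ω'] (ε : Ω →ₐ[k] k) (ε' : Ω' →ₐ[k] k)
    (f : Ω →ₐ[k] Ω') : CH ε →ₗ[k] CH ε' :=
  TensorProduct.map f.toLinearMap (barMap ε ε' f)

variable (c : Ω →ₗ[k] ℕ →₀ Ω) (d : Ω →ₗ[k] Ω) (ε : Ω →ₐ[k] k) (σ : Ω →ₐ[k] Ω)

/-- `(a₀, a₁, …, aₙ) ↦ (d a₀, a₁, …, aₙ) - ∑ i ≥ 1, (-1) ^ eᵢ₋₁ (a₀, …, d aᵢ, …, aₙ)`, where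
`eᵢ = |a₀| + ⋯ + |aᵢ| + i`. -/
def bInternal : CH ε →ₗ[k] CH ε :=
  TensorProduct.map d LinearMap.id -
  TensorProduct.map (signOp c)
    (LinearMap.mul' k (Bar ε) ∘ₗ
      TensorProduct.map (signOp (barComp c ε))
        (LinearMap.mul' k (Bar ε) ∘ₗ
          TensorProduct.map (barLetter ε ∘ₗ d ∘ₗ augIncl ε) LinearMap.id) ∘ₗ
      split)

/-- `(a₀, a₁, …, aₙ) ↦ (-1) ^ |a₀| (a₀ σ(a₁), a₂, …, aₙ)`. -/
def bFirst : CH ε →ₗ[k] CH ε :=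
  TensorProduct.map
    (LinearMap.mul' k Ω ∘ₗ
      TensorProduct.map (signOp c) (σ.toLinearMap ∘ₗ augIncl ε)) LinearMap.id ∘ₗ
  (TensorProduct.assoc k _ _ _).symm.toLinearMap ∘ₗ
  firstLetter.lTensor Ω

/-- The product `x ⊗ y ↦ [- (-1) ^ |x| x y]`, a map from pairs of letters to letters. -/
def barMul : AugIdeal ε ⊗[k] AugIdeal ε →ₗ[k] Bar ε :=
  barLetter ε ∘ₗ LinearMap.mul' k Ω ∘ₗ
    TensorProduct.map (-(signOp c ∘ₗ augIncl ε)) (augIncl ε)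

/-- `(a₀, a₁, …, aₙ) ↦ ∑ 1 ≤ i < n, (-1) ^ eᵢ (a₀, …, aᵢ aᵢ₊₁, …, aₙ)`, where
`eᵢ = |a₀| + ⋯ + |aᵢ| + i`. -/
def bMiddle : CH ε →ₗ[k] CH ε :=
  TensorProduct.map (signOp c)
    (LinearMap.mul' k (Bar ε) ∘ₗ
      TensorProduct.map (signOp (barComp c ε))
        (LinearMap.mul' k (Bar ε) ∘ₗ
          TensorProduct.map (barMul c ε) LinearMap.id ∘ₗ
          (TensorProduct.assoc k _ _ _).symm.toLinearMap ∘ₗ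
          firstLetter.lTensor (AugIdeal ε)) ∘ₗ
      split)

/-- `(a₀, a₁, …, aₙ) ↦ (-1) ^ ((|aₙ| + 1) eₙ₋₁) (aₙ a₀, a₁, …, aₙ₋₁)`, where
`eₙ₋₁ = |a₀| + ⋯ + |aₙ₋₁| + n - 1`. -/
def bLast : CH ε →ₗ[k] CH ε :=
  TensorProduct.map
    (LinearMap.mul' k Ω ∘ₗ TensorProduct.map (augIncl ε) LinearMap.id) LinearMap.id ∘ₗ
  (TensorProduct.assoc k _ _ _).symm.toLinearMap ∘ₗ
  koszulMove (TensorProduct.map (signOp c) (signOp (barComp c ε)))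
    (regrade (· + 1) (augComp c ε)) ∘ₗ
  (TensorProduct.assoc k _ _ _).symm.toLinearMap ∘ₗ
  lastLetter.lTensor Ω

/-- The Hochschild boundary of the augmented differential graded algebra `Ω` with coefficients in
the bimodule `Ω_σ` (`a · x · a' = a x σ(a')`). For an algebra in degree `0` with `d = 0` it sends
`(a₀, …, aₙ)` to `(a₀ σ(a₁), a₂, …, aₙ) + ∑ 1 ≤ i < n, (-1) ^ i (a₀, …, aᵢ aᵢ₊₁, …, aₙ) +
(-1) ^ n (aₙ a₀, a₁, …, aₙ₋₁)`. -/
def hochB : CH ε →ₗ[k] CH ε := bInternal c d ε + bFirst c ε σ + bMiddle c ε - bLast c ε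

/-- The Connes operator
`(a₀, …, aₙ) ↦ ∑ 1 ≤ i ≤ n + 1, ± (1, aᵢ, …, aₙ, a₀, σ(a₁), …, σ(aᵢ₋₁))`,
with the Koszul sign of moving the bar letters `aᵢ, …, aₙ` in front of `a₀, …, aᵢ₋₁`, all letters
`a` having degree `|a| + 1`. -/
def connesB : CH ε →ₗ[k] CH ε :=
  TensorProduct.mk k Ω (Bar ε) 1 ∘ₗ
  LinearMap.mul' k (Bar ε) ∘ₗ
  koszulMove (signOp (barComp c ε)) (barComp c ε) ∘ₗ
  TensorProduct.map (LinearMap.mul' k (Bar ε) ∘ₗ TensorProduct.map LinearMap.id (barMap ε ε σ))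
    LinearMap.id ∘ₗ
  (TensorProduct.assoc k _ _ _).symm.toLinearMap ∘ₗ
  TensorProduct.map (barLetter ε) deconc

/-- The part of total degree `n`, spanned by the `(a₀, a₁, …, aᵣ)` with homogeneous entries and
`|a₀| + ⋯ + |aᵣ| + r = n`. -/
def chDeg (n : ℕ) : Submodule k (CH ε) :=
  Submodule.span k {x | ∃ (i : ℕ) (a : Ω) (l : List (ℕ × AugIdeal ε)),
    c a = Finsupp.single i a ∧ (∀ p ∈ l, c (augIncl ε p.2) = Finsupp.single p.1 (augIncl ε p.2)) ∧
    i + (l.map fun p => p.1 + 1).sum = n ∧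
    x = a ⊗ₜ[k] (l.map fun p => TensorAlgebra.ι k p.2).prod}

/-- The subspace spanned by the `(a₀, a₁, …, aᵣ)` whose entries are eigenvectors of `σ`, the
product of the eigenvalues being `1`. -/
def chOne : Submodule k (CH ε) :=
  Submodule.span k {x | ∃ (μ : k) (a : Ω) (l : List (k × AugIdeal ε)),
    σ a = μ • a ∧ (∀ p ∈ l, σ (augIncl ε p.2) = p.1 • augIncl ε p.2) ∧
    μ * (l.map fun p => p.1).prod = 1 ∧
    x = a ⊗ₜ[k] (l.map fun p => TensorAlgebra.ι k p.2).prod}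

end Hochschild

/-! ### Mixed complexes -/

section Mixed

variable {k : Type u} [Field k] {X : Type v} [AddCommGroup X] [Module k X]
  {Y : Type w} [AddCommGroup Y] [Module k Y]

/-- The graded subspace `S` of `X = ⨁ n, G n` is, with the restrictions of `b` (of degree `-1`) and
`B` (of degree `1`), a mixed complex. -/
structure IsMixedComplex (G : ℕ → Submodule k X) (S : Submodule k X) (b B : X →ₗ[k] X) :
    Prop where
  graded : S = ⨆ n, S ⊓ G n
  b_mem : ∀ x ∈ S, b x ∈ S
  B_mem : ∀ x ∈ S, B x ∈ S
  b_zero : ∀ x ∈ S ⊓ G 0, b x = 0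
  b_succ : ∀ n, ∀ x ∈ S ⊓ G (n + 1), b x ∈ G n
  B_deg : ∀ n, ∀ x ∈ S ⊓ G n, B x ∈ G (n + 1)
  b_b : ∀ x ∈ S, b (b x) = 0
  B_B : ∀ x ∈ S, B (B x) = 0
  b_B : ∀ x ∈ S, b (B x) + B (b x) = 0

/-- `f` restricts to a morphism of mixed complexes `S → S'` which induces isomorphisms on the
homology groups `ker (b : Sₙ → Sₙ₋₁) / b (Sₙ₊₁)`, where `Sₙ = S ⊓ G n`. -/
structure IsMixedQuasiIso (G : ℕ → Submodule k X) (S : Submodule k X) (b B : X →ₗ[k] X)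
    (G' : ℕ → Submodule k Y) (S' : Submodule k Y) (b' B' : Y →ₗ[k] Y) (f : X →ₗ[k] Y) :
    Prop where
  map_mem : ∀ x ∈ S, f x ∈ S'
  map_deg : ∀ n, ∀ x ∈ S ⊓ G n, f x ∈ G' n
  comm_b : ∀ x ∈ S, f (b x) = b' (f x)
  comm_B : ∀ x ∈ S, f (B x) = B' (f x)
  injective : ∀ n, ∀ x ∈ S ⊓ G n, b x = 0 → (∃ y ∈ S' ⊓ G' (n + 1), b' y = f x) →
    ∃ z ∈ S ⊓ G (n + 1), b z = x
  surjective : ∀ n, ∀ y ∈ S' ⊓ G' n, b' y = 0 →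
    ∃ x ∈ S ⊓ G n, b x = 0 ∧ ∃ z ∈ S' ⊓ G' (n + 1), y - f x = b' z

end Mixed

/-! ### Quadratic algebras and their Koszul dual coalgebras -/

section Quadratic

variable {k : Type u} [Field k] {V : Type v} [AddCommGroup V] [Module k V]

/-- The words of length `n` in the tensor algebra. -/
abbrev wordPow (k : Type u) [Field k] (V : Type v) [AddCommGroup V] [Module k V] (n : ℕ) :
    Submodule k (TensorAlgebra k V) :=
  LinearMap.range (TensorAlgebra.ι k : V →ₗ[k] TensorAlgebra k V) ^ n

/-- The decomposition of tensors by word length. -/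
def wordComp : TensorAlgebra k V →ₗ[k] ℕ →₀ TensorAlgebra k V :=
  tensorComp (Finsupp.lsingle 1)

theorem wordComp_of_mem {n : ℕ} {x : TensorAlgebra k V} (hx : x ∈ wordPow k V n) :
    wordComp x = Finsupp.single n x := by
  have h : tensorCompHom (Finsupp.lsingle (R := k) 1) x = AddMonoidAlgebra.single n x := by
    induction hx using Submodule.pow_induction_on_left' with
    | algebraMap r =>
      rw [AlgHom.commutes]
      rfl
    | add x y i hx hy ihx ihy => rw [map_add, ihx, ihy, AddMonoidAlgebra.single_add]
    | mem_mul m hm i x hx ih =>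
      obtain ⟨v, rfl⟩ := hm
      have hv : tensorCompHom (Finsupp.lsingle (R := k) 1) (TensorAlgebra.ι k v) =
          AddMonoidAlgebra.single 1 (TensorAlgebra.ι k v) := by
        simp only [tensorCompHom, TensorAlgebra.lift_ι_apply, LinearMap.comp_apply,
          Finsupp.lsingle_apply, Finsupp.mapRange.linearMap_apply, Finsupp.mapRange_single]
        rfl
      rw [map_mul, ih, hv, AddMonoidAlgebra.single_mul_single, add_comm]
  change AddMonoidAlgebra.coeffLinearEquiv k (tensorCompHom (Finsupp.lsingle (R := k) 1) x) = _
  rw [h]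
  rfl

theorem word_induction {p : TensorAlgebra k V → Prop} (x : TensorAlgebra k V)
    (hom : ∀ n, ∀ y ∈ wordPow k V n, p y) (add : ∀ y z, p y → p z → p (y + z)) : p x := by
  have h : (⨆ n, wordPow k V n) = ⊤ :=
    (DirectSum.Decomposition.isInternal (wordPow k V)).submodule_iSup_eq_top
  have hx : x ∈ ⨆ n, wordPow k V n := h ▸ Submodule.mem_top
  induction hx using Submodule.iSup_induction' with
  | mem i x hx => exact hom i x hx
  | zero => exact hom 0 0 (zero_mem _)
  | add x y _ _ hx hy => exact add x y hx hy

theorem wordComp_mem (x : TensorAlgebra k V) (n : ℕ) : wordComp x n ∈ wordPow k V n := by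
  induction x using word_induction with
  | hom m y hy =>
    rw [wordComp_of_mem hy, Finsupp.single_apply]
    split_ifs with h
    · exact h ▸ hy
    · exact zero_mem _
  | add y z hy hz => rw [map_add]; exact add_mem hy hz

theorem ι_mul_mem (v : V) {n : ℕ} {x : TensorAlgebra k V} (hx : x ∈ wordPow k V n) :
    TensorAlgebra.ι k v * x ∈ wordPow k V (n + 1) := by
  rw [wordPow, pow_succ']
  exact Submodule.mul_mem_mul ⟨v, rfl⟩ hx

theorem mul_ι_mem (v : V) {n : ℕ} {x : TensorAlgebra k V} (hx : x ∈ wordPow k V n) :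
    x * TensorAlgebra.ι k v ∈ wordPow k V (n + 1) := by
  rw [wordPow, pow_succ]
  exact Submodule.mul_mem_mul hx ⟨v, rfl⟩

theorem wordComp_ι_mul (v : V) (x : TensorAlgebra k V) (n : ℕ) :
    wordComp (TensorAlgebra.ι k v * x) (n + 1) = TensorAlgebra.ι k v * wordComp x n := by
  induction x using word_induction with
  | hom m y hy =>
    rw [wordComp_of_mem hy, wordComp_of_mem (ι_mul_mem v hy), Finsupp.single_apply,
      Finsupp.single_apply]
    by_cases h : m = n <;> simp [h]
  | add y z hy hz => simp only [mul_add, map_add, Finsupp.add_apply, hy, hz]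

theorem wordComp_mul_ι (v : V) (x : TensorAlgebra k V) (n : ℕ) :
    wordComp (x * TensorAlgebra.ι k v) (n + 1) = wordComp x n * TensorAlgebra.ι k v := by
  induction x using word_induction with
  | hom m y hy =>
    rw [wordComp_of_mem hy, wordComp_of_mem (mul_ι_mem v hy), Finsupp.single_apply,
      Finsupp.single_apply]
    by_cases h : m = n <;> simp [h]
  | add y z hy hz => simp only [add_mul, map_add, Finsupp.add_apply, hy, hz]

theorem wordComp_ι_mul_zero (v : V) (x : TensorAlgebra k V) :
    wordComp (TensorAlgebra.ι k v * x) 0 = 0 := by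
  induction x using word_induction with
  | hom m y hy => simp [wordComp_of_mem (ι_mul_mem v hy)]
  | add y z hy hz => simp only [mul_add, map_add, Finsupp.add_apply, hy, hz, add_zero]

theorem wordComp_mul_ι_zero (v : V) (x : TensorAlgebra k V) :
    wordComp (x * TensorAlgebra.ι k v) 0 = 0 := by
  induction x using word_induction with
  | hom m y hy => simp [wordComp_of_mem (mul_ι_mem v hy)]
  | add y z hy hz => simp only [add_mul, map_add, Finsupp.add_apply, hy, hz, add_zero]

variable (R : Submodule k (V ⊗[k] V))

/-- The relations `R ⊆ V ⊗ V` as a space of words of length two. -/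
def relSub : Submodule k (TensorAlgebra k V) :=
  R.map (LinearMap.mul' k (TensorAlgebra k V) ∘ₗ
    TensorProduct.map (TensorAlgebra.ι k) (TensorAlgebra.ι k))

theorem relSub_le : relSub R ≤ wordPow k V 2 := by
  rintro _ ⟨r, -, rfl⟩
  induction r using TensorProduct.induction_on with
  | zero => simp
  | tmul v w =>
    simp only [LinearMap.comp_apply, TensorProduct.map_tmul, LinearMap.mul'_apply, wordPow, pow_two]
    exact Submodule.mul_mem_mul ⟨v, rfl⟩ ⟨w, rfl⟩
  | add x y hx hy => rw [map_add]; exact add_mem hx hy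

/-- The two-sided ideal generated by `R`. -/
def relIdeal : Ideal (TensorAlgebra k V) :=
  (TwoSidedIdeal.span (relSub R : Set (TensorAlgebra k V))).asIdeal

instance : (relIdeal R).IsTwoSided := by unfold relIdeal; infer_instance

/-- The quadratic algebra `T(V) / (R)`. -/
abbrev QuadAlg := TensorAlgebra k V ⧸ relIdeal R

/-- The projection `T(V) → T(V) / (R)`. -/
abbrev quadMk : TensorAlgebra k V →ₐ[k] QuadAlg R := Ideal.Quotient.mkₐ k (relIdeal R)

/-- The generators `V → T(V) / (R)`. -/
def quadι : V →ₗ[k] QuadAlg R := (quadMk R).toLinearMap ∘ₗ TensorAlgebra.ι k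

/-- The part of degree `n` of `T(V) / (R)`. -/
def quadDeg (n : ℕ) : Submodule k (QuadAlg R) := (wordPow k V n).map (quadMk R).toLinearMap

theorem relIdeal_low {x : TensorAlgebra k V} (hx : x ∈ relIdeal R) :
    wordComp x 0 = 0 ∧ wordComp x 1 = 0 ∧ wordComp x 2 ∈ relSub R := by
  have left : ∀ a x : TensorAlgebra k V,
      (wordComp x 0 = 0 ∧ wordComp x 1 = 0 ∧ wordComp x 2 ∈ relSub R) →
      (wordComp (a * x) 0 = 0 ∧ wordComp (a * x) 1 = 0 ∧ wordComp (a * x) 2 ∈ relSub R) := by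
    intro a
    induction a using TensorAlgebra.induction with
    | algebraMap r =>
      intro x hx
      rw [← Algebra.smul_def, map_smul]
      simpa [hx.1, hx.2.1] using Submodule.smul_mem _ r hx.2.2
    | ι v =>
      intro x hx
      rw [wordComp_ι_mul_zero, show (1 : ℕ) = 0 + 1 from rfl, wordComp_ι_mul,
        show (2 : ℕ) = 1 + 1 from rfl, wordComp_ι_mul, hx.1, hx.2.1]
      simp
    | mul a b ha hb =>
      intro x hx
      rw [mul_assoc]
      exact ha _ (hb _ hx)
    | add a b ha hb =>
      intro x hx
      have h1 := ha x hx
      have h2 := hb x hx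
      rw [add_mul, map_add]
      exact ⟨by simp [h1.1, h2.1], by simp [h1.2.1, h2.2.1], add_mem h1.2.2 h2.2.2⟩
  have right : ∀ a x : TensorAlgebra k V,
      (wordComp x 0 = 0 ∧ wordComp x 1 = 0 ∧ wordComp x 2 ∈ relSub R) →
      (wordComp (x * a) 0 = 0 ∧ wordComp (x * a) 1 = 0 ∧ wordComp (x * a) 2 ∈ relSub R) := by
    intro a
    induction a using TensorAlgebra.induction with
    | algebraMap r =>
      intro x hx
      rw [← Algebra.commutes, ← Algebra.smul_def, map_smul]
      simpa [hx.1, hx.2.1] using Submodule.smul_mem _ r hx.2.2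
    | ι v =>
      intro x hx
      rw [wordComp_mul_ι_zero, show (1 : ℕ) = 0 + 1 from rfl, wordComp_mul_ι,
        show (2 : ℕ) = 1 + 1 from rfl, wordComp_mul_ι, hx.1, hx.2.1]
      simp
    | mul a b ha hb =>
      intro x hx
      rw [← mul_assoc]
      exact hb _ (ha _ hx)
    | add a b ha hb =>
      intro x hx
      have h1 := ha x hx
      have h2 := hb x hx
      rw [mul_add, map_add]
      exact ⟨by simp [h1.1, h2.1], by simp [h1.2.1, h2.2.1], add_mem h1.2.2 h2.2.2⟩
  have hx' : x ∈ TwoSidedIdeal.span (relSub R : Set (TensorAlgebra k V)) := hx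
  induction hx' using TwoSidedIdeal.span_induction with
  | mem y hy => simpa [wordComp_of_mem (relSub_le R hy)] using hy
  | zero => simp
  | add y z _ _ hy hz =>
    have h1 := hy ‹_›
    have h2 := hz ‹_›
    rw [map_add]
    exact ⟨by simp [h1.1, h2.1], by simp [h1.2.1, h2.2.1], add_mem h1.2.2 h2.2.2⟩
  | neg y _ hy =>
    have h1 := hy ‹_›
    rw [map_neg]
    exact ⟨by simp [h1.1], by simp [h1.2.1], neg_mem h1.2.2⟩
  | left_absorb a y _ hy => exact left a y (hy ‹_›)
  | right_absorb a y _ hy => exact right a y (hy ‹_›)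

theorem algebraMapInv_eq (x : TensorAlgebra k V) :
    algebraMap k (TensorAlgebra k V) (TensorAlgebra.algebraMapInv x) = wordComp x 0 := by
  induction x using word_induction with
  | hom n y hy =>
    cases n with
    | zero =>
      rw [wordPow, pow_zero, Submodule.mem_one] at hy
      obtain ⟨r, rfl⟩ := hy
      rw [wordComp_of_mem (n := 0) (by rw [wordPow, pow_zero]; exact Submodule.mem_one.2 ⟨r, rfl⟩)]
      simp
    | succ n =>
      rw [wordComp_of_mem hy]
      have : TensorAlgebra.algebraMapInv y = 0 := by
        rw [wordPow, pow_succ'] at hy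
        induction hy using Submodule.mul_induction_on' with
        | mem_mul_mem m hm z hz =>
          obtain ⟨v, rfl⟩ := hm
          simp [TensorAlgebra.algebraMapInv]
        | add y hy z hz h1 h2 => rw [map_add, h1, h2, add_zero]
      simp [this]
  | add y z hy hz => simp only [map_add, hy, hz, Finsupp.add_apply]

/-- The augmentation of `T(V) / (R)`. -/
def quadAug : QuadAlg R →ₐ[k] k :=
  Ideal.Quotient.liftₐ (relIdeal R) TensorAlgebra.algebraMapInv (by
    intro a ha
    have h := algebraMapInv_eq a
    rw [(relIdeal_low R ha).1] at h
    exact (TensorAlgebra.algebraMap_eq_zero_iff (M := V) _).1 h)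

theorem quadι_injective : Function.Injective (quadι R) := by
  rw [injective_iff_map_eq_zero]
  intro v hv
  have h : TensorAlgebra.ι k v ∈ relIdeal R := Ideal.Quotient.eq_zero_iff_mem.1 hv
  have h1 := (relIdeal_low R h).2.1
  rw [wordComp_of_mem (n := 1) (by rw [wordPow, pow_one]; exact ⟨v, rfl⟩)] at h1
  simpa using h1

/-- An endomorphism `σ` of `T(V) / (R)` preserves the grading. -/
def IsGradedEnd (σ : QuadAlg R →ₐ[k] QuadAlg R) : Prop :=
  ∀ n, ∀ x ∈ quadDeg R n, σ x ∈ quadDeg R n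

/-- The automorphism of the generators induced by a graded endomorphism `σ` of `T(V) / (R)`: it is
characterised by `quadι R (genMap R σ hσ v) = σ (quadι R v)`. -/
def genMap (σ : QuadAlg R →ₐ[k] QuadAlg R) (hσ : IsGradedEnd R σ) : V →ₗ[k] V :=
  (LinearEquiv.ofInjective (quadι R) (quadι_injective R)).symm.toLinearMap ∘ₗ
    (σ.toLinearMap ∘ₗ quadι R).codRestrict (LinearMap.range (quadι R)) (by
      intro v
      have h := hσ 1 (quadι R v) ⟨TensorAlgebra.ι k v, by
        rw [wordPow, pow_one]; exact ⟨v, rfl⟩, rfl⟩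
      obtain ⟨x, hx, hx'⟩ := h
      rw [wordPow, pow_one] at hx
      obtain ⟨w, rfl⟩ := hx
      exact ⟨w, hx'⟩)

theorem quadι_genMap (σ : QuadAlg R →ₐ[k] QuadAlg R) (hσ : IsGradedEnd R σ) (v : V) :
    quadι R (genMap R σ hσ v) = σ (quadι R v) := by
  have h := LinearEquiv.apply_symm_apply (LinearEquiv.ofInjective (quadι R) (quadι_injective R))
    ((σ.toLinearMap ∘ₗ quadι R).codRestrict (LinearMap.range (quadι R)) (by
      intro v
      have h := hσ 1 (quadι R v) ⟨TensorAlgebra.ι k v, by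
        rw [wordPow, pow_one]; exact ⟨v, rfl⟩, rfl⟩
      obtain ⟨x, hx, hx'⟩ := h
      rw [wordPow, pow_one] at hx
      obtain ⟨w, rfl⟩ := hx
      exact ⟨w, hx'⟩) v)
  exact congrArg Subtype.val h

/-- The endomorphism `v₁ ⋯ vₙ ↦ g(v₁) ⋯ g(vₙ)` of the tensor algebra. -/
def wordMap (g : V →ₗ[k] V) : TensorAlgebra k V →ₐ[k] TensorAlgebra k V :=
  TensorAlgebra.lift k (TensorAlgebra.ι k ∘ₗ g)

theorem quadMk_wordMap (σ : QuadAlg R →ₐ[k] QuadAlg R) (hσ : IsGradedEnd R σ)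
    (x : TensorAlgebra k V) : quadMk R (wordMap (genMap R σ hσ) x) = σ (quadMk R x) := by
  have h : (quadMk R).comp (wordMap (genMap R σ hσ)) = σ.comp (quadMk R) := by
    apply TensorAlgebra.hom_ext
    ext v
    have := quadι_genMap R σ hσ v
    simpa [wordMap, quadι] using this
  exact DFunLike.congr_fun h x

theorem wordMap_wordPow (g : V →ₗ[k] V) (n : ℕ) :
    (wordPow k V n).map (wordMap g).toLinearMap ≤ wordPow k V n := by
  rw [wordPow, Submodule.map_pow]
  refine pow_le_pow_left' ?_ n
  rintro _ ⟨_, ⟨v, rfl⟩, rfl⟩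
  exact ⟨g v, by simp [wordMap]⟩

theorem wordMap_relSub (σ : QuadAlg R →ₐ[k] QuadAlg R) (hσ : IsGradedEnd R σ) :
    (relSub R).map (wordMap (genMap R σ hσ)).toLinearMap ≤ relSub R := by
  rintro _ ⟨x, hx, rfl⟩
  have h0 : x ∈ relIdeal R := TwoSidedIdeal.subset_span hx
  have h1 : wordMap (genMap R σ hσ) x ∈ relIdeal R := by
    rw [← Ideal.Quotient.eq_zero_iff_mem]
    have h := quadMk_wordMap R σ hσ x
    have h2 : quadMk R x = 0 := Ideal.Quotient.eq_zero_iff_mem.2 h0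
    rw [h2, map_zero] at h
    exact h
  have h2 : wordMap (genMap R σ hσ) x ∈ wordPow k V 2 :=
    wordMap_wordPow _ 2 ⟨x, relSub_le R hx, rfl⟩
  have h3 := (relIdeal_low R h1).2.2
  rw [wordComp_of_mem h2] at h3
  simpa using h3

/-- The part of degree `n` of the Koszul dual coalgebra,
`⋂ i + 2 + j = n, V^{⊗ i} ⊗ R ⊗ V^{⊗ j} ⊆ V^{⊗ n}`. -/
def coalgDeg (n : ℕ) : Submodule k (TensorAlgebra k V) :=
  wordPow k V n ⊓ ⨅ (i : ℕ) (j : ℕ) (_ : i + 2 + j = n), wordPow k V i * relSub R * wordPow k V j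

/-- The Koszul dual coalgebra, as a subspace of the tensor coalgebra. -/
def coalgSub : Submodule k (TensorAlgebra k V) := ⨆ n, coalgDeg R n

/-- The Koszul dual coalgebra. -/
abbrev Coalg := ↥(coalgSub R)

theorem mem_coalgSub {x : TensorAlgebra k V} :
    x ∈ coalgSub R ↔ ∀ n, wordComp x n ∈ coalgDeg R n := by
  constructor
  · intro hx n
    induction hx using Submodule.iSup_induction' with
    | mem m x hx =>
      rw [wordComp_of_mem hx.1, Finsupp.single_apply]
      split_ifs with h
      · exact h ▸ hx
      · exact zero_mem _
    | zero => simp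
    | add x y _ _ hx hy => rw [map_add]; exact add_mem hx hy
  · intro h
    have hsum : (wordComp x).sum (fun _ y => y) = x := by
      clear h
      induction x using word_induction with
      | hom n y hy => rw [wordComp_of_mem hy, Finsupp.sum_single_index rfl]
      | add y z hy hz =>
        rw [map_add, Finsupp.sum_add_index' (fun _ => rfl) (fun _ _ _ => rfl), hy, hz]
    rw [← hsum]
    exact Submodule.sum_mem _ fun n _ => Submodule.mem_iSup_of_mem n (h n)

/-- The grading of the Koszul dual coalgebra. -/
def coalgComp : Coalg R →ₗ[k] ℕ →₀ Coalg R where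
  toFun x := Finsupp.onFinset (wordComp (x : TensorAlgebra k V)).support
    (fun n => ⟨wordComp (x : TensorAlgebra k V) n,
      Submodule.mem_iSup_of_mem n ((mem_coalgSub R).1 x.2 n)⟩)
    (by
      intro n hn
      rw [Finsupp.mem_support_iff]
      intro h
      exact hn (Subtype.ext h))
  map_add' x y := by ext n; simp
  map_smul' r x := by ext n; simp

theorem one_mem_coalgSub : (1 : TensorAlgebra k V) ∈ coalgSub R := by
  refine Submodule.mem_iSup_of_mem 0 ⟨?_, ?_⟩
  · rw [wordPow, pow_zero]; exact Submodule.one_le.1 le_rfl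
  · simp

/-- The element `1` of the Koszul dual coalgebra. -/
def coalgOne : Coalg R := ⟨1, one_mem_coalgSub R⟩

/-- The counit of the Koszul dual coalgebra. -/
def counit : Coalg R →ₗ[k] k :=
  TensorAlgebra.algebraMapInv.toLinearMap ∘ₗ (coalgSub R).subtype

/-! The deconcatenation coproduct restricts to the Koszul dual coalgebra. -/

/-- Contraction of the second factor of the deconcatenation with `f`. -/
def sliceL (f : TensorAlgebra k V →ₗ[k] k) : TensorAlgebra k V →ₗ[k] TensorAlgebra k V :=
  (TensorProduct.rid k _).toLinearMap ∘ₗ f.lTensor _ ∘ₗ deconc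

/-- Contraction of the first factor of the deconcatenation with `f`. -/
def sliceR (f : TensorAlgebra k V →ₗ[k] k) : TensorAlgebra k V →ₗ[k] TensorAlgebra k V :=
  (TensorProduct.lid k _).toLinearMap ∘ₗ f.rTensor _ ∘ₗ deconc

theorem sliceL_one (f : TensorAlgebra k V →ₗ[k] k) : sliceL f 1 = f 1 • 1 := by
  simp [sliceL, deconc_one]

theorem sliceR_one (f : TensorAlgebra k V →ₗ[k] k) : sliceR f 1 = f 1 • 1 := by
  simp [sliceR, deconc_one]

theorem sliceL_ι_mul (f : TensorAlgebra k V →ₗ[k] k) (v : V) (w : TensorAlgebra k V) :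
    sliceL f (TensorAlgebra.ι k v * w) =
      f (TensorAlgebra.ι k v * w) • 1 + TensorAlgebra.ι k v * sliceL f w := by
  have h : ∀ z : TensorAlgebra k V ⊗[k] TensorAlgebra k V,
      TensorProduct.rid k _ (f.lTensor _
        ((LinearMap.mulLeft k (TensorAlgebra.ι k v)).rTensor _ z)) =
      TensorAlgebra.ι k v * TensorProduct.rid k _ (f.lTensor _ z) := by
    intro z
    induction z using TensorProduct.induction_on with
    | zero => simp
    | tmul a b => simp
    | add a b ha hb => simp only [map_add, ha, hb, mul_add]
  simp only [sliceL, LinearMap.comp_apply, deconc_ι_mul, map_add, LinearEquiv.coe_coe, h]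
  simp

theorem sliceR_ι_mul (f : TensorAlgebra k V →ₗ[k] k) (v : V) (w : TensorAlgebra k V) :
    sliceR f (TensorAlgebra.ι k v * w) =
      f 1 • (TensorAlgebra.ι k v * w) +
        sliceR (f ∘ₗ LinearMap.mulLeft k (TensorAlgebra.ι k v)) w := by
  simp only [sliceR, LinearMap.comp_apply, deconc_ι_mul, map_add, LinearEquiv.coe_coe,
    LinearMap.rTensor_comp]
  simp

theorem one_mem_wordPow : (1 : TensorAlgebra k V) ∈ wordPow k V 0 := by
  rw [wordPow, pow_zero]; exact Submodule.one_le.1 le_rfl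

theorem wordComp_sliceL_zero (f : TensorAlgebra k V →ₗ[k] k) (y : TensorAlgebra k V) :
    wordComp (sliceL f y) 0 = f y • 1 := by
  induction y using word_induction with
  | hom n y hy =>
    induction hy using Submodule.pow_induction_on_left' with
    | algebraMap r =>
      rw [Algebra.algebraMap_eq_smul_one, map_smul, sliceL_one, map_smul, map_smul,
        wordComp_of_mem one_mem_wordPow]
      simp [smul_smul]
    | add x y i hx hy ihx ihy => simp only [map_add, Finsupp.add_apply, ihx, ihy, add_smul]
    | mem_mul m hm i x hx ih =>
      obtain ⟨v, rfl⟩ := hm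
      rw [sliceL_ι_mul, map_add, Finsupp.add_apply, wordComp_ι_mul_zero, map_smul,
        wordComp_of_mem one_mem_wordPow]
      simp
  | add y z hy hz => simp only [map_add, Finsupp.add_apply, hy, hz, add_smul]

theorem wordComp_sliceL (f : TensorAlgebra k V →ₗ[k] k) {n : ℕ} {x : TensorAlgebra k V}
    (hx : x ∈ wordPow k V n) (y : TensorAlgebra k V) :
    wordComp (sliceL f (x * y)) n = f y • x := by
  induction hx using Submodule.pow_induction_on_left' with
  | algebraMap r =>
    rw [← Algebra.smul_def, map_smul, map_smul, Finsupp.smul_apply, wordComp_sliceL_zero,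
      Algebra.algebraMap_eq_smul_one, smul_comm]
  | add x z i hx hz ihx ihz =>
    simp only [add_mul, map_add, Finsupp.add_apply, ihx, ihz, smul_add]
  | mem_mul m hm i x hx ih =>
    obtain ⟨v, rfl⟩ := hm
    rw [mul_assoc, sliceL_ι_mul, map_add, Finsupp.add_apply, wordComp_ι_mul, ih, map_smul,
      wordComp_of_mem one_mem_wordPow]
    simp

theorem wordComp_sliceL_lt (f : TensorAlgebra k V →ₗ[k] k) {m : ℕ} {x : TensorAlgebra k V}
    (hx : x ∈ wordPow k V m) : ∀ n, m < n → wordComp (sliceL f x) n = 0 := by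
  induction hx using Submodule.pow_induction_on_left' with
  | algebraMap r =>
    intro n hn
    rw [Algebra.algebraMap_eq_smul_one, map_smul, sliceL_one, map_smul, map_smul,
      wordComp_of_mem one_mem_wordPow]
    simp [hn.ne]
  | add x z i hx hz ihx ihz =>
    intro n hn
    simp only [map_add, Finsupp.add_apply, ihx n hn, ihz n hn, add_zero]
  | mem_mul m hm i x hx ih =>
    obtain ⟨v, rfl⟩ := hm
    intro n hn
    obtain ⟨n, rfl⟩ : ∃ n', n = n' + 1 := ⟨n - 1, by omega⟩
    rw [sliceL_ι_mul, map_add wordComp, Finsupp.add_apply, wordComp_ι_mul, ih n (by omega),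
      map_smul,
      wordComp_of_mem one_mem_wordPow]
    simp

theorem wordComp_sliceR_lt {m : ℕ} {x : TensorAlgebra k V} (hx : x ∈ wordPow k V m) :
    ∀ (f : TensorAlgebra k V →ₗ[k] k) (n : ℕ), m < n → wordComp (sliceR f x) n = 0 := by
  induction hx using Submodule.pow_induction_on_left' with
  | algebraMap r =>
    intro f n hn
    rw [Algebra.algebraMap_eq_smul_one, map_smul, sliceR_one, map_smul, map_smul,
      wordComp_of_mem one_mem_wordPow]
    simp [hn.ne]
  | add x z i hx hz ihx ihz =>
    intro f n hn
    simp only [map_add, Finsupp.add_apply, ihx f n hn, ihz f n hn, add_zero]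
  | mem_mul m hm i x hx ih =>
    obtain ⟨v, rfl⟩ := hm
    intro f n hn
    rw [sliceR_ι_mul, map_add, Finsupp.add_apply, ih _ n (by omega), map_smul,
      wordComp_of_mem (ι_mul_mem v hx)]
    simp [hn.ne]

theorem wordComp_sliceR_self {p : ℕ} {y : TensorAlgebra k V} (hy : y ∈ wordPow k V p) :
    ∀ f : TensorAlgebra k V →ₗ[k] k, wordComp (sliceR f y) p = f 1 • y := by
  induction hy using Submodule.pow_induction_on_left' with
  | algebraMap r =>
    intro f
    rw [Algebra.algebraMap_eq_smul_one, map_smul, sliceR_one, map_smul, map_smul,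
      wordComp_of_mem one_mem_wordPow]
    simp only [Finsupp.smul_apply, Finsupp.single_eq_same]
    rw [smul_comm]
  | add x z i hx hz ihx ihz =>
    intro f
    simp only [map_add, Finsupp.add_apply, ihx f, ihz f, smul_add]
  | mem_mul m hm i x hx ih =>
    obtain ⟨v, rfl⟩ := hm
    intro f
    rw [sliceR_ι_mul, map_add, Finsupp.add_apply, wordComp_sliceR_lt hx _ _ (by omega), map_smul,
      wordComp_of_mem (ι_mul_mem v hx)]
    simp

theorem wordComp_sliceR {p : ℕ} {y : TensorAlgebra k V} (hy : y ∈ wordPow k V p) {n : ℕ}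
    {x : TensorAlgebra k V} (hx : x ∈ wordPow k V n) :
    ∀ f : TensorAlgebra k V →ₗ[k] k, wordComp (sliceR f (x * y)) p = f x • y := by
  induction hx using Submodule.pow_induction_on_left' with
  | algebraMap r =>
    intro f
    rw [← Algebra.smul_def, map_smul, map_smul, Finsupp.smul_apply, wordComp_sliceR_self hy,
      Algebra.algebraMap_eq_smul_one, map_smul, smul_smul, smul_eq_mul]
  | add x z i hx hz ihx ihz =>
    intro f
    simp only [add_mul, map_add, Finsupp.add_apply, ihx, ihz, add_smul]
  | mem_mul m hm i x hx ih =>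
    obtain ⟨v, rfl⟩ := hm
    intro f
    have hxy : x * y ∈ wordPow k V (i + p) := by
      rw [wordPow, pow_add]; exact Submodule.mul_mem_mul hx hy
    rw [mul_assoc, sliceR_ι_mul, map_add, Finsupp.add_apply, ih, map_smul,
      wordComp_of_mem (ι_mul_mem v hxy)]
    simp [show i + p + 1 ≠ p by omega]

theorem wordPow_relSub_le {n i j : ℕ} (hij : i + 2 + j = n) :
    wordPow k V i * relSub R * wordPow k V j ≤ wordPow k V n := by
  rw [← hij, show wordPow k V (i + 2 + j) = wordPow k V i * wordPow k V 2 * wordPow k V j by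
    simp only [wordPow, pow_add]]
  gcongr
  exact relSub_le R

theorem sliceL_mem (f : TensorAlgebra k V →ₗ[k] k) {x : TensorAlgebra k V}
    (hx : x ∈ coalgSub R) : sliceL f x ∈ coalgSub R := by
  rw [mem_coalgSub]
  intro n
  induction hx using Submodule.iSup_induction' with
  | mem m x hx =>
    obtain ⟨hx1, hx2⟩ := Submodule.mem_inf.1 hx
    rcases lt_or_ge m n with h | h
    · rw [wordComp_sliceL_lt f hx1 n h]; exact zero_mem _
    · refine Submodule.mem_inf.2 ⟨wordComp_mem _ _, ?_⟩
      simp only [Submodule.mem_iInf] at hx2 ⊢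
      intro i j hij
      have hx3 := hx2 i (j + (m - n)) (by omega)
      rw [show wordPow k V (j + (m - n)) = wordPow k V j * wordPow k V (m - n) from pow_add _ _ _,
        ← mul_assoc] at hx3
      refine Submodule.mul_induction_on (C := fun x => wordComp (sliceL f x) n ∈ _) hx3 ?_ ?_
      · intro a ha b hb
        rw [wordComp_sliceL f (wordPow_relSub_le R hij ha)]
        exact Submodule.smul_mem _ _ ha
      · intro a b ha hb
        simp only [map_add, Finsupp.add_apply]
        exact add_mem ha hb
  | zero => simp
  | add x y _ _ hx hy => simp only [map_add, Finsupp.add_apply]; exact add_mem hx hy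

theorem sliceR_mem (f : TensorAlgebra k V →ₗ[k] k) {x : TensorAlgebra k V}
    (hx : x ∈ coalgSub R) : sliceR f x ∈ coalgSub R := by
  rw [mem_coalgSub]
  intro n
  induction hx using Submodule.iSup_induction' with
  | mem m x hx =>
    obtain ⟨hx1, hx2⟩ := Submodule.mem_inf.1 hx
    rcases lt_or_ge m n with h | h
    · rw [wordComp_sliceR_lt hx1 f n h]; exact zero_mem _
    · refine Submodule.mem_inf.2 ⟨wordComp_mem _ _, ?_⟩
      simp only [Submodule.mem_iInf] at hx2 ⊢
      intro i j hij
      have hx3 := hx2 ((m - n) + i) j (by omega)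
      rw [show wordPow k V ((m - n) + i) = wordPow k V (m - n) * wordPow k V i from pow_add _ _ _,
        mul_assoc, mul_assoc, ← mul_assoc (wordPow k V i)] at hx3
      refine Submodule.mul_induction_on (C := fun x => wordComp (sliceR f x) n ∈ _) hx3 ?_ ?_
      · intro a ha b hb
        rw [wordComp_sliceR (wordPow_relSub_le R hij hb) ha]
        exact Submodule.smul_mem _ _ hb
      · intro a b ha hb
        simp only [map_add, Finsupp.add_apply]
        exact add_mem ha hb
  | zero => simp
  | add x y _ _ hx hy => simp only [map_add, Finsupp.add_apply]; exact add_mem hx hy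

theorem ext_slice {X : Type v} [AddCommGroup X] [Module k X] {z z' : X ⊗[k] X}
    (h : ∀ f : X →ₗ[k] k, TensorProduct.rid k X (f.lTensor X z) =
      TensorProduct.rid k X (f.lTensor X z')) : z = z' := by
  classical
  apply (TensorProduct.equivFinsuppOfBasisRight (M := X) (Module.Basis.ofVectorSpace k X)).injective
  ext i
  rw [TensorProduct.equivFinsuppOfBasisRight_apply, TensorProduct.equivFinsuppOfBasisRight_apply, h]

theorem ext_slice' {X : Type v} [AddCommGroup X] [Module k X] {z z' : X ⊗[k] X}
    (h : ∀ f : X →ₗ[k] k, TensorProduct.lid k X (f.rTensor X z) =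
      TensorProduct.lid k X (f.rTensor X z')) : z = z' := by
  apply (TensorProduct.comm k X X).injective
  apply ext_slice
  intro f
  have key : ∀ t : X ⊗[k] X, TensorProduct.rid k X (f.lTensor X (TensorProduct.comm k X X t)) =
      TensorProduct.lid k X (f.rTensor X t) := by
    intro t
    induction t using TensorProduct.induction_on with
    | zero => simp
    | tmul a b => simp
    | add a b ha hb => simp only [map_add, ha, hb]
  rw [key, key, h]

theorem deconc_mem (x : Coalg R) :
    deconc (x : TensorAlgebra k V) ∈
      LinearMap.range (TensorProduct.mapIncl (coalgSub R) (coalgSub R)) := by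
  obtain ⟨P, hP⟩ := (coalgSub R).subtype.exists_leftInverse_of_injective (Submodule.ker_subtype _)
  have hP' : ∀ y ∈ coalgSub R, ((P y : Coalg R) : TensorAlgebra k V) = y := by
    intro y hy
    have := LinearMap.congr_fun hP ⟨y, hy⟩
    exact congrArg Subtype.val this
  set Q : TensorAlgebra k V →ₗ[k] TensorAlgebra k V := (coalgSub R).subtype ∘ₗ P with hQ
  have h1 : Q.rTensor _ (deconc (x : TensorAlgebra k V)) = deconc (x : TensorAlgebra k V) := by
    apply ext_slice
    intro f
    have key : ∀ t : TensorAlgebra k V ⊗[k] TensorAlgebra k V,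
        TensorProduct.rid k _ (f.lTensor _ (Q.rTensor _ t)) =
          Q (TensorProduct.rid k _ (f.lTensor _ t)) := by
      intro t
      induction t using TensorProduct.induction_on with
      | zero => simp
      | tmul a b => simp
      | add a b ha hb => simp only [map_add, ha, hb]
    rw [key]
    exact hP' _ (sliceL_mem R f x.2)
  have h2 : Q.lTensor _ (deconc (x : TensorAlgebra k V)) = deconc (x : TensorAlgebra k V) := by
    apply ext_slice'
    intro f
    have key : ∀ t : TensorAlgebra k V ⊗[k] TensorAlgebra k V,
        TensorProduct.lid k _ (f.rTensor _ (Q.lTensor _ t)) =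
          Q (TensorProduct.lid k _ (f.rTensor _ t)) := by
      intro t
      induction t using TensorProduct.induction_on with
      | zero => simp
      | tmul a b => simp
      | add a b ha hb => simp only [map_add, ha, hb]
    rw [key]
    exact hP' _ (sliceR_mem R f x.2)
  refine ⟨TensorProduct.map P P (deconc (x : TensorAlgebra k V)), ?_⟩
  rw [TensorProduct.mapIncl, ← LinearMap.comp_apply, ← TensorProduct.map_comp, ← hQ,
    ← LinearMap.lTensor_comp_rTensor, LinearMap.comp_apply, h1, h2]

theorem mapIncl_injective :
    Function.Injective (TensorProduct.mapIncl (coalgSub R) (coalgSub R)) :=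
  Module.Flat.tensorProduct_mapIncl_injective_of_right _ _

/-- The coproduct of the Koszul dual coalgebra: the restriction of the deconcatenation, see
`mapIncl_comul`. -/
def comul : Coalg R →ₗ[k] Coalg R ⊗[k] Coalg R :=
  (LinearEquiv.ofInjective _ (mapIncl_injective R)).symm.toLinearMap ∘ₗ
    (deconc ∘ₗ (coalgSub R).subtype).codRestrict _ (deconc_mem R)

theorem mapIncl_comul (x : Coalg R) :
    TensorProduct.mapIncl (coalgSub R) (coalgSub R) (comul R x) =
      deconc (x : TensorAlgebra k V) :=
  congrArg Subtype.val (LinearEquiv.apply_symm_apply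
    (LinearEquiv.ofInjective _ (mapIncl_injective R))
    ((deconc ∘ₗ (coalgSub R).subtype).codRestrict _ (deconc_mem R) x))

theorem wordMap_mem (σ : QuadAlg R →ₐ[k] QuadAlg R) (hσ : IsGradedEnd R σ)
    {x : TensorAlgebra k V} (hx : x ∈ coalgSub R) :
    wordMap (genMap R σ hσ) x ∈ coalgSub R := by
  induction hx using Submodule.iSup_induction' with
  | mem m x hx =>
    obtain ⟨hx1, hx2⟩ := Submodule.mem_inf.1 hx
    refine Submodule.mem_iSup_of_mem m
      (Submodule.mem_inf.2 ⟨wordMap_wordPow _ m ⟨x, hx1, rfl⟩, ?_⟩)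
    simp only [Submodule.mem_iInf] at hx2 ⊢
    intro i j hij
    have h : (wordPow k V i * relSub R * wordPow k V j).map (wordMap (genMap R σ hσ)).toLinearMap ≤
        wordPow k V i * relSub R * wordPow k V j := by
      rw [Submodule.map_mul, Submodule.map_mul]
      exact mul_le_mul' (mul_le_mul' (wordMap_wordPow _ i) (wordMap_relSub R σ hσ))
        (wordMap_wordPow _ j)
    exact h ⟨x, hx2 i j hij, rfl⟩
  | zero => simp
  | add x y _ _ hx hy => rw [map_add]; exact add_mem hx hy

/-- The map `v₁ ⋯ vₙ ↦ σ(v₁) ⋯ σ(vₙ)` of the Koszul dual coalgebra induced by a graded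
endomorphism `σ` of `T(V) / (R)`. -/
def coalgMap (σ : QuadAlg R →ₐ[k] QuadAlg R) (hσ : IsGradedEnd R σ) : Coalg R →ₗ[k] Coalg R :=
  (wordMap (genMap R σ hσ)).toLinearMap.restrict fun _ hx => wordMap_mem R σ hσ hx

/-! ### Koszul algebras -/

/-- The projection `A^¡ → V → A` of the Koszul dual coalgebra onto its degree one part `V`,
followed by the inclusion of the generators. -/
def twisting : Coalg R →ₗ[k] QuadAlg R :=
  (quadMk R).toLinearMap ∘ₗ Finsupp.lapply 1 ∘ₗ wordComp ∘ₗ (coalgSub R).subtype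

/-- The differential `a ⊗ v₁ ⋯ vₙ ↦ a v₁ ⊗ v₂ ⋯ vₙ` of the Koszul complex `⨁ n, A ⊗ A^¡_n`. -/
def koszulD : QuadAlg R ⊗[k] Coalg R →ₗ[k] QuadAlg R ⊗[k] Coalg R :=
  (LinearMap.mul' k (QuadAlg R) ∘ₗ (twisting R).lTensor _).rTensor _ ∘ₗ
    (TensorProduct.assoc k _ _ _).symm.toLinearMap ∘ₗ (comul R).lTensor _

/-- `A = T(V) / (R)` is Koszul: the complex
`⋯ → A ⊗ A^¡_2 → A ⊗ A^¡_1 → A → k → 0` is exact. Here it is written as one complex `A ⊗ A^¡`,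
with the augmentation `A ⊗ A^¡ → A ⊗ A^¡_0 = A → k`. -/
def IsKoszul : Prop :=
  ∀ x : QuadAlg R ⊗[k] Coalg R, koszulD R x = 0 →
    TensorProduct.lid k k (TensorProduct.map (quadAug R).toLinearMap (counit R) x) = 0 →
    ∃ y, koszulD R y = x

/-! ### The cobar construction of the Koszul dual coalgebra -/

/-- The coaugmentation coideal `⨁ n ≥ 1, A^¡_n`. -/
def CoalgBar : Type (max u v) := ↥(LinearMap.ker (counit R))

instance : AddCommGroup (CoalgBar R) := inferInstanceAs (AddCommGroup ↥(LinearMap.ker (counit R)))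

instance : Module k (CoalgBar R) := inferInstanceAs (Module k ↥(LinearMap.ker (counit R)))

/-- The inclusion of the coaugmentation coideal. -/
def coalgIncl : CoalgBar R →ₗ[k] Coalg R := (LinearMap.ker (counit R)).subtype

/-- The projection `c ↦ c - ε(c) 1` onto the coaugmentation coideal. -/
def toCoalgBar : Coalg R →ₗ[k] CoalgBar R :=
  (LinearMap.id - (LinearMap.toSpanSingleton k _ (coalgOne R)) ∘ₗ counit R).codRestrict
    (LinearMap.ker (counit R)) (by
    intro x
    simp [counit, coalgOne])

/-- The grading of the coaugmentation coideal. -/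
def coalgBarComp : CoalgBar R →ₗ[k] ℕ →₀ CoalgBar R :=
  Finsupp.mapRange.linearMap (toCoalgBar R) ∘ₗ coalgComp R ∘ₗ coalgIncl R

/-- The cobar construction `Ω(A^¡)`, the tensor algebra on `s⁻¹ Ā^¡`. -/
abbrev Cobar := TensorAlgebra k (CoalgBar R)

/-- The letter `s⁻¹ c` for `c ∈ A^¡` (zero for `c = 1`). -/
def cobarLetter : Coalg R →ₗ[k] Cobar R := TensorAlgebra.ι k ∘ₗ toCoalgBar R

/-- The grading of the cobar construction: the letter `s⁻¹ c` has degree `|c| - 1`. -/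
def cobarComp : Cobar R →ₗ[k] ℕ →₀ Cobar R := tensorComp (regrade (· - 1) (coalgBarComp R))

/-- The augmentation of the cobar construction. -/
def cobarAug : Cobar R →ₐ[k] k := TensorAlgebra.algebraMapInv

/-- `s⁻¹ c ↦ ∑ (-1) ^ |c'| s⁻¹ c' s⁻¹ c''`. -/
def cobarD₁ : CoalgBar R →ₗ[k] Cobar R :=
  LinearMap.mul' k (Cobar R) ∘ₗ
    TensorProduct.map (cobarLetter R ∘ₗ signOp (coalgComp R)) (cobarLetter R) ∘ₗ
    comul R ∘ₗ coalgIncl R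

/-- The differential of the cobar construction,
`x₁ ⋯ xₙ ↦ ∑ i, (-1) ^ (|x₁| + ⋯ + |xᵢ₋₁|) x₁ ⋯ d(xᵢ) ⋯ xₙ`. -/
def cobarD : Cobar R →ₗ[k] Cobar R :=
  LinearMap.mul' k (Cobar R) ∘ₗ
    TensorProduct.map (signOp (cobarComp R))
      (LinearMap.mul' k (Cobar R) ∘ₗ TensorProduct.map (cobarD₁ R) LinearMap.id) ∘ₗ
    split

/-- The algebra map `q : Ω(A^¡) → A`, `s⁻¹ c₁ ⋯ s⁻¹ cₙ ↦ c̄₁ ⋯ c̄ₙ`, where `c̄` is the image of `c`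
under the projection `A^¡ → V → A`. -/
def cobarProj : Cobar R →ₐ[k] QuadAlg R :=
  TensorAlgebra.lift k (twisting R ∘ₗ coalgIncl R)

section Twisted

variable (σ : QuadAlg R →ₐ[k] QuadAlg R) (hσ : IsGradedEnd R σ)

/-- The algebra map of `Ω(A^¡)` induced by `σ`. -/
def cobarMap : Cobar R →ₐ[k] Cobar R :=
  TensorAlgebra.lift k (cobarLetter R ∘ₗ coalgMap R σ hσ ∘ₗ coalgIncl R)

/-! ### The Hochschild complex of the coalgebra with twisted coefficients -/

/-- The underlying space `Ω(A^¡) ⊗ A^¡` of the Hochschild complex of `A^¡` with coefficients in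
`_σ A^¡`; its element `(c₁, …, cₙ, c₀)` is `s⁻¹ c₁ ⋯ s⁻¹ cₙ ⊗ c₀`. -/
abbrev CoCH := Cobar R ⊗[k] Coalg R

/-- `u ⊗ c ↦ ∑ (-1) ^ |u| u s⁻¹σ(c') ⊗ c''`. -/
def cobFirst : CoCH R →ₗ[k] CoCH R :=
  TensorProduct.map
    (LinearMap.mul' k (Cobar R) ∘ₗ
      TensorProduct.map (signOp (cobarComp R)) (cobarLetter R ∘ₗ coalgMap R σ hσ))
    LinearMap.id ∘ₗ
  (TensorProduct.assoc k _ _ _).symm.toLinearMap ∘ₗ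
  (comul R).lTensor _

/-- `u ⊗ c ↦ ∑ (-1) ^ (|c''| (|u| + |c'|)) s⁻¹c'' u ⊗ c'`. -/
def cobLast : CoCH R →ₗ[k] CoCH R :=
  TensorProduct.map
    (LinearMap.mul' k (Cobar R) ∘ₗ TensorProduct.map (cobarLetter R) LinearMap.id)
    LinearMap.id ∘ₗ
  (TensorProduct.assoc k _ _ _).symm.toLinearMap ∘ₗ
  koszulMove (TensorProduct.map (signOp (cobarComp R)) (signOp (coalgComp R))) (coalgComp R) ∘ₗ
  (TensorProduct.assoc k _ _ _).symm.toLinearMap ∘ₗ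
  (comul R).lTensor _

/-- The boundary of the Hochschild complex of `A^¡` with coefficients in `_σ A^¡`, the bicomodule
with left coaction `c ↦ σ(c') ⊗ c''` and right coaction `c ↦ c' ⊗ c''`. -/
def coB : CoCH R →ₗ[k] CoCH R :=
  TensorProduct.map (cobarD R) LinearMap.id + cobFirst R σ hσ - cobLast R

/-- For words `v = v₁ ⋯ vₘ` in `Ω(A^¡)`, the map
`u ⊗ v ↦ ∑ i, ± vᵢ₊₁ ⋯ vₘ u σ(v₁) ⋯ σ(vᵢ₋₁) ⊗ vᵢ`, the sign being `(-1)` to the power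
`|v'| + |v''| (|u| + |v'| + |vᵢ|)`, where `v' = v₁ ⋯ vᵢ₋₁`, `v'' = vᵢ₊₁ ⋯ vₘ`, and `|vᵢ|` is the
degree of `vᵢ` in `A^¡`. -/
def rotate : Cobar R ⊗[k] Cobar R →ₗ[k] CoCH R :=
  (LinearMap.mul' k (Cobar R)).rTensor _ ∘ₗ
  (TensorProduct.assoc k _ _ _).symm.toLinearMap ∘ₗ
  koszulMove (TensorProduct.map (signOp (cobarComp R)) (signOp (coalgComp R))) (cobarComp R) ∘ₗ
  TensorProduct.map
    (TensorProduct.map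
      (LinearMap.mul' k (Cobar R) ∘ₗ
        TensorProduct.map LinearMap.id ((cobarMap R σ hσ).toLinearMap ∘ₗ signOp (cobarComp R)))
      (coalgIncl R))
    LinearMap.id ∘ₗ
  (TensorProduct.assoc k _ _ _).symm.toLinearMap ∘ₗ
  (TensorProduct.assoc k _ _ _).symm.toLinearMap ∘ₗ
  split.lTensor _

/-- The Connes operator `(c₁, …, cₙ, c₀) ↦ ε(c₀) ∑ i, ± (cᵢ₊₁, …, cₙ, σ(c₁), …, σ(cᵢ₋₁), cᵢ)`. -/
def coConnesB : CoCH R →ₗ[k] CoCH R :=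
  rotate R σ hσ ∘ₗ TensorProduct.mk k _ _ 1 ∘ₗ
    (TensorProduct.rid k _).toLinearMap ∘ₗ (counit R).lTensor _

/-- The part of total degree `n`, spanned by the `(c₁, …, cᵣ, c₀)` with homogeneous entries and
`∑ i ≥ 1, (|cᵢ| - 1) + |c₀| = n`. -/
def coDeg (n : ℕ) : Submodule k (CoCH R) :=
  Submodule.span k {x | ∃ (i : ℕ) (c : Coalg R) (l : List (ℕ × CoalgBar R)),
    (c : TensorAlgebra k V) ∈ coalgDeg R i ∧
    (∀ p ∈ l, (coalgIncl R p.2 : TensorAlgebra k V) ∈ coalgDeg R p.1) ∧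
    (l.map fun p => p.1 - 1).sum + i = n ∧
    x = (l.map fun p => TensorAlgebra.ι k p.2).prod ⊗ₜ[k] c}

/-- The subspace spanned by the `(c₁, …, cᵣ, c₀)` whose entries are eigenvectors of `σ`, the product
of the eigenvalues being `1`. -/
def coOne : Submodule k (CoCH R) :=
  Submodule.span k {x | ∃ (μ : k) (c : Coalg R) (l : List (k × CoalgBar R)),
    coalgMap R σ hσ c = μ • c ∧
    (∀ p ∈ l, coalgMap R σ hσ (coalgIncl R p.2) = p.1 • coalgIncl R p.2) ∧
    (l.map fun p => p.1).prod * μ = 1 ∧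
    x = (l.map fun p => TensorAlgebra.ι k p.2).prod ⊗ₜ[k] c}

/-! ### The maps `p₁`, `p₂`, `q₂` and the homotopy `h` -/

/-- `p₁ (a₀, a₁, …, aₙ) = (q a₀, q a₁, …, q aₙ)`. -/
def p₁ : CH (cobarAug R) →ₗ[k] CH (quadAug R) := chMap (cobarAug R) (quadAug R) (cobarProj R)

/-- `q₂ (u) = u ⊗ 1`, `q₂ (u, v₁ ⋯ vₘ) = ∑ i, ± vᵢ₊₁ ⋯ vₘ u σ(v₁) ⋯ σ(vᵢ₋₁) ⊗ vᵢ` and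
`q₂ (u, a₁, …, aᵣ) = 0` for `r ≥ 2`. -/
def q₂ : CH (cobarAug R) →ₗ[k] CoCH R :=
  TensorProduct.map LinearMap.id
    (LinearMap.toSpanSingleton k _ (coalgOne R) ∘ₗ TensorAlgebra.algebraMapInv.toLinearMap) +
  rotate R σ hσ ∘ₗ
    TensorProduct.map LinearMap.id (augIncl (cobarAug R) ∘ₗ TensorAlgebra.ιInv)

/-- The part `c ↦ ∑ [c⁽¹⁾|⋯|c⁽ʲ⁾]` with `j` bar letters of the map `barCobar`. -/
def barCobarPart : ℕ → Coalg R →ₗ[k] Bar (cobarAug R)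
  | 0 => Algebra.linearMap k _ ∘ₗ counit R
  | j + 1 => LinearMap.mul' k (Bar (cobarAug R)) ∘ₗ
      TensorProduct.map (barLetter (cobarAug R) ∘ₗ cobarLetter R) (barCobarPart j) ∘ₗ comul R

/-- The map `c ↦ ∑ j, ∑ [c⁽¹⁾|⋯|c⁽ʲ⁾]` from `A^¡` to the bar construction of `Ω(A^¡)`, with the
iterated reduced coproducts of `c`; for `c` of degree `n` only `j ≤ n` contribute. -/
def barCobar : Coalg R →ₗ[k] Bar (cobarAug R) :=
  Finsupp.lsum k (fun n : ℕ => ∑ j ∈ Finset.range (n + 1), barCobarPart R j) ∘ₗ coalgComp R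

/-- `p₂ (u ⊗ c) = ∑ j, ∑ (u, c⁽¹⁾, …, c⁽ʲ⁾)`. -/
def p₂ : CoCH R →ₗ[k] CH (cobarAug R) := (barCobar R).lTensor _

/-- For a word `v = v₁ ⋯ vₘ` in `Ω(A^¡)`, the sum over `i` of the
`((u ⊗ w) ⊗ (v₁ ⋯ vᵢ₋₁ ⊗ vᵢ)) ⊗ vᵢ₊₁ ⋯ vₘ`, where `v` is the last entry of a Hochschild chain
`u ⊗ w[v]`. It vanishes on chains without bar letters. -/
def splitLast : CH (cobarAug R) →ₗ[k]
    (CH (cobarAug R) ⊗[k] (Cobar R ⊗[k] CoalgBar R)) ⊗[k] Cobar R :=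
  (TensorProduct.assoc k _ _ _).symm.toLinearMap ∘ₗ
  TensorProduct.map LinearMap.id
    ((TensorProduct.assoc k _ _ _).symm.toLinearMap ∘ₗ split ∘ₗ
      augIncl (cobarAug R)) ∘ₗ
  (TensorProduct.assoc k _ _ _).symm.toLinearMap ∘ₗ
  lastLetter.lTensor _

/-- The contracting homotopy
`(a₀, …, aₙ, v₁ ⋯ vₘ) ↦ ∑ i ≥ 2, ∑ j, ± (vᵢ₊₁ ⋯ vₘ a₀, a₁, …, aₙ, v₁ ⋯ vᵢ₋₁, vᵢ⁽¹⁾, …, vᵢ⁽ʲ⁾)`,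
and `a₀ ↦ 0`. With `v' = v₁ ⋯ vᵢ₋₁`, `v'' = vᵢ₊₁ ⋯ vₘ` and `e = |a₀| + ∑ l ≥ 1, (|aₗ| + 1)`, the
sign is `(-1)` to the power `1 + |v''| + e + |v'| + |v''| (e + |v'| + |vᵢ|)`, where `|vᵢ|` is the
degree of `vᵢ` in `A^¡`. -/
def homotopy : CH (cobarAug R) →ₗ[k] CH (cobarAug R) :=
  TensorProduct.map
    (LinearMap.mul' k (Cobar R))
    (LinearMap.mul' k (Bar (cobarAug R)) ∘ₗ
      TensorProduct.map LinearMap.id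
        (LinearMap.mul' k (Bar (cobarAug R)) ∘ₗ
          TensorProduct.map (barLetter (cobarAug R)) (barCobar R ∘ₗ coalgIncl R))) ∘ₗ
  (TensorProduct.assoc k _ _ _).symm.toLinearMap ∘ₗ
  (TensorProduct.assoc k _ _ _).toLinearMap.lTensor _ ∘ₗ
  koszulMove
    (TensorProduct.map
      (TensorProduct.map (signOp (cobarComp R)) (signOp (barComp (cobarComp R) (cobarAug R))))
      (TensorProduct.map (signOp (cobarComp R)) (signOp (coalgBarComp R))))
    (cobarComp R) ∘ₗ
  TensorProduct.map
    (TensorProduct.map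
      (TensorProduct.map (-signOp (cobarComp R)) (signOp (barComp (cobarComp R) (cobarAug R))))
      (TensorProduct.map (signOp (cobarComp R)) LinearMap.id))
    (signOp (cobarComp R)) ∘ₗ
  splitLast R

/-! ### The three mixed complexes -/

/-- The boundary of `CH(A; A_σ)`; the algebra `A` is placed in degree `0`. -/
def bAlg : CH (quadAug R) →ₗ[k] CH (quadAug R) := hochB (Finsupp.lsingle 0) 0 (quadAug R) σ

/-- The Connes operator of `CH(A; A_σ)`. -/
def BAlg : CH (quadAug R) →ₗ[k] CH (quadAug R) := connesB (Finsupp.lsingle 0) (quadAug R) σ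

/-- The part of degree `n` of `CH(A; A_σ)`. -/
def degAlg (n : ℕ) : Submodule k (CH (quadAug R)) := chDeg (Finsupp.lsingle 0) (quadAug R) n

/-- The subspace `CH¹(A; A_σ)`. -/
def oneAlg : Submodule k (CH (quadAug R)) := chOne (quadAug R) σ

/-- The boundary of `CH(Ω(A^¡); Ω(A^¡)_σ)`. -/
def bCobar : CH (cobarAug R) →ₗ[k] CH (cobarAug R) :=
  hochB (cobarComp R) (cobarD R) (cobarAug R) (cobarMap R σ hσ)

/-- The Connes operator of `CH(Ω(A^¡); Ω(A^¡)_σ)`. -/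
def BCobar : CH (cobarAug R) →ₗ[k] CH (cobarAug R) :=
  connesB (cobarComp R) (cobarAug R) (cobarMap R σ hσ)

/-- The part of degree `n` of `CH(Ω(A^¡); Ω(A^¡)_σ)`. -/
def degCobar (n : ℕ) : Submodule k (CH (cobarAug R)) := chDeg (cobarComp R) (cobarAug R) n

/-- The subspace `CH¹(Ω(A^¡); Ω(A^¡)_σ)`. -/
def oneCobar : Submodule k (CH (cobarAug R)) := chOne (cobarAug R) (cobarMap R σ hσ)

end Twisted

end Quadratic

end KoszulHH

end

open KoszulHH

/-!
Write `C = A^¡` and `Ω = Ω(C)`. Chains of `CH(E; E_σ)` are elements of `E ⊗ T(Ē)`; everything is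
reduced to identities between operators on them, proved by adding letters on the right.

*The mixed complexes.* The boundary is determined by three operations, the left multiplication
`L_a` on `a₀`, the addition `X_a` of a last letter, and a right action `R_a` of `E`: up to signs,
the part of `b` that lowers the number of letters takes `X_a ω` to `R_a ω - L_a ω`
(`IsAugDGA.hochB_letterMul`). Since `R` is an action which commutes with `L`
(`IsAugDGA.rightAct_rightAct`, `IsAugDGA.leftMul_rightAct`), `b² = 0` follows, and naturality is
immediate. For the Connes operator, the sum of the twisted rotations of a word satisfies a recursion
in its last letter (`IsAugDGA.cycSum_mul_letter`), which gives `b B + B b = Σ - 1` for the total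
automorphism `Σ` induced by `σ`, on all chains (`IsAugDGA.hochB_connesB`). As `σ` is
diagonalizable, `CH¹` is the space of fixed points of `Σ` (`chOne_eq`), and there the relations of a
mixed complex hold.

*The coalgebra.* Let `W : C → T(Ω̄)` be the map with `W(c) = ∑ [s⁻¹c⁽¹⁾|⋯|s⁻¹c⁽ʲ⁾]`. It satisfies
`W = ε + s * W = ε + W * s` for the convolution product, `s` being `c ↦ [s⁻¹c]`, and it takes values
in the cycles of the bar construction (`barD_barCobar`), because `∂ W = (∂ W) * s` and `s` vanishes
in degree zero. Hence `p₂(u ⊗ c) = u ⊗ W(c)` commutes with `b` (`p₂_coB`). The rotations, the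
homotopy `h`, and the map `h b + p₂ q₂` without its internal part all satisfy a recursion with
respect to the last letter `s⁻¹c` of the last entry (`rotate_mul_letter`, `homotopy_mul_letter`,
`outerPart_mul_letter`). An induction on the length of that entry therefore proves
`h b + b h = 1 - p₂ q₂` (`homotopy_letterMul_add`, `homotopy_hochB`), for every quadratic algebra. As
`q₂ p₂ = 1`, the mixed complex structure of `Ω ⊗ C` and the compatibility of `q₂` with `b` are
transferred from `CH(Ω; Ω_σ)`.

*The algebra.* Koszulness is used to show that `ker (q : Ω → A)` is acyclic (`exists_cobarD_eq`). The
twisted tensor product `Ω ⊗ C` has a contraction, `u s⁻¹c ↦ ± u ⊗ c`, so a cycle `x ∈ ker q` has an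
explicit primitive `U` of `x ⊗ 1` (`twistedD_openLast`). The image of `U` in the Koszul complex
`A ⊗ C` is a cycle, hence a boundary, and can be removed; then the components of `U` in `Ω ⊗ C_n`,
`n ≥ 1`, are removed one by one, by induction on the weight (`exists_of_twistedD_eq`). Over a field
this gives a contraction of `Ω` onto `A` (`exists_isContraction`). Applied to the entries of chains,
it contracts the complex with the internal part of `b` only; the remaining part of `b` lowers the
number of letters, so that the kernel of `p₁` is acyclic by induction on that number
(`exists_hochB_eq`). Since `p₁` is surjective and preserves degrees and `Σ`, it is a
quasi-isomorphism on the fixed points of `Σ` in each degree.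
-/

open scoped TensorProduct

noncomputable section

namespace KoszulHH

open TensorProduct (tmul_add map_tmul tmul_smul add_tmul smul_tmul' zero_tmul tmul_zero assoc_tmul
  assoc_symm_tmul neg_tmul tmul_neg tmul_sub sub_tmul smul_tmul_smul)
open LinearMap (comp_apply mul' mulLeft mulRight mul'_apply mulLeft_apply mulRight_apply
  lTensor_tmul rTensor_tmul id_apply)
open Submodule (smul_mem subset_span span_induction mem_comap mem_bot)
open Module.End (eigenspace mem_eigenspace_iff)
open Finsupp (single_apply single_eq_same lapply lsingle)

universe u v w

/-! ### Shortcut instances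

These instances agree with the ones found by type class search, which they shorten. They are
scoped, so that the search is unchanged elsewhere. -/

namespace Shortcut

variable {k : Type u} [Field k]

section AddCommGroup

variable {M : Type v} [AddCommGroup M] [Module k M]

scoped instance : Semiring (TensorAlgebra k M) := inferInstance

scoped instance : AddCommMonoid (TensorAlgebra k M) := inferInstance

scoped instance : AddCommGroup (TensorAlgebra k M) := inferInstance

scoped instance : Algebra k (TensorAlgebra k M) := inferInstance

scoped instance : Module k (TensorAlgebra k M) := inferInstance

scoped instance {N : Type w} [AddCommGroup N] [Module k N] : AddCommGroup (M ⊗[k] N) :=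
  inferInstance

variable (R : Submodule k (M ⊗[k] M))

scoped instance : AddCommMonoid (QuadAlg R) := inferInstance

scoped instance : AddCommGroup (QuadAlg R) := inferInstance

scoped instance : Semiring (QuadAlg R) := inferInstance

scoped instance : Algebra k (QuadAlg R) := inferInstance

scoped instance : Module k (QuadAlg R) := inferInstance

scoped instance : AddCommMonoid (Coalg R) := inferInstance

scoped instance : AddCommGroup (Coalg R) := inferInstance

scoped instance : Module k (Coalg R) := inferInstance

end AddCommGroup

section AddCommMonoid

variable {M : Type v} [AddCommMonoid M] [Module k M] {N : Type w} [AddCommMonoid N] [Module k N]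

scoped instance : AddCommMonoid (M ⊗[k] N) := inferInstance

scoped instance : Module k (M ⊗[k] N) := inferInstance

scoped instance : AddHomClass (M →ₗ[k] N) M N := inferInstance

scoped instance : ZeroHomClass (M →ₗ[k] N) M N := inferInstance

scoped instance : AddMonoidHomClass (M →ₗ[k] N) M N := inferInstance

scoped instance : AddHomClass (M ≃ₗ[k] N) M N := inferInstance

scoped instance : ZeroHomClass (M ≃ₗ[k] N) M N := inferInstance

scoped instance : AddMonoidHomClass (M ≃ₗ[k] N) M N := inferInstance

end AddCommMonoid

section Algebra

variable {A : Type v} [Semiring A] [Algebra k A] {B : Type w} [Semiring B] [Algebra k B]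

scoped instance : AddHomClass (A →ₐ[k] B) A B := inferInstance

scoped instance : ZeroHomClass (A →ₐ[k] B) A B := inferInstance

scoped instance : AddMonoidHomClass (A →ₐ[k] B) A B := inferInstance

scoped instance : MulActionHomClass (A →ₐ[k] B) k A B := inferInstance

end Algebra

end Shortcut

open scoped Shortcut

/-! ### Graded modules recorded by component maps -/

section Grading

variable {k : Type u} [Field k] {M : Type v} [AddCommGroup M] [Module k M]
  {N : Type w} [AddCommGroup N] [Module k N]

/-- The homogeneous elements of degree `n`. -/
def homog (c : M →ₗ[k] ℕ →₀ M) (n : ℕ) : Submodule k M :=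
  LinearMap.eqLocus c (lsingle n)

theorem mem_homog {c : M →ₗ[k] ℕ →₀ M} {n : ℕ} {x : M} :
    x ∈ homog c n ↔ c x = Finsupp.single n x := Iff.rfl

/-- The component map `c` comes from a grading `M = ⨁ n, homog c n`. -/
structure IsGrading (c : M →ₗ[k] ℕ →₀ M) : Prop where
  sum_comp : ∀ x, ((c x).sum fun _ y => y) = x
  comp_mem : ∀ x n, c x n ∈ homog c n

theorem IsGrading.induction {c : M →ₗ[k] ℕ →₀ M} (hc : IsGrading c) {P : M → Prop} (x : M)
    (hom : ∀ n, ∀ y ∈ homog c n, P y) (add : ∀ y z, P y → P z → P (y + z)) : P x := by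
  rw [← hc.sum_comp x, Finsupp.sum]
  exact Finset.sum_induction _ P add (hom 0 0 (zero_mem _)) fun n _ => hom n _ (hc.comp_mem x n)

theorem IsGrading.ext_homog {c : M →ₗ[k] ℕ →₀ M} (hc : IsGrading c) {f g : M →ₗ[k] N}
    (h : ∀ n, ∀ y ∈ homog c n, f y = g y) : f = g := by
  ext x
  induction x using hc.induction with
  | hom n y hy => exact h n y hy
  | add y z hy hz => rw [map_add, map_add, hy, hz]

/-- A map which fixes elements of a family spanning `M` up to sums determines a grading. -/
theorem isGrading_of_span {c : M →ₗ[k] ℕ →₀ M}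
    (h : ∀ x, x ∈ Submodule.span k {y | ∃ n, y ∈ homog c n}) : IsGrading c where
  sum_comp x := by
    induction h x using span_induction with
    | mem x hx => obtain ⟨n, hn⟩ := hx; rw [mem_homog.1 hn, Finsupp.sum_single_index rfl]
    | zero => simp
    | add x y _ _ hx hy =>
      rw [map_add, Finsupp.sum_add_index' (fun _ => rfl) (fun _ _ _ => rfl), hx, hy]
    | smul r x _ hx =>
      rw [map_smul, Finsupp.sum_smul_index' (fun _ => rfl), ← Finsupp.smul_sum, hx]
  comp_mem x n := by
    induction h x using span_induction with
    | mem x hx =>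
      obtain ⟨m, hm⟩ := hx
      rw [mem_homog.1 hm, single_apply]
      split_ifs with h
      · exact h ▸ hm
      · exact zero_mem _
    | zero => simp
    | add x y _ _ hx hy => rw [map_add]; exact add_mem hx hy
    | smul r x _ hx => rw [map_smul]; exact smul_mem _ r hx

theorem homog_eq_zero {c : M →ₗ[k] ℕ →₀ M} {n m : ℕ} {x : M} (hx : x ∈ homog c n)
    (hx' : x ∈ homog c m) (h : n ≠ m) : x = 0 := by
  have := DFunLike.congr_fun ((mem_homog.1 hx).symm.trans (mem_homog.1 hx')) n
  simpa [single_apply, h.symm] using this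

theorem signOp_of_mem {c : M →ₗ[k] ℕ →₀ M} {n : ℕ} {x : M} (hx : x ∈ homog c n) :
    signOp c x = (-1 : k) ^ n • x := by
  simp [signOp, mem_homog.1 hx]

/-- The Koszul sign is produced by applying the sign operator `s` once for each degree of the
element that moves. -/
theorem koszulMove_tmul {c : M →ₗ[k] ℕ →₀ M} (s : N →ₗ[k] N) {n : ℕ} {x : M}
    (hx : x ∈ homog c n) (y : N) : koszulMove s c (y ⊗ₜ[k] x) = x ⊗ₜ[k] (s ^ n) y := by
  simp [koszulMove, mem_homog.1 hx]

theorem pow_apply_of_eq_smul {s : N →ₗ[k] N} {r : k} {y : N} (h : s y = r • y) (n : ℕ) :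
    (s ^ n) y = r ^ n • y := by
  induction n with
  | zero => simp
  | succ n ih => rw [pow_succ', Module.End.mul_apply, ih, map_smul, h, smul_smul, pow_succ]

theorem regrade_mem {c : M →ₗ[k] ℕ →₀ M} (f : ℕ → ℕ) {n : ℕ} {x : M} (hx : x ∈ homog c n) :
    x ∈ homog (regrade f c) (f n) := by
  rw [mem_homog, regrade, comp_apply, mem_homog.1 hx, Finsupp.lmapDomain_apply,
    Finsupp.mapDomain_single]

theorem IsGrading.mem_span {c : M →ₗ[k] ℕ →₀ M} (hc : IsGrading c) (x : M) :
    x ∈ Submodule.span k {y | ∃ n, y ∈ homog c n} := by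
  induction x using hc.induction with
  | hom n y hy => exact subset_span ⟨n, hy⟩
  | add y z hy hz => exact add_mem hy hz

theorem IsGrading.regrade {c : M →ₗ[k] ℕ →₀ M} (hc : IsGrading c) (f : ℕ → ℕ) :
    IsGrading (regrade f c) :=
  isGrading_of_span fun x =>
    Submodule.span_mono (by rintro _ ⟨n, hn⟩; exact ⟨f n, regrade_mem f hn⟩) (hc.mem_span x)

theorem isGrading_lsingle : IsGrading (lsingle 0 : M →ₗ[k] ℕ →₀ M) :=
  isGrading_of_span fun _ => subset_span (s := {y | ∃ n, y ∈ homog _ n}) ⟨0, rfl⟩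

/-- The total grading of a tensor product. -/
def tmulComp (c : M →ₗ[k] ℕ →₀ M) (c' : N →ₗ[k] ℕ →₀ N) : M ⊗[k] N →ₗ[k] ℕ →₀ M ⊗[k] N :=
  Finsupp.lmapDomain _ k (fun p : ℕ × ℕ => p.1 + p.2) ∘ₗ
    (finsuppTensorFinsupp k k M N ℕ ℕ).toLinearMap ∘ₗ TensorProduct.map c c'

theorem tmul_mem {c : M →ₗ[k] ℕ →₀ M} {c' : N →ₗ[k] ℕ →₀ N} {i j : ℕ} {x : M} {y : N}
    (hx : x ∈ homog c i) (hy : y ∈ homog c' j) : x ⊗ₜ[k] y ∈ homog (tmulComp c c') (i + j) := by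
  rw [mem_homog, tmulComp]
  simp [mem_homog.1 hx, mem_homog.1 hy, finsuppTensorFinsupp_single, Finsupp.mapDomain_single]

theorem IsGrading.span_tmul {c : M →ₗ[k] ℕ →₀ M} {c' : N →ₗ[k] ℕ →₀ N} (hc : IsGrading c)
    (hc' : IsGrading c') (x : M ⊗[k] N) : x ∈ Submodule.span k
      {z | ∃ i j, ∃ y ∈ homog c i, ∃ y' ∈ homog c' j, z = y ⊗ₜ[k] y'} := by
  induction x with
  | zero => exact zero_mem _
  | tmul a b =>
    induction a using hc.induction with
    | hom i a ha =>
      induction b using hc'.induction with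
      | hom j b hb => exact subset_span ⟨i, j, a, ha, b, hb, rfl⟩
      | add y z hy hz => rw [tmul_add]; exact add_mem hy hz
    | add y z hy hz => rw [add_tmul]; exact add_mem hy hz
  | add a b ha hb => exact add_mem ha hb

theorem IsGrading.tmul {c : M →ₗ[k] ℕ →₀ M} {c' : N →ₗ[k] ℕ →₀ N} (hc : IsGrading c)
    (hc' : IsGrading c') : IsGrading (tmulComp c c') :=
  isGrading_of_span fun x => Submodule.span_mono
    (by rintro _ ⟨i, j, y, hy, y', hy', rfl⟩; exact ⟨i + j, tmul_mem hy hy'⟩)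
    (hc.span_tmul hc' x)

theorem ext_tmul_homog {c : M →ₗ[k] ℕ →₀ M} {c' : N →ₗ[k] ℕ →₀ N} (hc : IsGrading c)
    (hc' : IsGrading c') {Y : Type*} [AddCommMonoid Y] [Module k Y] {f g : M ⊗[k] N →ₗ[k] Y}
    (h : ∀ i j, ∀ y ∈ homog c i, ∀ y' ∈ homog c' j, f (y ⊗ₜ[k] y') = g (y ⊗ₜ[k] y')) :
    f = g := by
  apply LinearMap.ext
  intro x
  induction hc.span_tmul hc' x using span_induction with
  | mem x hx => obtain ⟨i, j, y, hy, y', hy', rfl⟩ := hx; exact h i j y hy y' hy'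
  | zero => simp
  | add y z _ _ hy hz => rw [map_add, map_add, hy, hz]
  | smul r y _ hy => rw [map_smul, map_smul, hy]

/-! ### Gradings of tensor algebras -/

open TensorAlgebra

theorem one_mem_homog (c : M →ₗ[k] ℕ →₀ M) : (1 : TensorAlgebra k M) ∈ homog (tensorComp c) 0 := by
  rw [mem_homog, tensorComp, comp_apply, AlgHom.toLinearMap_apply, map_one]
  rfl

theorem ι_mem_homog {c : M →ₗ[k] ℕ →₀ M} {i : ℕ} {m : M} (hm : m ∈ homog c i) :
    ι k m ∈ homog (tensorComp c) i := by
  rw [mem_homog, tensorComp, comp_apply, AlgHom.toLinearMap_apply, tensorCompHom,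
    lift_ι_apply, comp_apply, comp_apply, mem_homog.1 hm,
    Finsupp.mapRange.linearMap_apply, Finsupp.mapRange_single]
  rfl

theorem mul_mem_homog {c : M →ₗ[k] ℕ →₀ M} {i j : ℕ} {x y : TensorAlgebra k M}
    (hx : x ∈ homog (tensorComp c) i) (hy : y ∈ homog (tensorComp c) j) :
    x * y ∈ homog (tensorComp c) (i + j) := by
  have key : ∀ (n : ℕ) (z : TensorAlgebra k M), z ∈ homog (tensorComp c) n ↔
      tensorCompHom c z = AddMonoidAlgebra.single n z := by
    intro n z
    rw [mem_homog, tensorComp, comp_apply, AlgHom.toLinearMap_apply]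
    exact ((AddMonoidAlgebra.coeffLinearEquiv k).injective.eq_iff
      (b := AddMonoidAlgebra.single n z))
  rw [key] at *
  rw [map_mul, hx, hy, AddMonoidAlgebra.single_mul_single]

/-- Induction over the words whose letters are taken from a spanning set `S` of homogeneous
elements, adding letters on the right. -/
theorem tensor_induction_of_span {c : M →ₗ[k] ℕ →₀ M} (S : Set M)
    (hS : ∀ m, m ∈ Submodule.span k S) (hS' : ∀ m ∈ S, ∃ j, m ∈ homog c j)
    {P : TensorAlgebra k M → Prop} (add : ∀ x y, P x → P y → P (x + y))
    (smul : ∀ (r : k) x, P x → P (r • x)) (one : P 1)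
    (snoc : ∀ (i : ℕ) (x : TensorAlgebra k M) (m : M), x ∈ homog (tensorComp c) i →
      m ∈ S → P x → P (x * ι k m)) (x : TensorAlgebra k M) : P x := by
  have zero : P 0 := by simpa using smul 0 _ one
  have key : ∀ x y : TensorAlgebra k M, x ∈ Submodule.span k
      {x | P x ∧ ∃ i, x ∈ homog (tensorComp c) i} → x * y ∈ Submodule.span k
      {x | P x ∧ ∃ i, x ∈ homog (tensorComp c) i} := by
    intro x y
    induction y using TensorAlgebra.induction generalizing x with
    | algebraMap r =>
      intro hx
      rw [← Algebra.commutes, ← Algebra.smul_def]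
      exact smul_mem _ r hx
    | ι m =>
      intro hx
      induction hS m using span_induction with
      | mem m hm =>
        induction hx using span_induction with
        | mem x hx =>
          obtain ⟨h1, i, h2⟩ := hx
          obtain ⟨j, hj⟩ := hS' m hm
          exact subset_span ⟨snoc i x m h2 hm h1, _, mul_mem_homog h2 (ι_mem_homog hj)⟩
        | zero => simp
        | add y z _ _ hy hz => rw [add_mul]; exact add_mem hy hz
        | smul r y _ hy => rw [smul_mul_assoc]; exact smul_mem _ r hy
      | zero => simp
      | add y z _ _ hy hz => rw [map_add, mul_add]; exact add_mem hy hz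
      | smul r y _ hy => rw [map_smul, mul_smul_comm]; exact smul_mem _ r hy
    | mul a b ha hb => intro hx; rw [← mul_assoc]; exact hb _ (ha _ hx)
    | add a b ha hb => intro hx; rw [mul_add]; exact add_mem (ha _ hx) (hb _ hx)
  have h := key 1 x (subset_span ⟨one, 0, one_mem_homog c⟩)
  rw [one_mul] at h
  induction h using span_induction with
  | mem x hx => exact hx.1
  | zero => exact zero
  | add y z _ _ hy hz => exact add _ _ hy hz
  | smul r y _ hy => exact smul _ _ hy

/-- Induction over the words with homogeneous letters, adding letters on the right. -/
theorem tensor_induction_snoc {c : M →ₗ[k] ℕ →₀ M} (hc : IsGrading c)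
    {P : TensorAlgebra k M → Prop} (add : ∀ x y, P x → P y → P (x + y))
    (smul : ∀ (r : k) x, P x → P (r • x)) (one : P 1)
    (snoc : ∀ (i j : ℕ) (x : TensorAlgebra k M) (m : M), x ∈ homog (tensorComp c) i →
      m ∈ homog c j → P x → P (x * ι k m)) (x : TensorAlgebra k M) : P x :=
  tensor_induction_of_span (c := c) {y | ∃ n, y ∈ homog c n} hc.mem_span (fun _ h => h)
    add smul one (fun i x m hx ⟨j, hm⟩ h => snoc i j x m hx hm h) x

theorem IsGrading.tensor {c : M →ₗ[k] ℕ →₀ M} (hc : IsGrading c) : IsGrading (tensorComp c) := by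
  refine isGrading_of_span fun x => ?_
  induction x using tensor_induction_snoc hc with
  | add x y hx hy => exact add_mem hx hy
  | smul r x hx => exact smul_mem _ r hx
  | one => exact subset_span ⟨0, one_mem_homog c⟩
  | snoc i j x m hx hm _ =>
    exact subset_span ⟨_, mul_mem_homog hx (ι_mem_homog hm)⟩

theorem signOp_one (c : M →ₗ[k] ℕ →₀ M) : signOp (tensorComp c) 1 = 1 := by
  rw [signOp_of_mem (one_mem_homog c)]; simp

theorem signOp_mul {c : M →ₗ[k] ℕ →₀ M} (hc : IsGrading c) (x y : TensorAlgebra k M) :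
    signOp (tensorComp c) (x * y) = signOp (tensorComp c) x * signOp (tensorComp c) y := by
  induction x using hc.tensor.induction with
  | hom i x hx =>
    induction y using hc.tensor.induction with
    | hom j y hy =>
      rw [signOp_of_mem hx, signOp_of_mem hy, signOp_of_mem (mul_mem_homog hx hy), pow_add,
        smul_mul_smul_comm]
    | add y z hy hz => rw [mul_add, map_add, hy, hz, map_add, mul_add]
  | add y z hy hz => rw [add_mul, map_add, hy, hz, map_add, add_mul]

theorem IsGrading.signOp_signOp {c : M →ₗ[k] ℕ →₀ M} (hc : IsGrading c) (x : M) :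
    signOp c (signOp c x) = x := by
  induction x using hc.induction with
  | hom i x hx =>
    rw [signOp_of_mem hx, map_smul, signOp_of_mem hx, smul_smul, ← mul_pow]; simp
  | add y z hy hz => rw [map_add, map_add, hy, hz]

/-! ### Letters of words -/

theorem split_mul (x y : TensorAlgebra k M) : split (x * y) =
    ((mulRight k y).lTensor M).lTensor _ (split x) +
      (mulLeft k x).rTensor _ (split y) := by
  induction x using TensorAlgebra.induction generalizing y with
  | algebraMap r =>
    rw [Algebra.algebraMap_eq_smul_one, smul_mul_assoc, one_mul, map_smul, map_smul, split_one]
    have : mulLeft k (r • (1 : TensorAlgebra k M)) = r • LinearMap.id := by ext; simp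
    simp [this, LinearMap.rTensor_smul]
  | ι m =>
    rw [split_ι_mul]
    have := split_ι_mul m (1 : TensorAlgebra k M)
    rw [mul_one, split_one, map_zero, add_zero] at this
    simp [this]
  | mul a b ha hb =>
    rw [mul_assoc, ha, hb, ha]
    simp only [map_add, ← comp_apply, LinearMap.mulLeft_mul,
      LinearMap.mulRight_mul, LinearMap.lTensor_comp, LinearMap.rTensor_comp]
    rw [LinearMap.comp_assoc, LinearMap.comp_assoc, ← add_assoc]
    congr 2
    simp only [← LinearMap.comp_assoc, LinearMap.lTensor_comp_rTensor,
      LinearMap.rTensor_comp_lTensor]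
  | add a b ha hb =>
    have : mulLeft k (a + b) = mulLeft k a + mulLeft k b := by
      ext; simp [add_mul]
    rw [add_mul, map_add, ha, hb, this, LinearMap.rTensor_add, map_add, map_add,
      LinearMap.add_apply]
    abel

theorem split_ι (m : M) : split (ι k m) = (1 : TensorAlgebra k M) ⊗ₜ[k] (m ⊗ₜ[k] 1) := by
  have := split_ι_mul m (1 : TensorAlgebra k M)
  rwa [mul_one, split_one, map_zero, add_zero] at this

theorem split_mul_ι (x : TensorAlgebra k M) (m : M) : split (x * ι k m) =
    ((mulRight k (ι k m)).lTensor M).lTensor _ (split x) + x ⊗ₜ[k] (m ⊗ₜ[k] 1) := by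
  rw [split_mul, split_ι]; simp

theorem algebraMapInv_ι (m : M) : algebraMapInv (ι k m) = 0 := by simp [algebraMapInv]

theorem firstLetter_one : firstLetter (1 : TensorAlgebra k M) = 0 := by
  simp [firstLetter, split_one]

theorem firstLetter_ι_mul (m : M) (x : TensorAlgebra k M) :
    firstLetter (ι k m * x) = m ⊗ₜ[k] x := by
  have h : ∀ s : TensorAlgebra k M ⊗[k] (M ⊗[k] TensorAlgebra k M),
      ((algebraMapInv (R := k) (M := M)).toLinearMap.rTensor _)
        ((mulLeft k (ι k m)).rTensor _ s) = 0 := by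
    intro s
    induction s with
    | zero => simp
    | tmul a b => simp [algebraMapInv_ι]
    | add a b ha hb => rw [map_add, map_add, ha, hb, add_zero]
  rw [firstLetter, comp_apply, comp_apply, split_ι_mul, map_add, h]
  simp

theorem firstLetter_mul_ι (x : TensorAlgebra k M) (m : M) : firstLetter (x * ι k m) =
    (mulRight k (ι k m)).lTensor M (firstLetter x) +
      algebraMapInv x • m ⊗ₜ[k] 1 := by
  have h : ∀ s : TensorAlgebra k M ⊗[k] (M ⊗[k] TensorAlgebra k M),
      TensorProduct.lid k _ (((algebraMapInv (R := k) (M := M)).toLinearMap.rTensor _)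
        (((mulRight k (ι k m)).lTensor M).lTensor _ s)) =
      (mulRight k (ι k m)).lTensor M (TensorProduct.lid k _
        (((algebraMapInv (R := k) (M := M)).toLinearMap.rTensor _) s)) := by
    intro s
    induction s with
    | zero => simp
    | tmul a b => simp
    | add a b ha hb => simp only [map_add, ha, hb]
  simp only [firstLetter, comp_apply, split_mul_ι, map_add, LinearEquiv.coe_coe, h]
  simp

theorem lastLetter_one : lastLetter (1 : TensorAlgebra k M) = 0 := by
  simp [lastLetter, split_one]

theorem lastLetter_mul_ι (x : TensorAlgebra k M) (m : M) :
    lastLetter (x * ι k m) = x ⊗ₜ[k] m := by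
  have h : ((TensorProduct.rid k M).toLinearMap ∘ₗ
      (algebraMapInv (R := k) (M := M)).toLinearMap.lTensor M) ∘ₗ
        (mulRight k (ι k m)).lTensor M = 0 := by
    ext a b
    simp [algebraMapInv_ι]
  rw [lastLetter, comp_apply, split_mul_ι, map_add, ← comp_apply,
    ← LinearMap.lTensor_comp, h]
  simp

theorem deconc_mul_ι (x : TensorAlgebra k M) (m : M) : deconc (x * ι k m) =
    (x * ι k m) ⊗ₜ[k] 1 + (mulRight k (ι k m)).lTensor _ (deconc x) := by
  have h : ∀ s : TensorAlgebra k M ⊗[k] (M ⊗[k] TensorAlgebra k M),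
      (mul' k (TensorAlgebra k M) ∘ₗ (ι k).rTensor _).lTensor
        (TensorAlgebra k M) (((mulRight k (ι k m)).lTensor M).lTensor _ s) =
      (mulRight k (ι k m)).lTensor _
        ((mul' k (TensorAlgebra k M) ∘ₗ (ι k).rTensor _).lTensor
          (TensorAlgebra k M) s) := by
    intro s
    simp only [← comp_apply, ← LinearMap.lTensor_comp]
    congr 2
    ext a b
    simp [mul_assoc]
  simp only [deconc, LinearMap.add_apply, comp_apply, split_mul_ι, map_add, h]
  simp [add_comm]

/-- A map `x₁ ⋯ xₙ ↦ ∑ i, f(x₁ ⋯ xᵢ₋₁) g(xᵢ) xᵢ₊₁ ⋯ xₙ` is an `f`-derivation if `f` is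
multiplicative. -/
theorem split_derivation_mul (f : TensorAlgebra k M →ₗ[k] TensorAlgebra k M)
    (hf : ∀ x y, f (x * y) = f x * f y) (g : M →ₗ[k] TensorAlgebra k M)
    {δ : TensorAlgebra k M →ₗ[k] TensorAlgebra k M}
    (hδ : δ = mul' k _ ∘ₗ TensorProduct.map f
      (mul' k _ ∘ₗ TensorProduct.map g LinearMap.id) ∘ₗ split)
    (x y : TensorAlgebra k M) : δ (x * y) = δ x * y + f x * δ y := by
  have h1 : ∀ s : TensorAlgebra k M ⊗[k] (M ⊗[k] TensorAlgebra k M),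
      mul' k _ (TensorProduct.map f
        (mul' k _ ∘ₗ TensorProduct.map g LinearMap.id)
        (((mulRight k y).lTensor M).lTensor _ s)) =
      mul' k _ (TensorProduct.map f
        (mul' k _ ∘ₗ TensorProduct.map g LinearMap.id) s) * y := by
    intro s
    induction s with
    | zero => simp
    | tmul a b =>
      induction b with
      | zero => simp
      | tmul b c => simp [mul_assoc]
      | add b c hb hc => simp only [tmul_add, map_add, hb, hc, add_mul]
    | add a b ha hb => simp only [map_add, ha, hb, add_mul]
  have h2 : ∀ s : TensorAlgebra k M ⊗[k] (M ⊗[k] TensorAlgebra k M),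
      mul' k _ (TensorProduct.map f
        (mul' k _ ∘ₗ TensorProduct.map g LinearMap.id)
        ((mulLeft k x).rTensor _ s)) =
      f x * mul' k _ (TensorProduct.map f
        (mul' k _ ∘ₗ TensorProduct.map g LinearMap.id) s) := by
    intro s
    induction s with
    | zero => simp
    | tmul a b => simp [hf, mul_assoc]
    | add a b ha hb => simp only [map_add, ha, hb, mul_add]
  rw [hδ]
  simp only [comp_apply, split_mul, map_add, h1, h2]

end Grading

/-! ### Operators on Hochschild chains -/

section Operators

open TensorAlgebra

variable {k : Type u} [Field k] {E : Type v} [Ring E] [Algebra k E]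

/-- The structure of an augmented differential graded algebra on `E`, with grading `c`,
differential `d` and augmentation `ε`, together with an endomorphism `σ`. -/
structure IsAugDGA (c : E →ₗ[k] ℕ →₀ E) (d : E →ₗ[k] E) (ε : E →ₐ[k] k) (σ : E →ₐ[k] E) :
    Prop where
  grading : IsGrading c
  one_mem : 1 ∈ homog c 0
  mul_mem : ∀ {i j : ℕ} {x y : E}, x ∈ homog c i → y ∈ homog c j → x * y ∈ homog c (i + j)
  aug_succ : ∀ {i : ℕ} {x : E}, x ∈ homog c (i + 1) → ε x = 0
  d_mem : ∀ {i : ℕ} {x : E}, x ∈ homog c (i + 1) → d x ∈ homog c i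
  d_zero : ∀ {x : E}, x ∈ homog c 0 → d x = 0
  d_d : ∀ x, d (d x) = 0
  d_mul : ∀ x y, d (x * y) = d x * y + signOp c x * d y
  aug_d : ∀ x, ε (d x) = 0
  σ_mem : ∀ {i : ℕ} {x : E}, x ∈ homog c i → σ x ∈ homog c i
  σ_d : ∀ x, σ (d x) = d (σ x)
  aug_σ : ∀ x, ε (σ x) = ε x

variable (c : E →ₗ[k] ℕ →₀ E) (d : E →ₗ[k] E) (ε : E →ₐ[k] k) (σ : E →ₐ[k] E)

/-- Right multiplication `(a₀, …, aₙ) ↦ (a₀, …, aₙ, t)` by bar words `t`. -/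
def rightMul : Bar ε →ₗ[k] Module.End k (CH ε) :=
  LinearMap.lTensorHom E ∘ₗ (LinearMap.mul k (Bar ε)).flip

/-- Right multiplication `(a₀, …, aₙ) ↦ (a₀, …, aₙ, a)` by bar letters. -/
def letterMul : E →ₗ[k] Module.End k (CH ε) := rightMul ε ∘ₗ barLetter ε

/-- Left multiplication `(a₀, …, aₙ) ↦ (a a₀, …, aₙ)`. -/
def leftMul : E →ₗ[k] Module.End k (CH ε) := LinearMap.rTensorHom (Bar ε) ∘ₗ LinearMap.mul k E

/-- The sign operator of the Hochschild chains. -/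
def chSign : Module.End k (CH ε) := TensorProduct.map (signOp c) (signOp (barComp c ε))

/-- The total grading of the Hochschild chains. -/
def chComp : CH ε →ₗ[k] ℕ →₀ CH ε := tmulComp c (barComp c ε)

/-- The right action `(a₀, …, aₙ) ↦ (a₀, …, aₙ a) ± … ± (a₀ σ(a₁), …, aₙ, a)` of `E` on the
Hochschild chains. -/
def rightAct : E →ₗ[k] Module.End k (CH ε) :=
  ε.toLinearMap.smulRight (1 : Module.End k (CH ε)) +
    mulLeft k (bFirst c ε σ + bMiddle c ε : Module.End k (CH ε)) ∘ₗ
      mulRight k (chSign c ε) ∘ₗ letterMul ε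

/-- The map `[a₁|⋯|aₙ] ↦ ∑ i, ± [a₁|⋯|d aᵢ|⋯|aₙ]` on bar words. -/
def barInt : Bar ε →ₗ[k] Bar ε :=
  mul' k (Bar ε) ∘ₗ
    TensorProduct.map (signOp (barComp c ε))
      (mul' k (Bar ε) ∘ₗ
        TensorProduct.map (barLetter ε ∘ₗ d ∘ₗ augIncl ε) LinearMap.id) ∘ₗ split

/-- The map `[a₁|⋯|aₙ] ↦ ∑ i, ± [a₁|⋯|aᵢ aᵢ₊₁|⋯|aₙ]` on bar words. -/
def barMid : Bar ε →ₗ[k] Bar ε :=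
  mul' k (Bar ε) ∘ₗ
    TensorProduct.map (signOp (barComp c ε))
      (mul' k (Bar ε) ∘ₗ
        TensorProduct.map (barMul c ε) LinearMap.id ∘ₗ
        (TensorProduct.assoc k _ _ _).symm.toLinearMap ∘ₗ
        firstLetter.lTensor (AugIdeal ε)) ∘ₗ split

@[simp] theorem rightMul_tmul (t : Bar ε) (x : E) (w : Bar ε) :
    rightMul ε t (x ⊗ₜ[k] w) = x ⊗ₜ[k] (w * t) := rfl

@[simp] theorem letterMul_tmul (a x : E) (w : Bar ε) :
    letterMul ε a (x ⊗ₜ[k] w) = x ⊗ₜ[k] (w * barLetter ε a) := rfl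

@[simp] theorem leftMul_tmul (a x : E) (w : Bar ε) :
    leftMul ε a (x ⊗ₜ[k] w) = (a * x) ⊗ₜ[k] w := rfl

@[simp] theorem chSign_tmul (x : E) (w : Bar ε) :
    chSign c ε (x ⊗ₜ[k] w) = signOp c x ⊗ₜ[k] signOp (barComp c ε) w := rfl

theorem letterMul_eq (a : E) : letterMul ε a = rightMul ε (barLetter ε a) := rfl

theorem rightMul_one (ω : CH ε) : rightMul ε 1 ω = ω := by
  induction ω using TensorProduct.induction_on with
  | zero => simp
  | tmul x w => simp
  | add x y hx hy => rw [map_add, hx, hy]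

theorem rightMul_mul (s t : Bar ε) (ω : CH ε) :
    rightMul ε (s * t) ω = rightMul ε t (rightMul ε s ω) := by
  induction ω using TensorProduct.induction_on with
  | zero => simp
  | tmul x w => simp [mul_assoc]
  | add x y hx hy => simp only [map_add, hx, hy]

theorem leftMul_mul (a b : E) (ω : CH ε) :
    leftMul ε (a * b) ω = leftMul ε a (leftMul ε b ω) := by
  induction ω using TensorProduct.induction_on with
  | zero => simp
  | tmul x w => simp [mul_assoc]
  | add x y hx hy => simp only [map_add, hx, hy]

theorem leftMul_one (ω : CH ε) : leftMul ε 1 ω = ω := by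
  induction ω using TensorProduct.induction_on with
  | zero => simp
  | tmul x w => simp
  | add x y hx hy => rw [map_add, hx, hy]

theorem leftMul_rightMul (a : E) (t : Bar ε) (ω : CH ε) :
    leftMul ε a (rightMul ε t ω) = rightMul ε t (leftMul ε a ω) := by
  induction ω using TensorProduct.induction_on with
  | zero => simp
  | tmul x w => simp
  | add x y hx hy => simp only [map_add, hx, hy]

theorem leftMul_letterMul (a b : E) (ω : CH ε) :
    leftMul ε a (letterMul ε b ω) = letterMul ε b (leftMul ε a ω) :=
  leftMul_rightMul ε a _ ω

@[simp] theorem toAug_augIncl (m : AugIdeal ε) : toAug ε (augIncl ε m) = m := by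
  apply Subtype.ext
  have : ε (augIncl ε m) = 0 := m.2
  change augIncl ε m - algebraMap k E (ε (augIncl ε m)) = augIncl ε m
  simp [this]

theorem augIncl_toAug (a : E) : augIncl ε (toAug ε a) = a - ε a • 1 := by
  rw [← Algebra.algebraMap_eq_smul_one]; rfl

@[simp] theorem toAug_one : toAug ε 1 = 0 := by
  apply Subtype.ext
  change augIncl ε (toAug ε 1) = 0
  rw [augIncl_toAug]; simp

@[simp] theorem barLetter_one : barLetter ε 1 = 0 := by simp [barLetter]

theorem barLetter_augIncl (m : AugIdeal ε) : barLetter ε (augIncl ε m) = ι k m := by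
  simp [barLetter]

@[simp] theorem aug_augIncl (m : AugIdeal ε) : ε (augIncl ε m) = 0 := m.2

variable {c d ε σ}

section Sign

theorem IsAugDGA.toAug_mem (h : IsAugDGA c d ε σ) {i : ℕ} {a : E} (ha : a ∈ homog c i) :
    toAug ε a ∈ homog (augComp c ε) i := by
  rw [mem_homog, augComp, comp_apply, comp_apply, augIncl_toAug]
  have : a - ε a • 1 ∈ homog c i := by
    cases i with
    | zero => exact sub_mem ha (smul_mem _ _ h.one_mem)
    | succ i => rw [h.aug_succ ha, zero_smul, sub_zero]; exact ha
  rw [mem_homog.1 this, Finsupp.mapRange.linearMap_apply, Finsupp.mapRange_single, map_sub,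
    map_smul, toAug_one, smul_zero, sub_zero]

theorem IsAugDGA.augIncl_mem (h : IsAugDGA c d ε σ) {i : ℕ} {m : AugIdeal ε}
    (hm : m ∈ homog (augComp c ε) i) : augIncl ε m ∈ homog c i := by
  have key : ∀ n, augIncl ε (augComp c ε m n) = c (augIncl ε m) n := by
    intro n
    generalize hx : augIncl ε m = x
    have hx0 : ε x = 0 := by rw [← hx]; exact aug_augIncl ε m
    have h0 : ∀ n, ε (c x n) = 0 := by
      have h1 : ∀ n, n ≠ 0 → ε (c x n) = 0 := by
        intro n hn
        obtain ⟨n, rfl⟩ := Nat.exists_eq_succ_of_ne_zero hn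
        exact h.aug_succ (h.grading.comp_mem x _)
      intro n
      rcases eq_or_ne n 0 with rfl | hn
      · rw [← h.grading.sum_comp x, map_finsuppSum, Finsupp.sum] at hx0
        by_cases hs : 0 ∈ (c x).support
        · rwa [Finset.sum_eq_single 0 (fun n _ hn => h1 n hn) (fun h => absurd hs h)] at hx0
        · rw [Finsupp.notMem_support_iff.1 hs, map_zero]
      · exact h1 n hn
    rw [augComp, comp_apply, comp_apply, Finsupp.mapRange.linearMap_apply,
      Finsupp.mapRange_apply, augIncl_toAug, hx, h0, zero_smul, sub_zero]
  rw [mem_homog]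
  ext n
  rw [← key, mem_homog.1 hm, single_apply, single_apply]
  split_ifs <;> simp

theorem IsAugDGA.span_toAug (h : IsAugDGA c d ε σ) (m : AugIdeal ε) :
    m ∈ Submodule.span k {m | ∃ i, ∃ a ∈ homog c i, m = toAug ε a} := by
  rw [← toAug_augIncl ε m]
  induction augIncl ε m using h.grading.induction with
  | hom n y hy => exact subset_span ⟨n, y, hy, rfl⟩
  | add y z hy hz => rw [map_add]; exact add_mem hy hz

theorem IsAugDGA.grading_aug (h : IsAugDGA c d ε σ) : IsGrading (augComp c ε) :=
  isGrading_of_span fun m => Submodule.span_mono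
    (by rintro _ ⟨i, a, ha, rfl⟩; exact ⟨i, h.toAug_mem ha⟩) (h.span_toAug m)

theorem IsAugDGA.grading_bar (h : IsAugDGA c d ε σ) : IsGrading (barComp c ε) :=
  (h.grading_aug.regrade _).tensor

theorem IsAugDGA.grading_ch (h : IsAugDGA c d ε σ) : IsGrading (chComp c ε) :=
  h.grading.tmul h.grading_bar

theorem IsAugDGA.barLetter_mem (h : IsAugDGA c d ε σ) {i : ℕ} {a : E} (ha : a ∈ homog c i) :
    barLetter ε a ∈ homog (barComp c ε) (i + 1) :=
  ι_mem_homog (regrade_mem _ (h.toAug_mem ha))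

/-- Induction over bar words with homogeneous letters, adding letters on the right. -/
theorem IsAugDGA.bar_induction (h : IsAugDGA c d ε σ) {P : Bar ε → Prop}
    (add : ∀ x y, P x → P y → P (x + y)) (smul : ∀ (r : k) x, P x → P (r • x)) (one : P 1)
    (snoc : ∀ (e : ℕ) (w : Bar ε) (i : ℕ) (a : E), w ∈ homog (barComp c ε) e → a ∈ homog c i →
      ε a = 0 → P w → P (w * barLetter ε a)) (w : Bar ε) : P w := by
  refine tensor_induction_of_span (c := regrade (· + 1) (augComp c ε))
    {m | ∃ i, ∃ a ∈ homog c i, m = toAug ε a} h.span_toAug ?_ add smul one ?_ w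
  · rintro _ ⟨i, a, ha, rfl⟩
    exact ⟨_, regrade_mem _ (h.toAug_mem ha)⟩
  · rintro e w _ hw ⟨i, a, ha, rfl⟩ hP
    have h0 := h.augIncl_mem (h.toAug_mem ha)
    have := snoc e w i _ hw h0 (aug_augIncl ε _) hP
    rwa [barLetter_augIncl] at this

/-- Induction over Hochschild chains with homogeneous entries, adding letters on the right. -/
theorem IsAugDGA.ch_induction (h : IsAugDGA c d ε σ) {P : CH ε → Prop}
    (add : ∀ x y, P x → P y → P (x + y)) (smul : ∀ (r : k) x, P x → P (r • x))
    (base : ∀ (i : ℕ) (a : E), a ∈ homog c i → P (a ⊗ₜ[k] 1))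
    (snoc : ∀ (e : ℕ) (ω : CH ε) (i : ℕ) (a : E), ω ∈ homog (chComp c ε) e → a ∈ homog c i →
      ε a = 0 → P ω → P (letterMul ε a ω)) (ω : CH ε) : P ω := by
  induction ω using TensorProduct.induction_on with
  | zero => have := smul 0 _ (base 0 1 h.one_mem); rwa [zero_smul] at this
  | tmul x w =>
    induction x using h.grading.induction with
    | hom j x hx =>
      induction w using h.bar_induction with
      | add y z hy hz => rw [tmul_add]; exact add _ _ hy hz
      | smul r y hy => rw [tmul_smul]; exact smul _ _ hy
      | one => exact base j x hx
      | snoc e w i a hw ha h0 ih => exact snoc (j + e) _ i a (tmul_mem hx hw) ha h0 ih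
    | add y z hy hz => rw [add_tmul]; exact add _ _ hy hz
  | add x y hx hy => exact add _ _ hx hy

theorem IsAugDGA.ch_ext (h : IsAugDGA c d ε σ) {Y : Type*} [AddCommGroup Y] [Module k Y]
    {f g : CH ε →ₗ[k] Y} (base : ∀ (i : ℕ) (a : E), a ∈ homog c i → f (a ⊗ₜ[k] 1) = g (a ⊗ₜ[k] 1))
    (snoc : ∀ (e : ℕ) (ω : CH ε) (i : ℕ) (a : E), ω ∈ homog (chComp c ε) e → a ∈ homog c i →
      ε a = 0 → f ω = g ω → f (letterMul ε a ω) = g (letterMul ε a ω)) (ω : CH ε) : f ω = g ω := by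
  induction ω using h.ch_induction with
  | add x y hx hy => rw [map_add, map_add, hx, hy]
  | smul r x hx => rw [map_smul, map_smul, hx]
  | base i a ha => exact base i a ha
  | snoc e ω i a hω ha h0 ih => exact snoc e ω i a hω ha h0 ih

theorem IsAugDGA.signOp_mul (h : IsAugDGA c d ε σ) (x y : E) :
    signOp c (x * y) = signOp c x * signOp c y := by
  induction x using h.grading.induction with
  | hom i x hx =>
    induction y using h.grading.induction with
    | hom j y hy =>
      rw [signOp_of_mem hx, signOp_of_mem hy, signOp_of_mem (h.mul_mem hx hy), pow_add,
        smul_mul_smul_comm]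
    | add y z hy hz => rw [mul_add, map_add, hy, hz, map_add, mul_add]
  | add y z hy hz => rw [add_mul, map_add, hy, hz, map_add, add_mul]

theorem IsAugDGA.signOp_d (h : IsAugDGA c d ε σ) (x : E) :
    signOp c (d x) = -d (signOp c x) := by
  induction x using h.grading.induction with
  | hom i x hx =>
    cases i with
    | zero => rw [signOp_of_mem hx, map_smul, h.d_zero hx]; simp
    | succ i =>
      rw [signOp_of_mem hx, map_smul, signOp_of_mem (h.d_mem hx), pow_succ]; simp
  | add y z hy hz => rw [map_add, map_add, hy, hz, map_add, map_add, neg_add]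

theorem IsAugDGA.d_one (h : IsAugDGA c d ε σ) : d 1 = 0 := h.d_zero h.one_mem

theorem IsAugDGA.barSign_mul (h : IsAugDGA c d ε σ) (w t : Bar ε) :
    signOp (barComp c ε) (w * t) = signOp (barComp c ε) w * signOp (barComp c ε) t :=
  KoszulHH.signOp_mul (h.grading_aug.regrade _) w t

theorem barSign_one : signOp (barComp c ε) 1 = 1 := signOp_one _

theorem IsAugDGA.barSign_letter (h : IsAugDGA c d ε σ) (a : E) :
    signOp (barComp c ε) (barLetter ε a) = -barLetter ε (signOp c a) := by
  induction a using h.grading.induction with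
  | hom i x hx =>
    rw [signOp_of_mem hx, signOp_of_mem (h.barLetter_mem hx), pow_succ, map_smul]; simp
  | add y z hy hz => rw [map_add, map_add, hy, hz, map_add, map_add, neg_add]

theorem IsAugDGA.chSign_chSign (h : IsAugDGA c d ε σ) (ω : CH ε) :
    chSign c ε (chSign c ε ω) = ω := by
  induction ω using TensorProduct.induction_on with
  | zero => simp
  | tmul x w => simp [h.grading.signOp_signOp, h.grading_bar.signOp_signOp]
  | add x y hx hy => simp only [map_add, hx, hy]

theorem chSign_of_mem {i : ℕ} {ω : CH ε} (h : IsAugDGA c d ε σ)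
    (hω : ω ∈ homog (chComp c ε) i) : chSign c ε ω = (-1 : k) ^ i • ω := by
  have : chSign c ε = signOp (chComp c ε) := by
    refine ext_tmul_homog h.grading h.grading_bar fun i j x hx y hy => ?_
    rw [chSign_tmul, chComp, signOp_of_mem (tmul_mem hx hy), signOp_of_mem hx, signOp_of_mem hy,
      pow_add,
      smul_tmul_smul]
  rw [this, signOp_of_mem hω]

theorem IsAugDGA.chSign_rightMul (h : IsAugDGA c d ε σ) (t : Bar ε) (ω : CH ε) :
    chSign c ε (rightMul ε t ω) = rightMul ε (signOp (barComp c ε) t) (chSign c ε ω) := by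
  induction ω using TensorProduct.induction_on with
  | zero => simp
  | tmul x w => simp [h.barSign_mul]
  | add x y hx hy => simp only [map_add, hx, hy]

theorem IsAugDGA.chSign_letterMul (h : IsAugDGA c d ε σ) (a : E) (ω : CH ε) :
    chSign c ε (letterMul ε a ω) = -letterMul ε (signOp c a) (chSign c ε ω) := by
  rw [letterMul_eq, h.chSign_rightMul, h.barSign_letter, map_neg]; rfl

theorem IsAugDGA.chSign_leftMul (h : IsAugDGA c d ε σ) (a : E) (ω : CH ε) :
    chSign c ε (leftMul ε a ω) = leftMul ε (signOp c a) (chSign c ε ω) := by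
  induction ω using TensorProduct.induction_on with
  | zero => simp
  | tmul x w => simp [h.signOp_mul]
  | add x y hx hy => simp only [map_add, hx, hy]

end Sign

/-! ### The Hochschild boundary in terms of operators -/

section Boundary

theorem bInternal_tmul_one (x : E) :
    bInternal c d ε (x ⊗ₜ[k] 1) = d x ⊗ₜ[k] 1 := by
  simp [bInternal, split_one]

theorem bFirst_tmul_one (x : E) : bFirst c ε σ (x ⊗ₜ[k] 1) = 0 := by
  simp [bFirst, firstLetter_one]

theorem bMiddle_tmul_one (x : E) : bMiddle c ε (x ⊗ₜ[k] 1) = 0 := by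
  simp [bMiddle, split_one]

theorem bLast_tmul_one (x : E) : bLast c ε (x ⊗ₜ[k] 1) = 0 := by
  simp [bLast, lastLetter_one]

theorem bInternal_tmul (x : E) (w : Bar ε) : bInternal c d ε (x ⊗ₜ[k] w) =
    d x ⊗ₜ[k] w - signOp c x ⊗ₜ[k] barInt c d ε w := rfl

theorem bMiddle_tmul (x : E) (w : Bar ε) :
    bMiddle c ε (x ⊗ₜ[k] w) = signOp c x ⊗ₜ[k] barMid c ε w := rfl

theorem barInt_mul (h : IsAugDGA c d ε σ) (w t : Bar ε) :
    barInt c d ε (w * t) = barInt c d ε w * t + signOp (barComp c ε) w * barInt c d ε t :=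
  split_derivation_mul _ h.barSign_mul _ rfl w t

theorem barInt_letter (h : IsAugDGA c d ε σ) (a : E) :
    barInt c d ε (barLetter ε a) = barLetter ε (d a) := by
  change barInt c d ε (ι k (toAug ε a)) = _
  rw [barInt, comp_apply, comp_apply, split_ι]
  simp only [map_tmul, comp_apply, LinearMap.id_coe, id,
    mul'_apply, barSign_one, one_mul, mul_one, augIncl_toAug]
  simp [h.d_one]

/-- The internal differential is a derivation with respect to adding letters on the right. -/
theorem IsAugDGA.bInternal_letterMul (h : IsAugDGA c d ε σ) (a : E) (ω : CH ε) :
    bInternal c d ε (letterMul ε a ω) =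
      letterMul ε a (bInternal c d ε ω) - letterMul ε (d a) (chSign c ε ω) := by
  induction ω using TensorProduct.induction_on with
  | zero => simp
  | tmul x w =>
    simp only [letterMul_tmul, bInternal_tmul, barInt_mul h, barInt_letter h, map_sub,
      tmul_add, chSign_tmul]
    abel
  | add x y hx hy => simp only [map_add, hx, hy]; abel

theorem barMid_mul_ι (w : Bar ε) (m : AugIdeal ε) :
    barMid c ε (w * ι k m) = barMid c ε w * ι k m +
      mul' k (Bar ε) (TensorProduct.map (signOp (barComp c ε))
        (barMul c ε ∘ₗ (TensorProduct.mk k _ _).flip m) (lastLetter w)) := by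
  set F : AugIdeal ε ⊗[k] Bar ε →ₗ[k] Bar ε := mul' k (Bar ε) ∘ₗ
    TensorProduct.map (barMul c ε) LinearMap.id ∘ₗ
    (TensorProduct.assoc k _ _ _).symm.toLinearMap ∘ₗ firstLetter.lTensor (AugIdeal ε) with hF
  have h1 : ∀ (b : AugIdeal ε) (y : Bar ε), F (b ⊗ₜ[k] (y * ι k m)) =
      F (b ⊗ₜ[k] y) * ι k m + algebraMapInv y • barMul c ε (b ⊗ₜ[k] m) := by
    intro b y
    simp only [hF, comp_apply, lTensor_tmul, firstLetter_mul_ι,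
      tmul_add, map_add]
    congr 1
    · induction firstLetter y with
      | zero => simp
      | tmul p q => simp [mul_assoc]
      | add p q hp hq => simp only [map_add, tmul_add, hp, hq, add_mul]
    · simp
  have h2 : ∀ b : AugIdeal ε, F (b ⊗ₜ[k] (1 : Bar ε)) = 0 := by
    intro b
    simp [hF, firstLetter_one]
  have h3 : ∀ s : Bar ε ⊗[k] (AugIdeal ε ⊗[k] Bar ε),
      mul' k (Bar ε) (TensorProduct.map (signOp (barComp c ε)) F
        (((mulRight k (ι k m)).lTensor _).lTensor _ s)) =
      mul' k (Bar ε) (TensorProduct.map (signOp (barComp c ε)) F s) * ι k m +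
        mul' k (Bar ε) (TensorProduct.map (signOp (barComp c ε))
          (barMul c ε ∘ₗ (TensorProduct.mk k _ _).flip m)
          (((TensorProduct.rid k _).toLinearMap ∘ₗ
            (algebraMapInv (R := k) (M := AugIdeal ε)).toLinearMap.lTensor _).lTensor _ s)) := by
    intro s
    induction s with
    | zero => simp
    | tmul x b =>
      induction b with
      | zero => simp
      | tmul b y => simp [h1, mul_add, mul_assoc]
      | add b c hb hc => simp only [tmul_add, map_add, hb, hc, add_mul]; abel
    | add a b ha hb => simp only [map_add, ha, hb, add_mul]; abel
  rw [barMid, comp_apply, comp_apply, split_mul_ι, map_add, map_add, h3]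
  rw [map_tmul, h2, mul'_apply, mul_zero, add_zero]
  rfl

theorem barMid_one : barMid c ε 1 = 0 := by simp [barMid, split_one]

theorem barMid_letter (a : E) : barMid c ε (barLetter ε a) = 0 := by
  have := barMid_mul_ι (c := c) (1 : Bar ε) (toAug ε a)
  rw [one_mul, barMid_one, lastLetter_one] at this
  rw [show barLetter ε a = ι k (toAug ε a) from rfl, this]
  simp

theorem IsAugDGA.barMul_toAug (h : IsAugDGA c d ε σ) (b a : E) :
    barMul c ε (toAug ε b ⊗ₜ[k] toAug ε a) =
      -barLetter ε (signOp c b * a) + ε b • barLetter ε a + ε a • barLetter ε (signOp c b) := by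
  have h1 : signOp c 1 = 1 := by rw [signOp_of_mem h.one_mem]; simp
  simp only [barMul, comp_apply, map_tmul, LinearMap.neg_apply,
    augIncl_toAug, mul'_apply, map_sub, map_smul, h1, mul_sub, sub_mul, neg_mul,
    map_neg, smul_mul_assoc, one_mul, mul_smul_comm, mul_one, barLetter_one]
  module

theorem IsAugDGA.barMid_mul_letter (h : IsAugDGA c d ε σ) (w : Bar ε) (b a : E) :
    barMid c ε (w * barLetter ε b * barLetter ε a) =
      barMid c ε (w * barLetter ε b) * barLetter ε a +
        signOp (barComp c ε) w * (-barLetter ε (signOp c b * a) + ε b • barLetter ε a +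
          ε a • barLetter ε (signOp c b)) := by
  rw [← h.barMul_toAug]
  change barMid c ε (_ * ι k (toAug ε a)) = _
  rw [barMid_mul_ι]
  rw [show barLetter ε b = ι k (toAug ε b) from rfl, lastLetter_mul_ι]
  rfl

theorem IsAugDGA.bLast_letterMul (h : IsAugDGA c d ε σ) {i : ℕ} {a : E} (ha : a ∈ homog c i)
    (ω : CH ε) : bLast c ε (letterMul ε a ω) =
      leftMul ε (a - ε a • 1) ((chSign c ε ^ (i + 1)) ω) := by
  induction ω using TensorProduct.induction_on with
  | zero => simp
  | tmul x w =>
    rw [letterMul_tmul, bLast]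
    simp only [comp_apply, lTensor_tmul, LinearEquiv.coe_coe,
      assoc_symm_tmul, show barLetter ε a = ι k (toAug ε a) from rfl,
      lastLetter_mul_ι]
    rw [koszulMove_tmul _ (regrade_mem _ (h.toAug_mem ha))]
    change _ = leftMul ε _ (((TensorProduct.map (signOp c) (signOp (barComp c ε))) ^ (i + 1))
      (x ⊗ₜ[k] w))
    induction ((TensorProduct.map (signOp c) (signOp (barComp c ε))) ^ (i + 1))
      (x ⊗ₜ[k] w) with
    | zero => simp
    | tmul p q =>
      simp [augIncl_toAug, sub_tmul, smul_tmul']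
    | add p q hp hq => rw [tmul_add, map_add, map_add, hp, hq, map_add]
  | add x y hx hy => simp only [map_add, hx, hy]

theorem bFirst_tmul_letter (x a : E) (w : Bar ε) :
    bFirst c ε σ (x ⊗ₜ[k] (barLetter ε a * w)) =
      (signOp c x * σ (a - ε a • 1)) ⊗ₜ[k] w := by
  simp [bFirst, barLetter, firstLetter_ι_mul, augIncl_toAug]

theorem bFirst_mul_letter (x a b : E) (w : Bar ε) :
    bFirst c ε σ (x ⊗ₜ[k] (w * barLetter ε b * barLetter ε a)) =
      letterMul ε a (bFirst c ε σ (x ⊗ₜ[k] (w * barLetter ε b))) := by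
  have h0 : algebraMapInv (w * barLetter ε b) = 0 := by
    rw [map_mul, barLetter, comp_apply, algebraMapInv_ι, mul_zero]
  simp only [bFirst, comp_apply, lTensor_tmul]
  rw [show w * barLetter ε b * barLetter ε a = w * barLetter ε b * ι k (toAug ε a) from rfl,
    firstLetter_mul_ι, h0, zero_smul, add_zero]
  induction firstLetter (w * barLetter ε b) with
  | zero => simp
  | tmul p q => simp [barLetter]
  | add p q hp hq => simp only [map_add, tmul_add, hp, hq]

/-- Adding two letters on the right: the only new term is the product of these letters. -/
theorem IsAugDGA.bOpen_letterMul_letterMul (h : IsAugDGA c d ε σ) {j : ℕ} {b : E}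
    (hb : b ∈ homog c j) (a : E) (ω : CH ε) :
    (bFirst c ε σ + bMiddle c ε) (letterMul ε a (letterMul ε b ω)) =
      letterMul ε a ((bFirst c ε σ + bMiddle c ε) (letterMul ε b ω)) -
        (-1 : k) ^ j • letterMul ε (b * a) (chSign c ε ω) +
        ε b • letterMul ε a (chSign c ε ω) + ε a • (-1 : k) ^ j • letterMul ε b (chSign c ε ω) := by
  induction ω using TensorProduct.induction_on with
  | zero => simp
  | tmul x w =>
    simp only [LinearMap.add_apply, letterMul_tmul, bFirst_mul_letter, bMiddle_tmul,
      h.barMid_mul_letter, map_add, chSign_tmul, signOp_of_mem hb, smul_mul_assoc, map_smul,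
      mul_add, tmul_add, mul_neg, tmul_neg, mul_smul_comm,
      tmul_smul]
    abel
  | add x y hx hy => simp only [map_add, hx, hy, smul_add]; abel

end Boundary

end Operators

section Square

open TensorAlgebra

variable {k : Type u} [Field k] {E : Type v} [Ring E] [Algebra k E]
variable {c : E →ₗ[k] ℕ →₀ E} {d : E →ₗ[k] E} {ε : E →ₐ[k] k} {σ : E →ₐ[k] E}

theorem rightAct_apply (a : E) (ω : CH ε) : rightAct c ε σ a ω =
    ε a • ω + (bFirst c ε σ + bMiddle c ε) (letterMul ε a (chSign c ε ω)) := rfl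

theorem IsAugDGA.aug_smul_pow (h : IsAugDGA c d ε σ) {i : ℕ} {a : E} (ha : a ∈ homog c i)
    (s : k) : ε a * s ^ i = ε a := by
  cases i with
  | zero => simp
  | succ i => rw [h.aug_succ ha, zero_mul]

theorem IsAugDGA.rightAct_tmul_one (h : IsAugDGA c d ε σ) (a x : E) :
    rightAct c ε σ a (x ⊗ₜ[k] 1) = (x * σ a) ⊗ₜ[k] 1 := by
  have := bFirst_tmul_letter (c := c) (ε := ε) (σ := σ) (signOp c x) a 1
  rw [mul_one] at this
  rw [rightAct_apply, chSign_tmul, barSign_one, letterMul_tmul, one_mul, LinearMap.add_apply,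
    bMiddle_tmul, barMid_letter, this, h.grading.signOp_signOp, map_sub, map_smul, map_one,
    mul_sub, sub_tmul, mul_smul_comm, mul_one, tmul_zero, add_zero,
    smul_tmul']
  abel

/-- The recursion which determines the right action. -/
theorem IsAugDGA.rightAct_letterMul (h : IsAugDGA c d ε σ) {j : ℕ} {b : E} (hb : b ∈ homog c j)
    (a : E) (ω : CH ε) : rightAct c ε σ a (letterMul ε b ω) =
      letterMul ε (b * a) ω - (-1 : k) ^ j • letterMul ε a (rightAct c ε σ b ω) := by
  simp only [rightAct_apply, h.chSign_letterMul, map_neg, signOp_of_mem hb, map_smul,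
    LinearMap.smul_apply, h.bOpen_letterMul_letterMul hb, h.chSign_chSign, map_add]
  rcases neg_one_pow_eq_or k j with hj | hj <;> rw [hj] <;> module

/-- `rightAct` is a right action of the algebra; this is the source of `b² = 0`. -/
theorem IsAugDGA.rightAct_rightAct (h : IsAugDGA c d ε σ) {i : ℕ} {a : E} (ha : a ∈ homog c i)
    (b : E) (ω : CH ε) :
    rightAct c ε σ b (rightAct c ε σ a ω) = rightAct c ε σ (a * b) ω := by
  have key : ∀ ω : CH ε, ∀ (i : ℕ) (a : E), a ∈ homog c i →
      ∀ b, rightAct c ε σ b (rightAct c ε σ a ω) = rightAct c ε σ (a * b) ω := by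
    intro ω
    induction ω using h.ch_induction with
    | add x y hx hy => intro i a ha b; simp only [map_add, hx i a ha, hy i a ha]
    | smul r x hx => intro i a ha b; simp only [map_smul, hx i a ha]
    | base j x hx => intro i a ha b; simp only [h.rightAct_tmul_one, map_mul, mul_assoc]
    | snoc e ω j x hω hx _ ih =>
      intro i a ha b
      rw [h.rightAct_letterMul hx, map_sub, map_smul, h.rightAct_letterMul (h.mul_mem hx ha),
        h.rightAct_letterMul ha, h.rightAct_letterMul hx, ih j x hx, mul_assoc, pow_add]
      module
  exact key ω i a ha b

theorem IsAugDGA.leftMul_rightAct (h : IsAugDGA c d ε σ) (a b : E) (ω : CH ε) :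
    leftMul ε b (rightAct c ε σ a ω) = rightAct c ε σ a (leftMul ε b ω) := by
  induction ω using h.ch_induction generalizing a with
  | add x y hx hy => simp only [map_add, hx, hy]
  | smul r x hx => simp only [map_smul, hx]
  | base j x hx => simp [h.rightAct_tmul_one, mul_assoc]
  | snoc e ω j x hω hx _ ih =>
    rw [h.rightAct_letterMul hx, map_sub, map_smul, leftMul_letterMul, leftMul_letterMul, ih,
      leftMul_letterMul, h.rightAct_letterMul hx]

theorem IsAugDGA.chSign_rightAct (h : IsAugDGA c d ε σ) {i : ℕ} {a : E} (ha : a ∈ homog c i)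
    (ω : CH ε) : chSign c ε (rightAct c ε σ a ω) =
      (-1 : k) ^ i • rightAct c ε σ a (chSign c ε ω) := by
  induction ω using h.ch_induction generalizing a i with
  | add x y hx hy => simp only [map_add, hx ha, hy ha, smul_add]
  | smul r x hx => simp only [map_smul, hx ha]; module
  | base j x hx =>
    simp only [h.rightAct_tmul_one, chSign_tmul, h.signOp_mul, signOp_of_mem hx, barSign_one,
      signOp_of_mem (h.σ_mem ha), smul_mul_assoc, mul_smul_comm, ← smul_tmul',
      smul_smul]
    rw [map_smul, h.rightAct_tmul_one, smul_smul]
  | snoc e ω j x hω hx _ ih =>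
    simp only [h.rightAct_letterMul hx, map_sub, map_smul, h.chSign_letterMul, ih hx, map_neg,
      signOp_of_mem hx, signOp_of_mem ha, signOp_of_mem (h.mul_mem hx ha), LinearMap.smul_apply,
      pow_add]
    module

theorem IsAugDGA.bInternal_leftMul (h : IsAugDGA c d ε σ) (a : E) (ω : CH ε) :
    bInternal c d ε (leftMul ε a ω) =
      leftMul ε (d a) ω + leftMul ε (signOp c a) (bInternal c d ε ω) := by
  induction ω using TensorProduct.induction_on with
  | zero => simp
  | tmul x w =>
    simp only [leftMul_tmul, bInternal_tmul, h.d_mul, h.signOp_mul, map_sub,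
      add_tmul]
    abel
  | add x y hx hy => simp only [map_add, hx, hy]; abel

theorem IsAugDGA.chSign_bInternal (h : IsAugDGA c d ε σ) (ω : CH ε) :
    chSign c ε (bInternal c d ε ω) = -bInternal c d ε (chSign c ε ω) := by
  induction ω using h.ch_induction with
  | add x y hx hy => simp only [map_add, hx, hy]; abel
  | smul r x hx => simp only [map_smul, hx, smul_neg]
  | base j x hx =>
    simp [bInternal_tmul_one, barSign_one, h.signOp_d, neg_tmul]
  | snoc e ω j x hω hx _ ih =>
    simp only [h.bInternal_letterMul, map_sub, h.chSign_letterMul, ih, map_neg,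
      LinearMap.neg_apply, h.signOp_d]
    abel

theorem IsAugDGA.bInternal_bInternal (h : IsAugDGA c d ε σ) (ω : CH ε) :
    bInternal c d ε (bInternal c d ε ω) = 0 := by
  induction ω using h.ch_induction with
  | add x y hx hy => simp only [map_add, hx, hy, add_zero]
  | smul r x hx => simp only [map_smul, hx, smul_zero]
  | base j x hx => simp [bInternal_tmul_one, h.d_d]
  | snoc e ω j x hω hx _ ih =>
    simp only [h.bInternal_letterMul, map_sub, ih, h.chSign_bInternal, h.d_d]
    simp

theorem IsAugDGA.bInternal_rightAct (h : IsAugDGA c d ε σ) {i : ℕ} {a : E} (ha : a ∈ homog c i)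
    (ω : CH ε) : bInternal c d ε (rightAct c ε σ a ω) =
      rightAct c ε σ a (bInternal c d ε ω) + rightAct c ε σ (d a) (chSign c ε ω) := by
  induction ω using h.ch_induction generalizing a i with
  | add x y hx hy => simp only [map_add, hx ha, hy ha]; abel
  | smul r x hx => simp only [map_smul, hx ha, smul_add]
  | base j x hx =>
    simp only [h.rightAct_tmul_one, bInternal_tmul_one, h.d_mul, chSign_tmul, barSign_one, h.σ_d,
      add_tmul]
  | snoc e ω j x hω hx _ ih =>
    have hdx : rightAct c ε σ a (letterMul ε (d x) (chSign c ε ω)) =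
        letterMul ε (d x * a) (chSign c ε ω) +
          (-1 : k) ^ j • letterMul ε a (rightAct c ε σ (d x) (chSign c ε ω)) := by
      cases j with
      | zero => simp [h.d_zero hx]
      | succ j => rw [h.rightAct_letterMul (h.d_mem hx), pow_succ]; module
    simp only [h.rightAct_letterMul hx, map_sub, map_smul, h.bInternal_letterMul, ih hx, hdx,
      h.d_mul, signOp_of_mem hx, h.chSign_letterMul, map_neg, map_add, LinearMap.add_apply,
      LinearMap.smul_apply, smul_mul_assoc, h.chSign_rightAct hx, smul_add, smul_sub, smul_smul]
    rcases neg_one_pow_eq_or k j with hj | hj <;> rw [hj] <;> module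

/-- The part of the Hochschild boundary which lowers the number of bar letters. -/
def bExternal (c : E →ₗ[k] ℕ →₀ E) (ε : E →ₐ[k] k) (σ : E →ₐ[k] E) : Module.End k (CH ε) :=
  bFirst c ε σ + bMiddle c ε - bLast c ε

theorem hochB_eq (ω : CH ε) :
    hochB c d ε σ ω = bInternal c d ε ω + bExternal c ε σ ω := by
  simp only [hochB, bExternal, LinearMap.add_apply, LinearMap.sub_apply]
  abel

theorem bExternal_tmul_one (x : E) : bExternal c ε σ (x ⊗ₜ[k] 1) = 0 := by
  simp [bExternal, bFirst_tmul_one, bMiddle_tmul_one, bLast_tmul_one]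

theorem hochB_tmul_one (x : E) : hochB c d ε σ (x ⊗ₜ[k] 1) = d x ⊗ₜ[k] 1 := by
  rw [hochB_eq, bExternal_tmul_one, bInternal_tmul_one, add_zero]

theorem IsAugDGA.bOpen_letterMul (h : IsAugDGA c d ε σ) (a : E) (ω : CH ε) :
    (bFirst c ε σ + bMiddle c ε) (letterMul ε a ω) =
      rightAct c ε σ a (chSign c ε ω) - ε a • chSign c ε ω := by
  rw [rightAct_apply, h.chSign_chSign, add_sub_cancel_left]

/-- Adding the letter `a` on the right, the new terms of the boundary are the products of `a` with
the entries on its left, and with `a₀` from the left. -/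
theorem IsAugDGA.bExternal_letterMul (h : IsAugDGA c d ε σ) {i : ℕ} {a : E} (ha : a ∈ homog c i)
    {s : k} {ω : CH ε} (hω : chSign c ε ω = s • ω) : bExternal c ε σ (letterMul ε a ω) =
      s • rightAct c ε σ a ω - s ^ (i + 1) • leftMul ε a ω := by
  have hs : s ^ (i + 1) * ε a = ε a * s := by
    rw [pow_succ, mul_comm, ← mul_assoc, h.aug_smul_pow ha]
  rw [bExternal, LinearMap.sub_apply, h.bOpen_letterMul, h.bLast_letterMul ha,
    pow_apply_of_eq_smul hω, hω, map_smul, map_smul, map_sub, LinearMap.sub_apply, map_smul,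
    LinearMap.smul_apply, leftMul_one, smul_sub, smul_smul (s ^ (i + 1)), smul_smul (ε a), hs]
  abel

/-- The version of `IsAugDGA.bExternal_letterMul` for `d a`, whose sign is expressed by the degree
of `a` rather than by its predecessor. -/
theorem IsAugDGA.bExternal_letterMul_d (h : IsAugDGA c d ε σ) {i : ℕ} {a : E} (ha : a ∈ homog c i)
    {s : k} {ω : CH ε} (hω : chSign c ε ω = s • ω) : bExternal c ε σ (letterMul ε (d a) ω) =
      s • rightAct c ε σ (d a) ω - s ^ i • leftMul ε (d a) ω := by
  cases i with
  | zero => simp [h.d_zero ha]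
  | succ i => exact h.bExternal_letterMul (h.d_mem ha) hω

/-- The Hochschild boundary in terms of the right action and the left multiplication. -/
theorem IsAugDGA.hochB_letterMul (h : IsAugDGA c d ε σ) {i : ℕ} {a : E} (ha : a ∈ homog c i)
    {s : k} {ω : CH ε} (hω : chSign c ε ω = s • ω) : hochB c d ε σ (letterMul ε a ω) =
      letterMul ε a (bInternal c d ε ω) - s • letterMul ε (d a) ω +
        s • rightAct c ε σ a ω - s ^ (i + 1) • leftMul ε a ω := by
  rw [hochB_eq, h.bInternal_letterMul, h.bExternal_letterMul ha hω, hω, map_smul]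
  abel

theorem IsAugDGA.bExternal_bInternal (h : IsAugDGA c d ε σ) (ω : CH ε) :
    bInternal c d ε (bExternal c ε σ ω) + bExternal c ε σ (bInternal c d ε ω) = 0 := by
  induction ω using h.ch_induction with
  | add x y hx hy =>
    simp only [map_add]
    rw [add_add_add_comm, hx, hy, add_zero]
  | smul r x hx => simp only [map_smul, ← smul_add, hx, smul_zero]
  | base j x hx => simp [bInternal_tmul_one, bExternal_tmul_one]
  | snoc e ω i a hω ha _ _ =>
    have hs := chSign_of_mem h hω
    generalize hse : (-1 : k) ^ e = s at hs
    have hs2 : s * s = 1 := by rw [← hse, ← mul_pow]; simp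
    have hs' : chSign c ε (bInternal c d ε ω) = (-s) • bInternal c d ε ω := by
      rw [h.chSign_bInternal, hs, map_smul, neg_smul]
    rw [h.bExternal_letterMul ha hs, h.bInternal_letterMul, hs, map_smul, map_sub, map_sub,
      map_smul, map_smul, map_smul, h.bExternal_letterMul ha hs', h.bExternal_letterMul_d ha hs,
      h.bInternal_rightAct ha, h.bInternal_leftMul, signOp_of_mem ha, hs]
    simp only [map_smul, LinearMap.smul_apply, smul_add, smul_sub, smul_smul, hs2, neg_pow s,
      pow_succ, mul_comm s (s ^ i)]
    module

theorem IsAugDGA.bExternal_bExternal (h : IsAugDGA c d ε σ) (ω : CH ε) :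
    bExternal c ε σ (bExternal c ε σ ω) = 0 := by
  have key : ∀ ω : CH ε, ∀ (i : ℕ) (a : E), a ∈ homog c i →
      bExternal c ε σ (bExternal c ε σ (letterMul ε a ω)) = 0 := by
    intro ω i a ha
    induction ω using h.ch_induction with
    | add x y hx hy => simp only [map_add, hx, hy, add_zero]
    | smul r x hx => simp only [map_smul, hx, smul_zero]
    | base j x hx =>
      have : chSign c ε (x ⊗ₜ[k] 1) = (-1 : k) ^ j • (x ⊗ₜ[k] 1) := by
        rw [chSign_tmul, signOp_of_mem hx, barSign_one, smul_tmul']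
      rw [h.bExternal_letterMul ha this, h.rightAct_tmul_one, leftMul_tmul, map_sub, map_smul,
        map_smul, bExternal_tmul_one, bExternal_tmul_one]
      simp
    | snoc e ω j b hω hb _ _ =>
      have hs := chSign_of_mem h hω
      generalize hse : (-1 : k) ^ e = s at hs
      have h1 : chSign c ε (letterMul ε b ω) = (-(-1 : k) ^ j * s) • letterMul ε b ω := by
        rw [h.chSign_letterMul, signOp_of_mem hb, hs, map_smul, map_smul, LinearMap.smul_apply]
        module
      have h2 : chSign c ε (rightAct c ε σ b ω) = ((-1 : k) ^ j * s) • rightAct c ε σ b ω := by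
        rw [h.chSign_rightAct hb, hs, map_smul, smul_smul]
      have h3 : chSign c ε (leftMul ε a ω) = ((-1 : k) ^ i * s) • leftMul ε a ω := by
        rw [h.chSign_leftMul, signOp_of_mem ha, hs, map_smul, map_smul, LinearMap.smul_apply]
        module
      rw [h.bExternal_letterMul ha h1, h.rightAct_letterMul hb, leftMul_letterMul]
      simp only [map_sub, map_smul]
      rw [h.bExternal_letterMul (h.mul_mem hb ha) hs, h.bExternal_letterMul ha h2,
        h.bExternal_letterMul hb h3, h.rightAct_rightAct hb, ← leftMul_mul, h.leftMul_rightAct]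
      rcases neg_one_pow_eq_or k i with hi | hi <;> rcases neg_one_pow_eq_or k j with hj | hj <;>
        rcases neg_one_pow_eq_or k e with he | he <;> rw [he] at hse <;> subst hse <;>
        simp only [pow_succ, pow_add, hi, hj, neg_neg, one_pow, mul_one, mul_neg]
        <;> module
  induction ω using h.ch_induction with
  | add x y hx hy => simp only [map_add, hx, hy, add_zero]
  | smul r x hx => simp only [map_smul, hx, smul_zero]
  | base j x hx => simp [bExternal_tmul_one]
  | snoc e ω i a _ ha _ _ => exact key ω i a ha

theorem IsAugDGA.hochB_hochB (h : IsAugDGA c d ε σ) (ω : CH ε) :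
    hochB c d ε σ (hochB c d ε σ ω) = 0 := by
  have h1 := h.bExternal_bInternal ω
  simp only [hochB_eq, map_add, h.bInternal_bInternal, h.bExternal_bExternal, zero_add, add_zero]
  rw [add_comm]
  exact h1

end Square

/-! ### Naturality of the Hochschild boundary -/

section Natural

open TensorAlgebra

variable {k : Type u} [Field k] {E : Type v} [Ring E] [Algebra k E]
variable {E' : Type w} [Ring E'] [Algebra k E']
variable {c : E →ₗ[k] ℕ →₀ E} {d : E →ₗ[k] E} {ε : E →ₐ[k] k} {σ : E →ₐ[k] E}
variable {c' : E' →ₗ[k] ℕ →₀ E'} {d' : E' →ₗ[k] E'} {ε' : E' →ₐ[k] k} {σ' : E' →ₐ[k] E'}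

/-- `f` is a morphism of augmented differential graded algebras compatible with the given
endomorphisms. -/
structure IsAugDGAHom (c : E →ₗ[k] ℕ →₀ E) (d : E →ₗ[k] E) (ε : E →ₐ[k] k) (σ : E →ₐ[k] E)
    (c' : E' →ₗ[k] ℕ →₀ E') (d' : E' →ₗ[k] E') (ε' : E' →ₐ[k] k) (σ' : E' →ₐ[k] E')
    (f : E →ₐ[k] E') : Prop where
  map_mem : ∀ {i : ℕ} {x : E}, x ∈ homog c i → f x ∈ homog c' i
  map_d : ∀ x, f (d x) = d' (f x)
  aug_map : ∀ x, ε' (f x) = ε x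
  map_σ : ∀ x, f (σ x) = σ' (f x)

theorem IsAugDGA.hom_self (h : IsAugDGA c d ε σ) : IsAugDGAHom c d ε σ c d ε σ σ where
  map_mem := h.σ_mem
  map_d := h.σ_d
  aug_map := h.aug_σ
  map_σ _ := rfl

variable {f : E →ₐ[k] E'}

theorem barMap_one : barMap ε ε' f 1 = 1 := by simp [barMap]

theorem barMap_mul (w t : Bar ε) :
    barMap ε ε' f (w * t) = barMap ε ε' f w * barMap ε ε' f t := by simp [barMap]

@[simp] theorem chMap_tmul (x : E) (w : Bar ε) :
    chMap ε ε' f (x ⊗ₜ[k] w) = f x ⊗ₜ[k] barMap ε ε' f w := rfl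

theorem barMap_ι (m : AugIdeal ε) : barMap ε ε' f (ι k m) = barLetter ε' (f (augIncl ε m)) := by
  simp [barMap]

theorem barMap_letter (a : E) : barMap ε ε' f (barLetter ε a) = barLetter ε' (f a) := by
  rw [show barLetter ε a = ι k (toAug ε a) from rfl, barMap_ι, augIncl_toAug]
  simp

theorem chMap_rightMul (t : Bar ε) (ω : CH ε) : chMap ε ε' f (rightMul ε t ω) =
    rightMul ε' (barMap ε ε' f t) (chMap ε ε' f ω) := by
  induction ω using TensorProduct.induction_on with
  | zero => simp
  | tmul x w => simp [barMap_mul]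
  | add x y hx hy => simp only [map_add, hx, hy]

theorem chMap_letterMul (a : E) (ω : CH ε) : chMap ε ε' f (letterMul ε a ω) =
    letterMul ε' (f a) (chMap ε ε' f ω) := by
  rw [letterMul_eq, chMap_rightMul, barMap_letter]; rfl

theorem chMap_leftMul (a : E) (ω : CH ε) : chMap ε ε' f (leftMul ε a ω) =
    leftMul ε' (f a) (chMap ε ε' f ω) := by
  induction ω using TensorProduct.induction_on with
  | zero => simp
  | tmul x w => simp
  | add x y hx hy => simp only [map_add, hx, hy]

theorem IsAugDGAHom.map_signOp (hf : IsAugDGAHom c d ε σ c' d' ε' σ' f) (h : IsAugDGA c d ε σ)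
    (x : E) : f (signOp c x) = signOp c' (f x) := by
  induction x using h.grading.induction with
  | hom i x hx => rw [signOp_of_mem hx, signOp_of_mem (hf.map_mem hx), map_smul]
  | add y z hy hz => simp only [map_add, hy, hz]

theorem IsAugDGAHom.chMap_chSign (hf : IsAugDGAHom c d ε σ c' d' ε' σ' f) (h : IsAugDGA c d ε σ)
    (h' : IsAugDGA c' d' ε' σ') (ω : CH ε) :
    chMap ε ε' f (chSign c ε ω) = chSign c' ε' (chMap ε ε' f ω) := by
  induction ω using h.ch_induction with
  | add x y hx hy => simp only [map_add, hx, hy]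
  | smul r x hx => simp only [map_smul, hx]
  | base j x hx => simp [barSign_one, barMap_one, hf.map_signOp h]
  | snoc e ω j x hω hx _ ih =>
    simp only [h.chSign_letterMul, map_neg, chMap_letterMul, ih, h'.chSign_letterMul,
      hf.map_signOp h]

theorem IsAugDGAHom.chMap_bInternal (hf : IsAugDGAHom c d ε σ c' d' ε' σ' f)
    (h : IsAugDGA c d ε σ) (h' : IsAugDGA c' d' ε' σ') (ω : CH ε) :
    chMap ε ε' f (bInternal c d ε ω) = bInternal c' d' ε' (chMap ε ε' f ω) := by
  induction ω using h.ch_induction with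
  | add x y hx hy => simp only [map_add, hx, hy]
  | smul r x hx => simp only [map_smul, hx]
  | base j x hx => simp [barMap_one, bInternal_tmul_one, hf.map_d]
  | snoc e ω j x hω hx _ ih =>
    simp only [h.bInternal_letterMul, map_sub, chMap_letterMul, ih, h'.bInternal_letterMul,
      hf.map_d, hf.chMap_chSign h h']

theorem IsAugDGAHom.chMap_rightAct (hf : IsAugDGAHom c d ε σ c' d' ε' σ' f)
    (h : IsAugDGA c d ε σ) (h' : IsAugDGA c' d' ε' σ') (a : E) (ω : CH ε) :
    chMap ε ε' f (rightAct c ε σ a ω) = rightAct c' ε' σ' (f a) (chMap ε ε' f ω) := by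
  induction ω using h.ch_induction generalizing a with
  | add x y hx hy => simp only [map_add, hx, hy]
  | smul r x hx => simp only [map_smul, hx]
  | base j x hx => simp [barMap_one, h.rightAct_tmul_one, h'.rightAct_tmul_one, hf.map_σ]
  | snoc e ω j x hω hx _ ih =>
    simp only [h.rightAct_letterMul hx, map_sub, map_smul, chMap_letterMul, ih,
      h'.rightAct_letterMul (hf.map_mem hx), map_mul]

theorem IsAugDGAHom.chMap_hochB (hf : IsAugDGAHom c d ε σ c' d' ε' σ' f)
    (h : IsAugDGA c d ε σ) (h' : IsAugDGA c' d' ε' σ') (ω : CH ε) :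
    chMap ε ε' f (hochB c d ε σ ω) = hochB c' d' ε' σ' (chMap ε ε' f ω) := by
  induction ω using h.ch_induction with
  | add x y hx hy => simp only [map_add, hx, hy]
  | smul r x hx => simp only [map_smul, hx]
  | base j x hx => simp [barMap_one, hochB_tmul_one, hf.map_d]
  | snoc e ω j x hω hx _ _ =>
    have hs := chSign_of_mem h hω
    have hs' : chSign c' ε' (chMap ε ε' f ω) = (-1 : k) ^ e • chMap ε ε' f ω := by
      rw [← hf.chMap_chSign h h', hs, map_smul]
    rw [h.hochB_letterMul hx hs, chMap_letterMul, h'.hochB_letterMul (hf.map_mem hx) hs']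
    simp only [map_sub, map_add, map_smul, chMap_letterMul, hf.chMap_bInternal h h', hf.map_d,
      hf.chMap_rightAct h h', chMap_leftMul]

end Natural

/-! ### Degrees of operators on Hochschild chains -/

section Degree

open TensorAlgebra

variable {k : Type u} [Field k] {E : Type v} [Ring E] [Algebra k E]
variable {c : E →ₗ[k] ℕ →₀ E} {d : E →ₗ[k] E} {ε : E →ₐ[k] k} {σ : E →ₐ[k] E}

/-- The elements of degree `n - 1`; there are none for `n = 0`. -/
def lower {M : Type*} [AddCommGroup M] [Module k M] (c : M →ₗ[k] ℕ →₀ M) : ℕ → Submodule k M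
  | 0 => ⊥
  | n + 1 => homog c n

theorem IsAugDGA.rightMul_mem (h : IsAugDGA c d ε σ) {i n : ℕ} {t : Bar ε}
    (ht : t ∈ homog (barComp c ε) i) {ω : CH ε} (hω : ω ∈ homog (chComp c ε) n) :
    rightMul ε t ω ∈ homog (chComp c ε) (n + i) := by
  have h2 : chComp c ε ∘ₗ rightMul ε t = Finsupp.lmapDomain _ k (· + i) ∘ₗ
      Finsupp.mapRange.linearMap (rightMul ε t) ∘ₗ chComp c ε := by
    refine ext_tmul_homog h.grading h.grading_bar fun p q x hx y hy => ?_
    have e1 := mem_homog.1 (tmul_mem hx hy)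
    have e2 := mem_homog.1 (tmul_mem hx (mul_mem_homog hy ht))
    simp only [comp_apply, rightMul_tmul]
    change tmulComp c (barComp c ε) _ = Finsupp.lmapDomain _ k _
      (Finsupp.mapRange.linearMap (rightMul ε t) (tmulComp c (barComp c ε) _))
    rw [e1]
    refine e2.trans ?_
    simp [add_assoc]
  have h3 := LinearMap.congr_fun h2 ω
  simp only [comp_apply, mem_homog.1 hω] at h3
  rw [mem_homog, h3]
  simp

/-- A family of linear maps on Hochschild chains is compatible with degrees if this holds when
letters are added on the right. -/
theorem IsAugDGA.ch_degree_induction (h : IsAugDGA c d ε σ) {Y : Type*} [AddCommGroup Y]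
    [Module k Y] {T : Type*} (F : T → CH ε →ₗ[k] Y) (S : T → ℕ → Submodule k Y)
    (base : ∀ (i : ℕ) (a : E), a ∈ homog c i → ∀ t, F t (a ⊗ₜ[k] 1) ∈ S t i)
    (snoc : ∀ (e : ℕ) (ω : CH ε) (i : ℕ) (a : E), ω ∈ homog (chComp c ε) e → a ∈ homog c i →
      ε a = 0 → (∀ t, F t ω ∈ S t e) → ∀ t, F t (letterMul ε a ω) ∈ S t (e + (i + 1)))
    {n : ℕ} {ω : CH ε} (hω : ω ∈ homog (chComp c ε) n) (t : T) : F t ω ∈ S t n := by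
  have single_mem : ∀ (m : ℕ) (ω : CH ε), ω ∈ homog (chComp c ε) m → (∀ t, F t ω ∈ S t m) →
      ∀ n t, F t (chComp c ε ω n) ∈ S t n := by
    intro m ω hω hF n t
    rw [mem_homog.1 hω, single_apply]
    split_ifs with hmn
    · exact hmn ▸ hF t
    · rw [map_zero]; exact zero_mem _
  have key : ∀ ω : CH ε, ∀ n t, F t (chComp c ε ω n) ∈ S t n := by
    intro ω
    induction ω using h.ch_induction with
    | add x y hx hy =>
      intro n t; rw [map_add, Finsupp.add_apply, map_add]; exact add_mem (hx n t) (hy n t)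
    | smul r x hx =>
      intro n t; rw [map_smul, Finsupp.smul_apply, map_smul]; exact smul_mem _ r (hx n t)
    | base i a ha =>
      exact single_mem i _ (tmul_mem ha (one_mem_homog _)) (base i a ha)
    | snoc e ω i a hω ha h0 ih =>
      have hmem : letterMul ε a ω ∈ homog (chComp c ε) (e + (i + 1)) :=
        h.rightMul_mem (h.barLetter_mem ha) hω
      refine single_mem _ _ hmem (snoc e ω i a hω ha h0 fun t => ?_)
      have := ih e t
      rwa [mem_homog.1 hω, single_eq_same] at this
  have := key ω n t
  rwa [mem_homog.1 hω, single_eq_same] at this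

theorem IsAugDGA.letterMul_mem (h : IsAugDGA c d ε σ) {i n : ℕ} {a : E} (ha : a ∈ homog c i)
    {ω : CH ε} (hω : ω ∈ homog (chComp c ε) n) :
    letterMul ε a ω ∈ homog (chComp c ε) (n + (i + 1)) :=
  h.rightMul_mem (h.barLetter_mem ha) hω

theorem tmul_one_mem {i : ℕ} {a : E} (ha : a ∈ homog c i) :
    (a ⊗ₜ[k] 1 : CH ε) ∈ homog (chComp c ε) i :=
  tmul_mem ha (one_mem_homog _)

theorem IsAugDGA.leftMul_mem (h : IsAugDGA c d ε σ) {i n : ℕ} {a : E} (ha : a ∈ homog c i)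
    {ω : CH ε} (hω : ω ∈ homog (chComp c ε) n) :
    leftMul ε a ω ∈ homog (chComp c ε) (n + i) := by
  refine h.ch_degree_induction (fun _ : Unit => leftMul ε a)
    (fun _ n => homog (chComp c ε) (n + i)) (fun j x hx _ => ?_) ?_ hω ()
  · rw [leftMul_tmul, add_comm]; exact tmul_one_mem (h.mul_mem ha hx)
  · intro e ω j x hω hx _ ih _
    rw [leftMul_letterMul]
    have := h.letterMul_mem hx (ih ())
    rwa [show e + i + (j + 1) = e + (j + 1) + i by omega] at this

theorem IsAugDGA.rightAct_mem (h : IsAugDGA c d ε σ) {i n : ℕ} {a : E} (ha : a ∈ homog c i)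
    {ω : CH ε} (hω : ω ∈ homog (chComp c ε) n) :
    rightAct c ε σ a ω ∈ homog (chComp c ε) (n + i) := by
  refine h.ch_degree_induction (T := {p : ℕ × E // p.2 ∈ homog c p.1})
    (fun t => rightAct c ε σ t.1.2) (fun t n => homog (chComp c ε) (n + t.1.1))
    (fun j x hx t => ?_) ?_ hω ⟨(i, a), ha⟩
  · rw [h.rightAct_tmul_one]; exact tmul_one_mem (h.mul_mem hx (h.σ_mem t.2))
  · rintro e ω j x hω hx _ ih ⟨⟨i, a⟩, ha⟩
    change rightAct c ε σ a (letterMul ε x ω) ∈ homog (chComp c ε) (e + (j + 1) + i)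
    rw [h.rightAct_letterMul hx]
    refine sub_mem ?_ (smul_mem _ _ ?_)
    · have := h.letterMul_mem (h.mul_mem hx ha) hω
      rwa [show e + (j + i + 1) = e + (j + 1) + i by omega] at this
    · have := h.letterMul_mem ha (ih ⟨(j, x), hx⟩)
      rwa [show e + j + (i + 1) = e + (j + 1) + i by omega] at this

theorem IsAugDGA.letterMul_lower (h : IsAugDGA c d ε σ) {i n : ℕ} {a : E} (ha : a ∈ homog c i)
    {ω : CH ε} (hω : ω ∈ lower (chComp c ε) n) :
    letterMul ε a ω ∈ homog (chComp c ε) (n + i) := by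
  cases n with
  | zero =>
    rw [(mem_bot k).1 hω, map_zero]; exact zero_mem _
  | succ n =>
    have := h.letterMul_mem ha hω
    rwa [show n + (i + 1) = n + 1 + i by omega] at this

/-- The letter `d a` has the degree of `a`, since letters are suspended. -/
theorem IsAugDGA.letterMul_d_mem (h : IsAugDGA c d ε σ) {i n : ℕ} {a : E} (ha : a ∈ homog c i)
    {ω : CH ε} (hω : ω ∈ homog (chComp c ε) n) :
    letterMul ε (d a) ω ∈ homog (chComp c ε) (n + i) := by
  cases i with
  | zero => rw [h.d_zero ha, map_zero]; exact zero_mem _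
  | succ i => exact h.letterMul_mem (h.d_mem ha) hω

theorem IsAugDGA.bInternal_mem (h : IsAugDGA c d ε σ) {n : ℕ} {ω : CH ε}
    (hω : ω ∈ homog (chComp c ε) n) : bInternal c d ε ω ∈ lower (chComp c ε) n := by
  refine h.ch_degree_induction (fun _ : Unit => bInternal c d ε)
    (fun _ n => lower (chComp c ε) n) (fun j x hx _ => ?_) ?_ hω ()
  · rw [bInternal_tmul_one]
    cases j with
    | zero => rw [h.d_zero hx, zero_tmul]; exact zero_mem _
    | succ j => exact tmul_one_mem (h.d_mem hx)
  · intro e ω j x hω hx _ ih _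
    rw [h.bInternal_letterMul, chSign_of_mem h hω, map_smul]
    exact sub_mem (h.letterMul_lower hx (ih ())) (smul_mem _ _ (h.letterMul_d_mem hx hω))

theorem IsAugDGA.bExternal_mem (h : IsAugDGA c d ε σ) {n : ℕ} {ω : CH ε}
    (hω : ω ∈ homog (chComp c ε) n) : bExternal c ε σ ω ∈ lower (chComp c ε) n := by
  refine h.ch_degree_induction (fun _ : Unit => bExternal c ε σ)
    (fun _ n => lower (chComp c ε) n) (fun j x hx _ => ?_) ?_ hω ()
  · rw [bExternal_tmul_one]; exact zero_mem _
  · intro e ω j x hω hx _ _ _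
    rw [h.bExternal_letterMul hx (chSign_of_mem h hω)]
    exact sub_mem (smul_mem _ _ (h.rightAct_mem hx hω))
      (smul_mem _ _ (h.leftMul_mem hx hω))

theorem IsAugDGA.hochB_mem (h : IsAugDGA c d ε σ) {n : ℕ} {ω : CH ε}
    (hω : ω ∈ homog (chComp c ε) n) : hochB c d ε σ ω ∈ lower (chComp c ε) n := by
  rw [hochB_eq]
  exact add_mem (h.bInternal_mem hω) (h.bExternal_mem hω)

theorem prod_ι_mem_homog {M : Type*} [AddCommGroup M] [Module k M] {c : M →ₗ[k] ℕ →₀ M}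
    (l : List (ℕ × M)) (hl : ∀ p ∈ l, p.2 ∈ homog c p.1) :
    (l.map fun p => ι k p.2).prod ∈ homog (tensorComp c) (l.map fun p => p.1).sum := by
  induction l with
  | nil => simpa using one_mem_homog c
  | cons p l ih =>
    simp only [List.map_cons, List.prod_cons, List.sum_cons]
    exact mul_mem_homog (ι_mem_homog (hl p (by simp))) (ih fun q hq => hl q (by simp [hq]))

/-- The part of degree `n` of the Hochschild chains consists of the chains which are homogeneous
of degree `n`. -/
theorem IsAugDGA.chDeg_eq (h : IsAugDGA c d ε σ) (n : ℕ) :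
    chDeg c ε n = homog (chComp c ε) n := by
  apply le_antisymm
  · rw [chDeg, Submodule.span_le]
    rintro _ ⟨i, a, l, ha, hl, rfl, rfl⟩
    refine tmul_mem ha ?_
    have := prod_ι_mem_homog (c := regrade (· + 1) (augComp c ε))
      (l.map fun p => (p.1 + 1, p.2)) (by
      intro p hp
      obtain ⟨q, hq, rfl⟩ := List.mem_map.1 hp
      have h1 := h.toAug_mem (hl q hq)
      rw [toAug_augIncl] at h1
      exact regrade_mem (· + 1) h1)
    simp only [List.map_map, Function.comp_def] at this
    exact this
  · intro ω hω
    refine h.ch_degree_induction (fun _ : Unit => LinearMap.id) (fun _ n => chDeg c ε n)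
      (fun j x hx _ => ?_) ?_ hω ()
    · exact subset_span ⟨j, x, [], hx, by simp, by simp, by simp⟩
    · intro e ω j x hω hx h0 ih _
      have key : ∀ ω ∈ chDeg c ε e, letterMul ε x ω ∈ chDeg c ε (e + (j + 1)) := by
        intro ω hω
        induction hω using span_induction with
        | mem ω hω =>
          obtain ⟨i, a, l, ha, hl, hsum, rfl⟩ := hω
          refine subset_span ⟨i, a, l ++ [(j, toAug ε x)], ha, ?_, ?_, ?_⟩
          · intro p hp
            rcases List.mem_append.1 hp with hp | hp
            · exact hl p hp
            · rw [List.mem_singleton] at hp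
              rw [hp, augIncl_toAug, h0, zero_smul, sub_zero]
              exact hx
          · simp only [List.map_append, List.sum_append, List.map_cons, List.map_nil,
              List.sum_cons, List.sum_nil]
            omega
          · simp [barLetter]
        | zero => rw [map_zero]; exact zero_mem _
        | add y z _ _ hy hz => rw [map_add]; exact add_mem hy hz
        | smul r y _ hy => rw [map_smul]; exact smul_mem _ r hy
      exact key ω (ih ())

end Degree

/-! ### Eigenvectors of the total automorphism -/

section Eigen

open TensorAlgebra

variable {k : Type u} [Field k] {X : Type v} [AddCommGroup X] [Module k X]
  {Y : Type w} [AddCommGroup Y] [Module k Y]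

/-- If subspaces `P μ` of the eigenspaces of `T` span everything, then they are the
eigenspaces. -/
theorem eq_eigenspace {T : Module.End k X} {P : k → Submodule k X}
    (hP : ∀ μ, P μ ≤ T.eigenspace μ) (htop : ⨆ μ, P μ = ⊤) (μ : k) : P μ = T.eigenspace μ := by
  apply le_antisymm (hP μ)
  intro x hx
  have h1 : x ∈ P μ ⊔ ⨆ (ν : k) (_ : ν ≠ μ), P ν := by
    have : ⨆ ν, P ν ≤ P μ ⊔ ⨆ (ν : k) (_ : ν ≠ μ), P ν := by
      refine iSup_le fun ν => ?_
      by_cases hν : ν = μ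
      · exact hν ▸ le_sup_left
      · exact le_sup_of_le_right (le_iSup₂_of_le ν hν le_rfl)
    exact this (htop ▸ Submodule.mem_top)
  obtain ⟨p, hp, r, hr, rfl⟩ := Submodule.mem_sup.1 h1
  have hr1 : r ∈ T.eigenspace μ := by
    have := sub_mem hx (hP μ hp)
    rwa [add_sub_cancel_left] at this
  have hr2 : r ∈ ⨆ (ν : k) (_ : ν ≠ μ), T.eigenspace ν :=
    iSup₂_mono (fun ν _ => hP ν) hr
  have := Submodule.disjoint_def.1 ((Module.End.eigenspaces_iSupIndep T) μ) r hr1 hr2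
  rw [this, add_zero]
  exact hp

/-- A solution of `f x = y` with `y` fixed by a diagonalizable automorphism can be replaced by
a fixed one. -/
theorem exists_fixed {T : Module.End k X} (hT : ⨆ μ, T.eigenspace μ = ⊤) {T' : Module.End k Y}
    {f : X →ₗ[k] Y} (hf : ∀ x, f (T x) = T' (f x)) (x : X) (hx : T' (f x) = f x) :
    ∃ x', T x' = x' ∧ f x' = f x := by
  have h1 : x ∈ T.eigenspace 1 ⊔ ⨆ (ν : k) (_ : ν ≠ 1), T.eigenspace ν := by
    have : ⨆ ν, T.eigenspace ν ≤ T.eigenspace 1 ⊔ ⨆ (ν : k) (_ : ν ≠ 1), T.eigenspace ν := by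
      refine iSup_le fun ν => ?_
      by_cases hν : ν = 1
      · exact hν ▸ le_sup_left
      · exact le_sup_of_le_right (le_iSup₂_of_le ν hν le_rfl)
    exact this (hT ▸ Submodule.mem_top)
  obtain ⟨p, hp, r, hr, rfl⟩ := Submodule.mem_sup.1 h1
  have hmap : ∀ μ, (T.eigenspace μ).map f ≤ T'.eigenspace μ := by
    rintro μ _ ⟨z, hz, rfl⟩
    rw [mem_eigenspace_iff, ← hf, Module.End.mem_eigenspace_iff.1 hz, map_smul]
  have hr2 : f r ∈ ⨆ (ν : k) (_ : ν ≠ 1), T'.eigenspace ν := by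
    have : (⨆ (ν : k) (_ : ν ≠ 1), T.eigenspace ν).map f ≤
        ⨆ (ν : k) (_ : ν ≠ 1), T'.eigenspace ν := by
      rw [Submodule.map_iSup]
      refine iSup_mono fun ν => ?_
      rw [Submodule.map_iSup]
      exact iSup_mono fun _ => hmap ν
    exact this ⟨r, hr, rfl⟩
  have hr1 : f r ∈ T'.eigenspace 1 := by
    have h2 : f (p + r) ∈ T'.eigenspace 1 := by
      rw [mem_eigenspace_iff, hx, one_smul]
    have := sub_mem h2 (hmap 1 ⟨p, hp, rfl⟩)
    rwa [map_add, add_sub_cancel_left] at this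
  have := Submodule.disjoint_def.1 ((Module.End.eigenspaces_iSupIndep T') 1) _ hr1 hr2
  refine ⟨p, ?_, ?_⟩
  · rw [Module.End.mem_eigenspace_iff.1 hp, one_smul]
  · rw [map_add, this, add_zero]

/-- The components of `T x` are the images of the components of `x` if `T` preserves degrees. -/
theorem comp_apply_of_deg_zero {c : X →ₗ[k] ℕ →₀ X} {c' : Y →ₗ[k] ℕ →₀ Y} (hc : IsGrading c)
    {f : X →ₗ[k] Y} (hf : ∀ n, ∀ x ∈ homog c n, f x ∈ homog c' n) (x : X) (n : ℕ) :
    c' (f x) n = f (c x n) := by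
  induction x using hc.induction with
  | hom m y hy =>
    rw [mem_homog.1 hy, mem_homog.1 (hf m y hy), single_apply, single_apply]
    split_ifs <;> simp
  | add y z hy hz => simp only [map_add, Finsupp.add_apply, hy, hz]

theorem comp_apply_of_lower {c : X →ₗ[k] ℕ →₀ X} {c' : Y →ₗ[k] ℕ →₀ Y} (hc : IsGrading c)
    {f : X →ₗ[k] Y} (hf : ∀ n, ∀ x ∈ homog c n, f x ∈ lower c' n) (x : X) (n : ℕ) :
    c' (f x) n = f (c x (n + 1)) := by
  induction x using hc.induction with
  | hom m y hy =>
    have h := hf m y hy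
    cases m with
    | zero =>
      rw [(mem_bot k).1 h, mem_homog.1 hy]
      simp
    | succ m =>
      rw [mem_homog.1 hy, mem_homog.1 h, single_apply, single_apply]
      by_cases hmn : m = n <;> simp [hmn]
  | add y z hy hz => simp only [map_add, Finsupp.add_apply, hy, hz]

/-- A graded space is the sum of its homogeneous parts; this also holds for the fixed points of a
degree preserving endomorphism. -/
theorem fixed_graded {c : X →ₗ[k] ℕ →₀ X} (hc : IsGrading c) {T : Module.End k X}
    (hT : ∀ n, ∀ x ∈ homog c n, T x ∈ homog c n) :
    T.eigenspace 1 = ⨆ n, T.eigenspace 1 ⊓ homog c n := by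
  apply le_antisymm
  · intro x hx
    rw [← hc.sum_comp x, Finsupp.sum]
    refine Submodule.sum_mem _ fun n _ => Submodule.mem_iSup_of_mem n ⟨?_, hc.comp_mem x n⟩
    rw [mem_eigenspace_iff, one_smul] at hx
    change c x n ∈ T.eigenspace 1
    rw [mem_eigenspace_iff, one_smul, ← comp_apply_of_deg_zero hc hT, hx]
  · exact iSup_le fun n => inf_le_left

theorem prod_ι_eigen {M : Type*} [AddCommGroup M] [Module k M] {A : Type*} [Ring A] [Algebra k A]
    (F : TensorAlgebra k M →ₐ[k] A) (G : M →ₗ[k] A) (l : List (k × M))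
    (hl : ∀ p ∈ l, F (ι k p.2) = p.1 • G p.2) :
    F (l.map fun p => ι k p.2).prod =
      (l.map fun p => p.1).prod • (l.map fun p => G p.2).prod := by
  induction l with
  | nil => simp
  | cons p l ih =>
    simp only [List.map_cons, List.prod_cons, map_mul]
    rw [hl p (by simp), ih fun q hq => hl q (by simp [hq]), smul_mul_smul_comm]

variable {E : Type v} [Ring E] [Algebra k E]
variable {c : E →ₗ[k] ℕ →₀ E} {d : E →ₗ[k] E} {ε : E →ₐ[k] k} {σ : E →ₐ[k] E}

theorem span_eigen {T : Module.End k X} (hT : ⨆ μ, T.eigenspace μ = ⊤) (x : X) :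
    x ∈ Submodule.span k {y | ∃ μ : k, T y = μ • y} := by
  have hx : x ∈ ⨆ μ, T.eigenspace μ := hT ▸ Submodule.mem_top
  induction hx using Submodule.iSup_induction' with
  | mem μ y hy => exact subset_span ⟨μ, Module.End.mem_eigenspace_iff.1 hy⟩
  | zero => exact zero_mem _
  | add y z _ _ hy hz => exact add_mem hy hz

theorem iSup_eigenspace_eq_top {T : Module.End k X}
    (h : ∀ x, x ∈ Submodule.span k {y | ∃ μ : k, T y = μ • y}) : ⨆ μ, T.eigenspace μ = ⊤ := by
  rw [eq_top_iff]
  rintro x -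
  induction h x using span_induction with
  | mem x hx =>
    obtain ⟨μ, hμ⟩ := hx
    exact Submodule.mem_iSup_of_mem μ (Module.End.mem_eigenspace_iff.2 hμ)
  | zero => exact zero_mem _
  | add y z _ _ hy hz => exact add_mem hy hz
  | smul r y _ hy => exact smul_mem _ r hy

/-- The span of the Hochschild chains whose entries are eigenvectors of `σ`, the product of the
eigenvalues being `ν`. -/
def chEigen (ε : E →ₐ[k] k) (σ : E →ₐ[k] E) (ν : k) : Submodule k (CH ε) :=
  Submodule.span k {x | ∃ (μ : k) (a : E) (l : List (k × AugIdeal ε)),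
    σ a = μ • a ∧ (∀ p ∈ l, σ (augIncl ε p.2) = p.1 • augIncl ε p.2) ∧
    μ * (l.map fun p => p.1).prod = ν ∧
    x = a ⊗ₜ[k] (l.map fun p => TensorAlgebra.ι k p.2).prod}

theorem chEigen_le (ν : k) :
    chEigen ε σ ν ≤ eigenspace (chMap ε ε σ) ν := by
  rw [chEigen, Submodule.span_le]
  rintro _ ⟨μ, a, l, ha, hl, rfl, rfl⟩
  rw [SetLike.mem_coe, mem_eigenspace_iff, chMap_tmul, ha]
  have := prod_ι_eigen (TensorAlgebra.lift k (barLetter ε ∘ₗ σ.toLinearMap ∘ₗ augIncl ε)) (ι k) l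
    (fun p hp => by
      rw [lift_ι_apply, comp_apply, comp_apply, AlgHom.toLinearMap_apply,
        hl p hp, map_smul, barLetter_augIncl])
  rw [show barMap ε ε σ (l.map fun p => ι k p.2).prod = _ from this, smul_tmul_smul]

theorem iSup_chEigen (hσ : ∀ a, ε (σ a) = ε a)
    (hE : ⨆ μ, eigenspace σ.toLinearMap μ = ⊤) : ⨆ ν, chEigen ε σ ν = ⊤ := by
  rw [eq_top_iff]
  rintro ω -
  have letter : ∀ (a : E) (μ : k), σ a = μ • a →
      σ (augIncl ε (toAug ε a)) = μ • augIncl ε (toAug ε a) := by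
    intro a μ ha
    have h1 : ε a = μ * ε a := by
      have := hσ a
      rw [ha, map_smul, smul_eq_mul] at this
      exact this.symm
    rw [augIncl_toAug, map_sub, map_smul, map_one, ha, smul_sub, smul_smul, ← h1]
  induction ω using TensorProduct.induction_on with
  | zero => exact zero_mem _
  | tmul x w =>
    induction span_eigen hE x using span_induction with
    | mem x hx =>
      obtain ⟨μ, hμ⟩ := hx
      refine tensor_induction_of_span (c := (lsingle 0 : AugIdeal ε →ₗ[k] ℕ →₀ AugIdeal ε))
        (P := fun w => x ⊗ₜ[k] w ∈ ⨆ ν, chEigen ε σ ν)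
        {m | ∃ μ : k, ∃ a : E, σ a = μ • a ∧ m = toAug ε a}
        ?_ (fun m _ => ⟨0, rfl⟩) ?_ ?_ ?_ ?_ w
      · intro m
        rw [← toAug_augIncl ε m]
        generalize augIncl ε m = y
        induction span_eigen hE y using span_induction with
        | mem y hy => obtain ⟨ν, hν⟩ := hy; exact subset_span ⟨ν, y, hν, rfl⟩
        | zero => rw [map_zero]; exact zero_mem _
        | add y z _ _ hy hz => rw [map_add]; exact add_mem hy hz
        | smul r y _ hy => rw [map_smul]; exact smul_mem _ r hy
      · intro y z hy hz; rw [tmul_add]; exact add_mem hy hz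
      · intro r y hy; rw [tmul_smul]; exact smul_mem _ r hy
      · exact Submodule.mem_iSup_of_mem μ
          (subset_span ⟨μ, x, [], hμ, by simp, by simp, by simp⟩)
      · rintro - w _ - ⟨ν, a, ha, rfl⟩ hP
        have key : ∀ ω ∈ ⨆ ν, chEigen ε σ ν, letterMul ε a ω ∈ ⨆ ν, chEigen ε σ ν := by
          intro ω hω
          induction hω using Submodule.iSup_induction' with
          | mem ρ ω hω =>
            induction hω using span_induction with
            | mem ω hω =>
              obtain ⟨μ', a', l, ha', hl, hprod, rfl⟩ := hω
              refine Submodule.mem_iSup_of_mem (μ' * (l.map fun p => p.1).prod * ν)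
                (subset_span ⟨μ', a', l ++ [(ν, toAug ε a)], ha', ?_, ?_, ?_⟩)
              · intro p hp
                rcases List.mem_append.1 hp with hp | hp
                · exact hl p hp
                · rw [List.mem_singleton] at hp
                  rw [hp]
                  exact letter a ν ha
              · simp [mul_assoc]
              · simp [barLetter]
            | zero => rw [map_zero]; exact zero_mem _
            | add y z _ _ hy hz => rw [map_add]; exact add_mem hy hz
            | smul r y _ hy => rw [map_smul]; exact smul_mem _ r hy
          | zero => rw [map_zero]; exact zero_mem _
          | add y z _ _ hy hz => rw [map_add]; exact add_mem hy hz
        exact key _ hP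
    | zero => rw [zero_tmul]; exact zero_mem _
    | add y z _ _ hy hz => rw [add_tmul]; exact add_mem hy hz
    | smul r y _ hy => rw [← smul_tmul']; exact smul_mem _ r hy
  | add x y hx hy => exact add_mem hx hy

/-- If `σ` is diagonalizable, then the total automorphism of the Hochschild chains is so. -/
theorem iSup_eigenspace_chMap (hσ : ∀ a, ε (σ a) = ε a)
    (hE : ⨆ μ, eigenspace σ.toLinearMap μ = ⊤) :
    ⨆ μ, eigenspace (chMap ε ε σ) μ = ⊤ :=
  top_le_iff.1 ((iSup_chEigen hσ hE).ge.trans (iSup_mono chEigen_le))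

/-- If `σ` is diagonalizable, then `chOne` consists of the fixed points of the total
automorphism. -/
theorem chOne_eq (hσ : ∀ a, ε (σ a) = ε a)
    (hE : ⨆ μ, eigenspace σ.toLinearMap μ = ⊤) :
    chOne ε σ = eigenspace (chMap ε ε σ) 1 :=
  eq_eigenspace chEigen_le (iSup_chEigen hσ hE) 1

end Eigen

/-! ### The Connes operator -/

section Connes

open TensorAlgebra

variable {k : Type u} [Field k] {E : Type v} [Ring E] [Algebra k E]
variable (c : E →ₗ[k] ℕ →₀ E) (d : E →ₗ[k] E) (ε : E →ₐ[k] k) (σ : E →ₐ[k] E)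

/-- The sum over the twisted rotations of a word: `cycSum x w = ∑ ± w'' x σ(w')` over all
decompositions `w = w' w''`. -/
def cycSum : Bar ε →ₗ[k] Bar ε →ₗ[k] Bar ε :=
  TensorProduct.curry
    (mul' k (Bar ε) ∘ₗ
      koszulMove (signOp (barComp c ε)) (barComp c ε) ∘ₗ
      TensorProduct.map (mul' k (Bar ε) ∘ₗ TensorProduct.map LinearMap.id (barMap ε ε σ))
        LinearMap.id ∘ₗ
      (TensorProduct.assoc k _ _ _).symm.toLinearMap ∘ₗ
      deconc.lTensor (Bar ε))

/-- The differential of the bar construction. -/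
def barD : Bar ε →ₗ[k] Bar ε := barMid c ε - barInt c d ε

/-- The products of the letter `[a]` with the first letter of a word on its right. -/
def leftCross : E →ₗ[k] Module.End k (Bar ε) :=
  mulLeft k (barMid c ε : Module.End k (Bar ε)) ∘ₗ LinearMap.mul k (Bar ε) ∘ₗ
    barLetter ε - mulRight k (barMid c ε : Module.End k (Bar ε)) ∘ₗ
      LinearMap.mul k (Bar ε) ∘ₗ signOp (barComp c ε) ∘ₗ barLetter ε

/-- The product of the letter `[a]` with the last letter of the word `w` on its left. -/
def rightCross (a : E) (w : Bar ε) : Bar ε :=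
  barMid c ε (w * barLetter ε a) - barMid c ε w * barLetter ε a

/-- The products of the last letter of a word `w` with the first letter of `x` in the rotations of
`w` around `x`, where `r = (-1) ^ |x|`. -/
def cycLast (r : k) (x : Bar ε) : Bar ε →ₗ[k] Bar ε :=
  TensorProduct.lift (cycSum c ε σ ∘ₗ (leftCross c ε).flip x ∘ₗ augIncl ε) ∘ₗ
    koszulMove (r • signOp (barComp c ε)) (regrade (· + 1) (augComp c ε)) ∘ₗ lastLetter

variable {c d ε σ}

theorem connesB_tmul (x : E) (w : Bar ε) :
    connesB c ε σ (x ⊗ₜ[k] w) = 1 ⊗ₜ[k] cycSum c ε σ (barLetter ε x) w := by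
  simp [connesB, cycSum]

theorem connesB_one_tmul (w : Bar ε) : connesB c ε σ (1 ⊗ₜ[k] w) = 0 := by
  rw [connesB_tmul]; simp

theorem connesB_connesB (ω : CH ε) : connesB c ε σ (connesB c ε σ ω) = 0 := by
  induction ω using TensorProduct.induction_on with
  | zero => simp
  | tmul x w => rw [connesB_tmul, connesB_one_tmul]
  | add x y hx hy => rw [map_add, map_add, hx, hy, add_zero]

theorem hochB_tmul (x : E) (t : Bar ε) : hochB c d ε σ (x ⊗ₜ[k] t) =
    d x ⊗ₜ[k] t + signOp c x ⊗ₜ[k] barD c d ε t + bFirst c ε σ (x ⊗ₜ[k] t) -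
      bLast c ε (x ⊗ₜ[k] t) := by
  simp only [hochB, LinearMap.add_apply, LinearMap.sub_apply, bInternal_tmul, bMiddle_tmul, barD,
    tmul_sub]
  abel

theorem leftCross_apply (a : E) (t : Bar ε) : leftCross c ε a t =
    barMid c ε (barLetter ε a * t) - signOp (barComp c ε) (barLetter ε a) * barMid c ε t := rfl

theorem barD_one : barD c d ε 1 = 0 := by
  simp [barD, barMid_one, barInt, split_one]

theorem IsAugDGA.barD_letter (h : IsAugDGA c d ε σ) (a : E) :
    barD c d ε (barLetter ε a) = -barLetter ε (d a) := by
  simp [barD, barMid_letter, barInt_letter h]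

theorem IsAugDGA.barD_letter_mul (h : IsAugDGA c d ε σ) (a : E) (t : Bar ε) :
    barD c d ε (barLetter ε a * t) = -(barLetter ε (d a) * t) -
      barLetter ε (signOp c a) * barD c d ε t + leftCross c ε a t := by
  simp only [barD, LinearMap.sub_apply, barInt_mul h, barInt_letter h, leftCross_apply,
    h.barSign_letter, neg_mul, mul_sub]
  abel

theorem IsAugDGA.barD_mul_letter (h : IsAugDGA c d ε σ) (t : Bar ε) (a : E) :
    barD c d ε (t * barLetter ε a) = barD c d ε t * barLetter ε a -
      signOp (barComp c ε) t * barLetter ε (d a) + rightCross c ε a t := by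
  simp only [barD, LinearMap.sub_apply, barInt_mul h, barInt_letter h, rightCross, sub_mul]
  abel

theorem rightCross_one (a : E) : rightCross c ε a 1 = 0 := by
  simp [rightCross, barMid_one, barMid_letter]

theorem IsAugDGA.rightCross_mul_letter (h : IsAugDGA c d ε σ) {a b : E} (ha : ε a = 0)
    (hb : ε b = 0) (w : Bar ε) : rightCross c ε a (w * barLetter ε b) =
      -(signOp (barComp c ε) w * barLetter ε (signOp c b * a)) := by
  rw [rightCross, h.barMid_mul_letter, ha, hb]
  simp

theorem leftCross_one (a : E) : leftCross c ε a 1 = 0 := by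
  simp [leftCross_apply, barMid_one, barMid_letter]

/-- A multiplication of bar words by a word on the left does not affect the product at the right
end. -/
theorem IsAugDGA.rightCross_mul (h : IsAugDGA c d ε σ) {a b : E} (ha : ε a = 0)
    (hb : ε b = 0) (w t : Bar ε) : rightCross c ε a (w * (t * barLetter ε b)) =
      signOp (barComp c ε) w * rightCross c ε a (t * barLetter ε b) := by
  rw [← mul_assoc, h.rightCross_mul_letter ha hb, h.rightCross_mul_letter ha hb, h.barSign_mul,
    mul_neg, mul_assoc]

/-- The product at the junction of two words. -/
theorem IsAugDGA.barMid_mul (h : IsAugDGA c d ε σ) {b : E} (hb : ε b = 0) (x t : Bar ε) :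
    barMid c ε (x * (barLetter ε b * t)) = barMid c ε x * (barLetter ε b * t) +
      signOp (barComp c ε) x * barMid c ε (barLetter ε b * t) + rightCross c ε b x * t := by
  induction t using h.bar_induction with
  | add y z hy hz => simp only [mul_add, map_add, hy, hz]; abel
  | smul r y hy => simp only [mul_smul_comm, map_smul, hy, smul_add]
  | one => simp [rightCross, barMid_letter]
  | snoc e w i a hw ha h0 ih =>
    have key : ∃ (t : Bar ε), ∀ y : Bar ε, rightCross c ε a (y * (barLetter ε b * w)) =
        signOp (barComp c ε) y * t := by
      refine ⟨rightCross c ε a (barLetter ε b * w), fun y => ?_⟩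
      clear ih
      have hlin : ∀ z z' : Bar ε, rightCross c ε a (z + z') =
          rightCross c ε a z + rightCross c ε a z' := by
        intro z z'; simp only [rightCross, add_mul, map_add]; abel
      have hsm : ∀ (r : k) (z : Bar ε), rightCross c ε a (r • z) = r • rightCross c ε a z := by
        intro r z; simp only [rightCross, smul_mul_assoc, map_smul, smul_sub]
      clear hw
      induction w using h.bar_induction with
      | add p q hp hq => simp only [mul_add, hlin, hp, hq]
      | smul r p hp => simp only [mul_smul_comm, hsm, hp]
      | one =>
        have := h.rightCross_mul h0 hb y 1
        simpa using this
      | snoc e' w' i' a' _ _ h0' _ =>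
        rw [← mul_assoc (barLetter ε b)]
        exact h.rightCross_mul h0 h0' y _
    obtain ⟨t, ht⟩ := key
    have e1 : ∀ y : Bar ε, barMid c ε (y * (barLetter ε b * w) * barLetter ε a) =
        barMid c ε (y * (barLetter ε b * w)) * barLetter ε a + signOp (barComp c ε) y * t := by
      intro y
      rw [← ht]; simp [rightCross]
    have e2 := e1 1
    rw [one_mul, barSign_one, one_mul] at e2
    rw [← mul_assoc (barLetter ε b), ← mul_assoc x, e1, ih, e2]
    simp only [add_mul, mul_add, mul_assoc]
    abel

theorem IsAugDGA.leftCross_letter_mul (h : IsAugDGA c d ε σ) {a b : E} (ha : ε a = 0)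
    (hb : ε b = 0) (t : Bar ε) : leftCross c ε a (barLetter ε b * t) =
      -(barLetter ε (signOp c a * b) * t) := by
  have h1 := h.rightCross_mul_letter (c := c) hb ha 1
  rw [barSign_one, one_mul, one_mul] at h1
  rw [leftCross_apply, h.barMid_mul hb, barMid_letter, h1]
  simp

theorem cycSum_one (x : Bar ε) : cycSum c ε σ x 1 = x := by
  simp only [cycSum, TensorProduct.curry_apply, comp_apply, lTensor_tmul,
    deconc_one, LinearEquiv.coe_coe, assoc_symm_tmul, map_tmul,
    LinearMap.id_coe, id, mul'_apply, barMap_one, mul_one]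
  have h1 : (1 : Bar ε) ∈ homog (barComp c ε) 0 := one_mem_homog _
  rw [koszulMove_tmul _ h1]
  simp

theorem IsAugDGA.cycSum_one_letter_mul (h : IsAugDGA c d ε σ) (b : E) (w : Bar ε) :
    cycSum c ε σ 1 (barLetter ε b * w) =
    barLetter ε b * w + cycSum c ε σ (barLetter ε (σ b)) w := by
  have key : ∀ s : Bar ε ⊗[k] Bar ε,
      mul' k (Bar ε) (koszulMove (signOp (barComp c ε)) (barComp c ε)
        (TensorProduct.map (mul' k (Bar ε) ∘ₗ TensorProduct.map LinearMap.id
          (barMap ε ε σ)) LinearMap.id ((TensorProduct.assoc k _ _ _).symm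
            (1 ⊗ₜ[k] (mulLeft k (barLetter ε b)).rTensor _ s)))) =
      mul' k (Bar ε) (koszulMove (signOp (barComp c ε)) (barComp c ε)
        (TensorProduct.map (mul' k (Bar ε) ∘ₗ TensorProduct.map LinearMap.id
          (barMap ε ε σ)) LinearMap.id ((TensorProduct.assoc k _ _ _).symm
            (barLetter ε (σ b) ⊗ₜ[k] s)))) := by
    intro s
    induction s with
    | zero => simp
    | tmul p q => simp [barMap_mul, barMap_letter]
    | add p q hp hq => simp only [map_add, tmul_add, hp, hq]
  have key2 : ∀ y : Bar ε, mul' k (Bar ε) (koszulMove (signOp (barComp c ε))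
      (barComp c ε) (1 ⊗ₜ[k] y)) = y := by
    intro y
    have : ∀ n, ((signOp (barComp c ε)) ^ n) 1 = 1 := fun n => by
      rw [pow_apply_of_eq_smul (r := 1) (by rw [barSign_one, one_smul])]; simp
    induction y using h.grading_bar.induction with
    | hom n y hy => rw [koszulMove_tmul _ hy, this]; simp
    | add y z hy hz => simp only [tmul_add, map_add, hy, hz]
  simp only [cycSum, TensorProduct.curry_apply, comp_apply, lTensor_tmul,
    LinearEquiv.coe_coe] at key ⊢
  rw [show barLetter ε b * w = ι k (toAug ε b) * w from rfl, deconc_ι_mul]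
  simp only [tmul_add, map_add]
  congr 1
  · simp [barMap_one, key2]
  · exact key _

theorem IsAugDGA.barMap_barSign (h : IsAugDGA c d ε σ) (w : Bar ε) :
    barMap ε ε σ (signOp (barComp c ε) w) = signOp (barComp c ε) (barMap ε ε σ w) := by
  induction w using h.bar_induction with
  | add y z hy hz => simp only [map_add, hy, hz]
  | smul r y hy => simp only [map_smul, hy]
  | one => simp [barSign_one, barMap_one]
  | snoc e w i a hw ha h0 ih =>
    simp only [h.barSign_mul, barMap_mul, ih, h.barSign_letter, map_neg, barMap_letter,
      h.hom_self.map_signOp h]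

theorem IsAugDGA.map_barSign_deconc (h : IsAugDGA c d ε σ) (w : Bar ε) :
    TensorProduct.map (signOp (barComp c ε)) (signOp (barComp c ε)) (deconc w) =
      deconc (signOp (barComp c ε) w) := by
  induction w using h.bar_induction with
  | add y z hy hz => simp only [map_add, hy, hz]
  | smul r y hy => simp only [map_smul, hy]
  | one => simp [barSign_one, deconc_one]
  | snoc e w i a hw ha h0 ih =>
    have h1 : ∀ s : Bar ε ⊗[k] Bar ε,
        TensorProduct.map (signOp (barComp c ε)) (signOp (barComp c ε))
          ((mulRight k (barLetter ε a)).lTensor _ s) =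
        -(mulRight k (barLetter ε (signOp c a))).lTensor _
          (TensorProduct.map (signOp (barComp c ε)) (signOp (barComp c ε)) s) := by
      intro s
      induction s with
      | zero => simp
      | tmul p q => simp [h.barSign_mul, h.barSign_letter, tmul_neg]
      | add p q hp hq => simp only [map_add, hp, hq]; abel
    have h2 : ∀ (a : E) (w : Bar ε), deconc (w * barLetter ε a) = (w * barLetter ε a) ⊗ₜ[k] 1 +
        (mulRight k (barLetter ε a)).lTensor _ (deconc w) :=
      fun a w => deconc_mul_ι w _
    rw [h2, map_add, h1, ih, h.barSign_mul, h.barSign_letter, mul_neg, map_neg, h2]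
    simp [h.barSign_mul, h.barSign_letter, barSign_one, neg_tmul]
    abel

/-- Rotating the last letter to the front. -/
theorem IsAugDGA.cycSum_mul_letter (h : IsAugDGA c d ε σ) {i : ℕ} {a : E} (ha : a ∈ homog c i)
    {r s : k} {x w : Bar ε} (hx : signOp (barComp c ε) x = r • x)
    (hw : signOp (barComp c ε) w = s • w) :
    cycSum c ε σ x (w * barLetter ε a) = x * barMap ε ε σ (w * barLetter ε a) +
      (r * s) ^ (i + 1) • cycSum c ε σ (barLetter ε a * x) w := by
  set τ : Module.End k (Bar ε) := signOp (barComp c ε) with hτ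
  -- moving the letter `a` through a homogeneous pair
  have hK : ∀ y t : Bar ε, mul' k (Bar ε)
      (koszulMove τ (barComp c ε) (y ⊗ₜ[k] (t * barLetter ε a))) =
      mul' k (Bar ε) (koszulMove τ (barComp c ε)
        ((barLetter ε a * (τ ^ (i + 1)) y) ⊗ₜ[k] (τ ^ (i + 1)) t)) := by
    intro y t
    induction t using h.grading_bar.induction with
    | add t t' ht ht' => simp only [add_mul, tmul_add, map_add, ht, ht']
    | hom m t ht =>
      induction y using h.grading_bar.induction with
      | add y y' hy hy' => simp only [mul_add, add_tmul, map_add, hy, hy']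
      | hom n y hy =>
        have e1 : τ t = (-1 : k) ^ m • t := signOp_of_mem ht
        have e2 : τ y = (-1 : k) ^ n • y := signOp_of_mem hy
        have e3 : t * barLetter ε a ∈ homog (barComp c ε) (m + (i + 1)) :=
          mul_mem_homog ht (h.barLetter_mem ha)
        have e4 : τ (barLetter ε a * y) = (-1 : k) ^ (i + 1 + n) • (barLetter ε a * y) :=
          signOp_of_mem (mul_mem_homog (h.barLetter_mem ha) hy)
        rw [koszulMove_tmul _ e3, pow_apply_of_eq_smul e1, pow_apply_of_eq_smul e2,
          pow_apply_of_eq_smul e2, mul'_apply,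
          mul_smul_comm, mul_smul_comm, smul_tmul_smul, map_smul, map_smul,
          koszulMove_tmul _ ht, pow_apply_of_eq_smul e4, mul'_apply, mul_smul_comm,
          smul_smul, mul_assoc]
        congr 1
        rcases neg_one_pow_eq_or k m with hm | hm <;> rcases neg_one_pow_eq_or k n with hn | hn <;>
          rcases neg_one_pow_eq_or k i with hi | hi <;>
          simp [pow_add, hm, hn, hi]
  have hdec : ∀ n : ℕ, TensorProduct.map (τ ^ n) (τ ^ n) (deconc w) = deconc ((τ ^ n) w) := by
    intro n
    induction n with
    | zero => simp only [pow_zero]; exact LinearMap.congr_fun (TensorProduct.map_id) _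
    | succ n ih =>
      rw [pow_succ', Module.End.mul_apply, hτ, ← h.map_barSign_deconc, ← hτ, ← ih,
        ← comp_apply (f := TensorProduct.map τ τ), ← TensorProduct.map_comp]
      rfl
  have hbm : ∀ (n : ℕ) (p : Bar ε), barMap ε ε σ ((τ ^ n) p) = (τ ^ n) (barMap ε ε σ p) := by
    intro n p
    induction n with
    | zero => rfl
    | succ n ih => rw [pow_succ', Module.End.mul_apply, h.barMap_barSign, ih]; rfl
  have hmul : ∀ (n : ℕ) (p q : Bar ε), (τ ^ n) (p * q) = (τ ^ n) p * (τ ^ n) q := by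
    intro n p q
    induction n with
    | zero => rfl
    | succ n ih => rw [pow_succ', Module.End.mul_apply, ih, hτ, h.barSign_mul]; rfl
  -- The decompositions of `w a` are `w a ⊗ 1` and the `w' ⊗ w'' a`; the latter give the rotations
  -- of `w` around `a x`.
  have hsum : ∀ u : Bar ε ⊗[k] Bar ε,
      mul' k (Bar ε) (koszulMove τ (barComp c ε)
        (TensorProduct.map (mul' k (Bar ε) ∘ₗ TensorProduct.map LinearMap.id
          (barMap ε ε σ)) LinearMap.id ((TensorProduct.assoc k _ _ _).symm
            (x ⊗ₜ[k] (mulRight k (barLetter ε a)).lTensor _ u)))) =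
      mul' k (Bar ε) (koszulMove τ (barComp c ε)
        (TensorProduct.map (mul' k (Bar ε) ∘ₗ TensorProduct.map LinearMap.id
          (barMap ε ε σ)) LinearMap.id ((TensorProduct.assoc k _ _ _).symm
            ((barLetter ε a * (τ ^ (i + 1)) x) ⊗ₜ[k]
              TensorProduct.map (τ ^ (i + 1)) (τ ^ (i + 1)) u)))) := by
    intro u
    induction u with
    | zero => simp
    | tmul p q =>
      simp only [lTensor_tmul, mulRight_apply,
        assoc_symm_tmul, map_tmul, comp_apply,
        LinearMap.id_coe, id, mul'_apply, hK, hbm, hmul, mul_assoc]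
    | add p q hp hq => simp only [map_add, tmul_add, hp, hq]
  have h1 : (1 : Bar ε) ∈ homog (barComp c ε) 0 := one_mem_homog _
  have hd : deconc (w * barLetter ε a) = (w * barLetter ε a) ⊗ₜ[k] 1 +
      (mulRight k (barLetter ε a)).lTensor _ (deconc w) := deconc_mul_ι w _
  have e : cycSum c ε σ x (w * barLetter ε a) = x * barMap ε ε σ (w * barLetter ε a) +
      cycSum c ε σ (barLetter ε a * (τ ^ (i + 1)) x) ((τ ^ (i + 1)) w) := by
    simp only [cycSum, TensorProduct.curry_apply, comp_apply, lTensor_tmul,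
      LinearEquiv.coe_coe] at hsum ⊢
    rw [hd, ← hdec, tmul_add, map_add, map_add, map_add, map_add, ← hsum]
    congr 1
    simp only [assoc_symm_tmul, map_tmul, comp_apply,
        LinearMap.id_coe, id, mul'_apply]
    rw [koszulMove_tmul _ h1]
    simp
  rw [e, pow_apply_of_eq_smul hx, pow_apply_of_eq_smul hw]
  simp only [mul_smul_comm, map_smul, LinearMap.smul_apply, smul_smul, mul_pow,
    mul_comm (s ^ (i + 1))]

end Connes

section Connes

open TensorAlgebra

variable {k : Type u} [Field k] {E : Type v} [Ring E] [Algebra k E]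
variable {c : E →ₗ[k] ℕ →₀ E} {d : E →ₗ[k] E} {ε : E →ₐ[k] k} {σ : E →ₐ[k] E}

/-- The sign version of `IsAugDGA.cycSum_mul_letter` for a differential; it is stated with the
degree of `a` to avoid the predecessor of a degree. -/
theorem IsAugDGA.cycSum_mul_letter_d (h : IsAugDGA c d ε σ) {i : ℕ} {a : E} (ha : a ∈ homog c i)
    {r s : k} {x w : Bar ε} (hx : signOp (barComp c ε) x = r • x)
    (hw : signOp (barComp c ε) w = s • w) :
    cycSum c ε σ x (w * barLetter ε (d a)) = x * barMap ε ε σ (w * barLetter ε (d a)) +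
      (r * s) ^ i • cycSum c ε σ (barLetter ε (d a) * x) w := by
  cases i with
  | zero => simp [h.d_zero ha]
  | succ i => exact h.cycSum_mul_letter (h.d_mem ha) hx hw

theorem IsAugDGA.rightCross_barSign (h : IsAugDGA c d ε σ) {a b : E} (ha : ε a = 0)
    (hb : ε b = 0) (hsa : ε (signOp c a) = 0) (hsb : ε (signOp c b) = 0) (w : Bar ε) :
    signOp (barComp c ε) (rightCross c ε a (w * barLetter ε b)) =
      rightCross c ε (signOp c a) (signOp (barComp c ε) (w * barLetter ε b)) := by
  have hneg : ∀ z : Bar ε, rightCross c ε (signOp c a) (-z) = -rightCross c ε (signOp c a) z := by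
    intro z; simp only [rightCross, neg_mul, map_neg]; abel
  rw [h.rightCross_mul_letter ha hb, h.barSign_mul, h.barSign_letter, mul_neg, hneg,
    h.rightCross_mul_letter hsa hsb, map_neg, h.barSign_mul, h.barSign_letter,
    h.signOp_mul, mul_neg]

theorem IsAugDGA.aug_signOp (h : IsAugDGA c d ε σ) (a : E) : ε (signOp c a) = ε a := by
  induction a using h.grading.induction with
  | hom i x hx =>
    rw [signOp_of_mem hx, map_smul, smul_eq_mul, mul_comm, h.aug_smul_pow hx]
  | add y z hy hz => simp only [map_add, hy, hz]

theorem IsAugDGA.barSign_barD (h : IsAugDGA c d ε σ) (w : Bar ε) :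
    signOp (barComp c ε) (barD c d ε w) = -barD c d ε (signOp (barComp c ε) w) := by
  induction w using h.bar_induction with
  | add x y hx hy => simp only [map_add, hx, hy, neg_add]
  | smul r x hx => simp only [map_smul, hx, smul_neg]
  | one => simp [barD_one, barSign_one]
  | snoc e w i a hw ha h0 ih =>
    have hrc : signOp (barComp c ε) (rightCross c ε a w) =
        rightCross c ε (signOp c a) (signOp (barComp c ε) w) := by
      clear ih hw
      have hlin : ∀ (a : E) (z z' : Bar ε), rightCross c ε a (z + z') =
          rightCross c ε a z + rightCross c ε a z' := by
        intro a z z'; simp only [rightCross, add_mul, map_add]; abel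
      have hsm : ∀ (a : E) (r : k) (z : Bar ε),
          rightCross c ε a (r • z) = r • rightCross c ε a z := by
        intro a r z; simp only [rightCross, smul_mul_assoc, map_smul, smul_sub]
      induction w using h.bar_induction with
      | add x y hx hy => simp only [map_add, hlin, hx, hy]
      | smul r x hx => simp only [map_smul, hsm, hx]
      | one => simp [barSign_one, rightCross_one]
      | snoc e w j b hw hb hb0 _ =>
        exact h.rightCross_barSign h0 hb0 (by rw [h.aug_signOp, h0]) (by rw [h.aug_signOp, hb0]) w
    simp only [h.barD_mul_letter, map_add, map_sub, h.barSign_mul, ih, hrc, h.barSign_letter,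
      h.signOp_d, neg_mul, mul_neg, neg_neg, map_neg]

/-- Every bar word is a combination of `1` and of words with a first letter. -/
theorem IsAugDGA.bar_cons_cases (h : IsAugDGA c d ε σ) {P : Bar ε → Prop}
    (add : ∀ x y, P x → P y → P (x + y)) (smul : ∀ (r : k) x, P x → P (r • x)) (one : P 1)
    (cons : ∀ (i : ℕ) (b : E) (w : Bar ε), b ∈ homog c i → ε b = 0 → P (barLetter ε b * w))
    (w : Bar ε) : P w := by
  have key : w ∈ Submodule.span k
      ({1} ∪ {z | ∃ (i : ℕ) (b : E) (w : Bar ε), b ∈ homog c i ∧ ε b = 0 ∧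
        z = barLetter ε b * w}) := by
    induction w using h.bar_induction with
    | add x y hx hy => exact add_mem hx hy
    | smul r x hx => exact smul_mem _ r hx
    | one => exact subset_span (Or.inl rfl)
    | snoc e w i a hw ha h0 ih =>
      clear hw
      induction ih using span_induction with
      | mem x hx =>
        rcases hx with rfl | ⟨j, b, w, hb, hb0, rfl⟩
        · exact subset_span (Or.inr ⟨i, a, 1, ha, h0, by rw [one_mul, mul_one]⟩)
        · exact subset_span (Or.inr ⟨j, b, _, hb, hb0, mul_assoc _ _ _⟩)
      | zero => simp
      | add x y _ _ hx hy => rw [add_mul]; exact add_mem hx hy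
      | smul r x _ hx => rw [smul_mul_assoc]; exact smul_mem _ r hx
  induction key using span_induction with
  | mem x hx =>
    rcases hx with rfl | ⟨j, b, w, hb, hb0, rfl⟩
    · exact one
    · exact cons j b w hb hb0
  | zero => simpa using smul 0 _ one
  | add x y _ _ hx hy => exact add x y hx hy
  | smul r x _ hx => exact smul r x hx

theorem cycLast_one (r : k) (x : Bar ε) : cycLast c ε σ r x 1 = 0 := by
  simp [cycLast, lastLetter_one]

theorem IsAugDGA.cycLast_mul_letter (h : IsAugDGA c d ε σ) {i : ℕ} {a : E} (ha : a ∈ homog c i)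
    (h0 : ε a = 0) {r s : k} (x : Bar ε) {w : Bar ε} (hw : signOp (barComp c ε) w = s • w) :
    cycLast c ε σ r x (w * barLetter ε a) =
      (r * s) ^ (i + 1) • cycSum c ε σ (leftCross c ε a x) w := by
  have h1 : toAug ε a ∈ homog (regrade (· + 1) (augComp c ε)) (i + 1) :=
    regrade_mem _ (h.toAug_mem ha)
  have h2 : (r • signOp (barComp c ε)) w = (r * s) • w := by
    rw [LinearMap.smul_apply, hw, smul_smul]
  rw [cycLast, comp_apply, comp_apply,
    show barLetter ε a = ι k (toAug ε a) from rfl, lastLetter_mul_ι, koszulMove_tmul _ h1,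
    pow_apply_of_eq_smul h2]
  simp [augIncl_toAug, h0]

theorem IsAugDGA.cycSum_rightCross (h : IsAugDGA c d ε σ) {i n : ℕ} {a : E} (ha : a ∈ homog c i)
    (h0 : ε a = 0) {x : Bar ε} (hx : signOp (barComp c ε) x = (-1 : k) ^ n • x) (w : Bar ε) :
    cycSum c ε σ x (rightCross c ε a w) = x * barMap ε ε σ (rightCross c ε a w) +
      (-1 : k) ^ (n * i) • cycLast c ε σ ((-1) ^ (i + 1 + n)) (barLetter ε a * x)
        ((signOp (barComp c ε) ^ (i + 1) : Module.End k (Bar ε)) w) := by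
  have hlin : ∀ z z' : Bar ε, rightCross c ε a (z + z') =
      rightCross c ε a z + rightCross c ε a z' := by
    intro z z'; simp only [rightCross, add_mul, map_add]; abel
  have hsm : ∀ (r : k) (z : Bar ε), rightCross c ε a (r • z) = r • rightCross c ε a z := by
    intro r z; simp only [rightCross, smul_mul_assoc, map_smul, smul_sub]
  induction w using h.bar_induction with
  | add y z hy hz => simp only [hlin, map_add, hy, hz, mul_add, smul_add]; abel
  | smul r y hy =>
    simp only [hsm, map_smul, hy, mul_smul_comm, smul_add]
    rw [smul_comm r]
  | one =>
    have : (signOp (barComp c ε) ^ (i + 1) : Module.End k (Bar ε)) 1 = 1 := by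
      rw [pow_apply_of_eq_smul (r := 1) (by rw [barSign_one, one_smul])]; simp
    rw [this]
    simp [rightCross_one, cycLast_one]
  | snoc e w j b hw hb hb0 ih =>
    have e1 : signOp (barComp c ε) w = (-1 : k) ^ e • w := signOp_of_mem hw
    have e2 : signOp (barComp c ε) (w * barLetter ε b) =
        (-1 : k) ^ (e + (j + 1)) • (w * barLetter ε b) :=
      signOp_of_mem (mul_mem_homog hw (h.barLetter_mem hb))
    rw [h.rightCross_mul_letter h0 hb0, pow_apply_of_eq_smul e2, map_smul (cycLast _ _ _ _ _),
      h.cycLast_mul_letter hb hb0 _ e1, h.leftCross_letter_mul hb0 h0, e1, signOp_of_mem hb]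
    simp only [smul_mul_assoc, mul_smul_comm, map_smul, map_neg, mul_neg,
      h.cycSum_mul_letter (h.mul_mem hb ha) hx e1, LinearMap.smul_apply, LinearMap.neg_apply]
    rcases neg_one_pow_eq_or k e with he | he <;> rcases neg_one_pow_eq_or k n with hn | hn <;>
      rcases neg_one_pow_eq_or k i with hi | hi <;> rcases neg_one_pow_eq_or k j with hj | hj <;>
      simp only [pow_add, pow_mul, he, hn, hi, hj, one_pow, pow_one, mul_neg, mul_one, neg_neg] <;>
      module

/-- The difference between `∂` applied to a sum of rotations and the rotations of the boundary,
without the products of the last letter of `w` with letters of `x`, where `r = (-1) ^ |x|`. -/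
def cycDefect (c : E →ₗ[k] ℕ →₀ E) (d : E →ₗ[k] E) (ε : E →ₐ[k] k) (σ : E →ₐ[k] E) (r : k)
    (x : Bar ε) : Bar ε →ₗ[k] Bar ε :=
  barD c d ε ∘ₗ cycSum c ε σ x - cycSum c ε σ (barD c d ε x) - r • cycSum c ε σ x ∘ₗ barD c d ε -
    cycLast c ε σ r x

theorem cycDefect_apply (r : k) (x w : Bar ε) : cycDefect c d ε σ r x w =
    barD c d ε (cycSum c ε σ x w) - cycSum c ε σ (barD c d ε x) w -
      r • cycSum c ε σ x (barD c d ε w) - cycLast c ε σ r x w := rfl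

theorem IsAugDGAHom.barMap_barSign {E' : Type w} [Ring E'] [Algebra k E']
    {c' : E' →ₗ[k] ℕ →₀ E'} {d' : E' →ₗ[k] E'} {ε' : E' →ₐ[k] k} {σ' : E' →ₐ[k] E'}
    {f : E →ₐ[k] E'} (hf : IsAugDGAHom c d ε σ c' d' ε' σ' f) (h : IsAugDGA c d ε σ)
    (h' : IsAugDGA c' d' ε' σ') (w : Bar ε) : barMap ε ε' f (signOp (barComp c ε) w) =
      signOp (barComp c' ε') (barMap ε ε' f w) := by
  induction w using h.bar_induction with
  | add y z hy hz => simp only [map_add, hy, hz]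
  | smul r y hy => simp only [map_smul, hy]
  | one => simp [barSign_one, barMap_one]
  | snoc e w i a hw ha h0 ih =>
    simp only [h.barSign_mul, h'.barSign_mul, barMap_mul, ih, h.barSign_letter,
      h'.barSign_letter, map_neg, barMap_letter, hf.map_signOp h]

theorem IsAugDGAHom.barMap_barD {E' : Type w} [Ring E'] [Algebra k E'] {c' : E' →ₗ[k] ℕ →₀ E'}
    {d' : E' →ₗ[k] E'} {ε' : E' →ₐ[k] k} {σ' : E' →ₐ[k] E'} {f : E →ₐ[k] E'}
    (hf : IsAugDGAHom c d ε σ c' d' ε' σ' f) (h : IsAugDGA c d ε σ) (h' : IsAugDGA c' d' ε' σ')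
    (w : Bar ε) : barMap ε ε' f (barD c d ε w) = barD c' d' ε' (barMap ε ε' f w) := by
  have hs := hf.barMap_barSign h h'
  induction w using h.bar_induction with
  | add x y hx hy => simp only [map_add, hx, hy]
  | smul r x hx => simp only [map_smul, hx]
  | one => simp [barD_one, barMap_one]
  | snoc e w i a hw ha h0 ih =>
    have hrc : barMap ε ε' f (rightCross c ε a w) =
        rightCross c' ε' (f a) (barMap ε ε' f w) := by
      clear ih hw
      have hlin : ∀ z z' : Bar ε, rightCross c ε a (z + z') =
          rightCross c ε a z + rightCross c ε a z' := by
        intro z z'; simp only [rightCross, add_mul, map_add]; abel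
      have hlin' : ∀ z z' : Bar ε', rightCross c' ε' (f a) (z + z') =
          rightCross c' ε' (f a) z + rightCross c' ε' (f a) z' := by
        intro z z'; simp only [rightCross, add_mul, map_add]; abel
      induction w using h.bar_induction with
      | add x y hx hy => simp only [map_add, hlin, hlin', hx, hy]
      | smul r x hx =>
        have e1 : rightCross c ε a (r • x) = r • rightCross c ε a x := by
          simp only [rightCross, smul_mul_assoc, map_smul, smul_sub]
        have e2 : rightCross c' ε' (f a) (r • barMap ε ε' f x) =
            r • rightCross c' ε' (f a) (barMap ε ε' f x) := by
          simp only [rightCross, smul_mul_assoc, map_smul, smul_sub]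
        rw [e1, map_smul, map_smul, e2, hx]
      | one => simp [barMap_one, rightCross_one]
      | snoc e w j b hw hb hb0 _ =>
        rw [h.rightCross_mul_letter h0 hb0, barMap_mul, barMap_letter,
          h'.rightCross_mul_letter (by rw [hf.aug_map, h0]) (by rw [hf.aug_map, hb0]), map_neg,
          barMap_mul, barMap_letter, hs, map_mul, hf.map_signOp h]
    rw [h.barD_mul_letter, barMap_mul, barMap_letter, h'.barD_mul_letter, map_add, map_sub, ← ih,
      ← hs, ← hrc, ← hf.map_d, barMap_mul, barMap_mul, barMap_letter, barMap_letter]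

/-- Rotating the last letter of `w` to the front of `x` reduces `cycDefect` to a shorter word, up to
the product of the last letter of `x` with the first letter of the image of `w a` under `σ`. -/
theorem IsAugDGA.cycDefect_mul_letter (h : IsAugDGA c d ε σ) {i n e : ℕ} {a : E}
    (ha : a ∈ homog c i) (h0 : ε a = 0) {x w : Bar ε}
    (hx : signOp (barComp c ε) x = (-1 : k) ^ n • x)
    (hw : signOp (barComp c ε) w = (-1 : k) ^ e • w) :
    cycDefect c d ε σ ((-1) ^ n) x (w * barLetter ε a) =
      (barD c d ε (x * barMap ε ε σ (w * barLetter ε a)) -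
        barD c d ε x * barMap ε ε σ (w * barLetter ε a) -
        (-1 : k) ^ n • (x * barD c d ε (barMap ε ε σ (w * barLetter ε a)))) +
      (-1 : k) ^ ((n + e) * (i + 1)) •
        cycDefect c d ε σ ((-1) ^ (i + 1 + n)) (barLetter ε a * x) w := by
  have e1 : signOp (barComp c ε) (barD c d ε x) = (-1 : k) ^ (n + 1) • barD c d ε x := by
    rw [h.barSign_barD, hx, map_smul, pow_succ]; simp
  have e2 : signOp (barComp c ε) (barD c d ε w) = (-1 : k) ^ (e + 1) • barD c d ε w := by
    rw [h.barSign_barD, hw, map_smul, pow_succ]; simp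
  rw [cycDefect_apply, cycDefect_apply, h.barD_mul_letter w a, hw, ← h.hom_self.barMap_barD h h,
    h.barD_mul_letter w a, hw, h.barD_letter_mul, signOp_of_mem ha, map_add, map_add, map_sub,
    map_sub, h.cycSum_rightCross ha h0 hx, h.cycSum_mul_letter ha hx hw,
    h.cycSum_mul_letter ha e1 hw, h.cycSum_mul_letter ha hx e2, smul_mul_assoc, map_smul,
    h.cycSum_mul_letter_d ha hx hw, h.cycLast_mul_letter ha h0 _ hw, pow_apply_of_eq_smul hw]
  simp only [map_add, map_sub, map_neg, map_smul, smul_mul_assoc, LinearMap.add_apply,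
    LinearMap.sub_apply, LinearMap.neg_apply, LinearMap.smul_apply, mul_add, mul_sub,
    mul_smul_comm]
  rcases neg_one_pow_eq_or k e with he | he <;> rcases neg_one_pow_eq_or k n with hn | hn <;>
    rcases neg_one_pow_eq_or k i with hi | hi <;>
    simp only [pow_add, pow_mul, he, hn, hi, one_pow, pow_one, mul_neg, mul_one, neg_neg] <;>
    module

/-- The sum of the terms of `∂ (cycSum x w)` in which letters of `x` are multiplied with letters on
their right. -/
theorem IsAugDGA.cycDefect_letter_mul (h : IsAugDGA c d ε σ) {j : ℕ} {b : E}
    (hb : b ∈ homog c j) (hb0 : ε b = 0) {e : E} (he : ε e = 0) {n : ℕ} {x : Bar ε}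
    (hx : signOp (barComp c ε) (x * barLetter ε e) = (-1 : k) ^ n • (x * barLetter ε e))
    (w : Bar ε) :
    cycDefect c d ε σ ((-1) ^ n) (x * barLetter ε e) (barLetter ε b * w) =
      cycSum c ε σ (rightCross c ε (σ b) (x * barLetter ε e)) w := by
  have hb1 : ε (σ b) = 0 := by rw [h.aug_σ, hb0]
  have hY : ∀ (m : ℕ) (y t : Bar ε),
      signOp (barComp c ε) y = (-1 : k) ^ m • y →
      barD c d ε (y * barMap ε ε σ (barLetter ε b * t)) -
        barD c d ε y * barMap ε ε σ (barLetter ε b * t) -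
        (-1 : k) ^ m • (y * barD c d ε (barMap ε ε σ (barLetter ε b * t))) =
      rightCross c ε (σ b) y * barMap ε ε σ t := by
    intro m y t hy
    rw [barMap_mul, barMap_letter, barD, LinearMap.sub_apply, LinearMap.sub_apply,
      LinearMap.sub_apply, h.barMid_mul hb1, barInt_mul h, hy]
    simp only [sub_mul, mul_sub, smul_mul_assoc, smul_sub]
    abel
  induction w using h.bar_induction generalizing n x with
  | add y z hy hz => simp only [mul_add, map_add, hy hx, hz hx]
  | smul r y hy => simp only [mul_smul_comm, map_smul, hy hx]
  | one =>
    have := h.cycDefect_mul_letter hb hb0 (e := 0) hx (w := 1) (by rw [barSign_one]; simp)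
    rw [one_mul] at this
    rw [mul_one, this]
    have h2 := hY n _ 1 hx
    rw [mul_one] at h2
    rw [h2, barMap_one, mul_one, cycSum_one, cycDefect_apply, cycSum_one, cycSum_one, barD_one,
      cycLast_one]
    simp
  | snoc f w i a hw ha h0 ih =>
    have e1 : signOp (barComp c ε) (barLetter ε b * w) =
        (-1 : k) ^ (j + 1 + f) • (barLetter ε b * w) :=
      signOp_of_mem (mul_mem_homog (h.barLetter_mem hb) hw)
    have e2 : signOp (barComp c ε) (barLetter ε a * x * barLetter ε e) =
        (-1 : k) ^ (i + 1 + n) • (barLetter ε a * x * barLetter ε e) := by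
      rw [mul_assoc, h.barSign_mul, hx, h.barSign_letter, signOp_of_mem ha]
      simp [pow_add, smul_smul, mul_comm]
    have e3 : signOp (barComp c ε) (rightCross c ε (σ b) (x * barLetter ε e)) =
        (-1 : k) ^ (j + n) • rightCross c ε (σ b) (x * barLetter ε e) := by
      rw [h.rightCross_barSign hb1 he (by rw [h.aug_signOp, hb1]) (by rw [h.aug_signOp, he]), hx,
        signOp_of_mem (h.σ_mem hb)]
      simp only [rightCross, map_smul, smul_mul_assoc, mul_smul_comm]
      module
    rw [← mul_assoc, h.cycDefect_mul_letter ha h0 hx e1, mul_assoc (barLetter ε b), hY n _ _ hx,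
      ← mul_assoc (barLetter ε a), ih e2, h.cycSum_mul_letter ha e3 (signOp_of_mem hw),
      mul_assoc (barLetter ε a), h.rightCross_mul hb1 he, h.barSign_letter, signOp_of_mem ha]
    congr 1
    simp only [map_neg, map_smul, neg_mul, smul_mul_assoc, LinearMap.neg_apply,
      LinearMap.smul_apply]
    rcases neg_one_pow_eq_or k f with he | he <;> rcases neg_one_pow_eq_or k n with hn | hn <;>
      rcases neg_one_pow_eq_or k i with hi | hi <;> rcases neg_one_pow_eq_or k j with hj | hj <;>
      simp only [pow_add, pow_mul, he, hn, hi, hj, one_pow, pow_one, mul_neg, mul_one, neg_neg] <;>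
      module

theorem cycDefect_one (r : k) (x : Bar ε) : cycDefect c d ε σ r x 1 = 0 := by
  rw [cycDefect_apply, cycSum_one, cycSum_one, barD_one, cycLast_one]
  simp

theorem IsAugDGA.bLast_tmul_mul_letter (h : IsAugDGA c d ε σ) {i : ℕ} {a : E}
    (ha : a ∈ homog c i) (h0 : ε a = 0) (x : E) (w : Bar ε) :
    bLast c ε (x ⊗ₜ[k] (w * barLetter ε a)) =
      leftMul ε a ((chSign c ε ^ (i + 1)) (x ⊗ₜ[k] w)) := by
  have := h.bLast_letterMul ha (x ⊗ₜ[k] w)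
  rwa [h0, zero_smul, sub_zero] at this

theorem IsAugDGA.signOp_one (h : IsAugDGA c d ε σ) : signOp c 1 = 1 := by
  rw [signOp_of_mem h.one_mem]; simp

/-- The part of the boundary of `1 ⊗ w` that is not of the form `1 ⊗ t`, for `w` a sum of
rotations. -/
theorem IsAugDGA.bFirst_sub_bLast_cycSum (h : IsAugDGA c d ε σ) {i : ℕ} {a : E}
    (ha : a ∈ homog c i) (h0 : ε a = 0) (w : Bar ε) :
    bFirst c ε σ (1 ⊗ₜ[k] cycSum c ε σ (barLetter ε a) w) -
      bLast c ε (1 ⊗ₜ[k] cycSum c ε σ (barLetter ε a) w) =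
    σ a ⊗ₜ[k] barMap ε ε σ w - a ⊗ₜ[k] w := by
  have hl : ∀ (j : ℕ) (b : E) (n : ℕ) (t : Bar ε), b ∈ homog c j → ε b = 0 →
      signOp (barComp c ε) t = (-1 : k) ^ n • t →
      bLast c ε (1 ⊗ₜ[k] (t * barLetter ε b)) = (-1 : k) ^ (n * (j + 1)) • b ⊗ₜ[k] t := by
    intro j b n t hb hb0 ht
    have : chSign c ε ((1 : E) ⊗ₜ[k] t) = (-1 : k) ^ n • ((1 : E) ⊗ₜ[k] t) := by
      rw [chSign_tmul, ht, h.signOp_one, tmul_smul]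
    rw [h.bLast_tmul_mul_letter hb hb0, pow_apply_of_eq_smul this, map_smul, leftMul_tmul,
      mul_one, pow_mul]
  -- The last entry of each rotation cancels against the first entry of the next one, so that only
  -- the two extreme terms remain.
  have key : ∀ (w : Bar ε) (n : ℕ) (x : Bar ε),
      signOp (barComp c ε) x = (-1 : k) ^ n • x →
      bFirst c ε σ (1 ⊗ₜ[k] cycSum c ε σ x w) - bLast c ε (1 ⊗ₜ[k] cycSum c ε σ x w) =
      bFirst c ε σ (1 ⊗ₜ[k] (x * barMap ε ε σ w)) -
        bLast c ε (1 ⊗ₜ[k] ((signOp (barComp c ε) ^ n : Module.End k (Bar ε)) w * x)) := by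
    intro w
    induction w using h.bar_induction with
    | add y z hy hz =>
      intro n x hx
      have e1 := hy n x hx
      have e2 := hz n x hx
      simp only [map_add, tmul_add, mul_add, add_mul]
      rw [add_sub_add_comm, e1, e2, add_sub_add_comm]
    | smul r y hy =>
      intro n x hx
      have e1 := hy n x hx
      simp only [map_smul, tmul_smul, mul_smul_comm, smul_mul_assoc, ← smul_sub, e1]
    | one =>
      intro n x hx
      have : (signOp (barComp c ε) ^ n : Module.End k (Bar ε)) 1 = 1 := by
        rw [pow_apply_of_eq_smul (r := 1) (by rw [barSign_one, one_smul])]; simp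
      rw [cycSum_one, this, barMap_one, mul_one, one_mul]
    | snoc e w j b hw hb hb0 ih =>
      intro n x hx
      have hw' : signOp (barComp c ε) w = (-1 : k) ^ e • w := signOp_of_mem hw
      have hbw : signOp (barComp c ε) (w * barLetter ε b) =
          (-1 : k) ^ (e + (j + 1)) • (w * barLetter ε b) :=
        signOp_of_mem (mul_mem_homog hw (h.barLetter_mem hb))
      have hbx : signOp (barComp c ε) (barLetter ε b * x) =
          (-1 : k) ^ (j + 1 + n) • (barLetter ε b * x) := by
        rw [h.barSign_mul, hx, signOp_of_mem (h.barLetter_mem hb), smul_mul_smul_comm, ← pow_add]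
      have hxw : signOp (barComp c ε) (x * barMap ε ε σ w) =
          (-1 : k) ^ (n + e) • (x * barMap ε ε σ w) := by
        rw [h.barSign_mul, hx, ← h.barMap_barSign, hw', map_smul, smul_mul_smul_comm, ← pow_add]
      have e1 := ih _ _ hbx
      rw [pow_apply_of_eq_smul hw', mul_assoc (barLetter ε b), bFirst_tmul_letter, h.signOp_one,
        one_mul, hb0, zero_smul,
        sub_zero] at e1
      rw [h.cycSum_mul_letter hb hx hw', tmul_add, tmul_smul, map_add,
        map_add, map_smul, map_smul, add_sub_add_comm, ← smul_sub, e1, pow_apply_of_eq_smul hbw,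
        barMap_mul, barMap_letter, ← mul_assoc,
        hl j (σ b) _ _ (h.σ_mem hb) (by rw [h.aug_σ, hb0]) hxw]
      simp only [smul_mul_assoc, mul_assoc, tmul_smul, map_smul]
      rcases neg_one_pow_eq_or k e with he | he <;> rcases neg_one_pow_eq_or k n with hn | hn <;>
        rcases neg_one_pow_eq_or k j with hj | hj <;>
        simp only [pow_add, pow_mul, he, hn, hj, one_pow, pow_one, mul_neg, mul_one, neg_neg] <;>
        module
  have ha' : signOp (barComp c ε) (barLetter ε a) = (-1 : k) ^ (i + 1) • barLetter ε a :=
    signOp_of_mem (h.barLetter_mem ha)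
  rw [key w _ _ ha', bFirst_tmul_letter, h.signOp_one, one_mul, h0, zero_smul, sub_zero]
  congr 1
  induction w using h.grading_bar.induction with
  | add y z hy hz => simp only [map_add, add_mul, tmul_add, hy, hz]
  | hom n y hy =>
    have hy' := signOp_of_mem hy
    rw [pow_apply_of_eq_smul hy', smul_mul_assoc, tmul_smul, map_smul,
      hl i a n y ha h0 hy', smul_smul, ← pow_mul, ← mul_pow]
    simp

theorem IsAugDGA.cycSum_bFirst (h : IsAugDGA c d ε σ) {i : ℕ} {a : E}
    (ha : a ∈ homog c i) (h0 : ε a = 0) (w : Bar ε) :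
    connesB c ε σ (bFirst c ε σ (a ⊗ₜ[k] w)) =
      -(1 ⊗ₜ[k] cycDefect c d ε σ ((-1) ^ (i + 1)) (barLetter ε a) w) := by
  induction w using h.bar_cons_cases with
  | add y z hy hz => simp only [tmul_add, map_add, hy, hz]; abel
  | smul r y hy => simp only [tmul_smul, map_smul, hy, smul_neg]
  | one => simp [bFirst_tmul_one, cycDefect_one]
  | cons j b w hb hb0 =>
    have e1 := h.cycDefect_letter_mul hb hb0 h0 (n := i + 1) (x := 1)
      (by rw [one_mul]; exact signOp_of_mem (h.barLetter_mem ha)) w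
    have e2 := h.rightCross_mul_letter (c := c) (show ε (σ b) = 0 by rw [h.aug_σ, hb0]) h0 1
    rw [one_mul] at e1 e2
    rw [e1, e2, barSign_one, one_mul, bFirst_tmul_letter, hb0, zero_smul, sub_zero, connesB_tmul]
    simp [tmul_neg]

theorem IsAugDGA.cycSum_bLast (h : IsAugDGA c d ε σ) {i : ℕ} {a : E}
    (ha : a ∈ homog c i) (h0 : ε a = 0) (w : Bar ε) :
    connesB c ε σ (bLast c ε (a ⊗ₜ[k] w)) =
      1 ⊗ₜ[k] cycLast c ε σ ((-1) ^ (i + 1)) (barLetter ε a) w := by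
  induction w using h.bar_induction with
  | add y z hy hz => simp only [tmul_add, map_add, hy, hz]
  | smul r y hy => simp only [tmul_smul, map_smul, hy]
  | one => simp [bLast_tmul_one, cycLast_one]
  | snoc e w j b hw hb hb0 _ =>
    have e1 := h.leftCross_letter_mul (c := c) hb0 h0 1
    rw [mul_one, mul_one] at e1
    have e2 : chSign c ε (a ⊗ₜ[k] w) = (-1 : k) ^ (i + e) • (a ⊗ₜ[k] w) :=
      chSign_of_mem h (tmul_mem ha hw)
    rw [h.bLast_tmul_mul_letter hb hb0, h.cycLast_mul_letter hb hb0 _ (signOp_of_mem hw), e1,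
      pow_apply_of_eq_smul e2, map_smul, leftMul_tmul, map_smul, connesB_tmul, signOp_of_mem hb]
    simp only [smul_mul_assoc, map_smul, map_neg, LinearMap.neg_apply, LinearMap.smul_apply,
      tmul_smul, tmul_neg]
    rcases neg_one_pow_eq_or k e with he | he <;> rcases neg_one_pow_eq_or k i with hn | hn <;>
      rcases neg_one_pow_eq_or k j with hj | hj <;>
      simp only [pow_add, he, hn, hj, one_pow, pow_one, mul_neg, mul_one, neg_neg] <;>
      module

/-- The relation `b B + B b = σ - 1`. -/
theorem IsAugDGA.hochB_connesB (h : IsAugDGA c d ε σ) (ω : CH ε) :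
    hochB c d ε σ (connesB c ε σ ω) + connesB c ε σ (hochB c d ε σ ω) =
      chMap ε ε σ ω - ω := by
  -- The cases `a₀ = 1` and `ε(a₀) = 0` are different: `B` vanishes on the chains of the first kind.
  have one : ∀ w : Bar ε, hochB c d ε σ (connesB c ε σ (1 ⊗ₜ[k] w)) +
      connesB c ε σ (hochB c d ε σ (1 ⊗ₜ[k] w)) =
      chMap ε ε σ (1 ⊗ₜ[k] w) - 1 ⊗ₜ[k] w := by
    intro w
    have h1 : connesB c ε σ (bFirst c ε σ (1 ⊗ₜ[k] w)) =
        1 ⊗ₜ[k] (cycSum c ε σ 1 w - w) := by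
      induction w using h.bar_cons_cases with
      | add y z hy hz => simp only [tmul_add, map_add, hy, hz, tmul_sub]; abel
      | smul r y hy => simp only [tmul_smul, map_smul, hy, ← smul_sub]
      | one => simp [bFirst_tmul_one, cycSum_one]
      | cons j b w hb hb0 =>
        rw [bFirst_tmul_letter, hb0, zero_smul, sub_zero, h.signOp_one, one_mul, connesB_tmul,
          h.cycSum_one_letter_mul, add_sub_cancel_left]
    have h2 : connesB c ε σ (bLast c ε (1 ⊗ₜ[k] w)) =
        1 ⊗ₜ[k] (cycSum c ε σ 1 w - barMap ε ε σ w) := by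
      clear h1
      induction w using h.bar_induction with
      | add y z hy hz => simp only [tmul_add, map_add, hy, hz, tmul_sub]; abel
      | smul r y hy => simp only [tmul_smul, map_smul, hy, ← smul_sub]
      | one => simp [bLast_tmul_one, cycSum_one, barMap_one]
      | snoc e w j b hw hb hb0 _ =>
        have e1 : signOp (barComp c ε) 1 = (1 : k) • 1 := by rw [barSign_one, one_smul]
        have e2 : chSign c ε ((1 : E) ⊗ₜ[k] w) = (-1 : k) ^ (0 + e) • ((1 : E) ⊗ₜ[k] w) :=
          chSign_of_mem h (tmul_mem h.one_mem hw)
        rw [h.bLast_tmul_mul_letter hb hb0, pow_apply_of_eq_smul e2, map_smul, leftMul_tmul,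
          map_smul, connesB_tmul, h.cycSum_mul_letter hb e1 (signOp_of_mem hw)]
        simp
    rw [connesB_one_tmul, hochB_tmul, map_sub, map_add, map_add, h1, h2, h.d_one, h.signOp_one,
      connesB_one_tmul, chMap_tmul]
    simp only [map_zero, zero_tmul, tmul_sub, map_one]
    abel
  have zero : ∀ (i : ℕ) (a : E) (w : Bar ε), a ∈ homog c i → ε a = 0 →
      hochB c d ε σ (connesB c ε σ (a ⊗ₜ[k] w)) +
      connesB c ε σ (hochB c d ε σ (a ⊗ₜ[k] w)) =
      chMap ε ε σ (a ⊗ₜ[k] w) - a ⊗ₜ[k] w := by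
    intro i a w ha h0
    have hd := h.barD_letter_mul a 1
    rw [mul_one, mul_one, barD_one, leftCross_one, mul_zero, sub_zero, add_zero] at hd
    rw [hochB_tmul a w, map_sub, map_add, map_add, h.cycSum_bFirst ha h0, h.cycSum_bLast ha h0,
      connesB_tmul, hochB_tmul, add_sub_assoc, h.bFirst_sub_bLast_cycSum ha h0, h.d_one,
      h.signOp_one, connesB_tmul, connesB_tmul, cycDefect_apply, hd, signOp_of_mem ha, chMap_tmul]
    simp only [map_neg, map_smul, LinearMap.neg_apply, LinearMap.smul_apply,
      tmul_sub, tmul_neg, tmul_smul,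
      zero_tmul, pow_succ]
    module
  induction ω using TensorProduct.induction_on with
  | zero => simp
  | add x y hx hy =>
    simp only [map_add]
    rw [add_add_add_comm, hx, hy]
    abel
  | tmul a w =>
    induction a using h.grading.induction with
    | add x y hx hy =>
      simp only [add_tmul, map_add]
      rw [add_add_add_comm, hx, hy]
      abel
    | hom i a ha =>
      have h1 := one w
      have h2 := zero i (augIncl ε (toAug ε a)) w (h.augIncl_mem (h.toAug_mem ha))
        (aug_augIncl _ _)
      have h3 : a = augIncl ε (toAug ε a) + ε a • 1 := by rw [augIncl_toAug]; abel
      rw [h3]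
      simp only [add_tmul, map_add, ← smul_tmul', map_smul] at h1 h2 ⊢
      rw [add_add_add_comm, h2, ← smul_add, h1, smul_sub]
      abel

/-! ### The mixed complex of an augmented differential graded algebra -/

theorem IsAugDGAHom.chMap_connesB {E' : Type w} [Ring E'] [Algebra k E'] {c' : E' →ₗ[k] ℕ →₀ E'}
    {d' : E' →ₗ[k] E'} {ε' : E' →ₐ[k] k} {σ' : E' →ₐ[k] E'} {f : E →ₐ[k] E'}
    (hf : IsAugDGAHom c d ε σ c' d' ε' σ' f) (h : IsAugDGA c d ε σ) (h' : IsAugDGA c' d' ε' σ')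
    (ω : CH ε) : chMap ε ε' f (connesB c ε σ ω) = connesB c' ε' σ' (chMap ε ε' f ω) := by
  have hs := hf.barMap_barSign h h'
  have hσ : ∀ w : Bar ε, barMap ε ε' f (barMap ε ε σ w) = barMap ε' ε' σ' (barMap ε ε' f w) := by
    intro w
    induction w using h.bar_induction with
    | add y z hy hz => simp only [map_add, hy, hz]
    | smul r y hy => simp only [map_smul, hy]
    | one => simp [barMap_one]
    | snoc e w i a hw ha h0 ih => simp only [barMap_mul, ih, barMap_letter, hf.map_σ]
  have key : ∀ (w : Bar ε) (n : ℕ) (x : Bar ε), x ∈ homog (barComp c ε) n →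
      barMap ε ε' f (cycSum c ε σ x w) =
        cycSum c' ε' σ' (barMap ε ε' f x) (barMap ε ε' f w) := by
    intro w
    induction w using h.bar_induction with
    | add y z hy hz => intro n x hx; simp only [map_add, hy n x hx, hz n x hx]
    | smul r y hy => intro n x hx; simp only [map_smul, hy n x hx]
    | one => intro n x hx; rw [cycSum_one, barMap_one, cycSum_one]
    | snoc e w i a hw ha h0 ih =>
      intro n x hx
      have e1 : signOp (barComp c' ε') (barMap ε ε' f x) = (-1 : k) ^ n • barMap ε ε' f x := by
        rw [← hs, signOp_of_mem hx, map_smul]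
      have e2 : signOp (barComp c' ε') (barMap ε ε' f w) = (-1 : k) ^ e • barMap ε ε' f w := by
        rw [← hs, signOp_of_mem hw, map_smul]
      rw [h.cycSum_mul_letter ha (signOp_of_mem hx) (signOp_of_mem hw), map_add, map_smul,
        ih _ _ (mul_mem_homog (h.barLetter_mem ha) hx),
        show barMap ε ε' f (w * barLetter ε a) = barMap ε ε' f w * barLetter ε' (f a) by
          rw [barMap_mul, barMap_letter], h'.cycSum_mul_letter (hf.map_mem ha) e1 e2]
      simp only [barMap_mul, barMap_letter, hf.map_σ, hσ]
  induction ω using TensorProduct.induction_on with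
  | zero => simp
  | add x y hx hy => simp only [map_add, hx, hy]
  | tmul a w =>
    induction a using h.grading.induction with
    | add x y hx hy => simp only [add_tmul, map_add, hx, hy]
    | hom i a ha =>
      rw [connesB_tmul, chMap_tmul, chMap_tmul, connesB_tmul, key _ _ _ (h.barLetter_mem ha),
        barMap_letter, map_one]

theorem IsAugDGA.connesB_mem (h : IsAugDGA c d ε σ) {n : ℕ} {ω : CH ε}
    (hω : ω ∈ homog (chComp c ε) n) : connesB c ε σ ω ∈ homog (chComp c ε) (n + 1) := by
  have hm : ∀ l : List (ℕ × AugIdeal ε),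
      (∀ p ∈ l, c (augIncl ε p.2) = Finsupp.single p.1 (augIncl ε p.2)) →
      (l.map fun p => ι k p.2).prod ∈ homog (barComp c ε) (l.map fun p => p.1 + 1).sum := by
    intro l hl
    have := prod_ι_mem_homog (c := regrade (· + 1) (augComp c ε))
      (l.map fun p => (p.1 + 1, p.2)) (by
        intro p hp
        obtain ⟨q, hq, rfl⟩ := List.mem_map.1 hp
        have h1 : toAug ε (augIncl ε q.2) ∈ homog (augComp c ε) q.1 := h.toAug_mem (hl q hq)
        rw [toAug_augIncl] at h1
        exact regrade_mem _ h1)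
    rw [List.map_map, List.map_map] at this
    exact this
  have key : ∀ (l : List (ℕ × AugIdeal ε)),
      (∀ p ∈ l, c (augIncl ε p.2) = Finsupp.single p.1 (augIncl ε p.2)) →
      ∀ (m : ℕ) (x : Bar ε), x ∈ homog (barComp c ε) m →
      cycSum c ε σ x (l.map fun p => ι k p.2).prod ∈
        homog (barComp c ε) (m + (l.map fun p => p.1 + 1).sum) := by
    intro l
    induction l using List.reverseRecOn with
    | nil => intro _ m x hx; simpa [cycSum_one] using hx
    | append_singleton l p ih =>
      intro hl m x hx
      have hp : augIncl ε p.2 ∈ homog c p.1 := hl p (by simp)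
      have hl' : ∀ q ∈ l, c (augIncl ε q.2) = Finsupp.single q.1 (augIncl ε q.2) :=
        fun q hq => hl q (by simp [hq])
      have hw := hm l hl'
      have hσw : ∀ l : List (ℕ × AugIdeal ε),
          (∀ p ∈ l, c (augIncl ε p.2) = Finsupp.single p.1 (augIncl ε p.2)) →
          barMap ε ε σ (l.map fun p => ι k p.2).prod ∈
            homog (barComp c ε) (l.map fun p => p.1 + 1).sum := by
        intro l hl
        induction l with
        | nil =>
          simp only [List.map_nil, List.prod_nil, List.sum_nil, barMap_one]
          exact one_mem_homog _
        | cons q l ih =>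
          simp only [List.map_cons, List.prod_cons, List.sum_cons]
          rw [barMap_mul, barMap_ι]
          exact mul_mem_homog (h.barLetter_mem (h.σ_mem (hl q (by simp))))
            (ih fun p hp => hl p (by simp [hp]))
      rw [List.map_append, List.map_append, List.prod_append, List.sum_append]
      simp only [List.map_cons, List.map_nil, List.prod_cons, List.prod_nil, mul_one,
        List.sum_cons, List.sum_nil, add_zero]
      rw [← barLetter_augIncl, h.cycSum_mul_letter hp (signOp_of_mem hx) (signOp_of_mem hw),
        barMap_mul, barMap_letter]
      refine add_mem ?_ (smul_mem _ _ ?_)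
      · exact mul_mem_homog hx (mul_mem_homog (hσw l hl') (h.barLetter_mem (h.σ_mem hp)))
      · have := ih hl' _ _ (mul_mem_homog (h.barLetter_mem hp) hx)
        rwa [show p.1 + 1 + m + (l.map fun p => p.1 + 1).sum =
          m + ((l.map fun p => p.1 + 1).sum + (p.1 + 1)) by omega] at this
  rw [← h.chDeg_eq] at hω
  induction hω using span_induction with
  | mem x hx =>
    obtain ⟨i, a, l, ha, hl, rfl, rfl⟩ := hx
    have h1 := key l hl _ _ (h.barLetter_mem ha)
    rw [connesB_tmul]
    have h2 : 1 ⊗ₜ[k] cycSum c ε σ (barLetter ε a) (l.map fun p => ι k p.2).prod ∈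
        homog (chComp c ε) (0 + (i + 1 + (l.map fun p => p.1 + 1).sum)) := tmul_mem h.one_mem h1
    rwa [zero_add, add_right_comm] at h2
  | zero => simp
  | add x y _ _ hx hy => rw [map_add]; exact add_mem hx hy
  | smul r x _ hx => rw [map_smul]; exact smul_mem _ r hx

theorem IsAugDGAHom.chMap_mem {E' : Type w} [Ring E'] [Algebra k E'] {c' : E' →ₗ[k] ℕ →₀ E'}
    {d' : E' →ₗ[k] E'} {ε' : E' →ₐ[k] k} {σ' : E' →ₐ[k] E'} {f : E →ₐ[k] E'}
    (hf : IsAugDGAHom c d ε σ c' d' ε' σ' f) (h : IsAugDGA c d ε σ) (h' : IsAugDGA c' d' ε' σ')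
    {n : ℕ} {ω : CH ε} (hω : ω ∈ homog (chComp c ε) n) :
    chMap ε ε' f ω ∈ homog (chComp c' ε') n := by
  refine h.ch_degree_induction (fun _ : Unit => chMap ε ε' f)
    (fun _ n => homog (chComp c' ε') n) (fun j x hx _ => ?_) ?_ hω ()
  · rw [chMap_tmul, barMap_one]; exact tmul_one_mem (hf.map_mem hx)
  · intro e ω j x hω hx _ ih _
    rw [chMap_letterMul]
    exact h'.letterMul_mem (hf.map_mem hx) (ih ())

/-- The fixed points of the total action of a diagonalizable automorphism form a mixed complex. -/
theorem IsAugDGA.isMixedComplex (h : IsAugDGA c d ε σ)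
    (hE : ⨆ μ, eigenspace σ.toLinearMap μ = ⊤) :
    IsMixedComplex (chDeg c ε) (chOne ε σ) (hochB c d ε σ) (connesB c ε σ) := by
  have h1 : chDeg c ε = homog (chComp c ε) := funext h.chDeg_eq
  have mem : ∀ x, x ∈ chOne ε σ ↔ chMap ε ε σ x = x := by
    intro x
    rw [chOne_eq h.aug_σ hE, mem_eigenspace_iff, one_smul]
  rw [h1]
  refine ⟨?_, ?_, ?_, ?_, ?_, ?_, ?_, ?_, ?_⟩
  · rw [chOne_eq h.aug_σ hE]
    exact fixed_graded h.grading_ch fun n x hx => h.hom_self.chMap_mem h h hx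
  · intro x hx
    rw [mem] at hx ⊢
    rw [h.hom_self.chMap_hochB h h, hx]
  · intro x hx
    rw [mem] at hx ⊢
    rw [h.hom_self.chMap_connesB h h, hx]
  · rintro x ⟨_, hx⟩
    exact (mem_bot k).1 (h.hochB_mem hx)
  · rintro n x ⟨_, hx⟩
    exact h.hochB_mem hx
  · rintro n x ⟨_, hx⟩
    exact h.connesB_mem hx
  · exact fun x _ => h.hochB_hochB x
  · exact fun x _ => connesB_connesB x
  · intro x hx
    rw [h.hochB_connesB, (mem x).1 hx, sub_self]

end Connes

/-! ### Diagonalizable operators -/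

section Diagonalizable

variable {k : Type u} [Field k] {X : Type v} [AddCommGroup X] [Module k X]
  {Y : Type w} [AddCommGroup Y] [Module k Y]

/-- The eigenvector components of an element of an invariant subspace lie in this subspace. -/
theorem eigen_components_mem {T : Module.End k X} {p : Submodule k X} (hp : ∀ x ∈ p, T x ∈ p)
    (s : Finset k) (y : k → X) (hy : ∀ μ ∈ s, T (y μ) = μ • y μ) (hs : ∑ μ ∈ s, y μ ∈ p) :
    ∀ μ ∈ s, y μ ∈ p := by
  classical
  induction s using Finset.induction_on generalizing y with
  | empty => simp
  | insert ν s hν ih =>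
    have h1 : ∑ μ ∈ s, (μ - ν) • y μ ∈ p := by
      have h2 := sub_mem (hp _ hs) (smul_mem _ ν hs)
      rw [Finset.sum_insert hν, map_add, map_sum, hy ν (by simp), smul_add, Finset.smul_sum,
        add_sub_add_left_eq_sub, ← Finset.sum_sub_distrib] at h2
      rwa [Finset.sum_congr rfl fun μ hμ => by
        rw [sub_smul, ← hy μ (Finset.mem_insert_of_mem hμ)]]
    have h2 := ih (fun μ => (μ - ν) • y μ) (fun μ hμ => by
      rw [map_smul, hy μ (Finset.mem_insert_of_mem hμ), smul_comm]) h1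
    have h3 : ∀ μ ∈ s, y μ ∈ p := by
      intro μ hμ
      have hne : μ - ν ≠ 0 := sub_ne_zero.2 fun h => hν (h ▸ hμ)
      have := smul_mem p (μ - ν)⁻¹ (h2 μ hμ)
      rwa [smul_smul, inv_mul_cancel₀ hne, one_smul] at this
    intro μ hμ
    rcases Finset.mem_insert.1 hμ with rfl | hμ
    · rw [Finset.sum_insert hν] at hs
      have := sub_mem hs (Submodule.sum_mem _ h3)
      rwa [add_sub_cancel_right] at this
    · exact h3 μ hμ

/-- The restriction of a diagonalizable operator to an invariant subspace is diagonalizable. -/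
theorem iSup_eigenspace_of_injective {T : Module.End k X} {T' : Module.End k Y} {f : X →ₗ[k] Y}
    (hf : Function.Injective f) (h : ∀ x, f (T x) = T' (f x))
    (hT : ⨆ μ, T'.eigenspace μ = ⊤) : ⨆ μ, T.eigenspace μ = ⊤ := by
  classical
  rw [eq_top_iff]
  rintro x -
  have hx : f x ∈ ⨆ μ, T'.eigenspace μ := hT ▸ Submodule.mem_top
  obtain ⟨y, hy, hsum⟩ := (Submodule.mem_iSup_iff_exists_finsupp _ _).1 hx
  have h1 := eigen_components_mem (p := LinearMap.range f) (T := T')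
    (by rintro _ ⟨z, rfl⟩; exact ⟨T z, h z⟩) y.support y
    (fun μ _ => Module.End.mem_eigenspace_iff.1 (hy μ)) (by
      have h0 : ∑ μ ∈ y.support, y μ = f x := hsum
      rw [h0]; exact ⟨x, rfl⟩)
  have h2 : ∀ μ, ∃ z, f z = y μ := by
    intro μ
    by_cases hμ : μ ∈ y.support
    · exact h1 μ hμ
    · exact ⟨0, by rw [map_zero, Finsupp.notMem_support_iff.1 hμ]⟩
  choose z hz using h2
  have h3 : x = ∑ μ ∈ y.support, z μ := by
    apply hf
    rw [map_sum, Finset.sum_congr rfl fun μ _ => hz μ]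
    exact hsum.symm
  rw [h3]
  refine Submodule.sum_mem _ fun μ _ => Submodule.mem_iSup_of_mem μ ?_
  rw [mem_eigenspace_iff]
  apply hf
  rw [h, map_smul, hz]
  exact Module.End.mem_eigenspace_iff.1 (hy μ)

theorem iSup_eigenspace_tensorAlgebra {M : Type v} [AddCommGroup M] [Module k M]
    {g : Module.End k M} (hg : ⨆ μ, g.eigenspace μ = ⊤)
    (F : TensorAlgebra k M →ₐ[k] TensorAlgebra k M)
    (hF : ∀ m, F (TensorAlgebra.ι k m) = TensorAlgebra.ι k (g m)) :
    ⨆ μ, eigenspace F.toLinearMap μ = ⊤ := by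
  apply iSup_eigenspace_eq_top
  have hmul : ∀ x y : TensorAlgebra k M,
      x ∈ Submodule.span k {y | ∃ μ : k, F.toLinearMap y = μ • y} →
      y ∈ Submodule.span k {y | ∃ μ : k, F.toLinearMap y = μ • y} →
      x * y ∈ Submodule.span k {y | ∃ μ : k, F.toLinearMap y = μ • y} := by
    intro x y hx hy
    have := Submodule.mul_mem_mul hx hy
    rw [Submodule.span_mul_span] at this
    refine Submodule.span_mono ?_ this
    rintro _ ⟨a, ⟨μ, ha⟩, b, ⟨ν, hb⟩, rfl⟩
    refine ⟨μ * ν, ?_⟩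
    change F (a * b) = _
    rw [map_mul, show F a = μ • a from ha, show F b = ν • b from hb, smul_mul_smul_comm]
  intro x
  induction x using TensorAlgebra.induction with
  | algebraMap r =>
    refine subset_span ⟨1, ?_⟩
    simp
  | ι m =>
    induction span_eigen hg m using span_induction with
    | mem m hm =>
      obtain ⟨μ, hm⟩ := hm
      refine subset_span ⟨μ, ?_⟩
      simp [hF, hm]
    | zero => simp
    | add a b _ _ ha hb => rw [map_add]; exact add_mem ha hb
    | smul r a _ ha => rw [map_smul]; exact smul_mem _ r ha
  | mul a b ha hb => exact hmul a b ha hb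
  | add a b ha hb => exact add_mem ha hb

end Diagonalizable

/-! ### The Koszul dual coalgebra -/

section Deconcatenation

open TensorAlgebra

variable {k : Type u} [Field k] {M : Type v} [AddCommGroup M] [Module k M]

theorem deconc_coassoc (x : TensorAlgebra k M) :
    TensorProduct.assoc k _ _ _ (deconc.rTensor _ (deconc x)) = deconc.lTensor _ (deconc x) := by
  induction x using tensor_induction_snoc (isGrading_lsingle (k := k) (M := M)) with
  | add x y hx hy => simp only [map_add, hx, hy]
  | smul r x hx => simp only [map_smul, hx]
  | one => simp [deconc_one]
  | snoc i j x m hx hm ih =>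
    have h1 : ∀ s : TensorAlgebra k M ⊗[k] TensorAlgebra k M,
        TensorProduct.assoc k _ _ _ (deconc.rTensor (TensorAlgebra k M)
          ((mulRight k (ι k m)).lTensor _ s)) =
        ((mulRight k (ι k m)).lTensor _).lTensor _
          (TensorProduct.assoc k _ _ _ (deconc.rTensor (TensorAlgebra k M) s)) := by
      intro s
      induction s with
      | zero => simp
      | tmul a b =>
        simp only [lTensor_tmul, rTensor_tmul]
        generalize deconc a = t
        induction t with
        | zero => simp
        | tmul p q => simp
        | add p q hp hq => simp only [add_tmul, map_add, hp, hq]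
      | add p q hp hq => simp only [map_add, hp, hq]
    have h2 : ∀ s : TensorAlgebra k M ⊗[k] TensorAlgebra k M,
        deconc.lTensor (TensorAlgebra k M) ((mulRight k (ι k m)).lTensor _ s) =
        ((TensorProduct.mk k _ _).flip 1 ∘ₗ mulRight k (ι k m)).lTensor _ s +
        ((mulRight k (ι k m)).lTensor _).lTensor _ (deconc.lTensor _ s) := by
      intro s
      induction s with
      | zero => simp
      | tmul a b => simp [deconc_mul_ι, tmul_add]
      | add p q hp hq => simp only [map_add, hp, hq]; abel
    have h3 : ∀ s : TensorAlgebra k M ⊗[k] TensorAlgebra k M,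
        TensorProduct.assoc k _ _ _ (((mulRight k (ι k m)).lTensor _ s) ⊗ₜ[k]
          (1 : TensorAlgebra k M)) =
        ((TensorProduct.mk k _ _).flip 1 ∘ₗ mulRight k (ι k m)).lTensor _ s := by
      intro s
      induction s with
      | zero => simp
      | tmul a b => simp
      | add p q hp hq => simp only [map_add, add_tmul, hp, hq]
    rw [deconc_mul_ι, map_add, map_add, h1, ih, map_add, h2, rTensor_tmul, deconc_mul_ι,
      add_tmul, map_add, h3]
    simp [deconc_one]
    abel

theorem deconc_counit_left (x : TensorAlgebra k M) :
    TensorProduct.lid k _ (algebraMapInv.toLinearMap.rTensor _ (deconc x)) = x := by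
  induction x using tensor_induction_snoc (isGrading_lsingle (k := k) (M := M)) with
  | add x y hx hy => simp only [map_add, hx, hy]
  | smul r x hx => simp only [map_smul, hx]
  | one => simp [deconc_one]
  | snoc i j x m hx hm ih =>
    have h1 : ∀ s : TensorAlgebra k M ⊗[k] TensorAlgebra k M,
        TensorProduct.lid k _ (algebraMapInv.toLinearMap.rTensor _
          ((mulRight k (ι k m)).lTensor _ s)) =
        TensorProduct.lid k _ (algebraMapInv.toLinearMap.rTensor _ s) * ι k m := by
      intro s
      induction s with
      | zero => simp
      | tmul a b => simp
      | add p q hp hq => simp only [map_add, add_mul, hp, hq]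
    rw [deconc_mul_ι, map_add, map_add, h1, ih]
    simp [algebraMapInv_ι]

theorem deconc_counit_right (x : TensorAlgebra k M) :
    TensorProduct.rid k _ (algebraMapInv.toLinearMap.lTensor _ (deconc x)) = x := by
  induction x using tensor_induction_snoc (isGrading_lsingle (k := k) (M := M)) with
  | add x y hx hy => simp only [map_add, hx, hy]
  | smul r x hx => simp only [map_smul, hx]
  | one => simp [deconc_one]
  | snoc i j x m hx hm ih =>
    have h1 : ∀ s : TensorAlgebra k M ⊗[k] TensorAlgebra k M,
        (algebraMapInv.toLinearMap.lTensor (TensorAlgebra k M)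
          ((mulRight k (ι k m)).lTensor _ s)) = 0 := by
      intro s
      induction s with
      | zero => simp
      | tmul a b => simp [algebraMapInv_ι]
      | add p q hp hq => simp only [map_add, hp, hq, add_zero]
    rw [deconc_mul_ι, map_add, map_add, h1]
    simp

theorem isGrading_wordComp : IsGrading (wordComp (k := k) (V := M)) :=
  IsGrading.tensor (isGrading_of_span fun _ => subset_span ⟨1, rfl⟩)

theorem one_mem_homog_wordComp : (1 : TensorAlgebra k M) ∈ homog wordComp 0 :=
  wordComp_of_mem one_mem_wordPow

theorem deconc_mem_homog {n : ℕ} {x : TensorAlgebra k M} (hx : x ∈ wordPow k M n) :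
    deconc x ∈ homog (tmulComp wordComp wordComp) n := by
  induction hx using Submodule.pow_induction_on_left' with
  | algebraMap r =>
    rw [Algebra.algebraMap_eq_smul_one, map_smul, deconc_one]
    exact smul_mem _ r (by
      have h := tmul_mem (M := TensorAlgebra k M) (N := TensorAlgebra k M)
        (c := wordComp) (c' := wordComp) one_mem_homog_wordComp one_mem_homog_wordComp
      exact h)
  | add x z i hx hz ihx ihz => rw [map_add]; exact add_mem ihx ihz
  | mem_mul m hm i x hx ih =>
    obtain ⟨v, rfl⟩ := hm
    have h1 : ∀ s : TensorAlgebra k M ⊗[k] TensorAlgebra k M,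
        tmulComp wordComp wordComp ((mulLeft k (ι k v)).rTensor _ s) =
          Finsupp.lmapDomain _ k (· + 1) (Finsupp.mapRange.linearMap
            ((mulLeft k (ι k v)).rTensor _) (tmulComp wordComp wordComp s)) := by
      intro s
      refine LinearMap.congr_fun (f := tmulComp wordComp wordComp ∘ₗ
        (mulLeft k (ι k v)).rTensor _) (g := Finsupp.lmapDomain _ k (· + 1) ∘ₗ
          Finsupp.mapRange.linearMap ((mulLeft k (ι k v)).rTensor _) ∘ₗ
            tmulComp wordComp wordComp) ?_ s
      refine ext_tmul_homog (isGrading_wordComp (k := k) (M := M))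
        (isGrading_wordComp (k := k) (M := M)) fun i j y hy z hz => ?_
      have e1 : ι k v * y ∈ homog (wordComp (k := k) (V := M)) (1 + i) :=
        mul_mem_homog (ι_mem_homog rfl) hy
      have e2 := mem_homog.1 (tmul_mem e1 hz)
      have e3 := mem_homog.1 (tmul_mem hy hz)
      simp only [comp_apply, rTensor_tmul, mulLeft_apply, e2, e3,
        Finsupp.mapRange.linearMap_apply, Finsupp.mapRange_single, Finsupp.lmapDomain_apply,
        Finsupp.mapDomain_single]
      congr 1
      omega
    have hx' : ι k v * x ∈ homog (wordComp (k := k) (V := M)) (i + 1) :=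
      wordComp_of_mem (ι_mul_mem v hx)
    rw [deconc_ι_mul]
    refine add_mem ?_ ?_
    · have := tmul_mem (one_mem_homog_wordComp (k := k) (M := M)) hx'
      rwa [zero_add] at this
    · rw [mem_homog, h1, mem_homog.1 ih]
      simp [Finsupp.mapDomain_single]

end Deconcatenation

section Coalgebra

variable {k : Type u} [Field k] {V : Type v} [AddCommGroup V] [Module k V]
variable (R : Submodule k (V ⊗[k] V))

/-- The convolution product of linear maps out of the Koszul dual coalgebra. -/
def conv {A : Type w} [Ring A] [Algebra k A] (f g : Coalg R →ₗ[k] A) : Coalg R →ₗ[k] A :=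
  mul' k A ∘ₗ TensorProduct.map f g ∘ₗ comul R

variable {R}

theorem coalgComp_apply_coe (x : Coalg R) (n : ℕ) :
    (coalgComp R x n : TensorAlgebra k V) = wordComp (x : TensorAlgebra k V) n := rfl

theorem mem_homog_coalg {x : Coalg R} {n : ℕ} :
    x ∈ homog (coalgComp R) n ↔ (x : TensorAlgebra k V) ∈ homog wordComp n := by
  rw [mem_homog, mem_homog]
  constructor
  · intro h
    ext m
    rw [← coalgComp_apply_coe, h, single_apply, single_apply]
    split_ifs <;> rfl
  · intro h
    ext m
    rw [coalgComp_apply_coe, h, single_apply, single_apply]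
    split_ifs <;> rfl

theorem mem_coalgDeg_iff {x : Coalg R} {n : ℕ} :
    (x : TensorAlgebra k V) ∈ coalgDeg R n ↔ x ∈ homog (coalgComp R) n := by
  rw [mem_homog_coalg]
  constructor
  · intro h
    exact wordComp_of_mem h.1
  · intro h
    have := (mem_coalgSub R).1 x.2 n
    rwa [mem_homog.1 h, single_eq_same] at this

theorem grading_coalg : IsGrading (coalgComp R) where
  sum_comp x := by
    apply Subtype.ext
    have h := isGrading_wordComp.sum_comp (x : TensorAlgebra k V)
    rw [Finsupp.sum] at h ⊢
    rw [AddSubmonoidClass.coe_finsetSum]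
    conv_rhs => rw [← h]
    refine Finset.sum_congr ?_ fun _ _ => rfl
    ext n
    simp only [Finsupp.mem_support_iff, ne_eq, ← coalgComp_apply_coe, ZeroMemClass.coe_eq_zero]
  comp_mem x n := mem_homog_coalg.2 (isGrading_wordComp.comp_mem _ n)

theorem coalgOne_mem : coalgOne R ∈ homog (coalgComp R) 0 :=
  mem_homog_coalg.2 one_mem_homog_wordComp

theorem counit_coalgOne : counit R (coalgOne R) = 1 := by
  simp [counit, coalgOne]

theorem counit_smul_of_mem {x : Coalg R} (hx : x ∈ homog (coalgComp R) 0) :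
    x = counit R x • coalgOne R := by
  apply Subtype.ext
  have h := algebraMapInv_eq (x : TensorAlgebra k V)
  rw [mem_homog.1 (mem_homog_coalg.1 hx), single_eq_same, Algebra.algebraMap_eq_smul_one] at h
  exact h.symm

theorem counit_of_mem {n : ℕ} {x : Coalg R} (hx : x ∈ homog (coalgComp R) (n + 1)) :
    counit R x = 0 := by
  have h := algebraMapInv_eq (x : TensorAlgebra k V)
  rw [mem_homog.1 (mem_homog_coalg.1 hx), single_apply, if_neg (by omega)] at h
  exact (TensorAlgebra.algebraMap_eq_zero_iff (M := V) _).1 h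

theorem comul_coalgOne : comul R (coalgOne R) = coalgOne R ⊗ₜ[k] coalgOne R := by
  apply mapIncl_injective R
  rw [mapIncl_comul]
  exact deconc_one

theorem comul_mem {n : ℕ} {x : Coalg R} (hx : x ∈ homog (coalgComp R) n) :
    comul R x ∈ homog (tmulComp (coalgComp R) (coalgComp R)) n := by
  have h1 : Finsupp.mapRange.linearMap (TensorProduct.mapIncl (coalgSub R) (coalgSub R)) ∘ₗ
      tmulComp (coalgComp R) (coalgComp R) =
      tmulComp wordComp wordComp ∘ₗ TensorProduct.mapIncl (coalgSub R) (coalgSub R) := by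
    refine ext_tmul_homog (grading_coalg (R := R)) (grading_coalg (R := R)) fun i j y hy z hz => ?_
    have e1 := mem_homog.1 (tmul_mem hy hz)
    have e2 := mem_homog.1 (tmul_mem (M := TensorAlgebra k V) (N := TensorAlgebra k V)
      (c := wordComp) (c' := wordComp) (mem_homog_coalg.1 hy)
      (mem_homog_coalg.1 hz))
    simp only [comp_apply, e1, TensorProduct.mapIncl, map_tmul,
      Submodule.subtype_apply, e2, Finsupp.mapRange.linearMap_apply, Finsupp.mapRange_single]
  have h2 := LinearMap.congr_fun h1 (comul R x)
  have hx' : (x : TensorAlgebra k V) ∈ wordPow k V n := (mem_coalgDeg_iff.2 hx).1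
  rw [comp_apply, comp_apply, mapIncl_comul,
    mem_homog.1 (deconc_mem_homog hx'), ← mapIncl_comul] at h2
  rw [mem_homog]
  ext m
  apply mapIncl_injective R
  have h3 := DFunLike.congr_fun h2 m
  rw [Finsupp.mapRange.linearMap_apply, Finsupp.mapRange_apply] at h3
  rw [h3, single_apply, single_apply]
  split_ifs
  · rfl
  · rw [map_zero]

theorem comul_coassoc (x : Coalg R) :
    TensorProduct.assoc k _ _ _ ((comul R).rTensor _ (comul R x)) =
      (comul R).lTensor _ (comul R x) := by
  have hinj : Function.Injective (TensorProduct.map (coalgSub R).subtype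
      (TensorProduct.mapIncl (coalgSub R) (coalgSub R))) :=
    TensorProduct.map_injective_of_flat_flat _ _ (Submodule.subtype_injective _)
      (mapIncl_injective R)
  apply hinj
  have h1 : ∀ s : Coalg R ⊗[k] Coalg R, TensorProduct.map (coalgSub R).subtype
      (TensorProduct.mapIncl (coalgSub R) (coalgSub R))
      (TensorProduct.assoc k _ _ _ ((comul R).rTensor _ s)) =
      TensorProduct.assoc k _ _ _ (deconc.rTensor _
        (TensorProduct.mapIncl (coalgSub R) (coalgSub R) s)) := by
    intro s
    induction s with
    | zero => simp
    | tmul a b =>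
      have e : ∀ t : Coalg R ⊗[k] Coalg R, TensorProduct.map (coalgSub R).subtype
          (TensorProduct.mapIncl (coalgSub R) (coalgSub R))
          (TensorProduct.assoc k _ _ _ (t ⊗ₜ[k] b)) =
          TensorProduct.assoc k _ _ _ (TensorProduct.mapIncl (coalgSub R) (coalgSub R) t ⊗ₜ[k]
            (b : TensorAlgebra k V)) := by
        intro t
        induction t with
        | zero => simp
        | tmul p q => simp [TensorProduct.mapIncl]
        | add p q hp hq => simp only [add_tmul, map_add, hp, hq]
      rw [rTensor_tmul, e, mapIncl_comul]
      simp [TensorProduct.mapIncl]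
    | add p q hp hq => simp only [map_add, hp, hq]
  have h2 : ∀ s : Coalg R ⊗[k] Coalg R, TensorProduct.map (coalgSub R).subtype
      (TensorProduct.mapIncl (coalgSub R) (coalgSub R)) ((comul R).lTensor _ s) =
      deconc.lTensor _ (TensorProduct.mapIncl (coalgSub R) (coalgSub R) s) := by
    intro s
    induction s with
    | zero => simp
    | tmul a b =>
      simp only [lTensor_tmul, map_tmul, mapIncl_comul]
      simp
    | add p q hp hq => simp only [map_add, hp, hq]
  rw [h1, h2, mapIncl_comul, deconc_coassoc]

theorem comul_counit_left (x : Coalg R) :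
    TensorProduct.lid k _ ((counit R).rTensor _ (comul R x)) = x := by
  apply Subtype.ext
  have h1 : ∀ s : Coalg R ⊗[k] Coalg R,
      ((TensorProduct.lid k _ ((counit R).rTensor _ s) : Coalg R) : TensorAlgebra k V) =
      TensorProduct.lid k _ (TensorAlgebra.algebraMapInv.toLinearMap.rTensor _
        (TensorProduct.mapIncl (coalgSub R) (coalgSub R) s)) := by
    intro s
    induction s with
    | zero => simp
    | tmul a b => simp [TensorProduct.mapIncl, counit]
    | add p q hp hq => simp only [map_add, Submodule.coe_add, hp, hq]
  rw [h1, mapIncl_comul, deconc_counit_left]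

theorem comul_counit_right (x : Coalg R) :
    TensorProduct.rid k _ ((counit R).lTensor _ (comul R x)) = x := by
  apply Subtype.ext
  have h1 : ∀ s : Coalg R ⊗[k] Coalg R,
      ((TensorProduct.rid k _ ((counit R).lTensor _ s) : Coalg R) : TensorAlgebra k V) =
      TensorProduct.rid k _ (TensorAlgebra.algebraMapInv.toLinearMap.lTensor _
        (TensorProduct.mapIncl (coalgSub R) (coalgSub R) s)) := by
    intro s
    induction s with
    | zero => simp
    | tmul a b => simp [TensorProduct.mapIncl, counit]
    | add p q hp hq => simp only [map_add, Submodule.coe_add, hp, hq]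
  rw [h1, mapIncl_comul, deconc_counit_right]

theorem conv_apply {A : Type w} [Ring A] [Algebra k A] (f g : Coalg R →ₗ[k] A) (x : Coalg R) :
    conv R f g x = mul' k A (TensorProduct.map f g (comul R x)) := rfl

theorem conv_assoc {A : Type w} [Ring A] [Algebra k A] (f g h : Coalg R →ₗ[k] A) :
    conv R (conv R f g) h = conv R f (conv R g h) := by
  ext x
  have h1 : ∀ s : Coalg R ⊗[k] Coalg R,
      mul' k A (TensorProduct.map (conv R f g) h s) =
      mul' k A (TensorProduct.map f (mul' k A ∘ₗ TensorProduct.map g h)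
        (TensorProduct.assoc k _ _ _ ((comul R).rTensor _ s))) := by
    intro s
    induction s with
    | zero => simp
    | tmul a b =>
      rw [rTensor_tmul, map_tmul, conv_apply]
      generalize comul R a = t
      induction t with
      | zero => simp
      | tmul p q => simp [mul_assoc]
      | add p q hp hq => simp only [add_tmul, map_add, hp, hq]
    | add p q hp hq => simp only [map_add, hp, hq]
  have h2 : ∀ s : Coalg R ⊗[k] Coalg R,
      mul' k A (TensorProduct.map f (conv R g h) s) =
      mul' k A (TensorProduct.map f (mul' k A ∘ₗ TensorProduct.map g h)
        ((comul R).lTensor _ s)) := by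
    intro s
    induction s with
    | zero => simp
    | tmul a b => simp [conv_apply]
    | add p q hp hq => simp only [map_add, hp, hq]
  rw [conv_apply, h1, comul_coassoc, conv_apply, h2]

variable {A : Type w} [Ring A] [Algebra k A]

theorem conv_add_left (f f' g : Coalg R →ₗ[k] A) :
    conv R (f + f') g = conv R f g + conv R f' g := by
  simp [conv, TensorProduct.map_add_left, LinearMap.add_comp, LinearMap.comp_add]

theorem conv_add_right (f g g' : Coalg R →ₗ[k] A) :
    conv R f (g + g') = conv R f g + conv R f g' := by
  simp [conv, TensorProduct.map_add_right, LinearMap.add_comp, LinearMap.comp_add]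

theorem conv_neg_left (f g : Coalg R →ₗ[k] A) : conv R (-f) g = -conv R f g := by
  refine eq_neg_of_add_eq_zero_left ?_
  rw [← conv_add_left, neg_add_cancel]
  simp [conv, TensorProduct.map_zero_left]

theorem conv_neg_right (f g : Coalg R →ₗ[k] A) : conv R f (-g) = -conv R f g := by
  refine eq_neg_of_add_eq_zero_left ?_
  rw [← conv_add_right, neg_add_cancel]
  simp [conv, TensorProduct.map_zero_right]

theorem counit_conv (f : Coalg R →ₗ[k] A) :
    conv R (Algebra.linearMap k A ∘ₗ counit R) f = f := by
  ext x
  have h1 : ∀ s : Coalg R ⊗[k] Coalg R,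
      mul' k A (TensorProduct.map (Algebra.linearMap k A ∘ₗ counit R) f s) =
      f (TensorProduct.lid k _ ((counit R).rTensor _ s)) := by
    intro s
    induction s with
    | zero => simp
    | tmul a b => simp [Algebra.smul_def]
    | add p q hp hq => simp only [map_add, hp, hq]
  rw [conv_apply, h1, comul_counit_left]

theorem conv_counit (f : Coalg R →ₗ[k] A) :
    conv R f (Algebra.linearMap k A ∘ₗ counit R) = f := by
  ext x
  have h1 : ∀ s : Coalg R ⊗[k] Coalg R,
      mul' k A (TensorProduct.map f (Algebra.linearMap k A ∘ₗ counit R) s) =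
      f (TensorProduct.rid k _ ((counit R).lTensor _ s)) := by
    intro s
    induction s with
    | zero => simp
    | tmul a b => simp [Algebra.smul_def, Algebra.commutes]
    | add p q hp hq => simp only [map_add, hp, hq]
  rw [conv_apply, h1, comul_counit_right]

/-- Two linear maps that agree on products of homogeneous elements of total degree `n` agree on the
coproducts of elements of degree `n`. -/
theorem comul_ext {Y : Type*} [AddCommGroup Y] [Module k Y] {F G : Coalg R ⊗[k] Coalg R →ₗ[k] Y}
    {n : ℕ} {x : Coalg R} (hx : x ∈ homog (coalgComp R) n)
    (h : ∀ i j, i + j = n → ∀ y ∈ homog (coalgComp R) i, ∀ z ∈ homog (coalgComp R) j,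
      F (y ⊗ₜ[k] z) = G (y ⊗ₜ[k] z)) : F (comul R x) = G (comul R x) := by
  have key : ∀ s : Coalg R ⊗[k] Coalg R,
      F (tmulComp (coalgComp R) (coalgComp R) s n) =
        G (tmulComp (coalgComp R) (coalgComp R) s n) := by
    intro s
    have : F ∘ₗ lapply n ∘ₗ tmulComp (coalgComp R) (coalgComp R) =
        G ∘ₗ lapply n ∘ₗ tmulComp (coalgComp R) (coalgComp R) := by
      refine ext_tmul_homog (grading_coalg (R := R)) (grading_coalg (R := R)) fun i j y hy z hz =>
        ?_
      have e1 := mem_homog.1 (tmul_mem hy hz)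
      simp only [comp_apply, e1, Finsupp.lapply_apply, single_apply]
      split_ifs with hij
      · exact h i j hij y hy z hz
      · rw [map_zero, map_zero]
    exact LinearMap.congr_fun this s
  have := key (comul R x)
  rwa [mem_homog.1 (comul_mem hx), single_eq_same] at this

theorem conv_mem {c : A →ₗ[k] ℕ →₀ A} (hc : ∀ {i j : ℕ} {x y : A}, x ∈ homog c i → y ∈ homog c j →
    x * y ∈ homog c (i + j)) {f g : Coalg R →ₗ[k] A}
    (hf : ∀ n, ∀ x ∈ homog (coalgComp R) n, f x ∈ homog c n)
    (hg : ∀ n, ∀ x ∈ homog (coalgComp R) n, g x ∈ homog c n) {n : ℕ} {x : Coalg R}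
    (hx : x ∈ homog (coalgComp R) n) : conv R f g x ∈ homog c n := by
  rw [mem_homog, conv_apply]
  refine comul_ext (F := c ∘ₗ mul' k A ∘ₗ TensorProduct.map f g)
    (G := lsingle n ∘ₗ mul' k A ∘ₗ TensorProduct.map f g) hx ?_
  intro i j hij y hy z hz
  have := mem_homog.1 (hc (hf i y hy) (hg j z hz))
  rw [hij] at this
  exact this

theorem conv_signOp {f g : Coalg R →ₗ[k] A} (x : Coalg R) :
    conv R f g (signOp (coalgComp R) x) =
      conv R (f ∘ₗ signOp (coalgComp R)) (g ∘ₗ signOp (coalgComp R)) x := by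
  induction x using grading_coalg.induction with
  | add x y hx hy => simp only [map_add, hx, hy]
  | hom n x hx =>
    rw [signOp_of_mem hx, map_smul, conv_apply, conv_apply]
    refine comul_ext (F := (-1 : k) ^ n • mul' k A ∘ₗ TensorProduct.map f g)
      (G := mul' k A ∘ₗ TensorProduct.map _ _) hx ?_
    rintro i j rfl y hy z hz
    simp [signOp_of_mem hy, signOp_of_mem hz, pow_add, smul_smul, mul_comm]

end Coalgebra

section Cobar

variable {k : Type u} [Field k] {V : Type v} [AddCommGroup V] [Module k V]
variable {R : Submodule k (V ⊗[k] V)}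

theorem comul_mem_of {Y : Type*} [AddCommGroup Y] [Module k Y] (F : Coalg R ⊗[k] Coalg R →ₗ[k] Y)
    (P : Submodule k Y) {n : ℕ} {x : Coalg R} (hx : x ∈ homog (coalgComp R) n)
    (h : ∀ i j, i + j = n → ∀ y ∈ homog (coalgComp R) i, ∀ z ∈ homog (coalgComp R) j,
      F (y ⊗ₜ[k] z) ∈ P) : F (comul R x) ∈ P := by
  rw [← Submodule.Quotient.mk_eq_zero]
  refine comul_ext (F := P.mkQ ∘ₗ F) (G := 0) hx fun i j hij y hy z hz => ?_
  exact (Submodule.Quotient.mk_eq_zero P).2 (h i j hij y hy z hz)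

/-! ### The cobar construction -/

theorem coalgIncl_toCoalgBar (c : Coalg R) :
    coalgIncl R (toCoalgBar R c) = c - counit R c • coalgOne R := rfl

theorem coalgIncl_injective : Function.Injective (coalgIncl R) := Subtype.val_injective

theorem counit_coalgIncl (m : CoalgBar R) : counit R (coalgIncl R m) = 0 := m.2

theorem toCoalgBar_coalgIncl (m : CoalgBar R) : toCoalgBar R (coalgIncl R m) = m := by
  apply coalgIncl_injective
  rw [coalgIncl_toCoalgBar, counit_coalgIncl, zero_smul, sub_zero]

theorem cobarLetter_coalgIncl (m : CoalgBar R) :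
    cobarLetter R (coalgIncl R m) = TensorAlgebra.ι k m := by
  rw [cobarLetter, comp_apply, toCoalgBar_coalgIncl]

theorem toCoalgBar_one : toCoalgBar R (coalgOne R) = 0 := by
  apply coalgIncl_injective
  rw [coalgIncl_toCoalgBar, counit_coalgOne, one_smul, sub_self, map_zero]

theorem cobarLetter_one : cobarLetter R (coalgOne R) = 0 := by
  rw [cobarLetter, comp_apply, toCoalgBar_one, map_zero]

theorem toCoalgBar_of_zero {c : Coalg R} (hc : c ∈ homog (coalgComp R) 0) :
    toCoalgBar R c = 0 := by
  rw [counit_smul_of_mem hc, map_smul, toCoalgBar_one, smul_zero]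

theorem cobarLetter_of_zero {c : Coalg R} (hc : c ∈ homog (coalgComp R) 0) :
    cobarLetter R c = 0 := by
  rw [cobarLetter, comp_apply, toCoalgBar_of_zero hc, map_zero]

theorem coalgIncl_toCoalgBar_of_mem {n : ℕ} {c : Coalg R}
    (hc : c ∈ homog (coalgComp R) (n + 1)) : coalgIncl R (toCoalgBar R c) = c := by
  rw [coalgIncl_toCoalgBar, counit_of_mem hc, zero_smul, sub_zero]

theorem toCoalgBar_mem {n : ℕ} {c : Coalg R} (hc : c ∈ homog (coalgComp R) n) :
    toCoalgBar R c ∈ homog (coalgBarComp R) n := by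
  cases n with
  | zero => rw [toCoalgBar_of_zero hc]; exact zero_mem _
  | succ n =>
    rw [mem_homog, coalgBarComp, comp_apply, comp_apply,
      coalgIncl_toCoalgBar_of_mem hc, mem_homog.1 hc]
    simp

theorem span_toCoalgBar (m : CoalgBar R) : m ∈ Submodule.span k
    {m | ∃ n, ∃ c ∈ homog (coalgComp R) (n + 1), m = toCoalgBar R c} := by
  rw [← toCoalgBar_coalgIncl m]
  induction coalgIncl R m using grading_coalg.induction with
  | hom n y hy =>
    cases n with
    | zero => rw [toCoalgBar_of_zero hy]; exact zero_mem _
    | succ n => exact subset_span ⟨n, y, hy, rfl⟩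
  | add y z hy hz => rw [map_add]; exact add_mem hy hz

theorem grading_coalgBar : IsGrading (coalgBarComp R) :=
  isGrading_of_span fun m => Submodule.span_mono
    (by rintro _ ⟨n, c, hc, rfl⟩; exact ⟨n + 1, toCoalgBar_mem hc⟩) (span_toCoalgBar m)

theorem grading_cobar : IsGrading (cobarComp R) := (grading_coalgBar.regrade _).tensor

theorem cobarLetter_mem {n : ℕ} {c : Coalg R} (hc : c ∈ homog (coalgComp R) (n + 1)) :
    cobarLetter R c ∈ homog (cobarComp R) n :=
  ι_mem_homog (regrade_mem (· - 1) (toCoalgBar_mem hc))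

theorem cobar_mul_mem {i j : ℕ} {x y : Cobar R} (hx : x ∈ homog (cobarComp R) i)
    (hy : y ∈ homog (cobarComp R) j) : x * y ∈ homog (cobarComp R) (i + j) := mul_mem_homog hx hy

theorem cobarSign_mul (x y : Cobar R) : signOp (cobarComp R) (x * y) =
    signOp (cobarComp R) x * signOp (cobarComp R) y := signOp_mul (grading_coalgBar.regrade _) x y

theorem cobarSign_letter (c : Coalg R) :
    signOp (cobarComp R) (cobarLetter R c) = -cobarLetter R (signOp (coalgComp R) c) := by
  induction c using grading_coalg.induction with
  | hom n c hc =>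
    cases n with
    | zero => simp [signOp_of_mem hc, cobarLetter_of_zero hc]
    | succ n => rw [signOp_of_mem hc, signOp_of_mem (cobarLetter_mem hc), map_smul, pow_succ]; simp
  | add y z hy hz => simp only [map_add, hy, hz, neg_add]

/-- Induction on words in the letters `s⁻¹ c`. -/
theorem cobar_induction {P : Cobar R → Prop} (add : ∀ x y, P x → P y → P (x + y))
    (smul : ∀ (r : k) x, P x → P (r • x)) (one : P 1)
    (snoc : ∀ (i : ℕ) (x : Cobar R) (n : ℕ) (c : Coalg R), x ∈ homog (cobarComp R) i →
      c ∈ homog (coalgComp R) (n + 1) → P x → P (x * cobarLetter R c)) (x : Cobar R) : P x := by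
  refine tensor_induction_of_span (c := regrade (· - 1) (coalgBarComp R))
    {m | ∃ n, ∃ c ∈ homog (coalgComp R) (n + 1), m = toCoalgBar R c} span_toCoalgBar ?_ add smul
    one ?_ x
  · rintro _ ⟨n, c, hc, rfl⟩
    exact ⟨_, regrade_mem _ (toCoalgBar_mem hc)⟩
  · rintro i x _ hx ⟨n, c, hc, rfl⟩ ih
    exact snoc i x n c hx hc ih

theorem cobarD_mul (x y : Cobar R) :
    cobarD R (x * y) = cobarD R x * y + signOp (cobarComp R) x * cobarD R y :=
  split_derivation_mul _ cobarSign_mul (cobarD₁ R) rfl x y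

theorem cobarD_one : cobarD R 1 = 0 := by simp [cobarD, split_one]

theorem cobarD_letter (c : Coalg R) : cobarD R (cobarLetter R c) =
    conv R (cobarLetter R ∘ₗ signOp (coalgComp R)) (cobarLetter R) c := by
  have h : cobarD R (cobarLetter R c) =
      conv R (cobarLetter R ∘ₗ signOp (coalgComp R)) (cobarLetter R)
        (coalgIncl R (toCoalgBar R c)) := by
    rw [cobarLetter, comp_apply, cobarD]
    simp only [comp_apply, split_ι, map_tmul, mul'_apply]
    rw [cobarComp, signOp_one, one_mul]
    simp [conv, cobarD₁, cobarLetter]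
  have h1 : conv R (cobarLetter R ∘ₗ signOp (coalgComp R)) (cobarLetter R) (coalgOne R) = 0 := by
    rw [conv_apply, comul_coalgOne]
    simp [cobarLetter_one]
  rw [h, coalgIncl_toCoalgBar, map_sub, map_smul, h1, smul_zero, sub_zero]

theorem cobarD_letter_mem {n : ℕ} {c : Coalg R} (hc : c ∈ homog (coalgComp R) (n + 1)) :
    cobarD R (cobarLetter R c) ∈ lower (cobarComp R) n := by
  rw [cobarD_letter, conv]
  refine comul_mem_of (mul' k (Cobar R) ∘ₗ TensorProduct.map
    (cobarLetter R ∘ₗ signOp (coalgComp R)) (cobarLetter R)) _ hc fun i j hij y hy z hz => ?_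
  rw [comp_apply, map_tmul, mul'_apply, comp_apply,
    signOp_of_mem hy, map_smul, smul_mul_assoc]
  refine smul_mem _ _ ?_
  cases i with
  | zero => rw [cobarLetter_of_zero hy, zero_mul]; exact zero_mem _
  | succ i =>
    cases j with
    | zero => rw [cobarLetter_of_zero hz, mul_zero]; exact zero_mem _
    | succ j =>
      obtain rfl : n = i + j + 1 := by omega
      exact cobar_mul_mem (cobarLetter_mem hy) (cobarLetter_mem hz)

theorem cobar_mul_lower {i j : ℕ} {x y : Cobar R} (hx : x ∈ homog (cobarComp R) i)
    (hy : y ∈ lower (cobarComp R) j) : x * y ∈ lower (cobarComp R) (i + j) := by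
  cases j with
  | zero => rw [(mem_bot k).1 hy, mul_zero]; exact zero_mem _
  | succ j => exact cobar_mul_mem hx hy

theorem cobar_lower_mul {i j : ℕ} {x y : Cobar R} (hx : x ∈ lower (cobarComp R) i)
    (hy : y ∈ homog (cobarComp R) j) : x * y ∈ lower (cobarComp R) (i + j) := by
  cases i with
  | zero => rw [(mem_bot k).1 hx, zero_mul]; exact zero_mem _
  | succ i =>
    rw [show i + 1 + j = i + j + 1 by omega]
    exact cobar_mul_mem hx hy

theorem one_mem_cobar : (1 : Cobar R) ∈ homog (cobarComp R) 0 := one_mem_homog _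

/-- Induction for statements about the homogeneous elements of the cobar construction. -/
theorem cobar_degree_induction {Y : Type*} [AddCommGroup Y] [Module k Y] (F : Cobar R →ₗ[k] Y)
    (S : ℕ → Submodule k Y) (one : F 1 ∈ S 0)
    (snoc : ∀ (i : ℕ) (x : Cobar R) (n : ℕ) (c : Coalg R), x ∈ homog (cobarComp R) i →
      c ∈ homog (coalgComp R) (n + 1) → F x ∈ S i → F (x * cobarLetter R c) ∈ S (i + n))
    {n : ℕ} {x : Cobar R} (hx : x ∈ homog (cobarComp R) n) : F x ∈ S n := by
  have key : ∀ m, F (cobarComp R x m) ∈ S m := by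
    clear hx
    induction x using cobar_induction with
    | add x y hx hy =>
        intro m
        rw [map_add, Finsupp.add_apply, map_add]
        exact add_mem (hx m) (hy m)
    | smul r x hx =>
      intro m; rw [map_smul, Finsupp.smul_apply, map_smul]; exact smul_mem _ r (hx m)
    | one =>
      intro m
      rw [mem_homog.1 one_mem_cobar, single_apply]
      split_ifs with h
      · exact h ▸ one
      · rw [map_zero]; exact zero_mem _
    | snoc i x n c hx hc ih =>
      intro m
      rw [mem_homog.1 (cobar_mul_mem hx (cobarLetter_mem hc)), single_apply]
      split_ifs with h
      · have := ih i
        rw [mem_homog.1 hx, single_eq_same] at this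
        exact h ▸ snoc i x n c hx hc this
      · rw [map_zero]; exact zero_mem _
  have := key n
  rwa [mem_homog.1 hx, single_eq_same] at this

theorem cobarD_mem {n : ℕ} {x : Cobar R} (hx : x ∈ homog (cobarComp R) n) :
    cobarD R x ∈ lower (cobarComp R) n := by
  refine cobar_degree_induction (cobarD R) (lower (cobarComp R)) ?_ ?_ hx
  · rw [cobarD_one]; exact zero_mem _
  · intro i x n c hx hc ih
    rw [cobarD_mul, signOp_of_mem hx]
    refine add_mem (cobar_lower_mul ih (cobarLetter_mem hc)) ?_
    rw [smul_mul_assoc]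
    exact smul_mem _ _ (cobar_mul_lower hx (cobarD_letter_mem hc))

theorem signOp_of_lower {X : Type*} [AddCommGroup X] [Module k X] {c : X →ₗ[k] ℕ →₀ X} {n : ℕ}
    {x : X} (hx : x ∈ lower c n) : signOp c x = -((-1 : k) ^ n • x) := by
  cases n with
  | zero => rw [(mem_bot k).1 hx]; simp
  | succ n => rw [signOp_of_mem hx, pow_succ]; simp

theorem cobarSign_cobarD (x : Cobar R) :
    signOp (cobarComp R) (cobarD R x) = -cobarD R (signOp (cobarComp R) x) := by
  induction x using grading_cobar.induction with
  | hom n x hx => rw [signOp_of_lower (cobarD_mem hx), signOp_of_mem hx, map_smul]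
  | add x y hx hy => simp only [map_add, hx, hy, neg_add]

theorem cobarD_conv {f g : Coalg R →ₗ[k] Cobar R} (c : Coalg R) : cobarD R (conv R f g c) =
    conv R (cobarD R ∘ₗ f) g c + conv R (signOp (cobarComp R) ∘ₗ f) (cobarD R ∘ₗ g) c := by
  simp only [conv_apply]
  generalize comul R c = t
  induction t with
  | zero => simp
  | tmul y z => simp [cobarD_mul]
  | add x y hx hy => simp only [map_add, hx, hy]; abel

theorem cobarD_cobarD_letter (c : Coalg R) : cobarD R (cobarD R (cobarLetter R c)) = 0 := by
  have h1 : cobarD R ∘ₗ cobarLetter R =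
      conv R (cobarLetter R ∘ₗ signOp (coalgComp R)) (cobarLetter R) :=
    LinearMap.ext cobarD_letter
  have h2 : cobarD R ∘ₗ (cobarLetter R ∘ₗ signOp (coalgComp R)) =
      conv R (cobarLetter R) (cobarLetter R ∘ₗ signOp (coalgComp R)) := by
    ext c
    rw [comp_apply, comp_apply, cobarD_letter, conv_signOp]
    congr 2
    ext c
    simp [grading_coalg.signOp_signOp]
  have h3 : signOp (cobarComp R) ∘ₗ (cobarLetter R ∘ₗ signOp (coalgComp R)) =
      -cobarLetter R := by
    ext c
    simp [cobarSign_letter, grading_coalg.signOp_signOp]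
  rw [cobarD_letter, cobarD_conv, h1, h2, h3, conv_neg_left, conv_assoc, LinearMap.neg_apply,
    add_neg_cancel]

theorem cobarD_cobarD (x : Cobar R) : cobarD R (cobarD R x) = 0 := by
  induction x using cobar_induction with
  | add x y hx hy => simp only [map_add, hx, hy, add_zero]
  | smul r x hx => simp only [map_smul, hx, smul_zero]
  | one => rw [cobarD_one, map_zero]
  | snoc i x n c hx hc ih =>
    rw [cobarD_mul, map_add, cobarD_mul, cobarD_mul, ih, cobarD_cobarD_letter, cobarSign_cobarD]
    simp

theorem cobarAug_letter (c : Coalg R) : cobarAug R (cobarLetter R c) = 0 := algebraMapInv_ι _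

theorem cobarAug_d (x : Cobar R) : cobarAug R (cobarD R x) = 0 := by
  induction x using cobar_induction with
  | add x y hx hy => simp only [map_add, hx, hy, add_zero]
  | smul r x hx => simp only [map_smul, hx, smul_zero]
  | one => rw [cobarD_one, map_zero]
  | snoc i x n c hx hc ih =>
    have h : ∀ t : Coalg R ⊗[k] Coalg R, cobarAug R (mul' k (Cobar R)
        (TensorProduct.map (cobarLetter R ∘ₗ signOp (coalgComp R)) (cobarLetter R) t)) = 0 := by
      intro t
      induction t with
      | zero => simp
      | tmul y z => simp [cobarAug_letter]
      | add x y hx hy => simp only [map_add, hx, hy, add_zero]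
    rw [cobarD_mul, map_add, map_mul, map_mul, ih, cobarD_letter, conv_apply, h]
    simp

theorem cobarAug_succ {n : ℕ} {x : Cobar R} (hx : x ∈ homog (cobarComp R) (n + 1)) :
    cobarAug R x = 0 := by
  have := cobar_degree_induction (cobarAug R).toLinearMap (fun n => if n = 0 then ⊤ else ⊥)
    (by simp) (fun i x n c hx hc ih => by simp [cobarAug_letter]) hx
  simpa using this

/-! ### The maps of the Koszul dual coalgebra and of the cobar construction induced by `σ` -/

theorem deconc_wordMap (g : V →ₗ[k] V) (x : TensorAlgebra k V) :
    deconc (wordMap g x) =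
      TensorProduct.map (wordMap g).toLinearMap (wordMap g).toLinearMap (deconc x) := by
  induction x using tensor_induction_snoc (isGrading_lsingle (k := k) (M := V)) with
  | add x y hx hy => simp only [map_add, hx, hy]
  | smul r x hx => simp only [map_smul, hx]
  | one => simp [deconc_one]
  | snoc i j x m hx hm ih =>
    have h : wordMap g (TensorAlgebra.ι k m) = TensorAlgebra.ι k (g m) := by simp [wordMap]
    rw [map_mul, h, deconc_mul_ι, deconc_mul_ι, ih, map_add]
    congr 1
    · simp [h]
    · generalize deconc x = t
      induction t with
      | zero => simp
      | tmul y z => simp [h]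
      | add x y hx hy => simp only [map_add, hx, hy]

theorem wordMap_mem_homog (g : V →ₗ[k] V) {n : ℕ} {x : TensorAlgebra k V}
    (hx : x ∈ homog wordComp n) : wordMap g x ∈ homog wordComp n := by
  have h : ∀ x, wordComp (wordMap g x) =
      Finsupp.mapRange.linearMap (wordMap g).toLinearMap (wordComp x) := by
    intro x
    induction x using word_induction with
    | hom n y hy =>
      rw [wordComp_of_mem hy, wordComp_of_mem (x := wordMap g y) (wordMap_wordPow g n ⟨y, hy, rfl⟩)]
      simp
    | add x y hx hy => simp only [map_add, hx, hy]
  rw [mem_homog, h, mem_homog.1 hx]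
  simp

variable {σ : QuadAlg R →ₐ[k] QuadAlg R} {hσ : IsGradedEnd R σ}

theorem coalgMap_coe (x : Coalg R) : (coalgMap R σ hσ x : TensorAlgebra k V) =
    wordMap (genMap R σ hσ) (x : TensorAlgebra k V) := rfl

theorem coalgMap_mem {n : ℕ} {x : Coalg R} (hx : x ∈ homog (coalgComp R) n) :
    coalgMap R σ hσ x ∈ homog (coalgComp R) n :=
  mem_homog_coalg.2 (wordMap_mem_homog _ (mem_homog_coalg.1 hx))

theorem coalgMap_one : coalgMap R σ hσ (coalgOne R) = coalgOne R :=
  Subtype.ext (map_one (wordMap (genMap R σ hσ)))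

theorem counit_coalgMap (x : Coalg R) : counit R (coalgMap R σ hσ x) = counit R x := by
  have h : (TensorAlgebra.algebraMapInv (R := k) (M := V)).comp (wordMap (genMap R σ hσ)) =
      TensorAlgebra.algebraMapInv := by
    apply TensorAlgebra.hom_ext
    ext v
    simp [wordMap, algebraMapInv_ι]
  exact DFunLike.congr_fun h (x : TensorAlgebra k V)

theorem comul_coalgMap (x : Coalg R) : comul R (coalgMap R σ hσ x) =
    TensorProduct.map (coalgMap R σ hσ) (coalgMap R σ hσ) (comul R x) := by
  apply mapIncl_injective R
  have h : ∀ t : Coalg R ⊗[k] Coalg R, TensorProduct.mapIncl (coalgSub R) (coalgSub R)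
      (TensorProduct.map (coalgMap R σ hσ) (coalgMap R σ hσ) t) =
      TensorProduct.map (wordMap (genMap R σ hσ)).toLinearMap
        (wordMap (genMap R σ hσ)).toLinearMap
        (TensorProduct.mapIncl (coalgSub R) (coalgSub R) t) := by
    intro t
    induction t with
    | zero => simp
    | tmul y z => simp [TensorProduct.mapIncl, coalgMap_coe]
    | add x y hx hy => simp only [map_add, hx, hy]
  rw [h, mapIncl_comul, mapIncl_comul, coalgMap_coe, deconc_wordMap]

theorem coalgMap_signOp (x : Coalg R) : coalgMap R σ hσ (signOp (coalgComp R) x) =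
    signOp (coalgComp R) (coalgMap R σ hσ x) := by
  induction x using grading_coalg.induction with
  | hom n x hx => rw [signOp_of_mem hx, signOp_of_mem (coalgMap_mem hx), map_smul]
  | add x y hx hy => simp only [map_add, hx, hy]

theorem cobarMap_letter (c : Coalg R) :
    cobarMap R σ hσ (cobarLetter R c) = cobarLetter R (coalgMap R σ hσ c) := by
  rw [cobarMap]
  conv_lhs => rw [cobarLetter, comp_apply]
  rw [TensorAlgebra.lift_ι_apply]
  change cobarLetter R (coalgMap R σ hσ (coalgIncl R (toCoalgBar R c))) = _
  rw [coalgIncl_toCoalgBar, map_sub, map_smul, coalgMap_one, map_sub, map_smul, cobarLetter_one,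
    smul_zero, sub_zero]

theorem cobarMap_mem {n : ℕ} {x : Cobar R} (hx : x ∈ homog (cobarComp R) n) :
    cobarMap R σ hσ x ∈ homog (cobarComp R) n := by
  refine cobar_degree_induction (cobarMap R σ hσ).toLinearMap (homog (cobarComp R)) ?_ ?_ hx
  · rw [AlgHom.toLinearMap_apply, map_one]; exact one_mem_cobar
  · intro i x n c hx hc ih
    rw [AlgHom.toLinearMap_apply, map_mul, cobarMap_letter]
    exact cobar_mul_mem ih (cobarLetter_mem (coalgMap_mem hc))

theorem cobarMap_signOp (x : Cobar R) : cobarMap R σ hσ (signOp (cobarComp R) x) =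
    signOp (cobarComp R) (cobarMap R σ hσ x) := by
  induction x using grading_cobar.induction with
  | hom n x hx => rw [signOp_of_mem hx, signOp_of_mem (cobarMap_mem hx), map_smul]
  | add x y hx hy => simp only [map_add, hx, hy]

theorem cobarMap_d (x : Cobar R) :
    cobarMap R σ hσ (cobarD R x) = cobarD R (cobarMap R σ hσ x) := by
  induction x using cobar_induction with
  | add x y hx hy => simp only [map_add, hx, hy]
  | smul r x hx => simp only [map_smul, hx]
  | one => rw [cobarD_one, map_zero, map_one, cobarD_one]
  | snoc i x n c hx hc ih =>
    have h : cobarMap R σ hσ (cobarD R (cobarLetter R c)) =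
        cobarD R (cobarMap R σ hσ (cobarLetter R c)) := by
      rw [cobarMap_letter, cobarD_letter, cobarD_letter, conv_apply, conv_apply, comul_coalgMap]
      generalize comul R c = t
      induction t with
      | zero => simp
      | tmul y z => simp [cobarMap_letter, coalgMap_signOp]
      | add x y hx hy => simp only [map_add, hx, hy]
    rw [cobarD_mul, map_add, map_mul, map_mul, map_mul, ih, h, cobarD_mul, cobarMap_signOp]

theorem cobarAug_cobarMap (x : Cobar R) : cobarAug R (cobarMap R σ hσ x) = cobarAug R x := by
  have h : (cobarAug R).comp (cobarMap R σ hσ) = cobarAug R := by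
    apply TensorAlgebra.hom_ext
    apply LinearMap.ext
    intro m
    change cobarAug R (cobarMap R σ hσ (TensorAlgebra.ι k m)) = cobarAug R (TensorAlgebra.ι k m)
    rw [← cobarLetter_coalgIncl, cobarMap_letter, cobarAug_letter, cobarAug_letter]
  exact DFunLike.congr_fun h x

theorem isAugDGA_cobar :
    IsAugDGA (cobarComp R) (cobarD R) (cobarAug R) (cobarMap R σ hσ) where
  grading := grading_cobar
  one_mem := one_mem_cobar
  mul_mem := cobar_mul_mem
  aug_succ := cobarAug_succ
  d_mem := fun hx => cobarD_mem hx
  d_zero := fun hx => (mem_bot k).1 (cobarD_mem hx)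
  d_d := cobarD_cobarD
  d_mul := cobarD_mul
  aug_d := cobarAug_d
  σ_mem := cobarMap_mem
  σ_d := cobarMap_d
  aug_σ := cobarAug_cobarMap

/-! ### The projection onto the quadratic algebra -/

theorem quadMk_surjective : Function.Surjective (quadMk R) := Ideal.Quotient.mk_surjective

theorem quadAug_quadMk (x : TensorAlgebra k V) :
    quadAug R (quadMk R x) = TensorAlgebra.algebraMapInv x := rfl

theorem quadAug_map (hσ : IsGradedEnd R σ) (x : QuadAlg R) : quadAug R (σ x) = quadAug R x := by
  obtain ⟨x, rfl⟩ := quadMk_surjective x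
  rw [← quadMk_wordMap R σ hσ, quadAug_quadMk, quadAug_quadMk]
  have h : (TensorAlgebra.algebraMapInv (R := k) (M := V)).comp (wordMap (genMap R σ hσ)) =
      TensorAlgebra.algebraMapInv := by
    apply TensorAlgebra.hom_ext
    ext v
    simp [wordMap, algebraMapInv_ι]
  exact DFunLike.congr_fun h x

theorem mem_homog_lsingle {X : Type*} [AddCommGroup X] [Module k X] (x : X) :
    x ∈ homog (lsingle 0 : X →ₗ[k] ℕ →₀ X) 0 := rfl

theorem eq_zero_of_mem_lsingle {X : Type*} [AddCommGroup X] [Module k X] {n : ℕ} {x : X}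
    (hx : x ∈ homog (lsingle 0 : X →ₗ[k] ℕ →₀ X) (n + 1)) : x = 0 :=
  homog_eq_zero hx (mem_homog_lsingle x) (by omega)

theorem isAugDGA_quad (hσ : IsGradedEnd R σ) : IsAugDGA (lsingle 0) 0 (quadAug R) σ where
  grading := isGrading_lsingle
  one_mem := mem_homog_lsingle _
  mul_mem := by
    intro i j x y hx hy
    cases i with
    | zero =>
      cases j with
      | zero => exact mem_homog_lsingle _
      | succ j => rw [eq_zero_of_mem_lsingle hy, mul_zero]; exact zero_mem _
    | succ i => rw [eq_zero_of_mem_lsingle hx, zero_mul]; exact zero_mem _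
  aug_succ := fun hx => by rw [eq_zero_of_mem_lsingle hx, map_zero]
  d_mem := fun _ => zero_mem _
  d_zero := fun _ => rfl
  d_d := fun _ => rfl
  d_mul := fun _ _ => by simp
  aug_d := fun _ => by simp
  σ_mem := by
    intro i x hx
    cases i with
    | zero => exact mem_homog_lsingle _
    | succ i => rw [eq_zero_of_mem_lsingle hx, map_zero]; exact zero_mem _
  σ_d := fun _ => by simp
  aug_σ := quadAug_map hσ

theorem twisting_apply (c : Coalg R) :
    twisting R c = quadMk R (wordComp (c : TensorAlgebra k V) 1) := rfl

theorem twisting_of_mem {n : ℕ} {c : Coalg R} (hc : c ∈ homog (coalgComp R) n) (hn : n ≠ 1) :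
    twisting R c = 0 := by
  rw [twisting_apply, mem_homog.1 (mem_homog_coalg.1 hc), single_apply, if_neg hn, map_zero]

theorem twisting_signOp (c : Coalg R) : twisting R (signOp (coalgComp R) c) = -twisting R c := by
  induction c using grading_coalg.induction with
  | hom n x hx =>
    rw [signOp_of_mem hx, map_smul]
    by_cases hn : n = 1
    · subst hn; simp
    · rw [twisting_of_mem hx hn]; simp
  | add x y hx hy => simp only [map_add, hx, hy, neg_add]

theorem cobarProj_letter (c : Coalg R) : cobarProj R (cobarLetter R c) = twisting R c := by
  rw [cobarProj, cobarLetter, comp_apply, TensorAlgebra.lift_ι_apply,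
    comp_apply, coalgIncl_toCoalgBar, map_sub, map_smul,
    twisting_of_mem coalgOne_mem (by omega), smul_zero, sub_zero]

/-- The relation `∑ v' v'' = x₂` for the components of degree one of the coproduct of a word. -/
theorem mul_deconc_one_one (x : TensorAlgebra k V) :
    mul' k (TensorAlgebra k V) (TensorProduct.map (lapply 1 ∘ₗ wordComp)
      (lapply 1 ∘ₗ wordComp) (deconc x)) = wordComp x 2 := by
  induction x using word_induction with
  | add x y hx hy => simp only [map_add, Finsupp.add_apply, hx, hy]
  | hom n x hx =>
    induction hx using Submodule.pow_induction_on_left' with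
    | algebraMap r =>
      have h1 : wordComp (1 : TensorAlgebra k V) = Finsupp.single 0 1 :=
        wordComp_of_mem one_mem_wordPow
      rw [Algebra.algebraMap_eq_smul_one, map_smul, map_smul, deconc_one]
      simp [h1]
    | add x y i hx hy ihx ihy => simp only [map_add, Finsupp.add_apply, ihx, ihy]
    | mem_mul m hm i x hx ih =>
      obtain ⟨v, rfl⟩ := hm
      have h : ∀ t : TensorAlgebra k V ⊗[k] TensorAlgebra k V,
          mul' k (TensorAlgebra k V) (TensorProduct.map (lapply 1 ∘ₗ wordComp)
            (lapply 1 ∘ₗ wordComp)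
            ((mulLeft k (TensorAlgebra.ι k v)).rTensor _ t)) =
          TensorAlgebra.ι k v * wordComp (TensorProduct.lid k _
            (TensorAlgebra.algebraMapInv.toLinearMap.rTensor _ t)) 1 := by
        intro t
        induction t with
        | zero => simp
        | tmul y z =>
          have := wordComp_ι_mul v y 0
          rw [zero_add] at this
          simp [this, ← algebraMapInv_eq, ← Algebra.smul_def, mul_assoc]
        | add x y hx hy => simp only [map_add, Finsupp.add_apply, mul_add, hx, hy]
      rw [deconc_ι_mul, map_add, map_add, h, deconc_counit_left, wordComp_ι_mul]
      simp [wordComp_of_mem one_mem_wordPow]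

/-- The projection `A^¡ → V ⊆ A` is a twisting cochain, because `A^¡₂ = R` vanishes in `A`. -/
theorem conv_twisting : conv R (twisting R) (twisting R) = 0 := by
  ext c
  have h : ∀ t : Coalg R ⊗[k] Coalg R,
      mul' k _ (TensorProduct.map (twisting R) (twisting R) t) =
      quadMk R (mul' k (TensorAlgebra k V) (TensorProduct.map
        (lapply 1 ∘ₗ wordComp) (lapply 1 ∘ₗ wordComp)
        (TensorProduct.mapIncl (coalgSub R) (coalgSub R) t))) := by
    intro t
    induction t with
    | zero => simp
    | tmul y z => simp [TensorProduct.mapIncl, twisting_apply]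
    | add x y hx hy => simp only [map_add, hx, hy]
  rw [conv_apply, h, mapIncl_comul, mul_deconc_one_one, LinearMap.zero_apply]
  have h2 := ((mem_coalgSub R).1 c.2 2).2
  have h3 :=
    (Submodule.mem_iInf _).1 ((Submodule.mem_iInf _).1 ((Submodule.mem_iInf _).1 h2 0) 0) rfl
  rw [wordPow, pow_zero, one_mul, mul_one] at h3
  exact Ideal.Quotient.eq_zero_iff_mem.2 (TwoSidedIdeal.subset_span h3)

theorem cobarProj_mem {n : ℕ} {x : Cobar R} (hx : x ∈ homog (cobarComp R) n) :
    cobarProj R x ∈ homog (lsingle 0 : QuadAlg R →ₗ[k] ℕ →₀ QuadAlg R) n := by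
  refine cobar_degree_induction (cobarProj R).toLinearMap
    (homog (lsingle 0 : QuadAlg R →ₗ[k] ℕ →₀ QuadAlg R)) ?_ ?_ hx
  · exact mem_homog_lsingle _
  · intro i x n c hx hc ih
    rw [AlgHom.toLinearMap_apply, map_mul, cobarProj_letter]
    cases n with
    | zero =>
      cases i with
      | zero => exact mem_homog_lsingle _
      | succ i =>
        have h := eq_zero_of_mem_lsingle ih
        rw [AlgHom.toLinearMap_apply] at h
        rw [h, zero_mul]; exact zero_mem _
    | succ n => rw [twisting_of_mem hc (by omega), mul_zero]; exact zero_mem _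

theorem cobarProj_d (x : Cobar R) : cobarProj R (cobarD R x) = 0 := by
  induction x using cobar_induction with
  | add x y hx hy => simp only [map_add, hx, hy, add_zero]
  | smul r x hx => simp only [map_smul, hx, smul_zero]
  | one => rw [cobarD_one, map_zero]
  | snoc i x n c hx hc ih =>
    have h : ∀ t : Coalg R ⊗[k] Coalg R, cobarProj R (mul' k (Cobar R)
        (TensorProduct.map (cobarLetter R ∘ₗ signOp (coalgComp R)) (cobarLetter R) t)) =
        -mul' k _ (TensorProduct.map (twisting R) (twisting R) t) := by
      intro t
      induction t with
      | zero => simp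
      | tmul y z => simp [cobarProj_letter, twisting_signOp]
      | add x y hx hy => simp only [map_add, hx, hy, neg_add]
    rw [cobarD_mul, map_add, map_mul, map_mul, ih, cobarD_letter, conv_apply, h, ← conv_apply,
      conv_twisting]
    simp

theorem quadAug_cobarProj (x : Cobar R) : quadAug R (cobarProj R x) = cobarAug R x := by
  induction x using cobar_induction with
  | add x y hx hy => simp only [map_add, hx, hy]
  | smul r x hx => simp only [map_smul, hx]
  | one => simp only [map_one]
  | snoc i x n c hx hc ih =>
    rw [map_mul, map_mul, map_mul, cobarAug_letter, cobarProj_letter, twisting_apply,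
      quadAug_quadMk]
    have : TensorAlgebra.algebraMapInv (wordComp (c : TensorAlgebra k V) 1) = 0 := by
      have h := algebraMapInv_eq (wordComp (c : TensorAlgebra k V) 1)
      rw [mem_homog.1 (isGrading_wordComp.comp_mem (c : TensorAlgebra k V) 1), single_apply,
        if_neg (by omega)] at h
      exact (TensorAlgebra.algebraMap_eq_zero_iff (M := V) _).1 h
    rw [this, mul_zero, mul_zero]

theorem twisting_coalgMap (c : Coalg R) : twisting R (coalgMap R σ hσ c) = σ (twisting R c) := by
  induction c using grading_coalg.induction with
  | add x y hx hy => simp only [map_add, hx, hy]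
  | hom n x hx =>
    by_cases hn : n = 1
    · rw [twisting_apply, twisting_apply, mem_homog.1 (mem_homog_coalg.1 hx),
        mem_homog.1 (mem_homog_coalg.1 (coalgMap_mem hx)), hn, single_eq_same,
        single_eq_same, coalgMap_coe, quadMk_wordMap]
    · rw [twisting_of_mem hx hn, twisting_of_mem (coalgMap_mem hx) hn, map_zero]

theorem cobarProj_cobarMap (x : Cobar R) :
    cobarProj R (cobarMap R σ hσ x) = σ (cobarProj R x) := by
  induction x using cobar_induction with
  | add x y hx hy => simp only [map_add, hx, hy]
  | smul r x hx => simp only [map_smul, hx]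
  | one => simp only [map_one]
  | snoc i x n c hx hc ih =>
    rw [map_mul, map_mul, map_mul, map_mul, ih, cobarMap_letter, cobarProj_letter,
      cobarProj_letter, twisting_coalgMap]

theorem isAugDGAHom_cobarProj :
    IsAugDGAHom (cobarComp R) (cobarD R) (cobarAug R) (cobarMap R σ hσ)
      (lsingle 0) 0 (quadAug R) σ (cobarProj R) where
  map_mem := cobarProj_mem
  map_d := cobarProj_d
  aug_map := quadAug_cobarProj
  map_σ := cobarProj_cobarMap

/-! ### Diagonalizability of the induced maps -/

section Diagonalizable

theorem iSup_eigenspace_coalgMap (hss : ⨆ μ : k, eigenspace σ.toLinearMap μ = ⊤) :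
    ⨆ μ : k, eigenspace (coalgMap R σ hσ) μ = ⊤ := by
  have h1 : ⨆ μ : k, eigenspace (genMap R σ hσ) μ = ⊤ :=
    iSup_eigenspace_of_injective (quadι_injective R) (quadι_genMap R σ hσ) hss
  have h2 := iSup_eigenspace_tensorAlgebra h1 (wordMap (genMap R σ hσ)) fun m => by simp [wordMap]
  exact iSup_eigenspace_of_injective (f := (coalgSub R).subtype) (Submodule.subtype_injective _)
    (fun x => rfl) h2

theorem iSup_eigenspace_cobarMap (hss : ⨆ μ : k, eigenspace σ.toLinearMap μ = ⊤) :
    ⨆ μ : k, eigenspace (cobarMap R σ hσ).toLinearMap μ = ⊤ := by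
  have h1 : ⨆ μ : k, eigenspace
      (toCoalgBar R ∘ₗ coalgMap R σ hσ ∘ₗ coalgIncl R : Module.End k (CoalgBar R)) μ = ⊤ := by
    refine iSup_eigenspace_of_injective coalgIncl_injective (fun x => ?_)
      (iSup_eigenspace_coalgMap (hσ := hσ) hss)
    rw [comp_apply, comp_apply, coalgIncl_toCoalgBar, counit_coalgMap,
      counit_coalgIncl, zero_smul, sub_zero]
  exact iSup_eigenspace_tensorAlgebra h1 (cobarMap R σ hσ) fun m => by
    rw [← cobarLetter_coalgIncl, cobarMap_letter]; rfl

end Diagonalizable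

end Cobar

section Grading

variable {k : Type u} [Field k] {M : Type v} [AddCommGroup M] [Module k M]
  {N : Type w} [AddCommGroup N] [Module k N]

theorem tmul_ext_of_mem {c : M →ₗ[k] ℕ →₀ M} {c' : N →ₗ[k] ℕ →₀ N} (hc : IsGrading c)
    (hc' : IsGrading c') {Y : Type*} [AddCommMonoid Y] [Module k Y] {F G : M ⊗[k] N →ₗ[k] Y}
    {n : ℕ} {x : M ⊗[k] N} (hx : x ∈ homog (tmulComp c c') n)
    (h : ∀ i j, i + j = n → ∀ y ∈ homog c i, ∀ z ∈ homog c' j, F (y ⊗ₜ[k] z) = G (y ⊗ₜ[k] z)) :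
    F x = G x := by
  have key : ∀ s : M ⊗[k] N, F (tmulComp c c' s n) = G (tmulComp c c' s n) := by
    intro s
    have : F ∘ₗ lapply n ∘ₗ tmulComp c c' = G ∘ₗ lapply n ∘ₗ tmulComp c c' := by
      refine ext_tmul_homog hc hc' fun i j y hy z hz => ?_
      have e1 := mem_homog.1 (tmul_mem hy hz)
      simp only [comp_apply, e1, Finsupp.lapply_apply, single_apply]
      split_ifs with hij
      · exact h i j hij y hy z hz
      · rw [map_zero, map_zero]
    exact LinearMap.congr_fun this s
  have := key x
  rwa [mem_homog.1 hx, single_eq_same] at this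

theorem tmul_mem_of_mem {c : M →ₗ[k] ℕ →₀ M} {c' : N →ₗ[k] ℕ →₀ N} (hc : IsGrading c)
    (hc' : IsGrading c') {Y : Type*} [AddCommGroup Y] [Module k Y] (F : M ⊗[k] N →ₗ[k] Y)
    (P : Submodule k Y) {n : ℕ} {x : M ⊗[k] N} (hx : x ∈ homog (tmulComp c c') n)
    (h : ∀ i j, i + j = n → ∀ y ∈ homog c i, ∀ z ∈ homog c' j, F (y ⊗ₜ[k] z) ∈ P) :
    F x ∈ P := by
  rw [← Submodule.Quotient.mk_eq_zero]
  refine tmul_ext_of_mem (F := P.mkQ ∘ₗ F) (G := 0) hc hc' hx fun i j hij y hy z hz => ?_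
  exact (Submodule.Quotient.mk_eq_zero P).2 (h i j hij y hy z hz)

end Grading

/-! ### From the Koszul dual coalgebra to the bar construction of its cobar construction -/

section BarCobar

variable {k : Type u} [Field k] {V : Type v} [AddCommGroup V] [Module k V]
variable {R : Submodule k (V ⊗[k] V)}
variable {σ : QuadAlg R →ₐ[k] QuadAlg R} {hσ : IsGradedEnd R σ}

/-- The letter `[s⁻¹ c]` of the bar construction of the cobar construction. -/
def barCobarLetter (R : Submodule k (V ⊗[k] V)) : Coalg R →ₗ[k] Bar (cobarAug R) :=
  barLetter (cobarAug R) ∘ₗ cobarLetter R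

theorem barCobarLetter_apply (c : Coalg R) :
    barCobarLetter R c = barLetter (cobarAug R) (cobarLetter R c) := rfl

theorem barCobarLetter_of_zero {c : Coalg R} (hc : c ∈ homog (coalgComp R) 0) :
    barCobarLetter R c = 0 := by
  rw [barCobarLetter_apply, cobarLetter_of_zero hc, map_zero]

theorem cobar_barLetter_mem {i : ℕ} {a : Cobar R} (ha : a ∈ homog (cobarComp R) i) :
    barLetter (cobarAug R) a ∈ homog (barComp (cobarComp R) (cobarAug R)) (i + 1) :=
  (isAugDGA_cobar (R := R) (σ := AlgHom.id k _) (hσ := fun _ _ h => h)).barLetter_mem ha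

theorem barCobarLetter_mem {n : ℕ} {c : Coalg R} (hc : c ∈ homog (coalgComp R) n) :
    barCobarLetter R c ∈ homog (barComp (cobarComp R) (cobarAug R)) n := by
  cases n with
  | zero => rw [barCobarLetter_of_zero hc]; exact zero_mem _
  | succ n => exact cobar_barLetter_mem (cobarLetter_mem hc)

theorem barCobarPart_zero : barCobarPart R 0 = Algebra.linearMap k _ ∘ₗ counit R := rfl

theorem barCobarPart_succ (j : ℕ) :
    barCobarPart R (j + 1) = conv R (barCobarLetter R) (barCobarPart R j) := rfl

theorem barCobarPart_succ' (j : ℕ) :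
    barCobarPart R (j + 1) = conv R (barCobarPart R j) (barCobarLetter R) := by
  induction j with
  | zero => rw [barCobarPart_succ, barCobarPart_zero, counit_conv, conv_counit]
  | succ j ih => rw [barCobarPart_succ, ih, ← conv_assoc, ← barCobarPart_succ, ih]

theorem bar_one_mem : (1 : Bar (cobarAug R)) ∈ homog (barComp (cobarComp R) (cobarAug R)) 0 :=
  one_mem_homog _

theorem barCobarPart_mem (j : ℕ) {n : ℕ} {c : Coalg R} (hc : c ∈ homog (coalgComp R) n) :
    barCobarPart R j c ∈ homog (barComp (cobarComp R) (cobarAug R)) n := by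
  induction j generalizing n c with
  | zero =>
    rw [barCobarPart_zero, comp_apply, Algebra.linearMap_apply,
      Algebra.algebraMap_eq_smul_one]
    cases n with
    | zero => exact smul_mem _ _ bar_one_mem
    | succ n => rw [counit_of_mem hc, zero_smul]; exact zero_mem _
  | succ j ih => exact conv_mem mul_mem_homog (fun n c => barCobarLetter_mem) (fun n c => ih) hc

theorem barCobarPart_eq_zero {j n : ℕ} (hn : n < j) {c : Coalg R}
    (hc : c ∈ homog (coalgComp R) n) : barCobarPart R j c = 0 := by
  induction j generalizing n c with
  | zero => omega
  | succ j ih =>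
    refine comul_ext (F := mul' k _ ∘ₗ
      TensorProduct.map (barCobarLetter R) (barCobarPart R j)) (G := 0) hc ?_
    intro i l hil y hy z hz
    rw [comp_apply, map_tmul, mul'_apply, LinearMap.zero_apply]
    cases i with
    | zero => rw [barCobarLetter_of_zero hy, zero_mul]
    | succ i => rw [ih (by omega) hz, mul_zero]

theorem barCobar_of_mem {n : ℕ} {c : Coalg R} (hc : c ∈ homog (coalgComp R) n) {N : ℕ}
    (hN : n ≤ N) : barCobar R c = ∑ j ∈ Finset.range (N + 1), barCobarPart R j c := by
  rw [barCobar, comp_apply, mem_homog.1 hc]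
  simp only [Finsupp.lsum_single, LinearMap.sum_apply]
  refine Finset.sum_subset (Finset.range_mono (by omega)) fun j _ hj => ?_
  rw [Finset.mem_range] at hj
  exact barCobarPart_eq_zero (by omega) hc

theorem barCobar_mem {n : ℕ} {c : Coalg R} (hc : c ∈ homog (coalgComp R) n) :
    barCobar R c ∈ homog (barComp (cobarComp R) (cobarAug R)) n := by
  rw [barCobar_of_mem hc le_rfl]
  exact Submodule.sum_mem _ fun j _ => barCobarPart_mem j hc

/-- The recursion `W(c) = ε(c) + ∑ [s⁻¹c'] W(c'')` for `W = barCobar`. -/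
theorem barCobar_eq_left : barCobar R =
    Algebra.linearMap k _ ∘ₗ counit R + conv R (barCobarLetter R) (barCobar R) := by
  refine grading_coalg.ext_homog fun n c hc => ?_
  have h : conv R (barCobarLetter R) (barCobar R) c =
      ∑ j ∈ Finset.range (n + 1), barCobarPart R (j + 1) c := by
    have := comul_ext (F := mul' k _ ∘ₗ TensorProduct.map (barCobarLetter R) (barCobar R))
      (G := ∑ j ∈ Finset.range (n + 1), mul' k _ ∘ₗ
        TensorProduct.map (barCobarLetter R) (barCobarPart R j)) hc (by
        intro i l hil y hy z hz
        simp only [comp_apply, LinearMap.sum_apply, map_tmul,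
          mul'_apply, barCobar_of_mem hz (show l ≤ n by omega), Finset.mul_sum])
    rw [LinearMap.sum_apply] at this
    exact this
  rw [barCobar_of_mem hc (Nat.le_succ n), Finset.sum_range_succ', LinearMap.add_apply, h, add_comm]
  rfl

theorem barCobar_eq_right : barCobar R =
    Algebra.linearMap k _ ∘ₗ counit R + conv R (barCobar R) (barCobarLetter R) := by
  refine grading_coalg.ext_homog fun n c hc => ?_
  have h : conv R (barCobar R) (barCobarLetter R) c =
      ∑ j ∈ Finset.range (n + 1), barCobarPart R (j + 1) c := by
    have := comul_ext (F := mul' k _ ∘ₗ TensorProduct.map (barCobar R) (barCobarLetter R))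
      (G := ∑ j ∈ Finset.range (n + 1), mul' k _ ∘ₗ
        TensorProduct.map (barCobarPart R j) (barCobarLetter R)) hc (by
        intro i l hil y hy z hz
        simp only [comp_apply, LinearMap.sum_apply, map_tmul,
          mul'_apply, barCobar_of_mem hy (show i ≤ n by omega), Finset.sum_mul])
    rw [LinearMap.sum_apply] at this
    simp only [barCobarPart_succ']
    exact this
  rw [barCobar_of_mem hc (Nat.le_succ n), Finset.sum_range_succ', LinearMap.add_apply, h, add_comm]
  rfl

theorem barCobar_one : barCobar R (coalgOne R) = 1 := by
  rw [barCobar_of_mem coalgOne_mem le_rfl]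
  simp [barCobarPart_zero, counit_coalgOne]

/-- A map `f` with `f = f * g` for the convolution, where `g` vanishes in degree `0`, is zero. -/
theorem eq_zero_of_conv {A : Type*} [Ring A] [Algebra k A] {f g : Coalg R →ₗ[k] A}
    (hg : ∀ c ∈ homog (coalgComp R) 0, g c = 0) (h : f = conv R f g) : f = 0 := by
  have key : ∀ n, ∀ c ∈ homog (coalgComp R) n, f c = 0 := by
    intro n
    induction n using Nat.strong_induction_on with
    | _ n ih =>
      intro c hc
      rw [h]
      refine comul_ext (F := mul' k _ ∘ₗ TensorProduct.map f g) (G := 0) hc ?_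
      intro i l hil y hy z hz
      rw [comp_apply, map_tmul, mul'_apply, LinearMap.zero_apply]
      cases l with
      | zero => rw [hg z hz, mul_zero]
      | succ l => rw [ih i (by omega) y hy, zero_mul]
  exact grading_coalg.ext_homog fun n c hc => key n c hc

theorem barMap_barCobar (c : Coalg R) : barMap (cobarAug R) (cobarAug R) (cobarMap R σ hσ)
    (barCobar R c) = barCobar R (coalgMap R σ hσ c) := by
  have h1 : barMap (cobarAug R) (cobarAug R) (cobarMap R σ hσ) ∘ₗ barCobar R =
      Algebra.linearMap k _ ∘ₗ counit R +
        conv R (barMap (cobarAug R) (cobarAug R) (cobarMap R σ hσ) ∘ₗ barCobar R)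
          (barCobarLetter R ∘ₗ coalgMap R σ hσ) := by
    ext c
    conv_lhs => rw [barCobar_eq_right]
    simp only [comp_apply, LinearMap.add_apply, map_add, Algebra.linearMap_apply,
      Algebra.algebraMap_eq_smul_one, map_smul, barMap_one, conv_apply]
    congr 1
    generalize comul R c = t
    induction t with
    | zero => simp
    | tmul y z => simp [barMap_mul, barCobarLetter_apply, barMap_letter, cobarMap_letter]
    | add x y hx hy => simp only [map_add, hx, hy]
  have h2 : barCobar R ∘ₗ coalgMap R σ hσ = Algebra.linearMap k _ ∘ₗ counit R +
        conv R (barCobar R ∘ₗ coalgMap R σ hσ) (barCobarLetter R ∘ₗ coalgMap R σ hσ) := by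
    ext c
    conv_lhs => rw [barCobar_eq_right]
    simp only [comp_apply, LinearMap.add_apply, counit_coalgMap, conv_apply,
      comul_coalgMap]
    congr 1
    generalize comul R c = t
    induction t with
    | zero => simp
    | tmul y z => simp
    | add x y hx hy => simp only [map_add, hx, hy]
  have h3 : barMap (cobarAug R) (cobarAug R) (cobarMap R σ hσ) ∘ₗ barCobar R -
      barCobar R ∘ₗ coalgMap R σ hσ = 0 := by
    refine eq_zero_of_conv (g := barCobarLetter R ∘ₗ coalgMap R σ hσ) (fun c hc => ?_) ?_
    · rw [comp_apply, barCobarLetter_of_zero (coalgMap_mem hc)]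
    · conv_lhs => rw [h1, h2]
      rw [add_sub_add_left_eq_sub, sub_eq_add_neg (_ ∘ₗ _), conv_add_left, conv_neg_left,
        sub_eq_add_neg]
  exact LinearMap.congr_fun (sub_eq_zero.1 h3) c

theorem barSign_barCobar (c : Coalg R) : signOp (barComp (cobarComp R) (cobarAug R))
    (barCobar R c) = barCobar R (signOp (coalgComp R) c) := by
  induction c using grading_coalg.induction with
  | hom n c hc => rw [signOp_of_mem hc, signOp_of_mem (barCobar_mem hc), map_smul]
  | add x y hx hy => simp only [map_add, hx, hy]

theorem mul_map_lTensor_comul {A B : Type*} [Ring A] [Algebra k A] [Ring B] [Algebra k B]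
    (f : Coalg R →ₗ[k] A) (g : B →ₗ[k] A) (p q : Coalg R →ₗ[k] B) (t : Coalg R ⊗[k] Coalg R) :
    mul' k A (TensorProduct.map f (g ∘ₗ mul' k B ∘ₗ TensorProduct.map p q)
      ((comul R).lTensor _ t)) =
    mul' k A (TensorProduct.map f (g ∘ₗ conv R p q) t) := by
  induction t with
  | zero => simp
  | tmul y z => simp [conv_apply]
  | add x y hx hy => simp only [map_add, hx, hy]

/-- The map from the Koszul dual coalgebra to the bar construction of its cobar construction lands
in the cycles. -/
theorem barD_barCobar (c : Coalg R) :
    barD (cobarComp R) (cobarD R) (cobarAug R) (barCobar R c) = 0 := by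
  have h := isAugDGA_cobar (R := R) (σ := AlgHom.id k _) (hσ := fun _ _ h => h)
  set D := barD (cobarComp R) (cobarD R) (cobarAug R) with hD
  set τ := signOp (barComp (cobarComp R) (cobarAug R)) with hτ
  set s := barCobarLetter R with hs
  have h1 : D ∘ₗ s = -(barLetter (cobarAug R) ∘ₗ
      conv R (cobarLetter R ∘ₗ signOp (coalgComp R)) (cobarLetter R)) := by
    ext c
    rw [comp_apply, hs, barCobarLetter_apply, hD, h.barD_letter, cobarD_letter]
    rfl
  have h2 : ∀ t : Coalg R ⊗[k] Coalg R,
      D (mul' k _ (TensorProduct.map (conv R (barCobar R) s) s t)) =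
      mul' k _ (TensorProduct.map (D ∘ₗ conv R (barCobar R) s) s t) +
      mul' k _ (TensorProduct.map (τ ∘ₗ conv R (barCobar R) s) (D ∘ₗ s) t) +
      mul' k _ (TensorProduct.map (τ ∘ₗ barCobar R) (barLetter (cobarAug R) ∘ₗ
        mul' k _ ∘ₗ TensorProduct.map (cobarLetter R ∘ₗ signOp (coalgComp R))
          (cobarLetter R)) (TensorProduct.assoc k _ _ _ ((comul R).rTensor _ t))) := by
    intro t
    induction t with
    | zero => simp
    | tmul y z =>
      rw [rTensor_tmul]
      simp only [map_tmul, mul'_apply, comp_apply]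
      rw [hs, barCobarLetter_apply, hD, h.barD_mul_letter, h.barD_letter, mul_neg, ← sub_eq_add_neg]
      congr 1
      rw [conv_apply]
      generalize comul R y = r
      have hadd : ∀ p q, rightCross (cobarComp R) (cobarAug R) (cobarLetter R z) (p + q) =
          rightCross (cobarComp R) (cobarAug R) (cobarLetter R z) p +
          rightCross (cobarComp R) (cobarAug R) (cobarLetter R z) q := by
        intro p q
        simp only [rightCross, add_mul, map_add]
        abel
      induction r with
      | zero => simp [rightCross]
      | tmul p q =>
        rw [map_tmul, mul'_apply, barCobarLetter_apply,
          h.rightCross_mul_letter (cobarAug_letter _) (cobarAug_letter _), cobarSign_letter]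
        simp [hτ]
      | add p q hp hq => simp only [map_add, add_tmul, hadd, hp, hq]
    | add x y hx hy => simp only [map_add, hx, hy]; abel
  have h4 : D ∘ₗ barCobar R = D ∘ₗ s + D ∘ₗ conv R (conv R (barCobar R) s) s := by
    conv_lhs => rw [barCobar_eq_right]
    conv_lhs => rw [barCobar_eq_right, conv_add_left, counit_conv]
    ext c
    simp only [comp_apply, LinearMap.add_apply, map_add, Algebra.linearMap_apply,
      Algebra.algebraMap_eq_smul_one, map_smul, hD, barD_one, smul_zero, zero_add]
    rfl
  -- The boundaries of the letters cancel against the products of adjacent letters; what remains is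
  -- the boundary of the part of `barCobar` without its last letter.
  have h5 : D ∘ₗ barCobar R = conv R (D ∘ₗ barCobar R) s := by
    have e1 : D ∘ₗ conv R (barCobar R) s = D ∘ₗ barCobar R := by
      conv_rhs => rw [barCobar_eq_right]
      ext c
      simp only [comp_apply, LinearMap.add_apply, map_add, Algebra.linearMap_apply,
        Algebra.algebraMap_eq_smul_one, map_smul, hD, barD_one, smul_zero, zero_add]
      rfl
    have e2 : τ ∘ₗ barCobar R = Algebra.linearMap k _ ∘ₗ counit R +
        τ ∘ₗ conv R (barCobar R) s := by
      conv_lhs => rw [barCobar_eq_right]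
      ext c
      simp only [comp_apply, LinearMap.add_apply, map_add, Algebra.linearMap_apply,
        Algebra.algebraMap_eq_smul_one, map_smul, hτ, barSign_one]
      rfl
    have e3 : conv R (τ ∘ₗ conv R (barCobar R) s) (D ∘ₗ s) =
        conv R (τ ∘ₗ barCobar R) (D ∘ₗ s) - D ∘ₗ s := by
      rw [e2, conv_add_left, counit_conv, add_sub_cancel_left]
    have e4 : conv R (τ ∘ₗ barCobar R) (D ∘ₗ s) = -conv R (τ ∘ₗ barCobar R)
        (barLetter (cobarAug R) ∘ₗ
          conv R (cobarLetter R ∘ₗ signOp (coalgComp R)) (cobarLetter R)) := by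
      rw [h1, conv_neg_right]
    ext c
    conv_lhs => rw [h4]
    change (D ∘ₗ s) c + D (mul' k _ (TensorProduct.map (conv R (barCobar R) s) s
      (comul R c))) = _
    rw [h2, comul_coassoc, e1, ← conv_apply, ← conv_apply, e3, LinearMap.sub_apply, e4,
      LinearMap.neg_apply]
    rw [mul_map_lTensor_comul, ← conv_apply]
    abel
  have h6 := eq_zero_of_conv (fun c hc => barCobarLetter_of_zero hc) h5
  exact LinearMap.congr_fun h6 c

end BarCobar

/-! ### The map `p₂` and the boundaries -/

section BarCobarAction

variable {k : Type u} [Field k] {V : Type v} [AddCommGroup V] [Module k V]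
variable {R : Submodule k (V ⊗[k] V)}
variable {σ : QuadAlg R →ₐ[k] QuadAlg R} {hσ : IsGradedEnd R σ}

/-- The map `y ⊗ z ↦ g(z) f(y)`. -/
def swapMul {A : Type*} [Ring A] [Algebra k A] (f g : Coalg R →ₗ[k] A) :
    Coalg R ⊗[k] Coalg R →ₗ[k] A :=
  mul' k A ∘ₗ (TensorProduct.comm k A A).toLinearMap ∘ₗ TensorProduct.map f g

@[simp] theorem swapMul_tmul {A : Type*} [Ring A] [Algebra k A] (f g : Coalg R →ₗ[k] A)
    (y z : Coalg R) : swapMul f g (y ⊗ₜ[k] z) = g z * f y := rfl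

/-- The right multiplication by `barCobar c`. -/
def barCobarMul (R : Submodule k (V ⊗[k] V)) : Coalg R →ₗ[k] Module.End k (CH (cobarAug R)) :=
  rightMul (cobarAug R) ∘ₗ barCobar R

theorem barCobarMul_apply (c : Coalg R) (η : CH (cobarAug R)) :
    barCobarMul R c η = rightMul (cobarAug R) (barCobar R c) η := rfl

/-- The left multiplication `η ↦ (-1) ^ (|c| |η|) (s⁻¹ c) η`. -/
def signedLeft (R : Submodule k (V ⊗[k] V)) : Coalg R →ₗ[k] Module.End k (CH (cobarAug R)) :=
  Finsupp.lsum k (fun i : ℕ => mulRight k (chSign (cobarComp R) (cobarAug R) ^ i) ∘ₗ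
    leftMul (cobarAug R) ∘ₗ cobarLetter R) ∘ₗ coalgComp R

theorem signedLeft_of_mem {i : ℕ} {c : Coalg R} (hc : c ∈ homog (coalgComp R) i)
    (η : CH (cobarAug R)) : signedLeft R c η =
      leftMul (cobarAug R) (cobarLetter R c) ((chSign (cobarComp R) (cobarAug R) ^ i) η) := by
  rw [signedLeft, comp_apply, mem_homog.1 hc, Finsupp.lsum_single]
  rfl

theorem barCobar_apply_left (c : Coalg R) : barCobar R c = counit R c • 1 +
    mul' k _ (TensorProduct.map (barCobarLetter R) (barCobar R) (comul R c)) := by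
  conv_lhs => rw [barCobar_eq_left]
  rw [← Algebra.algebraMap_eq_smul_one]
  rfl

theorem barCobar_apply_right (c : Coalg R) : barCobar R c = counit R c • 1 +
    mul' k _ (TensorProduct.map (barCobar R) (barCobarLetter R) (comul R c)) := by
  conv_lhs => rw [barCobar_eq_right]
  rw [← Algebra.algebraMap_eq_smul_one]
  rfl

section General

variable {E : Type w} [Ring E] [Algebra k E]
variable {c : E →ₗ[k] ℕ →₀ E} {d : E →ₗ[k] E} {ε : E →ₐ[k] k} {τ : E →ₐ[k] E}

theorem IsAugDGA.bInternal_rightMul (h : IsAugDGA c d ε τ) (t : Bar ε) (η : CH ε) :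
    bInternal c d ε (rightMul ε t η) =
      rightMul ε t (bInternal c d ε η) - rightMul ε (barInt c d ε t) (chSign c ε η) := by
  induction η using TensorProduct.induction_on with
  | zero => simp
  | tmul x w =>
    simp only [rightMul_tmul, bInternal_tmul, barInt_mul h, map_sub, chSign_tmul,
      tmul_add]
    abel
  | add x y hx hy => simp only [map_add, hx, hy]; abel

theorem IsAugDGA.bFirst_rightMul (h : IsAugDGA c d ε τ) (a : E) (t : Bar ε) (η : CH ε) :
    bFirst c ε τ (rightMul ε t (letterMul ε a η)) =
      rightMul ε t (bFirst c ε τ (letterMul ε a η)) := by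
  induction η using TensorProduct.induction_on with
  | zero => simp
  | add x y hx hy => simp only [map_add, hx, hy]
  | tmul x w =>
    induction w using h.bar_cons_cases with
    | add y z hy hz => simp only [tmul_add, map_add, hy, hz]
    | smul r y hy => simp only [tmul_smul, map_smul, hy]
    | one =>
      have h1 := bFirst_tmul_letter (c := c) (ε := ε) (σ := τ) x a 1
      rw [mul_one] at h1
      rw [letterMul_tmul, rightMul_tmul, one_mul, bFirst_tmul_letter, h1, rightMul_tmul, one_mul]
    | cons i b w hb h0 =>
      simp only [letterMul_tmul, rightMul_tmul, mul_assoc, bFirst_tmul_letter]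

theorem IsAugDGA.bOpen_rightMul (h : IsAugDGA c d ε τ) {a : E} (ha : ε a = 0) (t : Bar ε)
    (η : CH ε) : (bFirst c ε τ + bMiddle c ε) (rightMul ε t (letterMul ε a η)) =
      rightMul ε t (rightAct c ε τ a (chSign c ε η)) +
        rightMul ε (barMid c ε (barLetter ε a * t)) (chSign c ε η) := by
  have h1 := h.bOpen_letterMul a η
  rw [ha, zero_smul, sub_zero] at h1
  rw [← h1, LinearMap.add_apply, LinearMap.add_apply, map_add, h.bFirst_rightMul, add_assoc]
  congr 1
  induction η using TensorProduct.induction_on with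
  | zero => simp
  | tmul x w =>
    simp only [letterMul_tmul, rightMul_tmul, bMiddle_tmul, chSign_tmul, mul_assoc,
      h.barMid_mul ha]
    have h2 := h.barMid_mul ha w 1
    rw [mul_one, barMid_letter, mul_zero, add_zero, mul_one] at h2
    rw [h2, ← tmul_add]
    congr 1
    rw [add_mul, mul_assoc]
    abel
  | add x y hx hy =>
    rw [map_add, map_add, map_add, map_add, map_add, map_add, map_add, hx, hy]
    · abel
    · exact (h.bOpen_letterMul a y).trans (by rw [ha, zero_smul, sub_zero])
    · exact (h.bOpen_letterMul a x).trans (by rw [ha, zero_smul, sub_zero])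

end General

/-- The products with the first letters of `barCobar c` combine to the right action of these
letters, followed by `barCobar`. -/
theorem bOpen_barCobarMul (c : Coalg R) (η : CH (cobarAug R)) :
    (bFirst (cobarComp R) (cobarAug R) (cobarMap R σ hσ) +
    bMiddle (cobarComp R) (cobarAug R)) (barCobarMul R c η) =
    counit R c • (bFirst (cobarComp R) (cobarAug R) (cobarMap R σ hσ) +
      bMiddle (cobarComp R) (cobarAug R)) η +
    swapMul (rightAct (cobarComp R) (cobarAug R) (cobarMap R σ hσ) ∘ₗ cobarLetter R)
      (barCobarMul R) (comul R c) (chSign (cobarComp R) (cobarAug R) η) +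
    rightMul (cobarAug R) (barMid (cobarComp R) (cobarAug R) (barCobar R c))
      (chSign (cobarComp R) (cobarAug R) η) := by
  have h := isAugDGA_cobar (R := R) (σ := σ) (hσ := hσ)
  rw [barCobarMul_apply]
  conv_lhs => rw [barCobar_apply_left]
  conv_rhs => rw [barCobar_apply_left]
  simp only [map_add, map_smul, LinearMap.add_apply _ (rightMul _ _), LinearMap.smul_apply,
    rightMul_one, barMid_one, smul_zero, zero_add]
  rw [add_assoc]
  congr 1
  generalize comul R c = t
  induction t with
  | zero => simp
  | tmul y z =>
    simp only [map_tmul, mul'_apply, swapMul_tmul, Module.End.mul_apply,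
      rightMul_mul, comp_apply, barCobarMul_apply]
    exact h.bOpen_rightMul (cobarAug_letter y) _ η
  | add x y hx hy => simp only [map_add, LinearMap.add_apply] at hx hy ⊢; rw [hx, hy]; abel

/-- The last letter of `barCobar c` moves to the front. -/
theorem bLast_barCobarMul (c : Coalg R) (η : CH (cobarAug R)) :
    bLast (cobarComp R) (cobarAug R) (barCobarMul R c η) =
    counit R c • bLast (cobarComp R) (cobarAug R) η +
      swapMul (barCobarMul R) (signedLeft R) (comul R c) η := by
  have h := isAugDGA_cobar (R := R) (σ := AlgHom.id k _) (hσ := fun _ _ h => h)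
  induction c using grading_coalg.induction with
  | hom n c hc =>
    rw [barCobarMul_apply, barCobar_apply_right]
    simp only [map_add, map_smul, LinearMap.add_apply, LinearMap.smul_apply, rightMul_one]
    congr 1
    refine comul_ext (F := bLast (cobarComp R) (cobarAug R) ∘ₗ LinearMap.applyₗ η ∘ₗ
      rightMul (cobarAug R) ∘ₗ mul' k _ ∘ₗ
        TensorProduct.map (barCobar R) (barCobarLetter R))
      (G := LinearMap.applyₗ η ∘ₗ swapMul (barCobarMul R) (signedLeft R)) hc ?_
    intro i j hij y hy z hz
    simp only [comp_apply, map_tmul, mul'_apply,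
      LinearMap.applyₗ_apply_apply, swapMul_tmul, Module.End.mul_apply, rightMul_mul,
      signedLeft_of_mem hz, barCobarMul_apply]
    cases j with
    | zero => simp [barCobarLetter_of_zero hz, cobarLetter_of_zero hz]
    | succ j =>
      rw [barCobarLetter_apply, ← letterMul_eq, h.bLast_letterMul (cobarLetter_mem hz),
        cobarAug_letter, zero_smul, sub_zero]
  | add x y hx hy =>
    simp only [map_add, LinearMap.add_apply, add_smul] at hx hy ⊢
    rw [hx, hy]
    abel

/-- The boundary of `η · barCobar c`. -/
theorem hochB_barCobar (c : Coalg R) (η : CH (cobarAug R)) :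
    bCobar R σ hσ (barCobarMul R c η) =
      barCobarMul R c (bInternal (cobarComp R) (cobarD R) (cobarAug R) η) +
      counit R c • bExternal (cobarComp R) (cobarAug R) (cobarMap R σ hσ) η +
      swapMul (rightAct (cobarComp R) (cobarAug R) (cobarMap R σ hσ) ∘ₗ cobarLetter R)
        (barCobarMul R) (comul R c) (chSign (cobarComp R) (cobarAug R) η) -
      swapMul (barCobarMul R) (signedLeft R) (comul R c) η := by
  have h := isAugDGA_cobar (R := R) (σ := σ) (hσ := hσ)
  have hD := barD_barCobar (R := R) c
  rw [barD, LinearMap.sub_apply, sub_eq_zero] at hD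
  have hInt := h.bInternal_rightMul (barCobar R c) η
  rw [bCobar, hochB, LinearMap.sub_apply, add_assoc, LinearMap.add_apply, bOpen_barCobarMul,
    bLast_barCobarMul,
    barCobarMul_apply, hInt, hD]
  simp only [bExternal, LinearMap.sub_apply, LinearMap.add_apply, smul_sub, smul_add,
    barCobarMul_apply]
  abel

theorem p₂_tmul (u : Cobar R) (c : Coalg R) : p₂ R (u ⊗ₜ[k] c) = u ⊗ₜ[k] barCobar R c := rfl

theorem barCobarMul_tmul_one (u : Cobar R) (c : Coalg R) :
    barCobarMul R c (u ⊗ₜ[k] 1) = p₂ R (u ⊗ₜ[k] c) := by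
  rw [barCobarMul_apply, rightMul_tmul, one_mul, p₂_tmul]

theorem p₂_signs (j : ℕ) (t : CoCH R) : p₂ R
    (((TensorProduct.map (signOp (cobarComp R)) (signOp (coalgComp R)) : Module.End k _) ^ j) t) =
    (chSign (cobarComp R) (cobarAug R) ^ j) (p₂ R t) := by
  have h1 : ∀ t, p₂ R (TensorProduct.map (signOp (cobarComp R)) (signOp (coalgComp R)) t) =
      chSign (cobarComp R) (cobarAug R) (p₂ R t) := by
    intro t
    induction t with
    | zero => simp
    | tmul u c => rw [map_tmul, p₂_tmul, p₂_tmul, chSign_tmul, barSign_barCobar]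
    | add x y hx hy => simp only [map_add, hx, hy]
  induction j generalizing t with
  | zero => rfl
  | succ j ih => rw [pow_succ, pow_succ, Module.End.mul_apply, Module.End.mul_apply, ih, h1]

theorem p₂_leftMul (a : Cobar R) (t : CoCH R) : p₂ R ((mulLeft k a).rTensor _ t) =
    leftMul (cobarAug R) a (p₂ R t) := by
  induction t using TensorProduct.induction_on with
  | zero => simp
  | tmul u c => simp [p₂_tmul]
  | add x y hx hy => simp only [map_add, hx, hy]

/-- The terms `u s⁻¹σ(c') ⊗ c''` of the boundary of `u ⊗ c` under `p₂`. -/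
theorem p₂_cobFirst (u : Cobar R) (c : Coalg R) : p₂ R (cobFirst R σ hσ (u ⊗ₜ[k] c)) =
    swapMul (rightAct (cobarComp R) (cobarAug R) (cobarMap R σ hσ) ∘ₗ cobarLetter R)
        (barCobarMul R) (comul R c) (chSign (cobarComp R) (cobarAug R) (u ⊗ₜ[k] 1)) := by
  have h := isAugDGA_cobar (R := R) (σ := σ) (hσ := hσ)
  simp only [cobFirst, comp_apply, lTensor_tmul]
  generalize comul R c = t
  induction t with
  | zero => simp
  | tmul y z =>
    simp only [LinearEquiv.coe_coe, assoc_symm_tmul, map_tmul,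
      comp_apply, mul'_apply, id_apply, swapMul_tmul,
      Module.End.mul_apply, chSign_tmul, barSign_one, h.rightAct_tmul_one, barCobarMul_tmul_one,
      cobarMap_letter]
  | add x y hx hy => simp only [map_add, tmul_add, LinearMap.add_apply, hx, hy]

theorem cobLast_tmul_of_mem (u : Cobar R) {y z : Coalg R} {j : ℕ}
    (hz : z ∈ homog (coalgComp R) j) : (TensorProduct.map
      (mul' k (Cobar R) ∘ₗ TensorProduct.map (cobarLetter R) LinearMap.id)
      LinearMap.id) ((TensorProduct.assoc k _ _ _).symm
        (koszulMove (TensorProduct.map (signOp (cobarComp R)) (signOp (coalgComp R))) (coalgComp R)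
          ((u ⊗ₜ[k] y) ⊗ₜ[k] z))) =
      (mulLeft k (cobarLetter R z)).rTensor (Coalg R)
        (((TensorProduct.map (signOp (cobarComp R)) (signOp (coalgComp R)) : Module.End k _) ^ j)
          (u ⊗ₜ[k] y)) := by
  rw [koszulMove_tmul _ hz]
  generalize (TensorProduct.map (signOp (cobarComp R)) (signOp (coalgComp R)) ^ j :
    Module.End k _) (u ⊗ₜ[k] y) = t
  induction t with
  | zero => simp
  | tmul y z => simp
  | add x y hx hy => simp only [map_add, tmul_add, hx, hy]

/-- The terms `s⁻¹c'' u ⊗ c'` of the boundary of `u ⊗ c` under `p₂`. -/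
theorem p₂_cobLast (u : Cobar R) (c : Coalg R) : p₂ R (cobLast R (u ⊗ₜ[k] c)) =
    swapMul (barCobarMul R) (signedLeft R) (comul R c) (u ⊗ₜ[k] 1) := by
  simp only [cobLast, comp_apply, lTensor_tmul]
  have key : p₂ R ∘ₗ (TensorProduct.map
      (mul' k (Cobar R) ∘ₗ TensorProduct.map (cobarLetter R) LinearMap.id)
      LinearMap.id) ∘ₗ (TensorProduct.assoc k _ _ _).symm.toLinearMap ∘ₗ
        koszulMove (TensorProduct.map (signOp (cobarComp R)) (signOp (coalgComp R)))
          (coalgComp R) ∘ₗ (TensorProduct.assoc k _ _ _).symm.toLinearMap ∘ₗ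
          TensorProduct.mk k _ _ u =
      LinearMap.applyₗ (u ⊗ₜ[k] 1) ∘ₗ swapMul (barCobarMul R) (signedLeft R) := by
    refine ext_tmul_homog grading_coalg grading_coalg fun i j y hy z hz => ?_
    have e := cobLast_tmul_of_mem u (y := y) hz
    simp only [comp_apply, TensorProduct.mk_apply, LinearEquiv.coe_coe,
      assoc_symm_tmul] at e ⊢
    rw [e, p₂_leftMul, p₂_signs, LinearMap.applyₗ_apply_apply, swapMul_tmul, Module.End.mul_apply,
      signedLeft_of_mem hz, barCobarMul_tmul_one]
  exact LinearMap.congr_fun key (comul R c)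

/-- The map `p₂` is a morphism of complexes. -/
theorem p₂_coB (x : CoCH R) : p₂ R (coB R σ hσ x) = bCobar R σ hσ (p₂ R x) := by
  induction x using TensorProduct.induction_on with
  | zero => simp
  | add x y hx hy => simp only [map_add, hx, hy]
  | tmul u c =>
    rw [← barCobarMul_tmul_one, hochB_barCobar, bExternal_tmul_one, smul_zero, add_zero,
      bInternal_tmul_one, barCobarMul_tmul_one, ← p₂_cobFirst, ← p₂_cobLast, coB,
      LinearMap.sub_apply, LinearMap.add_apply, map_sub, map_add]
    rfl

end BarCobarAction

/-! ### Recursive descriptions of the rotations and of the homotopy -/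

section Recursion

variable {k : Type u} [Field k] {V : Type v} [AddCommGroup V] [Module k V]
variable {R : Submodule k (V ⊗[k] V)}
variable {σ : QuadAlg R →ₐ[k] QuadAlg R} {hσ : IsGradedEnd R σ}

theorem eq_toCoalgBar_of_mem {l : ℕ} {m : CoalgBar R}
    (hm : m ∈ homog (regrade (· - 1) (coalgBarComp R)) l) :
    ∃ c ∈ homog (coalgComp R) (l + 1), m = toCoalgBar R c := by
  have key : ∀ (m : CoalgBar R) (q : ℕ), coalgIncl R (regrade (· - 1) (coalgBarComp R) m q) =
      coalgComp R (coalgIncl R m) (q + 1) := by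
    intro m q
    induction span_toCoalgBar m using span_induction with
    | mem m hm =>
      obtain ⟨n, c, hc, rfl⟩ := hm
      have h1 : toCoalgBar R c ∈ homog (regrade (· - 1) (coalgBarComp R)) n :=
        regrade_mem (· - 1) (toCoalgBar_mem hc)
      rw [mem_homog.1 h1, coalgIncl_toCoalgBar_of_mem hc, mem_homog.1 hc, single_apply,
        single_apply]
      by_cases hn : n = q
      · rw [if_pos hn, if_pos (by omega), coalgIncl_toCoalgBar_of_mem hc]
      · rw [if_neg hn, if_neg (by omega), map_zero]
    | zero => simp
    | add x y _ _ hx hy => simp only [map_add, Finsupp.add_apply, hx, hy]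
    | smul r x _ hx => simp only [map_smul, Finsupp.smul_apply, hx]
  have h1 := key m l
  rw [mem_homog.1 hm, single_eq_same] at h1
  refine ⟨coalgIncl R m, ?_, (toCoalgBar_coalgIncl m).symm⟩
  rw [h1]
  exact grading_coalg.comp_mem _ _

theorem split_mem {p : ℕ} {y : Cobar R} (hy : y ∈ homog (cobarComp R) p) :
    split y ∈ homog (tmulComp (cobarComp R)
      (tmulComp (regrade (· - 1) (coalgBarComp R)) (cobarComp R))) p := by
  refine cobar_degree_induction split (homog (tmulComp (cobarComp R)
    (tmulComp (regrade (· - 1) (coalgBarComp R)) (cobarComp R)))) ?_ ?_ hy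
  · rw [split_one]; exact zero_mem _
  · intro i x n c hx hc ih
    rw [cobarLetter, comp_apply, split_mul_ι]
    have hm : toCoalgBar R c ∈ homog (regrade (· - 1) (coalgBarComp R)) n :=
      regrade_mem (· - 1) (toCoalgBar_mem hc)
    refine add_mem ?_ ?_
    · refine tmul_mem_of_mem grading_cobar ((grading_coalgBar.regrade _).tmul grading_cobar) _ _ ih
        fun a q hq y hy r hr => ?_
      rw [lTensor_tmul]
      have h1 : (mulRight k (TensorAlgebra.ι k (toCoalgBar R c))).lTensor (CoalgBar R) r ∈
          homog (tmulComp (regrade (· - 1) (coalgBarComp R)) (cobarComp R)) (q + n) := by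
        refine tmul_mem_of_mem (grading_coalgBar.regrade _) grading_cobar _ _ hr
          fun a' q' hq' m hm' z hz => ?_
        rw [lTensor_tmul, ← hq', add_assoc]
        exact tmul_mem hm' (cobar_mul_mem hz (cobarLetter_mem hc))
      rw [← hq, add_assoc]
      exact tmul_mem hy h1
    · exact tmul_mem hx (tmul_mem hm one_mem_cobar)

/-- Two linear maps agree on `split y` if they agree on the triples of homogeneous elements whose
total degree is that of `y`. -/
theorem split_ext {Y : Type*} [AddCommGroup Y] [Module k Y]
    {F G : Cobar R ⊗[k] (CoalgBar R ⊗[k] Cobar R) →ₗ[k] Y} {p : ℕ} {y : Cobar R}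
    (hy : y ∈ homog (cobarComp R) p)
    (h : ∀ i l j, i + (l + j) = p → ∀ a ∈ homog (cobarComp R) i,
      ∀ c ∈ homog (coalgComp R) (l + 1), ∀ z ∈ homog (cobarComp R) j,
      F (a ⊗ₜ[k] (toCoalgBar R c ⊗ₜ[k] z)) = G (a ⊗ₜ[k] (toCoalgBar R c ⊗ₜ[k] z))) :
    F (split y) = G (split y) := by
  refine tmul_ext_of_mem grading_cobar ((grading_coalgBar.regrade _).tmul grading_cobar)
    (split_mem hy) fun i q hq a ha r hr => ?_
  refine tmul_ext_of_mem (F := F ∘ₗ TensorProduct.mk k _ _ a) (G := G ∘ₗ TensorProduct.mk k _ _ a)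
    (grading_coalgBar.regrade _) grading_cobar hr fun l j hl m hm z hz => ?_
  obtain ⟨c, hc, rfl⟩ := eq_toCoalgBar_of_mem hm
  exact h i l j (by omega) a ha c hc z hz

theorem coalgBarSign {l : ℕ} {c : Coalg R} (hc : c ∈ homog (coalgComp R) l) :
    signOp (coalgBarComp R) (toCoalgBar R c) = (-1 : k) ^ l • toCoalgBar R c :=
  signOp_of_mem (toCoalgBar_mem hc)

/-- The part of `rotate` after singling out a letter. -/
def rotateCore (R : Submodule k (V ⊗[k] V)) (σ : QuadAlg R →ₐ[k] QuadAlg R)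
    (hσ : IsGradedEnd R σ) (u : Cobar R) :
    Cobar R ⊗[k] (CoalgBar R ⊗[k] Cobar R) →ₗ[k] CoCH R :=
  (mul' k (Cobar R)).rTensor _ ∘ₗ
  (TensorProduct.assoc k _ _ _).symm.toLinearMap ∘ₗ
  koszulMove (TensorProduct.map (signOp (cobarComp R)) (signOp (coalgComp R))) (cobarComp R) ∘ₗ
  TensorProduct.map
    (TensorProduct.map
      (mul' k (Cobar R) ∘ₗ
        TensorProduct.map LinearMap.id ((cobarMap R σ hσ).toLinearMap ∘ₗ signOp (cobarComp R)))
      (coalgIncl R))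
    LinearMap.id ∘ₗ
  (TensorProduct.assoc k _ _ _).symm.toLinearMap ∘ₗ
  (TensorProduct.assoc k _ _ _).symm.toLinearMap ∘ₗ
  TensorProduct.mk k _ _ u

theorem rotate_tmul (u y : Cobar R) :
    rotate R σ hσ (u ⊗ₜ[k] y) = rotateCore R σ hσ u (split y) := rfl

theorem rotate_tmul_one (u : Cobar R) : rotate R σ hσ (u ⊗ₜ[k] 1) = 0 := by
  rw [rotate_tmul, split_one, map_zero]

theorem rotateCore_apply {s : k} {u : Cobar R} (hu : signOp (cobarComp R) u = s • u)
    {i l j : ℕ} {a z : Cobar R} {c : Coalg R} (ha : a ∈ homog (cobarComp R) i)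
    (hc : c ∈ homog (coalgComp R) (l + 1)) (hz : z ∈ homog (cobarComp R) j) :
    rotateCore R σ hσ u (a ⊗ₜ[k] (toCoalgBar R c ⊗ₜ[k] z)) =
      ((-1 : k) ^ i * (s * (-1) ^ (i + (l + 1))) ^ j) •
        (z * (u * cobarMap R σ hσ a)) ⊗ₜ[k] c := by
  have h1 : TensorProduct.map (signOp (cobarComp R)) (signOp (coalgComp R))
      ((u * cobarMap R σ hσ a) ⊗ₜ[k] c) =
      (s * (-1) ^ (i + (l + 1))) • ((u * cobarMap R σ hσ a) ⊗ₜ[k] c) := by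
    rw [map_tmul, cobarSign_mul, hu, signOp_of_mem (cobarMap_mem ha),
      signOp_of_mem hc, smul_mul_smul_comm, smul_tmul_smul, pow_add _ i (l + 1),
      mul_assoc]
  simp only [rotateCore, comp_apply, TensorProduct.mk_apply, LinearEquiv.coe_coe,
    assoc_symm_tmul, map_tmul, mul'_apply, id_apply,
    AlgHom.toLinearMap_apply, signOp_of_mem ha, map_smul, mul_smul_comm,
    coalgIncl_toCoalgBar_of_mem hc]
  rw [koszulMove_tmul _ hz]
  simp only [← smul_tmul', map_smul, pow_apply_of_eq_smul h1, tmul_smul,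
    assoc_symm_tmul, rTensor_tmul, mul'_apply, smul_smul]

/-- The rotations of a word with a given last letter. -/
theorem rotate_mul_letter {s : k} {u : Cobar R} (hu : signOp (cobarComp R) u = s • u)
    {p n : ℕ} {y : Cobar R} {c : Coalg R} (hy : y ∈ homog (cobarComp R) p)
    (hc : c ∈ homog (coalgComp R) (n + 1)) :
    rotate R σ hσ (u ⊗ₜ[k] (y * cobarLetter R c)) =
      (-1 : k) ^ p • (u * cobarMap R σ hσ y) ⊗ₜ[k] c +
      ((-1 : k) ^ (n * (p + 1)) * s ^ n) •
        rotate R σ hσ ((cobarLetter R c * u) ⊗ₜ[k] y) := by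
  have hx := cobarLetter_mem hc
  have hxu : signOp (cobarComp R) (cobarLetter R c * u) =
      ((-1) ^ n * s) • (cobarLetter R c * u) := by
    rw [cobarSign_mul, hu, signOp_of_mem hx, smul_mul_smul_comm]
  have h1 : split (y * cobarLetter R c) =
      ((mulRight k (cobarLetter R c)).lTensor (CoalgBar R)).lTensor _ (split y) +
        y ⊗ₜ[k] (toCoalgBar R c ⊗ₜ[k] 1) := split_mul_ι y (toCoalgBar R c)
  rw [rotate_tmul, h1, map_add, rotateCore_apply hu hy hc one_mem_cobar, add_comm]
  congr 1
  · rw [pow_zero, mul_one, one_mul]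
  · refine split_ext (F := rotateCore R σ hσ u ∘ₗ
      ((mulRight k (cobarLetter R c)).lTensor (CoalgBar R)).lTensor _)
      (G := ((-1 : k) ^ (n * (p + 1)) * s ^ n) • rotateCore R σ hσ (cobarLetter R c * u)) hy ?_
    rintro i l j rfl a ha c' hc' z hz
    simp only [comp_apply, lTensor_tmul, mulRight_apply,
      LinearMap.smul_apply]
    rw [rotateCore_apply hu ha hc' (cobar_mul_mem hz hx), rotateCore_apply hxu ha hc' hz, smul_smul,
      mul_assoc z, mul_assoc (cobarLetter R c)]
    congr 1
    rcases neg_one_pow_eq_or k i with hi | hi <;> rcases neg_one_pow_eq_or k l with hl | hl <;>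
      rcases neg_one_pow_eq_or k j with hj | hj <;> rcases neg_one_pow_eq_or k n with hn | hn <;>
      simp only [pow_add, pow_mul, mul_add, hi, hl, hj, hn, one_pow, pow_one,
        neg_mul, mul_neg, mul_one, neg_neg, one_mul] <;> simp only [neg_pow s, hj, hn, mul_comm] <;>
        ring

/-- The part of `homotopy` after singling out a letter of the last entry. -/
def homotopyCore (R : Submodule k (V ⊗[k] V)) (ω : CH (cobarAug R)) :
    Cobar R ⊗[k] (CoalgBar R ⊗[k] Cobar R) →ₗ[k] CH (cobarAug R) :=
  TensorProduct.map
    (mul' k (Cobar R))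
    (mul' k (Bar (cobarAug R)) ∘ₗ
      TensorProduct.map LinearMap.id
        (mul' k (Bar (cobarAug R)) ∘ₗ
          TensorProduct.map (barLetter (cobarAug R)) (barCobar R ∘ₗ coalgIncl R))) ∘ₗ
  (TensorProduct.assoc k _ _ _).symm.toLinearMap ∘ₗ
  (TensorProduct.assoc k _ _ _).toLinearMap.lTensor _ ∘ₗ
  koszulMove
    (TensorProduct.map
      (TensorProduct.map (signOp (cobarComp R)) (signOp (barComp (cobarComp R) (cobarAug R))))
      (TensorProduct.map (signOp (cobarComp R)) (signOp (coalgBarComp R))))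
    (cobarComp R) ∘ₗ
  TensorProduct.map
    (TensorProduct.map
      (TensorProduct.map (-signOp (cobarComp R)) (signOp (barComp (cobarComp R) (cobarAug R))))
      (TensorProduct.map (signOp (cobarComp R)) LinearMap.id))
    (signOp (cobarComp R)) ∘ₗ
  (TensorProduct.assoc k _ _ _).symm.toLinearMap ∘ₗ TensorProduct.mk k _ _ ω ∘ₗ
  (TensorProduct.assoc k _ _ _).symm.toLinearMap

theorem homotopy_tmul_one (u : Cobar R) : homotopy R (u ⊗ₜ[k] 1) = 0 := by
  rw [homotopy]
  simp only [comp_apply, splitLast, lTensor_tmul, lastLetter_one,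
    tmul_zero, map_zero]

theorem homotopy_letterMul (y : Cobar R) (ω : CH (cobarAug R)) :
    homotopy R (letterMul (cobarAug R) y ω) = homotopyCore R ω (split y) := by
  have h1 : splitLast R (letterMul (cobarAug R) y ω) =
      (TensorProduct.assoc k _ _ _).symm
        (ω ⊗ₜ[k] (TensorProduct.assoc k _ _ _).symm (split y)) := by
    induction ω using TensorProduct.induction_on with
    | zero => simp
    | tmul x w =>
      simp only [letterMul_tmul, barLetter, comp_apply, splitLast, lTensor_tmul,
        lastLetter_mul_ι, LinearEquiv.coe_coe, assoc_symm_tmul,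
        map_tmul, id_apply, augIncl_toAug, map_sub, map_smul, split_one,
        smul_zero, sub_zero]
    | add x y hx hy => simp only [map_add, add_tmul, hx, hy]
  rw [homotopy]
  simp only [comp_apply]
  rw [h1]
  rfl

theorem homotopyCore_apply {s : k} {ω : CH (cobarAug R)}
    (hω : chSign (cobarComp R) (cobarAug R) ω = s • ω)
    {i l j : ℕ} {a z : Cobar R} {c : Coalg R} (ha : a ∈ homog (cobarComp R) i)
    (hc : c ∈ homog (coalgComp R) (l + 1)) (hz : z ∈ homog (cobarComp R) j) :
    homotopyCore R ω (a ⊗ₜ[k] (toCoalgBar R c ⊗ₜ[k] z)) =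
      -((-1 : k) ^ (i + j) * s * (s * (-1) ^ (i + (l + 1))) ^ j) •
        leftMul (cobarAug R) z (barCobarMul R c (letterMul (cobarAug R) a ω)) := by
  have h0 : TensorProduct.map (-signOp (cobarComp R))
      (signOp (barComp (cobarComp R) (cobarAug R))) ω = -s • ω := by
    have e : ∀ ω : CH (cobarAug R), TensorProduct.map (-signOp (cobarComp R))
        (signOp (barComp (cobarComp R) (cobarAug R))) ω =
        -chSign (cobarComp R) (cobarAug R) ω := by
      intro ω
      induction ω using TensorProduct.induction_on with
      | zero => simp
      | tmul x w => simp [chSign, neg_tmul]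
      | add x y hx hy => simp only [map_add, neg_add, hx, hy]
    rw [e, hω, neg_smul]
  have h1 : TensorProduct.map
      (TensorProduct.map (signOp (cobarComp R)) (signOp (barComp (cobarComp R) (cobarAug R))))
      (TensorProduct.map (signOp (cobarComp R)) (signOp (coalgBarComp R)))
      (ω ⊗ₜ[k] (a ⊗ₜ[k] toCoalgBar R c)) =
      (s * (-1) ^ (i + (l + 1))) • (ω ⊗ₜ[k] (a ⊗ₜ[k] toCoalgBar R c)) := by
    rw [map_tmul, map_tmul, show TensorProduct.map (signOp (cobarComp R))
      (signOp (barComp (cobarComp R) (cobarAug R))) ω = s • ω from hω, signOp_of_mem ha,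
      coalgBarSign hc, smul_tmul_smul, smul_tmul_smul, ← pow_add]
  have h2 : ∀ ω : CH (cobarAug R), TensorProduct.map
      (mul' k (Cobar R))
      (mul' k (Bar (cobarAug R)) ∘ₗ
        TensorProduct.map LinearMap.id
          (mul' k (Bar (cobarAug R)) ∘ₗ
            TensorProduct.map (barLetter (cobarAug R)) (barCobar R ∘ₗ coalgIncl R)))
      ((TensorProduct.assoc k _ _ _).symm ((TensorProduct.assoc k _ _ _).toLinearMap.lTensor _
        (z ⊗ₜ[k] (ω ⊗ₜ[k] (a ⊗ₜ[k] toCoalgBar R c))))) =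
      leftMul (cobarAug R) z (barCobarMul R c (letterMul (cobarAug R) a ω)) := by
    intro ω
    induction ω using TensorProduct.induction_on with
    | zero => simp
    | tmul x w => simp [coalgIncl_toCoalgBar_of_mem hc, barCobarMul_apply, mul_assoc]
    | add x y hx hy =>
      simp only [map_add, add_tmul, tmul_add] at hx hy ⊢
      rw [hx, hy]
  simp only [homotopyCore, comp_apply, TensorProduct.mk_apply, LinearEquiv.coe_coe,
    assoc_symm_tmul, map_tmul, id_apply, h0,
    signOp_of_mem ha, signOp_of_mem hz]
  simp only [← smul_tmul', tmul_smul, map_smul]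
  have e := koszulMove_tmul (TensorProduct.map
      (TensorProduct.map (signOp (cobarComp R)) (signOp (barComp (cobarComp R) (cobarAug R))))
      (TensorProduct.map (signOp (cobarComp R)) (signOp (coalgBarComp R)))) hz
      (ω ⊗ₜ[k] (a ⊗ₜ[k] toCoalgBar R c))
  rw [pow_apply_of_eq_smul h1] at e
  erw [e]
  simp only [tmul_smul, map_smul, smul_smul]
  rw [h2]
  congr 1
  ring

/-- The homotopy on chains whose last entry is a word with a given last letter. -/
theorem homotopy_mul_letter {s : k} {ω : CH (cobarAug R)}
    (hω : chSign (cobarComp R) (cobarAug R) ω = s • ω)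
    {p n : ℕ} {y : Cobar R} {c : Coalg R} (hy : y ∈ homog (cobarComp R) p)
    (hc : c ∈ homog (coalgComp R) (n + 1)) :
    homotopy R (letterMul (cobarAug R) (y * cobarLetter R c) ω) =
      -((-1 : k) ^ p * s) • barCobarMul R c (letterMul (cobarAug R) y ω) +
      ((-1 : k) ^ (n * (p + 1)) * s ^ n) •
        homotopy R (letterMul (cobarAug R) y (leftMul (cobarAug R) (cobarLetter R c) ω)) := by
  have h := isAugDGA_cobar (R := R) (σ := AlgHom.id k _) (hσ := fun _ _ h => h)
  have hx := cobarLetter_mem hc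
  have hxω : chSign (cobarComp R) (cobarAug R) (leftMul (cobarAug R) (cobarLetter R c) ω) =
      ((-1) ^ n * s) • leftMul (cobarAug R) (cobarLetter R c) ω := by
    rw [h.chSign_leftMul, hω, signOp_of_mem hx, map_smul, map_smul, LinearMap.smul_apply, smul_smul,
      mul_comm]
  have h1 : split (y * cobarLetter R c) =
      ((mulRight k (cobarLetter R c)).lTensor (CoalgBar R)).lTensor _ (split y) +
        y ⊗ₜ[k] (toCoalgBar R c ⊗ₜ[k] 1) := split_mul_ι y (toCoalgBar R c)
  rw [homotopy_letterMul, homotopy_letterMul, h1, map_add,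
    homotopyCore_apply hω hy hc one_mem_cobar,
    add_comm]
  congr 1
  · rw [pow_zero, mul_one, leftMul_one, add_zero]
  · refine split_ext (F := homotopyCore R ω ∘ₗ
      ((mulRight k (cobarLetter R c)).lTensor (CoalgBar R)).lTensor _)
      (G := ((-1 : k) ^ (n * (p + 1)) * s ^ n) •
        homotopyCore R (leftMul (cobarAug R) (cobarLetter R c) ω)) hy ?_
    rintro i l j rfl a ha c' hc' z hz
    simp only [comp_apply, lTensor_tmul, mulRight_apply,
      LinearMap.smul_apply]
    rw [homotopyCore_apply hω ha hc' (cobar_mul_mem hz hx), homotopyCore_apply hxω ha hc' hz,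
      smul_smul, leftMul_mul, barCobarMul_apply, barCobarMul_apply, leftMul_rightMul,
      leftMul_letterMul]
    congr 1
    rcases neg_one_pow_eq_or k i with hi | hi <;> rcases neg_one_pow_eq_or k l with hl | hl <;>
      rcases neg_one_pow_eq_or k j with hj | hj <;> rcases neg_one_pow_eq_or k n with hn | hn <;>
      simp only [pow_add, pow_mul, mul_add, hi, hl, hj, hn, one_pow, pow_one,
        neg_mul, mul_neg, mul_one, neg_neg, one_mul] <;> simp only [neg_pow s, hj, hn, mul_comm] <;>
        ring

end Recursion

/-! ### The identities `q₂ p₂ = 1` and `h b + b h = 1 - p₂ q₂` -/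

section Retraction

variable {k : Type u} [Field k] {V : Type v} [AddCommGroup V] [Module k V]
variable {R : Submodule k (V ⊗[k] V)}
variable {σ : QuadAlg R →ₐ[k] QuadAlg R} {hσ : IsGradedEnd R σ}

theorem ιInv_mul_ι {M : Type*} [AddCommGroup M] [Module k M] (w : TensorAlgebra k M) (m : M) :
    TensorAlgebra.ιInv (w * TensorAlgebra.ι k m) = TensorAlgebra.algebraMapInv w • m := by
  let _ : Module kᵐᵒᵖ M := Module.compHom _ ((RingHom.id k).fromOpposite mul_comm)
  have : IsCentralScalar k M := ⟨fun r m => rfl⟩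
  have h : (TrivSqZeroExt.fstHom k k M).comp (TensorAlgebra.toTrivSqZeroExt (R := k) (M := M)) =
      TensorAlgebra.algebraMapInv := by
    apply TensorAlgebra.hom_ext
    ext m
    simp [algebraMapInv_ι]
  have h1 := DFunLike.congr_fun h w
  change TrivSqZeroExt.snd (TensorAlgebra.toTrivSqZeroExt (w * TensorAlgebra.ι k m)) = _
  rw [← h1]
  simp

theorem ιInv_one {M : Type*} [AddCommGroup M] [Module k M] :
    TensorAlgebra.ιInv (1 : TensorAlgebra k M) = 0 := by
  let _ : Module kᵐᵒᵖ M := Module.compHom _ ((RingHom.id k).fromOpposite mul_comm)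
  have : IsCentralScalar k M := ⟨fun r m => rfl⟩
  change TrivSqZeroExt.snd (TensorAlgebra.toTrivSqZeroExt (1 : TensorAlgebra k M)) = _
  simp

theorem q₂_tmul (u : Cobar R) (w : Bar (cobarAug R)) : q₂ R σ hσ (u ⊗ₜ[k] w) =
    TensorAlgebra.algebraMapInv w • u ⊗ₜ[k] coalgOne R +
      rotate R σ hσ (u ⊗ₜ[k] augIncl (cobarAug R) (TensorAlgebra.ιInv w)) := by
  simp [q₂, tmul_smul]

theorem q₂_tmul_one (u : Cobar R) : q₂ R σ hσ (u ⊗ₜ[k] 1) = u ⊗ₜ[k] coalgOne R := by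
  rw [q₂_tmul, ιInv_one, map_one, map_zero, tmul_zero, map_zero, add_zero, one_smul]

theorem q₂_letterMul (v u : Cobar R) (w : Bar (cobarAug R)) :
    q₂ R σ hσ (letterMul (cobarAug R) v (u ⊗ₜ[k] w)) =
      TensorAlgebra.algebraMapInv w • rotate R σ hσ (u ⊗ₜ[k] v) := by
  rw [letterMul_tmul, q₂_tmul, barLetter, comp_apply, ιInv_mul_ι, map_mul,
    algebraMapInv_ι, mul_zero, zero_smul, zero_add, map_smul, augIncl_toAug,
    tmul_smul, map_smul, tmul_sub, tmul_smul, map_sub,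
    map_smul, rotate_tmul_one, smul_zero, sub_zero]

theorem q₂_letterMul_letterMul (a b : Cobar R) (ω : CH (cobarAug R)) :
    q₂ R σ hσ (letterMul (cobarAug R) a (letterMul (cobarAug R) b ω)) = 0 := by
  induction ω using TensorProduct.induction_on with
  | zero => simp
  | tmul x w =>
    rw [letterMul_tmul, q₂_letterMul, map_mul, barLetter, comp_apply, algebraMapInv_ι,
      mul_zero, zero_smul]
  | add x y hx hy => simp only [map_add, hx, hy, add_zero]

theorem rotate_letter (u : Cobar R) {n : ℕ} {c : Coalg R} (hc : c ∈ homog (coalgComp R) (n + 1)) :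
    rotate R σ hσ (u ⊗ₜ[k] cobarLetter R c) = u ⊗ₜ[k] c := by
  induction u using grading_cobar.induction with
  | hom i u hu =>
    have h := rotate_mul_letter (σ := σ) (hσ := hσ) (signOp_of_mem hu) one_mem_cobar hc
    rw [one_mul, rotate_tmul_one, smul_zero, add_zero, pow_zero, one_smul, map_one, mul_one] at h
    exact h
  | add x y hx hy => rw [add_tmul, map_add, hx, hy, add_tmul]

theorem q₂_p₂ (x : CoCH R) : q₂ R σ hσ (p₂ R x) = x := by
  refine LinearMap.congr_fun (f := q₂ R σ hσ ∘ₗ p₂ R) (g := LinearMap.id) ?_ x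
  refine ext_tmul_homog grading_cobar grading_coalg fun i n u hu c hc => ?_
  rw [comp_apply, id_apply, p₂_tmul, barCobar_apply_right,
    tmul_add, map_add, tmul_smul, map_smul, q₂_tmul_one]
  have h1 : ∀ t : Coalg R ⊗[k] Coalg R, q₂ R σ hσ (u ⊗ₜ[k] (mul' k _
      (TensorProduct.map (barCobar R) (barCobarLetter R) t))) = rotate R σ hσ (u ⊗ₜ[k]
        cobarLetter R (TensorProduct.lid k _ ((counit R).rTensor _ t))) := by
    intro t
    induction t with
    | zero => simp
    | tmul y z =>
      have h2 : TensorAlgebra.algebraMapInv (barCobar R y) = counit R y := by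
        rw [barCobar_apply_right, map_add, map_smul, map_one, smul_eq_mul, mul_one]
        generalize comul R y = s
        induction s with
        | zero => simp
        | tmul a b => simp [barCobarLetter_apply, barLetter, algebraMapInv_ι]
        | add x y hx hy =>
          simp only [map_add] at hx hy ⊢
          rw [← add_assoc, hx]
          exact hy
      rw [map_tmul, mul'_apply, barCobarLetter_apply, ← letterMul_tmul,
        q₂_letterMul, h2, rTensor_tmul, TensorProduct.lid_tmul, map_smul,
        tmul_smul, map_smul]
    | add x y hx hy => simp only [map_add, tmul_add, hx, hy]
  rw [h1, comul_counit_left]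
  cases n with
  | zero =>
    rw [cobarLetter_of_zero hc, tmul_zero, map_zero, add_zero,
      ← tmul_smul, ← counit_smul_of_mem hc]
  | succ n => rw [counit_of_mem hc, zero_smul, zero_add, rotate_letter u hc]

/-- The part of `h b + p₂ q₂` on chains with last entry `v` which does not involve the
differential of the cobar construction. -/
def outerPart (R : Submodule k (V ⊗[k] V)) (σ : QuadAlg R →ₐ[k] QuadAlg R) (hσ : IsGradedEnd R σ)
    (v : Cobar R) : Module.End k (CH (cobarAug R)) :=
  (homotopy R ∘ₗ bExternal (cobarComp R) (cobarAug R) (cobarMap R σ hσ) + p₂ R ∘ₗ q₂ R σ hσ) ∘ₗ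
    letterMul (cobarAug R) v

theorem outerPart_apply (v : Cobar R) (ω : CH (cobarAug R)) : outerPart R σ hσ v ω =
    homotopy R (bExternal (cobarComp R) (cobarAug R) (cobarMap R σ hσ)
      (letterMul (cobarAug R) v ω)) + p₂ R (q₂ R σ hσ (letterMul (cobarAug R) v ω)) := rfl

theorem chSign_tmul_one {i : ℕ} {u : Cobar R} (hu : u ∈ homog (cobarComp R) i) :
    chSign (cobarComp R) (cobarAug R) (u ⊗ₜ[k] 1) = (-1 : k) ^ i • u ⊗ₜ[k] 1 := by
  rw [chSign_tmul, barSign_one, signOp_of_mem hu, smul_tmul']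

theorem outerPart_tmul_one {i p : ℕ} {u v : Cobar R} (hu : u ∈ homog (cobarComp R) i)
    (hv : v ∈ homog (cobarComp R) p) :
    outerPart R σ hσ v (u ⊗ₜ[k] 1) = p₂ R (rotate R σ hσ (u ⊗ₜ[k] v)) := by
  have h := isAugDGA_cobar (R := R) (σ := σ) (hσ := hσ)
  rw [outerPart_apply, h.bExternal_letterMul hv (chSign_tmul_one hu), h.rightAct_tmul_one,
    leftMul_tmul, map_sub, map_smul, map_smul, homotopy_tmul_one, homotopy_tmul_one, q₂_letterMul,
    map_one, one_smul, smul_zero, smul_zero, sub_zero, zero_add]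

theorem outerPart_letterMul {e j p : ℕ} {ω : CH (cobarAug R)} {b v : Cobar R}
    (hω : ω ∈ homog (chComp (cobarComp R) (cobarAug R)) e) (hb : b ∈ homog (cobarComp R) j)
    (hv : v ∈ homog (cobarComp R) p) :
    outerPart R σ hσ v (letterMul (cobarAug R) b ω) =
      (-(-1 : k) ^ (j + e)) • homotopy R (letterMul (cobarAug R) (b * v) ω) +
      (-1 : k) ^ e • homotopy R (letterMul (cobarAug R) v
        (rightAct (cobarComp R) (cobarAug R) (cobarMap R σ hσ) b ω)) -
      (-(-1 : k) ^ (j + e)) ^ (p + 1) • homotopy R (letterMul (cobarAug R) b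
        (leftMul (cobarAug R) v ω)) := by
  have h := isAugDGA_cobar (R := R) (σ := σ) (hσ := hσ)
  have hs : chSign (cobarComp R) (cobarAug R) (letterMul (cobarAug R) b ω) =
      (-(-1 : k) ^ (j + e)) • letterMul (cobarAug R) b ω := by
    rw [h.chSign_letterMul, signOp_of_mem hb, chSign_of_mem h hω, map_smul, map_smul,
      LinearMap.smul_apply, smul_smul, neg_smul, pow_add, mul_comm]
  rw [outerPart_apply, h.bExternal_letterMul hv hs, h.rightAct_letterMul hb, leftMul_letterMul,
    q₂_letterMul_letterMul, map_zero, add_zero, map_sub, map_smul, map_smul, map_sub, map_smul,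
    smul_sub, smul_smul, sub_eq_add_neg _ ((_ * _ : k) • _), ← neg_smul]
  congr 3
  rcases neg_one_pow_eq_or k j with hj | hj <;> simp only [pow_add, hj] <;> ring

theorem chSign_letterMul_of_mem {e j : ℕ} {ω : CH (cobarAug R)} {b : Cobar R}
    (hω : ω ∈ homog (chComp (cobarComp R) (cobarAug R)) e) (hb : b ∈ homog (cobarComp R) j) :
    chSign (cobarComp R) (cobarAug R) (letterMul (cobarAug R) b ω) =
      (-(-1 : k) ^ (j + e)) • letterMul (cobarAug R) b ω := by
  have h := isAugDGA_cobar (R := R) (σ := AlgHom.id k _) (hσ := fun _ _ h => h)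
  rw [h.chSign_letterMul, signOp_of_mem hb, chSign_of_mem h hω, map_smul, map_smul,
    LinearMap.smul_apply, smul_smul, neg_smul, pow_add, mul_comm]

set_option maxHeartbeats 2000000 in
/-- The recursion for `outerPart`. -/
theorem outerPart_mul_letter {p n : ℕ} {y : Cobar R} {c : Coalg R}
    (hy : y ∈ homog (cobarComp R) p) (hc : c ∈ homog (coalgComp R) (n + 1))
    (ω : CH (cobarAug R)) : outerPart R σ hσ (y * cobarLetter R c) ω =
      (-1 : k) ^ p • barCobarMul R c
        (rightAct (cobarComp R) (cobarAug R) (cobarMap R σ hσ) y ω) +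
      ((-1 : k) ^ (n * (p + 1))) • outerPart R σ hσ y (leftMul (cobarAug R) (cobarLetter R c)
        ((chSign (cobarComp R) (cobarAug R) ^ n) ω)) := by
  have h := isAugDGA_cobar (R := R) (σ := σ) (hσ := hσ)
  have hx := cobarLetter_mem hc
  refine h.ch_ext (f := outerPart R σ hσ (y * cobarLetter R c))
    (g := (-1 : k) ^ p • barCobarMul R c ∘ₗ
        (rightAct (cobarComp R) (cobarAug R) (cobarMap R σ hσ) y) +
      ((-1 : k) ^ (n * (p + 1))) • outerPart R σ hσ y ∘ₗ
        leftMul (cobarAug R) (cobarLetter R c) ∘ₗ (chSign (cobarComp R) (cobarAug R) ^ n)) ?_ ?_ ω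
  · intro i u hu
    simp only [LinearMap.add_apply, LinearMap.smul_apply, comp_apply]
    rw [pow_apply_of_eq_smul (chSign_tmul_one hu), map_smul, map_smul, leftMul_tmul,
      outerPart_tmul_one hu (cobar_mul_mem hy hx), outerPart_tmul_one (cobar_mul_mem hx hu) hy,
      rotate_mul_letter (signOp_of_mem hu) hy hc, h.rightAct_tmul_one, barCobarMul_tmul_one,
      map_add, map_smul, map_smul, smul_smul]
  · intro e ω j b hω hb _ _
    simp only [LinearMap.add_apply, LinearMap.smul_apply, comp_apply]
    have hxω := h.leftMul_mem hx hω
    have hb' := h.chSign_rightAct hb ω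
    rw [chSign_of_mem h hω, map_smul, smul_smul] at hb'
    have h1 := homotopy_mul_letter (chSign_of_mem h hω) (cobar_mul_mem hb hy) hc
    have h2 := homotopy_mul_letter hb' hy hc
    rw [pow_apply_of_eq_smul (chSign_letterMul_of_mem hω hb), map_smul, map_smul,
      leftMul_letterMul, outerPart_letterMul hω hb (cobar_mul_mem hy hx),
      outerPart_letterMul hxω hb hy, h.rightAct_letterMul hb, ← mul_assoc, h1, h2,
      h.leftMul_rightAct, leftMul_mul]
    simp only [map_sub, map_smul]
    generalize homotopy R (letterMul (cobarAug R) (b * y)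
      (leftMul (cobarAug R) (cobarLetter R c) ω)) = T1
    generalize homotopy R (letterMul (cobarAug R) y
      (rightAct (cobarComp R) (cobarAug R) (cobarMap R σ hσ) b
        (leftMul (cobarAug R) (cobarLetter R c) ω))) = T2
    generalize homotopy R (letterMul (cobarAug R) b (leftMul (cobarAug R) y
      (leftMul (cobarAug R) (cobarLetter R c) ω))) = T3
    generalize barCobarMul R c (letterMul (cobarAug R) (b * y) ω) = T4
    generalize barCobarMul R c (letterMul (cobarAug R) y
      (rightAct (cobarComp R) (cobarAug R) (cobarMap R σ hσ) b ω)) = T5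
    clear h1 h2 hb' hxω hω hb hx hc hy h
    rcases neg_one_pow_eq_or k e with he | he <;> rcases neg_one_pow_eq_or k j with hj | hj <;>
      rcases neg_one_pow_eq_or k p with hp | hp <;> rcases neg_one_pow_eq_or k n with hn | hn <;>
      simp only [pow_add, pow_mul, mul_add, he, hj, hp, hn, one_pow, pow_one,
        mul_neg, mul_one, neg_neg] <;> module

set_option maxHeartbeats 2000000 in
/-- The sum of the terms of `b h + h b + p₂ q₂` at a chain with last entry `y s⁻¹c`, `c` of degree
`n + 1`, in which the coproduct of `c` occurs. -/
theorem homotopy_comul {e p n : ℕ} {ω : CH (cobarAug R)} {y : Cobar R} {c : Coalg R}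
    (hω : ω ∈ homog (chComp (cobarComp R) (cobarAug R)) e) (hy : y ∈ homog (cobarComp R) p)
    (hc : c ∈ homog (coalgComp R) (n + 1)) :
    swapMul (letterMul (cobarAug R) ∘ₗ mulLeft k y ∘ₗ cobarLetter R) (barCobarMul R)
        (comul R c) ω +
      (-1 : k) ^ (p + e) • swapMul (barCobarMul R) (signedLeft R) (comul R c)
        (letterMul (cobarAug R) y ω) -
      (-1 : k) ^ (p + e) • homotopy R (letterMul (cobarAug R)
        (y * cobarD R (cobarLetter R c)) ω) -
      (-1 : k) ^ (n * (p + 1 + e)) • homotopy R (letterMul (cobarAug R) y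
        (leftMul (cobarAug R) (cobarD R (cobarLetter R c)) ω)) =
    letterMul (cobarAug R) (y * cobarLetter R c) ω -
      (-1 : k) ^ (n * (p + 1 + e)) • letterMul (cobarAug R) y
        (leftMul (cobarAug R) (cobarLetter R c) ω) := by
  have h := isAugDGA_cobar (R := R) (σ := AlgHom.id k _) (hσ := fun _ _ h => h)
  rw [cobarD_letter, conv_apply]
  -- By the counit identities both sides depend on the coproduct of `c` only, and can be compared on
  -- homogeneous pairs `a ⊗ b`.
  conv_rhs => rw [← comul_counit_right c]
  conv_rhs =>
    enter [2]
    rw [comul_counit_right c, ← comul_counit_left c]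
  refine comul_ext (F := LinearMap.applyₗ ω ∘ₗ
      swapMul (letterMul (cobarAug R) ∘ₗ mulLeft k y ∘ₗ cobarLetter R) (barCobarMul R) +
      (-1 : k) ^ (p + e) • LinearMap.applyₗ (letterMul (cobarAug R) y ω) ∘ₗ
        swapMul (barCobarMul R) (signedLeft R) -
      (-1 : k) ^ (p + e) • homotopy R ∘ₗ LinearMap.applyₗ ω ∘ₗ letterMul (cobarAug R) ∘ₗ
        mulLeft k y ∘ₗ mul' k _ ∘ₗ
          TensorProduct.map (cobarLetter R ∘ₗ signOp (coalgComp R)) (cobarLetter R) -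
      (-1 : k) ^ (n * (p + 1 + e)) • homotopy R ∘ₗ letterMul (cobarAug R) y ∘ₗ
        LinearMap.applyₗ ω ∘ₗ leftMul (cobarAug R) ∘ₗ mul' k _ ∘ₗ
          TensorProduct.map (cobarLetter R ∘ₗ signOp (coalgComp R)) (cobarLetter R))
    (G := LinearMap.applyₗ ω ∘ₗ letterMul (cobarAug R) ∘ₗ mulLeft k y ∘ₗ
        cobarLetter R ∘ₗ (TensorProduct.rid k _).toLinearMap ∘ₗ (counit R).lTensor _ -
      (-1 : k) ^ (n * (p + 1 + e)) • letterMul (cobarAug R) y ∘ₗ LinearMap.applyₗ ω ∘ₗ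
        leftMul (cobarAug R) ∘ₗ cobarLetter R ∘ₗ (TensorProduct.lid k _).toLinearMap ∘ₗ
          (counit R).rTensor _) hc fun i j hij a ha b hb => ?_
  have hyω := chSign_letterMul_of_mem hω hy
  simp only [LinearMap.add_apply, LinearMap.sub_apply, LinearMap.smul_apply, comp_apply,
    LinearMap.applyₗ_apply_apply, swapMul_tmul, Module.End.mul_apply, mulLeft_apply,
    map_tmul, mul'_apply, signedLeft_of_mem hb, signOp_of_mem ha,
    LinearEquiv.coe_coe, lTensor_tmul, rTensor_tmul, TensorProduct.rid_tmul,
    TensorProduct.lid_tmul, map_smul]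
  cases i with
  | zero =>
    obtain rfl : j = n + 1 := by omega
    rw [cobarLetter_of_zero ha, counit_of_mem hb, counit_smul_of_mem ha]
    simp only [map_smul, barCobarMul_apply, barCobar_one, counit_coalgOne,
      LinearMap.smul_apply, rightMul_one, pow_apply_of_eq_smul hyω, map_zero, zero_mul,
      LinearMap.zero_apply, mul_zero, smul_zero, leftMul_letterMul]
    rcases neg_one_pow_eq_or k e with he | he <;>
      rcases neg_one_pow_eq_or k p with hp | hp <;> rcases neg_one_pow_eq_or k n with hn | hn <;>
      simp only [pow_add, pow_mul, mul_add, he, hp, hn, one_pow, pow_one,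
        mul_neg, mul_one, neg_neg] <;> module
  | succ i =>
    cases j with
    | zero =>
      rw [cobarLetter_of_zero hb, counit_of_mem ha, counit_smul_of_mem hb]
      simp only [map_smul, barCobarMul_apply, barCobar_one, counit_coalgOne,
        LinearMap.smul_apply, rightMul_one, map_zero,
        LinearMap.zero_apply, mul_zero, smul_zero, sub_zero, add_zero,
        smul_eq_mul, mul_one]
    | succ j =>
      obtain rfl : n = i + j + 1 := by omega
      have ha' := cobarLetter_mem ha
      have hb' := cobarLetter_mem hb
      have hW : chSign (cobarComp R) (cobarAug R) (barCobarMul R a (letterMul (cobarAug R) y ω)) =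
          (-(-1 : k) ^ (i + p + e) * -1) • barCobarMul R a (letterMul (cobarAug R) y ω) := by
        rw [barCobarMul_apply, h.chSign_rightMul, barSign_barCobar, hyω, signOp_of_mem ha]
        simp only [map_smul, LinearMap.smul_apply, smul_smul]
        congr 1
        ring
      have h1 := homotopy_mul_letter (chSign_of_mem h hω) (cobar_mul_mem hy ha') hb
      have h2 := homotopy_mul_letter (chSign_of_mem h (h.leftMul_mem hb' hω)) hy ha
      simp only [smul_mul_assoc, mul_smul_comm, map_smul, LinearMap.smul_apply]
      rw [counit_of_mem ha, counit_of_mem hb, ← mul_assoc, h1, h2, pow_apply_of_eq_smul hW,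
        leftMul_mul]
      simp only [map_smul, barCobarMul_apply, leftMul_rightMul, leftMul_letterMul, zero_smul,
        smul_zero, sub_zero]
      generalize homotopy R (letterMul (cobarAug R) y (leftMul (cobarAug R) (cobarLetter R a)
        (leftMul (cobarAug R) (cobarLetter R b) ω))) = T1
      generalize rightMul (cobarAug R) (barCobar R b)
        (letterMul (cobarAug R) (y * cobarLetter R a) ω) = T2
      generalize rightMul (cobarAug R) (barCobar R a)
        (letterMul (cobarAug R) y (leftMul (cobarAug R) (cobarLetter R b) ω)) = T3
      -- Only three terms remain, and each of them cancels.
      clear h1 h2 hW hyω hω hy ha hb hc ha' hb' hij h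
      rcases neg_one_pow_eq_or k e with he | he <;> rcases neg_one_pow_eq_or k i with hi | hi <;>
        rcases neg_one_pow_eq_or k j with hj | hj <;>
        rcases neg_one_pow_eq_or k p with hp | hp <;>
        simp only [pow_add, pow_mul, mul_add, he, hp, hi, hj, one_pow, pow_one,
          mul_neg, mul_one, neg_neg] <;> module

/-- The differential of a word enters the homotopy through its last letter. -/
theorem homotopy_d_mul_letter {s : k} {ω : CH (cobarAug R)}
    (hω : chSign (cobarComp R) (cobarAug R) ω = s • ω)
    {p n : ℕ} {y : Cobar R} {c : Coalg R} (hy : y ∈ homog (cobarComp R) p)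
    (hc : c ∈ homog (coalgComp R) (n + 1)) :
    homotopy R (letterMul (cobarAug R) (cobarD R y * cobarLetter R c) ω) =
      ((-1 : k) ^ p * s) • barCobarMul R c (letterMul (cobarAug R) (cobarD R y) ω) +
      ((-1 : k) ^ (n * p) * s ^ n) • homotopy R
        (letterMul (cobarAug R) (cobarD R y) (leftMul (cobarAug R) (cobarLetter R c) ω)) := by
  cases p with
  | zero =>
    have h0 : cobarD R y = 0 := (mem_bot k).1 (cobarD_mem hy)
    simp [h0]
  | succ p =>
    rw [homotopy_mul_letter hω (cobarD_mem hy) hc]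
    congr 2
    ring

theorem swapMul_rightAct_letterMul {p : ℕ} {y : Cobar R} (hy : y ∈ homog (cobarComp R) p)
    (ω : CH (cobarAug R)) (t : Coalg R ⊗[k] Coalg R) :
      swapMul (rightAct (cobarComp R) (cobarAug R) (cobarMap R σ hσ) ∘ₗ cobarLetter R)
        (barCobarMul R) t (letterMul (cobarAug R) y ω) =
      swapMul (letterMul (cobarAug R) ∘ₗ mulLeft k y ∘ₗ cobarLetter R)
        (barCobarMul R) t ω -
      (-1 : k) ^ p • rightMul (cobarAug R) (mul' k _
        (TensorProduct.map (barCobarLetter R) (barCobar R) t))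
        (rightAct (cobarComp R) (cobarAug R) (cobarMap R σ hσ) y ω) := by
  have h := isAugDGA_cobar (R := R) (σ := σ) (hσ := hσ)
  induction t with
  | zero => simp
  | tmul a b =>
    simp only [swapMul_tmul, comp_apply, Module.End.mul_apply, h.rightAct_letterMul hy,
      map_sub, map_smul, mulLeft_apply, map_tmul, mul'_apply,
      rightMul_mul, barCobarLetter_apply, barCobarMul_apply]
    rfl
  | add x y hx hy =>
    simp only [map_add, LinearMap.add_apply, hx, hy, smul_add]
    abel

set_option maxHeartbeats 2000000 in
/-- The boundary of a chain which ends with the letter `y` followed by `barCobar c`. -/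
theorem hochB_barCobar_letterMul {e p n : ℕ} {ω : CH (cobarAug R)} {y : Cobar R} {c : Coalg R}
    (hω : ω ∈ homog (chComp (cobarComp R) (cobarAug R)) e) (hy : y ∈ homog (cobarComp R) p)
    (hc : c ∈ homog (coalgComp R) (n + 1)) :
    (-(-1 : k) ^ (p + e)) • bCobar R σ hσ (barCobarMul R c (letterMul (cobarAug R) y ω)) =
      (-(-1 : k) ^ (p + e)) • barCobarMul R c
        (letterMul (cobarAug R) y (bInternal (cobarComp R) (cobarD R) (cobarAug R) ω)) +
      (-1 : k) ^ p • barCobarMul R c (letterMul (cobarAug R) (cobarD R y) ω) +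
      swapMul (letterMul (cobarAug R) ∘ₗ mulLeft k y ∘ₗ cobarLetter R) (barCobarMul R)
        (comul R c) ω -
      (-1 : k) ^ p • barCobarMul R c
        (rightAct (cobarComp R) (cobarAug R) (cobarMap R σ hσ) y ω) +
      (-1 : k) ^ (p + e) • swapMul (barCobarMul R) (signedLeft R) (comul R c)
        (letterMul (cobarAug R) y ω) := by
  have h := isAugDGA_cobar (R := R) (σ := σ) (hσ := hσ)
  have h1 := swapMul_rightAct_letterMul (σ := σ) (hσ := hσ) hy ω
  have h2 : mul' k _ (TensorProduct.map (barCobarLetter R) (barCobar R) (comul R c)) =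
      barCobar R c := by
    conv_rhs => rw [barCobar_apply_left, counit_of_mem hc, zero_smul, zero_add]
  have h3 := h1 (comul R c)
  rw [h2, ← barCobarMul_apply] at h3
  rw [hochB_barCobar, counit_of_mem hc, zero_smul, add_zero, chSign_letterMul_of_mem hω hy,
    map_smul, h3, h.bInternal_letterMul, chSign_of_mem h hω]
  simp only [map_sub, map_smul]
  rcases neg_one_pow_eq_or k e with he | he <;> rcases neg_one_pow_eq_or k p with hp | hp <;>
    simp only [pow_add, he, hp] <;> module

theorem outerPart_add (a b : Cobar R) (ω : CH (cobarAug R)) :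
    outerPart R σ hσ (a + b) ω = outerPart R σ hσ a ω + outerPart R σ hσ b ω := by
  simp only [outerPart_apply, map_add, LinearMap.add_apply]
  abel

theorem outerPart_smul (r : k) (a : Cobar R) (ω : CH (cobarAug R)) :
    outerPart R σ hσ (r • a) ω = r • outerPart R σ hσ a ω := by
  simp only [outerPart_apply, map_smul, LinearMap.smul_apply, smul_add]

/-- The comparison of signs in the induction step of `homotopy_letterMul_add`. -/
theorem homotopy_signs {X : Type*} [AddCommGroup X] [Module k X] {p e n : ℕ}
    {x₁ x₂ x₃ x₄ x₅ x₆ x₇ x₈ x₉ y₁ y₂ y₃ z₁ z₂ : X}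
    (h1 : -(-1 : k) ^ (p + e) • x₁ =
      -(-1 : k) ^ (p + e) • x₃ + (-1 : k) ^ p • x₅ + y₁ - (-1 : k) ^ p • x₈ +
        (-1 : k) ^ (p + e) • y₂)
    (h2 : y₁ + (-1 : k) ^ (p + e) • y₂ - (-1 : k) ^ (p + e) • x₇ -
      (-1 : k) ^ (n * (p + 1 + e)) • y₃ = z₁ - (-1 : k) ^ (n * (p + 1 + e)) • z₂)
    (h3 : x₂ + (y₃ + (-1 : k) ^ n • x₄) - (-1 : k) ^ (e + n) • x₆ + x₉ = z₂) :
    -((-1 : k) ^ p * (-1) ^ e) • x₁ + ((-1 : k) ^ (n * (p + 1)) * ((-1) ^ e) ^ n) • x₂ +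
      (-((-1 : k) ^ p * -(-1) ^ e) • x₃ + ((-1 : k) ^ (n * (p + 1)) * (-(-1) ^ e) ^ n) • x₄) -
      (-1 : k) ^ e • (((-1 : k) ^ p * (-1) ^ e) • x₅ +
        ((-1 : k) ^ (n * p) * ((-1) ^ e) ^ n) • x₆ + (-1 : k) ^ p • x₇) +
      ((-1 : k) ^ p • x₈ + (-1 : k) ^ (n * (p + 1)) • ((-1 : k) ^ e) ^ n • x₉) = z₁ := by
  rcases neg_one_pow_eq_or k e with he | he <;> rcases neg_one_pow_eq_or k p with hp | hp <;>
    rcases neg_one_pow_eq_or k n with hn | hn <;>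
    simp only [pow_add, pow_mul, mul_add, he, hp, hn, one_pow, mul_neg, mul_one, neg_neg,
      one_smul, neg_smul] at h1 h2 h3 ⊢ <;>
    first
    | linear_combination (norm := module) h1 + h2 + h3
    | linear_combination (norm := module) h1 + h2 - h3

/-- The homotopy formula on the chain `(ω, v)`, with `h b (ω, v)` divided into the internal part of
`b` and the part which is contained in `outerPart`. It is proved for all `ω` simultaneously by
induction on `v`, since the recursion moves the last letter of `v` to the front of `ω`. -/
theorem homotopy_letterMul_add {e : ℕ} {ω : CH (cobarAug R)} (v : Cobar R)
    (hω : ω ∈ homog (chComp (cobarComp R) (cobarAug R)) e) :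
    bCobar R σ hσ (homotopy R (letterMul (cobarAug R) v ω)) +
      homotopy R (letterMul (cobarAug R) v
        (bInternal (cobarComp R) (cobarD R) (cobarAug R) ω)) -
      (-1 : k) ^ e • homotopy R (letterMul (cobarAug R) (cobarD R v) ω) +
      outerPart R σ hσ v ω = letterMul (cobarAug R) v ω := by
  have h := isAugDGA_cobar (R := R) (σ := σ) (hσ := hσ)
  induction v using cobar_induction generalizing e ω with
  | add x y hx hy =>
    have h1 := hx hω
    have h2 := hy hω
    simp only [map_add, LinearMap.add_apply, smul_add, outerPart_add]
    linear_combination (norm := module) h1 + h2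
  | smul r x hx =>
    have h1 := hx hω
    simp only [map_smul, LinearMap.smul_apply, outerPart_smul]
    linear_combination (norm := module) r • h1
  | one =>
    have h1 : letterMul (cobarAug R) (1 : Cobar R) = 0 := by
      rw [letterMul, comp_apply, barLetter_one, map_zero]
    simp [outerPart, h1, cobarD_one]
  | snoc p y n c hy hc ih =>
    have hx := cobarLetter_mem hc
    have hs := chSign_of_mem h hω
    have hDω : chSign (cobarComp R) (cobarAug R)
        (bInternal (cobarComp R) (cobarD R) (cobarAug R) ω) =
        (-(-1 : k) ^ e) • bInternal (cobarComp R) (cobarD R) (cobarAug R) ω := by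
      rw [h.chSign_bInternal, hs, map_smul, neg_smul]
    have ih := ih (h.leftMul_mem hx hω)
    rw [h.bInternal_leftMul, signOp_of_mem hx] at ih
    have h1 := hochB_barCobar_letterMul (σ := σ) (hσ := hσ) hω hy hc
    have h2 := homotopy_comul hω hy hc
    rw [homotopy_mul_letter hs hy hc, homotopy_mul_letter hDω hy hc, outerPart_mul_letter hy hc,
      pow_apply_of_eq_smul hs, cobarD_mul, signOp_of_mem hy]
    simp only [map_add, map_smul, LinearMap.add_apply, LinearMap.smul_apply, smul_mul_assoc] at ih ⊢
    rw [homotopy_d_mul_letter hs hy hc]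
    exact homotopy_signs h1 h2 ih

theorem homotopy_hochB (x : CH (cobarAug R)) :
    homotopy R (bCobar R σ hσ x) + bCobar R σ hσ (homotopy R x) =
      x - p₂ R (q₂ R σ hσ x) := by
  have h := isAugDGA_cobar (R := R) (σ := σ) (hσ := hσ)
  refine h.ch_ext (f := homotopy R ∘ₗ bCobar R σ hσ + bCobar R σ hσ ∘ₗ homotopy R)
    (g := LinearMap.id - p₂ R ∘ₗ q₂ R σ hσ) ?_ ?_ x
  · intro i u hu
    simp only [LinearMap.add_apply, LinearMap.sub_apply, comp_apply, id_apply]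
    rw [homotopy_tmul_one, q₂_tmul_one, p₂_tmul, barCobar_one, bCobar, hochB_tmul_one,
      homotopy_tmul_one, map_zero, add_zero, sub_self]
  · intro e ω i v hω hv _ _
    have h1 := homotopy_letterMul_add (σ := σ) (hσ := hσ) v hω
    rw [outerPart_apply] at h1
    simp only [LinearMap.add_apply, LinearMap.sub_apply, comp_apply, id_apply]
    have h2 : bCobar R σ hσ (letterMul (cobarAug R) v ω) = letterMul (cobarAug R) v
        (bInternal (cobarComp R) (cobarD R) (cobarAug R) ω) -
        (-1 : k) ^ e • letterMul (cobarAug R) (cobarD R v) ω +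
        bExternal (cobarComp R) (cobarAug R) (cobarMap R σ hσ) (letterMul (cobarAug R) v ω) := by
      rw [bCobar, hochB_eq, h.bInternal_letterMul, chSign_of_mem h hω, map_smul]
    rw [h2]
    simp only [map_add, map_sub, map_smul]
    linear_combination (norm := module) h1

end Retraction

/-! ### Degrees and eigenvectors in the Hochschild complex of the coalgebra -/

section CoalgebraChains

variable {k : Type u} [Field k] {V : Type v} [AddCommGroup V] [Module k V]
variable {R : Submodule k (V ⊗[k] V)}
variable {σ : QuadAlg R →ₐ[k] QuadAlg R} {hσ : IsGradedEnd R σ}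

/-- The total grading of `Ω(A^¡) ⊗ A^¡`. -/
def coComp (R : Submodule k (V ⊗[k] V)) : CoCH R →ₗ[k] ℕ →₀ CoCH R :=
  tmulComp (cobarComp R) (coalgComp R)

theorem grading_co : IsGrading (coComp R) := grading_cobar.tmul grading_coalg

/-- The total automorphism of `Ω(A^¡) ⊗ A^¡` induced by `σ`. -/
def coMap (R : Submodule k (V ⊗[k] V)) (σ : QuadAlg R →ₐ[k] QuadAlg R) (hσ : IsGradedEnd R σ) :
    Module.End k (CoCH R) :=
  TensorProduct.map (cobarMap R σ hσ).toLinearMap (coalgMap R σ hσ)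

theorem mem_span_words {i : ℕ} {u : Cobar R} (hu : u ∈ homog (cobarComp R) i) :
    u ∈ Submodule.span k {x | ∃ l : List (ℕ × CoalgBar R),
      (∀ p ∈ l, (coalgIncl R p.2 : TensorAlgebra k V) ∈ coalgDeg R p.1) ∧
      (l.map fun p => p.1 - 1).sum = i ∧ x = (l.map fun p => TensorAlgebra.ι k p.2).prod} := by
  refine cobar_degree_induction LinearMap.id (fun i => Submodule.span k
    {x | ∃ l : List (ℕ × CoalgBar R),
      (∀ p ∈ l, (coalgIncl R p.2 : TensorAlgebra k V) ∈ coalgDeg R p.1) ∧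
      (l.map fun p => p.1 - 1).sum = i ∧ x = (l.map fun p => TensorAlgebra.ι k p.2).prod}) ?_ ?_ hu
  · exact subset_span ⟨[], by simp, by simp, by simp⟩
  · intro i x n c hx hc ih
    rw [id_apply] at ih ⊢
    clear hx
    induction ih using span_induction with
    | mem x hx =>
      obtain ⟨l, hl, hsum, rfl⟩ := hx
      refine subset_span ⟨l ++ [(n + 1, toCoalgBar R c)], ?_, ?_, ?_⟩
      · intro p hp
        rcases List.mem_append.1 hp with hp | hp
        · exact hl p hp
        · rw [List.mem_singleton] at hp
          rw [hp, coalgIncl_toCoalgBar_of_mem hc]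
          exact mem_coalgDeg_iff.2 hc
      · simp [hsum]
      · simp [cobarLetter]
    | zero => rw [zero_mul]; exact zero_mem _
    | add y z _ _ hy hz => rw [add_mul]; exact add_mem hy hz
    | smul r y _ hy => rw [smul_mul_assoc]; exact smul_mem _ r hy

theorem coDeg_eq (n : ℕ) : coDeg R n = homog (coComp R) n := by
  apply le_antisymm
  · rw [coDeg, Submodule.span_le]
    rintro _ ⟨i, c, l, hc, hl, rfl, rfl⟩
    refine tmul_mem ?_ (mem_coalgDeg_iff.1 hc)
    have := prod_ι_mem_homog (c := regrade (· - 1) (coalgBarComp R))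
      (l.map fun p => (p.1 - 1, p.2)) (by
      intro p hp
      obtain ⟨q, hq, rfl⟩ := List.mem_map.1 hp
      have h1 := toCoalgBar_mem (mem_coalgDeg_iff.1 (hl q hq))
      rw [toCoalgBar_coalgIncl] at h1
      exact regrade_mem (· - 1) h1)
    simp only [List.map_map, Function.comp_def] at this
    exact this
  · intro x hx
    refine tmul_mem_of_mem grading_cobar grading_coalg LinearMap.id (coDeg R n) hx ?_
    rintro i j rfl u hu c hc
    rw [id_apply]
    have hu' := mem_span_words hu
    clear hu
    induction hu' using span_induction with
    | mem x hx =>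
      obtain ⟨l, hl, rfl, rfl⟩ := hx
      exact subset_span ⟨j, c, l, mem_coalgDeg_iff.2 hc, hl, rfl, rfl⟩
    | zero => rw [zero_tmul]; exact zero_mem _
    | add y z _ _ hy hz => rw [add_tmul]; exact add_mem hy hz
    | smul r y _ hy => rw [← smul_tmul']; exact smul_mem _ r hy

/-- The span of the `(c₁, …, cᵣ, c₀)` whose entries are eigenvectors of `σ`, the product of the
eigenvalues being `ν`. -/
def coEigen (R : Submodule k (V ⊗[k] V)) (σ : QuadAlg R →ₐ[k] QuadAlg R) (hσ : IsGradedEnd R σ)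
    (ν : k) : Submodule k (CoCH R) :=
  Submodule.span k {x | ∃ (μ : k) (c : Coalg R) (l : List (k × CoalgBar R)),
    coalgMap R σ hσ c = μ • c ∧
    (∀ p ∈ l, coalgMap R σ hσ (coalgIncl R p.2) = p.1 • coalgIncl R p.2) ∧
    (l.map fun p => p.1).prod * μ = ν ∧
    x = (l.map fun p => TensorAlgebra.ι k p.2).prod ⊗ₜ[k] c}

theorem coEigen_le (ν : k) : coEigen R σ hσ ν ≤ (coMap R σ hσ).eigenspace ν := by
  rw [coEigen, Submodule.span_le]
  rintro _ ⟨μ, c, l, hc, hl, rfl, rfl⟩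
  rw [SetLike.mem_coe, mem_eigenspace_iff, coMap, map_tmul, hc,
    AlgHom.toLinearMap_apply, prod_ι_eigen (cobarMap R σ hσ) (TensorAlgebra.ι k) l,
    smul_tmul_smul]
  intro p hp
  rw [← cobarLetter_coalgIncl, cobarMap_letter, hl p hp, map_smul]

theorem mem_span_eigen_words (hss : ⨆ μ : k, eigenspace σ.toLinearMap μ = ⊤)
    (u : Cobar R) : u ∈ Submodule.span k {x | ∃ l : List (k × CoalgBar R),
      (∀ p ∈ l, coalgMap R σ hσ (coalgIncl R p.2) = p.1 • coalgIncl R p.2) ∧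
      x = (l.map fun p => TensorAlgebra.ι k p.2).prod} := by
  have letter : ∀ (c : Coalg R) (μ : k), coalgMap R σ hσ c = μ • c →
      coalgMap R σ hσ (coalgIncl R (toCoalgBar R c)) = μ • coalgIncl R (toCoalgBar R c) := by
    intro c μ hc
    have h1 : counit R c = μ * counit R c := by
      have := counit_coalgMap (hσ := hσ) c
      rw [hc, map_smul, smul_eq_mul] at this
      exact this.symm
    rw [coalgIncl_toCoalgBar, map_sub, map_smul, coalgMap_one, hc, smul_sub, smul_smul, ← h1]
  refine tensor_induction_of_span
    (c := (lsingle 0 : CoalgBar R →ₗ[k] ℕ →₀ CoalgBar R))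
    (P := fun u => u ∈ Submodule.span k {x | ∃ l : List (k × CoalgBar R),
      (∀ p ∈ l, coalgMap R σ hσ (coalgIncl R p.2) = p.1 • coalgIncl R p.2) ∧
      x = (l.map fun p => TensorAlgebra.ι k p.2).prod})
    {m | ∃ μ : k, ∃ c : Coalg R, coalgMap R σ hσ c = μ • c ∧ m = toCoalgBar R c}
    ?_ (fun m _ => ⟨0, rfl⟩) (fun _ _ => add_mem) (fun r _ => smul_mem _ r) ?_ ?_ u
  · intro m
    rw [← toCoalgBar_coalgIncl m]
    generalize coalgIncl R m = y
    induction span_eigen (iSup_eigenspace_coalgMap (hσ := hσ) hss) y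
      using span_induction with
    | mem y hy => obtain ⟨ν, hν⟩ := hy; exact subset_span ⟨ν, y, hν, rfl⟩
    | zero => rw [map_zero]; exact zero_mem _
    | add y z _ _ hy hz => rw [map_add]; exact add_mem hy hz
    | smul r y _ hy => rw [map_smul]; exact smul_mem _ r hy
  · exact subset_span ⟨[], by simp, by simp⟩
  · rintro - x _ - ⟨ν, c, hc, rfl⟩ hx
    induction hx using span_induction with
    | mem x hx =>
      obtain ⟨l, hl, rfl⟩ := hx
      refine subset_span ⟨l ++ [(ν, toCoalgBar R c)], ?_, by simp⟩
      intro p hp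
      rcases List.mem_append.1 hp with hp | hp
      · exact hl p hp
      · rw [List.mem_singleton] at hp
        rw [hp]
        exact letter c ν hc
    | zero => rw [zero_mul]; exact zero_mem _
    | add y z _ _ hy hz => rw [add_mul]; exact add_mem hy hz
    | smul r y _ hy => rw [smul_mul_assoc]; exact smul_mem _ r hy

theorem iSup_coEigen (hss : ⨆ μ : k, eigenspace σ.toLinearMap μ = ⊤) :
    ⨆ ν, coEigen R σ hσ ν = ⊤ := by
  rw [eq_top_iff]
  rintro x -
  induction x using TensorProduct.induction_on with
  | zero => exact zero_mem _
  | add x y hx hy => exact add_mem hx hy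
  | tmul u c =>
    induction mem_span_eigen_words (hσ := hσ) hss u using span_induction with
    | zero => rw [zero_tmul]; exact zero_mem _
    | add y z _ _ hy hz => rw [add_tmul]; exact add_mem hy hz
    | smul r y _ hy => rw [← smul_tmul']; exact smul_mem _ r hy
    | mem u hu =>
      obtain ⟨l, hl, rfl⟩ := hu
      induction span_eigen (iSup_eigenspace_coalgMap (hσ := hσ) hss) c
        using span_induction with
      | mem c hc =>
        obtain ⟨μ, hμ⟩ := hc
        exact Submodule.mem_iSup_of_mem _ (subset_span ⟨μ, c, l, hμ, hl, rfl, rfl⟩)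
      | zero => rw [tmul_zero]; exact zero_mem _
      | add y z _ _ hy hz => rw [tmul_add]; exact add_mem hy hz
      | smul r y _ hy => rw [tmul_smul]; exact smul_mem _ r hy

theorem mem_coOne (hss : ⨆ μ : k, eigenspace σ.toLinearMap μ = ⊤) {x : CoCH R} :
    x ∈ coOne R σ hσ ↔ coMap R σ hσ x = x := by
  rw [show coOne R σ hσ = coEigen R σ hσ 1 from rfl,
    eq_eigenspace coEigen_le (iSup_coEigen hss) 1, mem_eigenspace_iff, one_smul]

theorem coMap_mem {n : ℕ} {x : CoCH R} (hx : x ∈ homog (coComp R) n) :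
    coMap R σ hσ x ∈ homog (coComp R) n := by
  refine tmul_mem_of_mem grading_cobar grading_coalg (coMap R σ hσ) _ hx ?_
  rintro i j rfl u hu c hc
  exact tmul_mem (cobarMap_mem hu) (coalgMap_mem hc)

end CoalgebraChains

/-! ### Compatibility of `p₂`, `q₂` and the homotopy with degrees, `σ` and the Connes operators -/

section Compatibility

variable {k : Type u} [Field k] {V : Type v} [AddCommGroup V] [Module k V]
variable {R : Submodule k (V ⊗[k] V)}
variable {σ : QuadAlg R →ₐ[k] QuadAlg R} {hσ : IsGradedEnd R σ}

theorem mem_oneCobar (hss : ⨆ μ : k, eigenspace σ.toLinearMap μ = ⊤)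
    {x : CH (cobarAug R)} : x ∈ oneCobar R σ hσ ↔
      chMap (cobarAug R) (cobarAug R) (cobarMap R σ hσ) x = x := by
  rw [oneCobar, chOne_eq cobarAug_cobarMap (iSup_eigenspace_cobarMap hss),
    mem_eigenspace_iff, one_smul]

theorem degCobar_eq (n : ℕ) :
    degCobar R n = homog (chComp (cobarComp R) (cobarAug R)) n :=
  (isAugDGA_cobar (σ := AlgHom.id k _) (hσ := fun _ _ h => h)).chDeg_eq n

theorem p₂_coMap (x : CoCH R) : p₂ R (coMap R σ hσ x) =
    chMap (cobarAug R) (cobarAug R) (cobarMap R σ hσ) (p₂ R x) := by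
  induction x using TensorProduct.induction_on with
  | zero => simp
  | add x y hx hy => simp only [map_add, hx, hy]
  | tmul u c =>
    rw [coMap, map_tmul, p₂_tmul, p₂_tmul, chMap_tmul, barMap_barCobar]
    rfl

theorem p₂_mem {n : ℕ} {x : CoCH R} (hx : x ∈ homog (coComp R) n) :
    p₂ R x ∈ homog (chComp (cobarComp R) (cobarAug R)) n := by
  refine tmul_mem_of_mem grading_cobar grading_coalg (p₂ R) _ hx ?_
  rintro i j rfl u hu c hc
  exact tmul_mem hu (barCobar_mem hc)

theorem p₂_injective : Function.Injective (p₂ R) :=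
  Function.LeftInverse.injective (g := q₂ R (AlgHom.id k _) fun _ _ h => h) q₂_p₂

/-- As `p₂` is injective and preserves degrees, degrees in `Ω(A^¡) ⊗ A^¡` can be tested after `p₂`.
-/
theorem mem_of_p₂_mem {n : ℕ} {x : CoCH R}
    (hx : p₂ R x ∈ homog (chComp (cobarComp R) (cobarAug R)) n) : x ∈ homog (coComp R) n := by
  have h := grading_co.comp_mem x n
  have h1 := comp_apply_of_deg_zero grading_co (fun n x => p₂_mem (n := n) (x := x)) x n
  rw [mem_homog.1 hx, single_eq_same] at h1
  rwa [← p₂_injective h1] at h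

theorem homotopy_chMap (x : CH (cobarAug R)) :
    homotopy R (chMap (cobarAug R) (cobarAug R) (cobarMap R σ hσ) x) =
      chMap (cobarAug R) (cobarAug R) (cobarMap R σ hσ) (homotopy R x) := by
  have h := isAugDGA_cobar (R := R) (σ := σ) (hσ := hσ)
  have key : ∀ (v : Cobar R) (e : ℕ) (ω : CH (cobarAug R)),
      ω ∈ homog (chComp (cobarComp R) (cobarAug R)) e →
      homotopy R (letterMul (cobarAug R) (cobarMap R σ hσ v)
        (chMap (cobarAug R) (cobarAug R) (cobarMap R σ hσ) ω)) =
      chMap (cobarAug R) (cobarAug R) (cobarMap R σ hσ)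
        (homotopy R (letterMul (cobarAug R) v ω)) := by
    intro v
    induction v using cobar_induction with
    | add x y hx hy =>
      intro e ω hω
      simp only [map_add, LinearMap.add_apply, hx e ω hω, hy e ω hω]
    | smul r x hx =>
      intro e ω hω
      simp only [map_smul, LinearMap.smul_apply, hx e ω hω]
    | one =>
      intro e ω hω
      have h1 : letterMul (cobarAug R) (1 : Cobar R) = 0 := by
        rw [letterMul, comp_apply, barLetter_one, map_zero]
      simp [h1]
    | snoc p y n c hy hc ih =>
      intro e ω hω
      have hω' := h.hom_self.chMap_mem h h hω
      have e1 := ih _ _ (h.leftMul_mem (cobarLetter_mem hc) hω)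
      rw [chMap_leftMul, cobarMap_letter] at e1
      rw [map_mul, cobarMap_letter, homotopy_mul_letter (chSign_of_mem h hω') (cobarMap_mem hy)
        (coalgMap_mem hc), homotopy_mul_letter (chSign_of_mem h hω) hy hc, e1, map_add, map_smul,
        map_smul, barCobarMul_apply, barCobarMul_apply, chMap_rightMul, barMap_barCobar,
        chMap_letterMul]
  refine h.ch_ext (f := homotopy R ∘ₗ chMap (cobarAug R) (cobarAug R) (cobarMap R σ hσ))
    (g := chMap (cobarAug R) (cobarAug R) (cobarMap R σ hσ) ∘ₗ homotopy R) ?_ ?_ x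
  · intro i u _
    simp [barMap_one, homotopy_tmul_one]
  · intro e ω i v hω _ _ _
    rw [comp_apply, comp_apply, chMap_letterMul, key v e ω hω]

theorem homotopy_mem {n : ℕ} {x : CH (cobarAug R)}
    (hx : x ∈ homog (chComp (cobarComp R) (cobarAug R)) n) :
    homotopy R x ∈ homog (chComp (cobarComp R) (cobarAug R)) (n + 1) := by
  have h := isAugDGA_cobar (R := R) (σ := AlgHom.id k _) (hσ := fun _ _ h => h)
  refine h.ch_degree_induction (fun _ : Unit => homotopy R)
    (fun _ n => homog (chComp (cobarComp R) (cobarAug R)) (n + 1)) ?_ ?_ hx ()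
  · intro i u _ _
    rw [homotopy_tmul_one]
    exact zero_mem _
  · intro e ω p v hω hv _ _ _
    rw [homotopy_letterMul]
    refine tmul_mem_of_mem grading_cobar ((grading_coalgBar.regrade _).tmul grading_cobar) _ _
      (split_mem hv) fun i q hq a ha r hr => ?_
    refine tmul_mem_of_mem (grading_coalgBar.regrade _) grading_cobar
      (homotopyCore R ω ∘ₗ TensorProduct.mk k _ _ a) _ hr fun l j hl m hm z hz => ?_
    obtain ⟨c, hc, rfl⟩ := eq_toCoalgBar_of_mem hm
    rw [comp_apply, TensorProduct.mk_apply,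
      homotopyCore_apply (chSign_of_mem h hω) ha hc hz]
    refine smul_mem _ _ ?_
    have := h.leftMul_mem hz (h.rightMul_mem (barCobar_mem hc) (h.letterMul_mem ha hω))
    rw [show e + (i + 1) + (l + 1) + j = e + (p + 1) + 1 by omega] at this
    exact this

theorem q₂_chMap (x : CH (cobarAug R)) :
    q₂ R σ hσ (chMap (cobarAug R) (cobarAug R) (cobarMap R σ hσ) x) =
      coMap R σ hσ (q₂ R σ hσ x) := by
  have h := isAugDGA_cobar (R := R) (σ := σ) (hσ := hσ)
  have hb : ∀ y, chMap (cobarAug R) (cobarAug R) (cobarMap R σ hσ) (bCobar R σ hσ y) =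
      bCobar R σ hσ (chMap (cobarAug R) (cobarAug R) (cobarMap R σ hσ) y) :=
    h.hom_self.chMap_hochB h h
  apply p₂_injective
  have h1 := homotopy_hochB (σ := σ) (hσ := hσ) x
  have h2 := homotopy_hochB (σ := σ) (hσ := hσ)
    (chMap (cobarAug R) (cobarAug R) (cobarMap R σ hσ) x)
  rw [eq_sub_iff_add_eq, ← eq_sub_iff_add_eq'] at h1 h2
  rw [p₂_coMap, h2, h1, ← hb, homotopy_chMap, homotopy_chMap, ← hb, map_sub, map_add]

theorem p₂_q₂ (x : CH (cobarAug R)) : p₂ R (q₂ R σ hσ x) =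
    x - (homotopy R (bCobar R σ hσ x) + bCobar R σ hσ (homotopy R x)) := by
  rw [homotopy_hochB, sub_sub_cancel]

theorem q₂_mem {n : ℕ} {x : CH (cobarAug R)}
    (hx : x ∈ homog (chComp (cobarComp R) (cobarAug R)) n) :
    q₂ R σ hσ x ∈ homog (coComp R) n := by
  have h := isAugDGA_cobar (R := R) (σ := σ) (hσ := hσ)
  apply mem_of_p₂_mem
  rw [p₂_q₂]
  refine sub_mem hx (add_mem ?_ (h.hochB_mem (homotopy_mem hx)))
  have h1 := h.hochB_mem hx
  cases n with
  | zero =>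
    rw [show bCobar R σ hσ x = 0 from (mem_bot k).1 h1, map_zero]
    exact zero_mem _
  | succ n => exact homotopy_mem h1

theorem q₂_hochB (x : CH (cobarAug R)) :
    q₂ R σ hσ (bCobar R σ hσ x) = coB R σ hσ (q₂ R σ hσ x) := by
  have h := isAugDGA_cobar (R := R) (σ := σ) (hσ := hσ)
  have hb : ∀ y, bCobar R σ hσ (bCobar R σ hσ y) = 0 := h.hochB_hochB
  apply p₂_injective
  rw [p₂_coB, p₂_q₂, p₂_q₂, map_sub, map_add, hb, hb, map_zero]
  simp

theorem ιInv_mul {M : Type*} [AddCommGroup M] [Module k M] (x y : TensorAlgebra k M) :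
    TensorAlgebra.ιInv (x * y) = TensorAlgebra.algebraMapInv x • TensorAlgebra.ιInv y +
      TensorAlgebra.algebraMapInv y • TensorAlgebra.ιInv x := by
  induction y using TensorAlgebra.induction generalizing x with
  | algebraMap r =>
    have h1 : TensorAlgebra.ιInv (algebraMap k (TensorAlgebra k M) r) = 0 := by
      rw [Algebra.algebraMap_eq_smul_one, map_smul, ιInv_one, smul_zero]
    rw [h1, smul_zero, zero_add, Algebra.algebraMap_eq_smul_one, mul_smul_comm, mul_one, map_smul,
      map_smul, map_one, smul_eq_mul, mul_one]
  | ι m =>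
    have h1 := ιInv_mul_ι (1 : TensorAlgebra k M) m
    rw [one_mul, map_one, one_smul] at h1
    rw [ιInv_mul_ι, h1, algebraMapInv_ι, zero_smul, add_zero]
  | mul a b ha hb =>
    rw [← mul_assoc, hb, ha, hb, map_mul, map_mul]
    module
  | add a b ha hb => rw [mul_add, map_add, ha, hb, map_add, map_add]; module

/-- The rotations around `x` contain the letters of `x`; so they have no components of length `0`
and `1` if `x` has none. -/
theorem cycSum_ιInv (w : Bar (cobarAug R)) {x : Bar (cobarAug R)} {r : k}
    (hr : signOp (barComp (cobarComp R) (cobarAug R)) x = r • x)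
    (hx : TensorAlgebra.algebraMapInv x = 0) (hx' : TensorAlgebra.ιInv x = 0) :
    TensorAlgebra.algebraMapInv (cycSum (cobarComp R) (cobarAug R) (cobarMap R σ hσ) x w) = 0 ∧
      TensorAlgebra.ιInv (cycSum (cobarComp R) (cobarAug R) (cobarMap R σ hσ) x w) = 0 := by
  have h := isAugDGA_cobar (R := R) (σ := σ) (hσ := hσ)
  induction w using h.bar_induction generalizing x r with
  | add y z hy hz =>
    simp only [map_add, hy hr hx hx', hz hr hx hx', add_zero, and_self]
  | smul s y hy => simp only [map_smul, hy hr hx hx', smul_zero, and_self]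
  | one => rw [cycSum_one]; exact ⟨hx, hx'⟩
  | snoc e w i a hw ha h0 ih =>
    have ha' : TensorAlgebra.algebraMapInv (barLetter (cobarAug R) a) = 0 := algebraMapInv_ι _
    have hs : signOp (barComp (cobarComp R) (cobarAug R)) (barLetter (cobarAug R) a * x) =
        ((-1) ^ (i + 1) * r) • (barLetter (cobarAug R) a * x) := by
      rw [h.barSign_mul, signOp_of_mem (h.barLetter_mem ha), hr, smul_mul_smul_comm]
    obtain ⟨h1, h2⟩ := ih hs (by rw [map_mul, ha', zero_mul])
      (by rw [ιInv_mul, ha', hx, zero_smul, zero_smul, add_zero])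
    rw [h.cycSum_mul_letter ha hr (signOp_of_mem hw), map_add, map_add, map_smul, map_smul, h1, h2,
      map_mul, ιInv_mul, hx, hx', smul_zero, smul_zero, smul_zero, zero_smul, zero_mul, add_zero]
    exact ⟨rfl, by simp⟩

theorem counit_rotate (u v : Cobar R) :
    (counit R).lTensor _ (rotate R σ hσ (u ⊗ₜ[k] v)) = 0 := by
  induction v using cobar_induction generalizing u with
  | add x y hx hy => simp only [tmul_add, map_add, hx, hy, add_zero]
  | smul r x hx => simp only [tmul_smul, map_smul, hx, smul_zero]
  | one => rw [rotate_tmul_one, map_zero]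
  | snoc p y n c hy hc ih =>
    induction u using grading_cobar.induction with
    | add x y hx hy => simp only [add_tmul, map_add, hx, hy, add_zero]
    | hom i u hu =>
      rw [rotate_mul_letter (signOp_of_mem hu) hy hc, map_add, map_smul, map_smul, ih, smul_zero,
        lTensor_tmul, counit_of_mem hc, tmul_zero, smul_zero, add_zero]

/-- The summands of a rotation are of the form `u ⊗ c` with `ε(c) = 0`, and `coConnesB` vanishes on
these. -/
theorem coConnesB_rotate (u v : Cobar R) :
    coConnesB R σ hσ (rotate R σ hσ (u ⊗ₜ[k] v)) = 0 := by
  rw [coConnesB, comp_apply, comp_apply, comp_apply, counit_rotate,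
    map_zero, map_zero, map_zero]

theorem q₂_connesB (x : CH (cobarAug R)) :
    q₂ R σ hσ (BCobar R σ hσ x) = coConnesB R σ hσ (q₂ R σ hσ x) := by
  have h := isAugDGA_cobar (R := R) (σ := σ) (hσ := hσ)
  rw [BCobar]
  induction x using TensorProduct.induction_on with
  | zero => simp
  | add x y hx hy => simp only [map_add, hx, hy]
  | tmul u w =>
    rw [connesB_tmul]
    induction u using grading_cobar.induction with
    | add x y hx hy =>
      simp only [add_tmul, tmul_add, map_add, LinearMap.add_apply] at hx hy ⊢
      rw [hx, hy]
    | hom j u hu =>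
      induction w using h.bar_induction with
      | add y z hy hz => simp only [tmul_add, map_add, hy, hz]
      | smul s y hy => simp only [tmul_smul, map_smul, hy]
      | one =>
        have h1 := q₂_letterMul (σ := σ) (hσ := hσ) u 1 1
        rw [letterMul_tmul, one_mul, map_one, one_smul] at h1
        rw [cycSum_one, h1, q₂_tmul_one, coConnesB]
        simp [counit_coalgOne]
      | snoc e w i a hw ha h0 _ =>
        have ha' : ∀ b, TensorAlgebra.algebraMapInv (barLetter (cobarAug R) b) = 0 :=
          fun b => algebraMapInv_ι _
        have hu' := signOp_of_mem (h.barLetter_mem hu)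
        have hs : signOp (barComp (cobarComp R) (cobarAug R))
            (barLetter (cobarAug R) a * barLetter (cobarAug R) u) =
            ((-1 : k) ^ (i + 1) * (-1) ^ (j + 1)) •
              (barLetter (cobarAug R) a * barLetter (cobarAug R) u) := by
          rw [h.barSign_mul, signOp_of_mem (h.barLetter_mem ha), hu', smul_mul_smul_comm]
        obtain ⟨h1, h2⟩ := cycSum_ιInv (σ := σ) (hσ := hσ) w hs (by rw [map_mul, ha', zero_mul])
          (by rw [ιInv_mul, ha', ha', zero_smul, zero_smul, add_zero])
        rw [← letterMul_tmul, q₂_letterMul, map_smul, coConnesB_rotate, smul_zero, q₂_tmul,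
          h.cycSum_mul_letter ha hu' (signOp_of_mem hw), map_add, map_add, map_smul, map_smul, h1,
          h2, map_mul, ιInv_mul, barMap_mul, map_mul, barMap_letter, ha', ha']
        simp

end Compatibility

/-! ### The mixed complex of the coalgebra -/

section Transfer

variable {k : Type u} [Field k] {V : Type v} [AddCommGroup V] [Module k V]
variable {R : Submodule k (V ⊗[k] V)}
variable {σ : QuadAlg R →ₐ[k] QuadAlg R} {hσ : IsGradedEnd R σ}

theorem p₂_mem_oneCobar (hss : ⨆ μ : k, eigenspace σ.toLinearMap μ = ⊤) {x : CoCH R}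
    (hx : x ∈ coOne R σ hσ) : p₂ R x ∈ oneCobar R σ hσ := by
  rw [mem_oneCobar hss, ← p₂_coMap, (mem_coOne hss).1 hx]

theorem q₂_mem_coOne (hss : ⨆ μ : k, eigenspace σ.toLinearMap μ = ⊤)
    {x : CH (cobarAug R)} (hx : x ∈ oneCobar R σ hσ) : q₂ R σ hσ x ∈ coOne R σ hσ := by
  rw [mem_coOne hss, ← q₂_chMap, (mem_oneCobar hss).1 hx]

theorem homotopy_mem_oneCobar (hss : ⨆ μ : k, eigenspace σ.toLinearMap μ = ⊤)
    {x : CH (cobarAug R)} (hx : x ∈ oneCobar R σ hσ) : homotopy R x ∈ oneCobar R σ hσ := by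
  rw [mem_oneCobar hss, ← homotopy_chMap, (mem_oneCobar hss).1 hx]

theorem coB_eq (x : CoCH R) : coB R σ hσ x = q₂ R σ hσ (bCobar R σ hσ (p₂ R x)) := by
  rw [q₂_hochB, q₂_p₂]

theorem coConnesB_eq (x : CoCH R) :
    coConnesB R σ hσ x = q₂ R σ hσ (BCobar R σ hσ (p₂ R x)) := by
  rw [q₂_connesB, q₂_p₂]

theorem isMixedComplex_cobar (hss : ⨆ μ : k, eigenspace σ.toLinearMap μ = ⊤) :
    IsMixedComplex (degCobar R) (oneCobar R σ hσ) (bCobar R σ hσ) (BCobar R σ hσ) :=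
  isAugDGA_cobar.isMixedComplex (iSup_eigenspace_cobarMap hss)

/-- The mixed complex structure is transferred from the cobar construction along the retraction
`q₂` of `p₂`. -/
theorem isMixedComplex_co (hss : ⨆ μ : k, eigenspace σ.toLinearMap μ = ⊤) :
    IsMixedComplex (coDeg R) (coOne R σ hσ) (coB R σ hσ) (coConnesB R σ hσ) := by
  have h := isMixedComplex_cobar (hσ := hσ) hss
  have e1 : coDeg R = homog (coComp R) := funext coDeg_eq
  have e2 : degCobar R = homog (chComp (cobarComp R) (cobarAug R)) := funext degCobar_eq
  rw [e2] at h
  rw [e1]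
  have hp : ∀ n, ∀ x ∈ coOne R σ hσ ⊓ homog (coComp R) n,
      p₂ R x ∈ oneCobar R σ hσ ⊓ homog (chComp (cobarComp R) (cobarAug R)) n :=
    fun n x hx => ⟨p₂_mem_oneCobar hss hx.1, p₂_mem hx.2⟩
  refine ⟨?_, ?_, ?_, ?_, ?_, ?_, ?_, ?_, ?_⟩
  · have e3 : coOne R σ hσ = (coMap R σ hσ).eigenspace 1 := by
      ext x
      rw [mem_coOne hss, mem_eigenspace_iff, one_smul]
    rw [e3]
    exact fixed_graded grading_co fun n x hx => coMap_mem hx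
  · intro x hx
    rw [coB_eq]
    exact q₂_mem_coOne hss (h.b_mem _ (p₂_mem_oneCobar hss hx))
  · intro x hx
    rw [coConnesB_eq]
    exact q₂_mem_coOne hss (h.B_mem _ (p₂_mem_oneCobar hss hx))
  · intro x hx
    rw [coB_eq, h.b_zero _ (hp 0 x hx), map_zero]
  · intro n x hx
    rw [coB_eq]
    exact q₂_mem (h.b_succ n _ (hp _ x hx))
  · intro n x hx
    rw [coConnesB_eq]
    exact q₂_mem (h.B_deg n _ (hp _ x hx))
  · intro x hx
    rw [coB_eq x, ← q₂_hochB, h.b_b _ (p₂_mem_oneCobar hss hx), map_zero]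
  · intro x hx
    rw [coConnesB_eq x, ← q₂_connesB, h.B_B _ (p₂_mem_oneCobar hss hx), map_zero]
  · intro x hx
    rw [coConnesB_eq x, ← q₂_hochB, coB_eq x, ← q₂_connesB, ← map_add,
      h.b_B _ (p₂_mem_oneCobar hss hx), map_zero]

theorem isMixedQuasiIso_q₂ (hss : ⨆ μ : k, eigenspace σ.toLinearMap μ = ⊤) :
    IsMixedQuasiIso (degCobar R) (oneCobar R σ hσ) (bCobar R σ hσ) (BCobar R σ hσ)
      (coDeg R) (coOne R σ hσ) (coB R σ hσ) (coConnesB R σ hσ) (q₂ R σ hσ) := by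
  have e1 : coDeg R = homog (coComp R) := funext coDeg_eq
  have e2 : degCobar R = homog (chComp (cobarComp R) (cobarAug R)) := funext degCobar_eq
  rw [e1, e2]
  refine ⟨fun x => q₂_mem_coOne hss, fun n x hx => q₂_mem hx.2, fun x _ => q₂_hochB x,
    fun x _ => q₂_connesB x, ?_, ?_⟩
  · rintro n x ⟨hx1, hx2⟩ hb ⟨y, ⟨hy1, hy2⟩, hy⟩
    refine ⟨p₂ R y + homotopy R x, ⟨add_mem (p₂_mem_oneCobar hss hy1)
      (homotopy_mem_oneCobar hss hx1), add_mem (p₂_mem hy2) (homotopy_mem hx2)⟩, ?_⟩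
    rw [map_add, ← p₂_coB, hy, p₂_q₂, hb, map_zero, zero_add, sub_add_cancel]
  · rintro n y ⟨hy1, hy2⟩ hb
    refine ⟨p₂ R y, ⟨p₂_mem_oneCobar hss hy1, p₂_mem hy2⟩, ?_, 0, zero_mem _, ?_⟩
    · rw [← p₂_coB, hb, map_zero]
    · rw [q₂_p₂, sub_self, map_zero]

end Transfer

/-! ### The weight gradings -/

section Weight

variable {k : Type u} [Field k] {V : Type v} [AddCommGroup V] [Module k V]
variable {R : Submodule k (V ⊗[k] V)}

/-- The algebra map which sends a word of length `n` to its class, placed in degree `n`. -/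
def quadCompHom (R : Submodule k (V ⊗[k] V)) :
    QuadAlg R →ₐ[k] AddMonoidAlgebra (QuadAlg R) ℕ :=
  Ideal.Quotient.liftₐ (relIdeal R)
    (TensorAlgebra.lift k ((AddMonoidAlgebra.lsingle 1 : QuadAlg R →ₗ[k] _) ∘ₗ quadι R)) (by
    set f := TensorAlgebra.lift k ((AddMonoidAlgebra.lsingle 1 : QuadAlg R →ₗ[k] _) ∘ₗ quadι R)
      with hf
    have h1 : ∀ y ∈ wordPow k V 2, f y = AddMonoidAlgebra.single 2 (quadMk R y) := by
      intro y hy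
      rw [wordPow, pow_two] at hy
      induction hy using Submodule.mul_induction_on' with
      | mem_mul_mem m hm n hn =>
        obtain ⟨v, rfl⟩ := hm
        obtain ⟨w, rfl⟩ := hn
        rw [map_mul, map_mul, hf, TensorAlgebra.lift_ι_apply, TensorAlgebra.lift_ι_apply]
        simp only [comp_apply, AddMonoidAlgebra.lsingle_apply,
          AddMonoidAlgebra.single_mul_single]
        rfl
      | add y hy z hz h1 h2 => rw [map_add, map_add, h1, h2, AddMonoidAlgebra.single_add]
    have h2 : TwoSidedIdeal.span (relSub R : Set (TensorAlgebra k V)) ≤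
        TwoSidedIdeal.ker f.toRingHom := by
      rw [TwoSidedIdeal.span_le]
      intro x hx
      rw [SetLike.mem_coe, TwoSidedIdeal.mem_ker]
      have h3 : quadMk R x = 0 :=
        Ideal.Quotient.eq_zero_iff_mem.2 (TwoSidedIdeal.subset_span hx)
      have h4 := h1 x (relSub_le R hx)
      rw [h3, AddMonoidAlgebra.single_zero] at h4
      exact h4
    intro x hx
    exact (TwoSidedIdeal.mem_ker _).1 (h2 hx))

/-- The grading of `T(V) / (R)` by word length. -/
def quadComp (R : Submodule k (V ⊗[k] V)) : QuadAlg R →ₗ[k] ℕ →₀ QuadAlg R :=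
  (AddMonoidAlgebra.coeffLinearEquiv k).toLinearMap ∘ₗ (quadCompHom R).toLinearMap

theorem mem_homog_quadComp {n : ℕ} {x : QuadAlg R} :
    x ∈ homog (quadComp R) n ↔ quadCompHom R x = AddMonoidAlgebra.single n x := by
  rw [mem_homog, quadComp, comp_apply, AlgHom.toLinearMap_apply]
  exact ((AddMonoidAlgebra.coeffLinearEquiv k).injective.eq_iff (b := AddMonoidAlgebra.single n x))

theorem quad_one_mem : (1 : QuadAlg R) ∈ homog (quadComp R) 0 := by
  rw [mem_homog_quadComp, map_one]; rfl

theorem quad_mul_mem {i j : ℕ} {x y : QuadAlg R} (hx : x ∈ homog (quadComp R) i)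
    (hy : y ∈ homog (quadComp R) j) : x * y ∈ homog (quadComp R) (i + j) := by
  rw [mem_homog_quadComp] at *
  rw [map_mul, hx, hy, AddMonoidAlgebra.single_mul_single]

theorem quadι_mem (v : V) : quadι R v ∈ homog (quadComp R) 1 := by
  rw [mem_homog_quadComp]
  change TensorAlgebra.lift k _ (TensorAlgebra.ι k v) = _
  rw [TensorAlgebra.lift_ι_apply]
  rfl

theorem twisting_mem {n : ℕ} {c : Coalg R} (hc : c ∈ homog (coalgComp R) n) :
    twisting R c ∈ homog (quadComp R) n := by
  by_cases hn : n = 1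
  · subst hn
    obtain ⟨v, hv⟩ : ∃ v, TensorAlgebra.ι k v = wordComp (c : TensorAlgebra k V) 1 := by
      have := wordComp_mem (c : TensorAlgebra k V) 1
      rwa [wordPow, pow_one] at this
    rw [twisting_apply, ← hv]
    exact quadι_mem v
  · rw [twisting_of_mem hc hn]
    exact zero_mem _

/-- The grading of the cobar construction by weight: `s⁻¹ c` has weight `|c|`. -/
def weightComp (R : Submodule k (V ⊗[k] V)) : Cobar R →ₗ[k] ℕ →₀ Cobar R :=
  tensorComp (coalgBarComp R)

theorem grading_weight : IsGrading (weightComp R) := grading_coalgBar.tensor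

theorem weight_one : (1 : Cobar R) ∈ homog (weightComp R) 0 := one_mem_homog _

theorem weight_mul {i j : ℕ} {x y : Cobar R} (hx : x ∈ homog (weightComp R) i)
    (hy : y ∈ homog (weightComp R) j) : x * y ∈ homog (weightComp R) (i + j) := mul_mem_homog hx hy

theorem weight_letter {n : ℕ} {c : Coalg R} (hc : c ∈ homog (coalgComp R) n) :
    cobarLetter R c ∈ homog (weightComp R) n := ι_mem_homog (toCoalgBar_mem hc)

/-- Induction for statements about the elements of a given weight. -/
theorem weight_induction {Y : Type*} [AddCommGroup Y] [Module k Y] (F : Cobar R →ₗ[k] Y)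
    (S : ℕ → Submodule k Y) (one : F 1 ∈ S 0)
    (snoc : ∀ (i : ℕ) (x : Cobar R) (n : ℕ) (c : Coalg R), x ∈ homog (weightComp R) i →
      c ∈ homog (coalgComp R) n → F x ∈ S i → F (x * cobarLetter R c) ∈ S (i + n))
    {n : ℕ} {x : Cobar R} (hx : x ∈ homog (weightComp R) n) : F x ∈ S n := by
  have key : ∀ m, F (weightComp R x m) ∈ S m := by
    clear hx
    induction x using tensor_induction_of_span (c := coalgBarComp R)
      {m | ∃ n, ∃ c ∈ homog (coalgComp R) (n + 1), m = toCoalgBar R c} span_toCoalgBar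
      (by rintro _ ⟨n, c, hc, rfl⟩; exact ⟨n + 1, toCoalgBar_mem hc⟩) with
    | add x y hx hy =>
        intro m
        rw [map_add, Finsupp.add_apply, map_add]
        exact add_mem (hx m) (hy m)
    | smul r x hx =>
      intro m; rw [map_smul, Finsupp.smul_apply, map_smul]; exact smul_mem _ r (hx m)
    | one =>
      intro m
      rw [mem_homog.1 weight_one, single_apply]
      split_ifs with h
      · exact h ▸ one
      · rw [map_zero]; exact zero_mem _
    | snoc i x m hx hm ih =>
      obtain ⟨n, c, hc, rfl⟩ := hm
      intro m
      have h1 : x * cobarLetter R c ∈ homog (weightComp R) (i + (n + 1)) :=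
        weight_mul hx (weight_letter hc)
      change F (weightComp R (x * cobarLetter R c) m) ∈ _
      rw [mem_homog.1 h1, single_apply]
      split_ifs with h
      · have h2 := ih i
        have h3 : weightComp R x = Finsupp.single i x := hx
        rw [h3, single_eq_same] at h2
        exact h ▸ snoc i x (n + 1) c hx hc h2
      · rw [map_zero]; exact zero_mem _
  have := key n
  rwa [mem_homog.1 hx, single_eq_same] at this

theorem weight_cobarProj {n : ℕ} {x : Cobar R} (hx : x ∈ homog (weightComp R) n) :
    cobarProj R x ∈ homog (quadComp R) n := by
  refine weight_induction (cobarProj R).toLinearMap (homog (quadComp R)) ?_ ?_ hx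
  · simpa using quad_one_mem
  · intro i x n c _ hc ih
    rw [AlgHom.toLinearMap_apply, map_mul, cobarProj_letter]
    exact quad_mul_mem ih (twisting_mem hc)

theorem signOp_coalg_mem {n : ℕ} {c : Coalg R} (hc : c ∈ homog (coalgComp R) n) :
    signOp (coalgComp R) c ∈ homog (coalgComp R) n := by
  rw [signOp_of_mem hc]; exact smul_mem _ _ hc

theorem weight_signOp {n : ℕ} {x : Cobar R} (hx : x ∈ homog (weightComp R) n) :
    signOp (cobarComp R) x ∈ homog (weightComp R) n := by
  refine weight_induction (signOp (cobarComp R)) (homog (weightComp R)) ?_ ?_ hx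
  · rw [cobarComp, signOp_one]; exact weight_one
  · intro i x n c _ hc ih
    rw [cobarSign_mul, cobarSign_letter]
    exact weight_mul ih (neg_mem (weight_letter (signOp_coalg_mem hc)))

theorem weight_cobarD {n : ℕ} {x : Cobar R} (hx : x ∈ homog (weightComp R) n) :
    cobarD R x ∈ homog (weightComp R) n := by
  refine weight_induction (cobarD R) (homog (weightComp R)) ?_ ?_ hx
  · rw [cobarD_one]; exact zero_mem _
  · intro i x n c hx hc ih
    rw [cobarD_mul, cobarD_letter]
    refine add_mem (weight_mul ih (weight_letter hc)) (weight_mul (weight_signOp hx) ?_)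
    exact conv_mem (c := weightComp R) (f := cobarLetter R ∘ₗ signOp (coalgComp R))
      (g := cobarLetter R) (fun hx hy => weight_mul hx hy)
      (fun n c hc => weight_letter (signOp_coalg_mem hc)) (fun n c hc => weight_letter hc) hc

end Weight

/-! ### The twisted tensor product of the cobar construction and the coalgebra -/

section TwistedTensor

variable {k : Type u} [Field k] {V : Type v} [AddCommGroup V] [Module k V]
variable {R : Submodule k (V ⊗[k] V)}

/-- `u ⊗ c ↦ ∑ (-1) ^ |u| u s⁻¹c' ⊗ c''`. -/
def twistedPart (R : Submodule k (V ⊗[k] V)) : CoCH R →ₗ[k] CoCH R :=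
  (mul' k (Cobar R) ∘ₗ
      TensorProduct.map (signOp (cobarComp R)) (cobarLetter R)).rTensor _ ∘ₗ
    (TensorProduct.assoc k _ _ _).symm.toLinearMap ∘ₗ (comul R).lTensor _

/-- The differential `u ⊗ c ↦ d u ⊗ c + ∑ (-1) ^ |u| u s⁻¹c' ⊗ c''`, for which `Ω(A^¡) ⊗ A^¡` is
acyclic. -/
def twistedD (R : Submodule k (V ⊗[k] V)) : CoCH R →ₗ[k] CoCH R :=
  (cobarD R).rTensor _ + twistedPart R

/-- The map `u s⁻¹c ↦ (-1) ^ |u| u ⊗ c`, which contracts `Ω(A^¡) ⊗ A^¡`. -/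
def openLast (R : Submodule k (V ⊗[k] V)) : Cobar R →ₗ[k] CoCH R :=
  TensorProduct.map (signOp (cobarComp R)) (coalgIncl R) ∘ₗ lastLetter

theorem openLast_mul_letter (x : Cobar R) (c : Coalg R) : openLast R (x * cobarLetter R c) =
    signOp (cobarComp R) x ⊗ₜ[k] (c - counit R c • coalgOne R) := by
  rw [openLast, comp_apply, cobarLetter, comp_apply, lastLetter_mul_ι,
    map_tmul, coalgIncl_toCoalgBar]

theorem openLast_one : openLast R 1 = 0 := by
  rw [openLast, comp_apply, lastLetter_one, map_zero]

theorem twistedPart_tmul (u : Cobar R) (c : Coalg R) : twistedPart R (u ⊗ₜ[k] c) =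
    (mulLeft k (signOp (cobarComp R) u) ∘ₗ cobarLetter R).rTensor _ (comul R c) := by
  simp only [twistedPart, comp_apply, lTensor_tmul]
  generalize comul R c = t
  induction t with
  | zero => simp
  | tmul y z => simp
  | add x y hx hy => simp only [tmul_add, map_add, hx, hy]

theorem cobarSign_cobarSign (x : Cobar R) :
    signOp (cobarComp R) (signOp (cobarComp R) x) = x := grading_cobar.signOp_signOp x

/-- `openLast` contracts the twisted tensor product: it provides a primitive of `x ⊗ 1` for every
cycle `x` of augmentation zero. -/
theorem twistedD_openLast (x : Cobar R) : twistedD R (openLast R x) =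
    (x - cobarAug R x • 1) ⊗ₜ[k] coalgOne R - openLast R (cobarD R x) := by
  induction x using cobar_induction with
  | add x y hx hy =>
    simp only [map_add, hx, hy, add_smul, sub_tmul, add_tmul]; abel
  | smul r x hx =>
    simp only [map_smul, hx, smul_sub, smul_eq_mul, mul_smul, sub_tmul,
      smul_tmul']
  | one => simp [openLast_one, cobarD_one]
  | snoc i x n c _ hc _ =>
    have h0 : counit R c = 0 := counit_of_mem hc
    have h1 : ∀ t : Coalg R ⊗[k] Coalg R, openLast R (signOp (cobarComp R) x *
        mul' k (Cobar R) (TensorProduct.map (cobarLetter R ∘ₗ signOp (coalgComp R))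
          (cobarLetter R) t)) =
        (mulLeft k x ∘ₗ cobarLetter R)
          (TensorProduct.rid k _ ((counit R).lTensor _ t)) ⊗ₜ[k] coalgOne R -
        (mulLeft k x ∘ₗ cobarLetter R).rTensor _ t := by
      intro t
      induction t with
      | zero => simp
      | add y z hy hz =>
        simp only [map_add, mul_add, hy, hz, add_tmul]; abel
      | tmul y z =>
        simp only [map_tmul, mul'_apply, comp_apply, ← mul_assoc,
          openLast_mul_letter, cobarSign_mul, cobarSign_cobarSign, cobarSign_letter,
          grading_coalg.signOp_signOp, lTensor_tmul, TensorProduct.rid_tmul, map_smul,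
          mulLeft_apply, rTensor_tmul, mul_neg, tmul_sub,
          neg_tmul, tmul_smul, ← smul_tmul', smul_neg]
        module
    have h2 := h1 (comul R c)
    rw [comul_counit_right] at h2
    rw [openLast_mul_letter, h0, zero_smul, sub_zero, cobarD_mul, map_add, openLast_mul_letter, h0,
      zero_smul, sub_zero, cobarD_letter, conv_apply, h2, twistedD, LinearMap.add_apply,
      rTensor_tmul, twistedPart_tmul, cobarSign_cobarSign, cobarSign_cobarD, map_mul,
      cobarAug_letter, mul_zero, zero_smul, sub_zero, neg_tmul]
    simp only [comp_apply, mulLeft_apply]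
    abel

theorem twistedD_twistedD (x : CoCH R) : twistedD R (twistedD R x) = 0 := by
  induction x using TensorProduct.induction_on with
  | zero => simp
  | add x y hx hy => rw [map_add, map_add, hx, hy, add_zero]
  | tmul u c =>
    have h1 : ∀ (v : Cobar R) (t : Coalg R ⊗[k] Coalg R),
        (cobarD R).rTensor _ ((mulLeft k v ∘ₗ cobarLetter R).rTensor _ t) =
        (mulLeft k (cobarD R v) ∘ₗ cobarLetter R).rTensor _ t +
        (mulLeft k (signOp (cobarComp R) v) ∘ₗ cobarD R ∘ₗ cobarLetter R).rTensor _ t := by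
      intro v t
      rw [← LinearMap.add_apply, ← LinearMap.rTensor_add, ← comp_apply,
        ← LinearMap.rTensor_comp]
      congr 2
      ext y
      exact cobarD_mul _ _
    have h2 : ∀ (v : Cobar R) (t : Coalg R ⊗[k] Coalg R),
        twistedPart R ((mulLeft k v ∘ₗ cobarLetter R).rTensor _ t) =
        -(mulLeft k (signOp (cobarComp R) v) ∘ₗ mul' k _ ∘ₗ TensorProduct.map
          (cobarLetter R ∘ₗ signOp (coalgComp R)) (cobarLetter R)).rTensor _
          ((TensorProduct.assoc k _ _ _).symm ((comul R).lTensor _ t)) := by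
      intro v t
      induction t with
      | zero => simp
      | add y z hy hz => simp only [map_add, hy, hz, neg_add]
      | tmul y z =>
        simp only [rTensor_tmul, twistedPart_tmul, lTensor_tmul]
        generalize comul R z = s
        induction s with
        | zero => simp
        | add y z hy hz => simp only [tmul_add, map_add, hy, hz, neg_add]
        | tmul a b =>
          simp [cobarSign_mul, cobarSign_letter, neg_tmul, mul_assoc]
    have h3 : (TensorProduct.assoc k _ _ _).symm ((comul R).lTensor _ (comul R c)) =
        (comul R).rTensor _ (comul R c) := by
      rw [← comul_coassoc, LinearEquiv.symm_apply_apply]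
    have h4 : cobarD R ∘ₗ cobarLetter R = (mul' k _ ∘ₗ TensorProduct.map
        (cobarLetter R ∘ₗ signOp (coalgComp R)) (cobarLetter R)) ∘ₗ comul R :=
      LinearMap.ext cobarD_letter
    have h5 : (mulLeft k (signOp (cobarComp R) (cobarD R u)) ∘ₗ
        cobarLetter R).rTensor (Coalg R) (comul R c) =
        -(mulLeft k (cobarD R (signOp (cobarComp R) u)) ∘ₗ
        cobarLetter R).rTensor (Coalg R) (comul R c) := by
      rw [cobarSign_cobarD]
      generalize comul R c = t
      induction t with
      | zero => simp
      | add y z hy hz => simp only [map_add, hy, hz, neg_add]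
      | tmul y z => simp [neg_tmul]
    simp only [twistedD, LinearMap.add_apply, map_add, rTensor_tmul, cobarD_cobarD,
      twistedPart_tmul, zero_tmul, h1, h2, h3, h4, h5]
    rw [← comp_apply (LinearMap.rTensor _ _) (LinearMap.rTensor _ _),
      ← LinearMap.rTensor_comp]
    simp only [LinearMap.comp_assoc]
    abel

theorem twistedD_tmul_one (u : Cobar R) :
    twistedD R (u ⊗ₜ[k] coalgOne R) = cobarD R u ⊗ₜ[k] coalgOne R := by
  simp [twistedD, twistedPart_tmul, comul_coalgOne, cobarLetter_one]

/-- The map `Ω(A^¡) ⊗ A^¡ → A ⊗ A^¡` induced by `q` is a map from the twisted tensor product to the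
Koszul complex. -/
theorem rTensor_cobarProj_twistedD (x : CoCH R) :
    (cobarProj R).toLinearMap.rTensor _ (twistedD R x) =
      koszulD R ((cobarProj R).toLinearMap.rTensor _ x) := by
  have hs : ∀ u : Cobar R, cobarProj R (signOp (cobarComp R) u) = cobarProj R u := by
    intro u
    induction u using grading_cobar.induction with
    | add x y hx hy => simp only [map_add, hx, hy]
    | hom n u hu =>
      cases n with
      | zero => rw [signOp_of_mem hu, pow_zero, one_smul]
      | succ n =>
        rw [signOp_of_mem hu, map_smul, eq_zero_of_mem_lsingle (cobarProj_mem hu), smul_zero]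
  induction x using TensorProduct.induction_on with
  | zero => simp
  | add x y hx hy => simp only [map_add, hx, hy]
  | tmul u c =>
    simp only [twistedD, LinearMap.add_apply, map_add, rTensor_tmul, twistedPart_tmul,
      koszulD, comp_apply, lTensor_tmul, AlgHom.toLinearMap_apply, cobarProj_d,
      zero_tmul, zero_add]
    generalize comul R c = t
    induction t with
    | zero => simp
    | add y z hy hz => simp only [tmul_add, map_add, hy, hz]
    | tmul y z => simp [hs, cobarProj_letter]

/-- The total weight on `Ω(A^¡) ⊗ A^¡`. -/
def totalWeight (R : Submodule k (V ⊗[k] V)) : CoCH R →ₗ[k] ℕ →₀ CoCH R :=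
  tmulComp (weightComp R) (coalgComp R)

theorem grading_totalWeight : IsGrading (totalWeight R) := grading_weight.tmul grading_coalg

theorem totalWeight_twistedD {n : ℕ} {x : CoCH R} (hx : x ∈ homog (totalWeight R) n) :
    twistedD R x ∈ homog (totalWeight R) n := by
  refine tmul_mem_of_mem grading_weight grading_coalg (twistedD R) _ hx ?_
  rintro i j rfl u hu c hc
  rw [twistedD, LinearMap.add_apply, rTensor_tmul, twistedPart_tmul]
  refine add_mem (tmul_mem (weight_cobarD hu) hc) ?_
  refine comul_mem_of _ _ hc ?_
  rintro a b rfl y hy z hz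
  rw [← add_assoc, rTensor_tmul]
  exact tmul_mem (weight_mul (weight_signOp hu) (weight_letter hy)) hz

theorem totalWeight_openLast {n : ℕ} {x : Cobar R} (hx : x ∈ homog (weightComp R) n) :
    openLast R x ∈ homog (totalWeight R) n := by
  refine weight_induction (openLast R) (homog (totalWeight R)) ?_ ?_ hx
  · rw [openLast_one]; exact zero_mem _
  · intro i x n c hx hc _
    rw [openLast_mul_letter]
    refine tmul_mem (weight_signOp hx) ?_
    cases n with
    | zero => rw [← counit_smul_of_mem hc, sub_self]; exact zero_mem _
    | succ n => rw [counit_of_mem hc, zero_smul, sub_zero]; exact hc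

end TwistedTensor

/-! ### Exactness of the cobar construction of a Koszul algebra -/

section Exactness

variable {k : Type u} [Field k] {V : Type v} [AddCommGroup V] [Module k V]
variable {R : Submodule k (V ⊗[k] V)}

/-- The projection of `Ω(A^¡) ⊗ A^¡` onto `Ω(A^¡) ⊗ A^¡_n`. -/
def coalgPart (R : Submodule k (V ⊗[k] V)) (n : ℕ) : CoCH R →ₗ[k] CoCH R :=
  (lapply n ∘ₗ coalgComp R).lTensor _

theorem coalgPart_tmul_of_mem {m : ℕ} (n : ℕ) (u : Cobar R) {c : Coalg R}
    (hc : c ∈ homog (coalgComp R) m) :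
    coalgPart R n (u ⊗ₜ[k] c) = if m = n then u ⊗ₜ[k] c else 0 := by
  rw [coalgPart, lTensor_tmul, comp_apply, mem_homog.1 hc,
    Finsupp.lapply_apply, single_apply]
  split_ifs <;> simp

theorem coalgPart_induction {P : CoCH R → Prop} (add : ∀ x y, P x → P y → P (x + y))
    (zero : P 0) (tmul : ∀ (n : ℕ) (u : Cobar R) (c : Coalg R), c ∈ homog (coalgComp R) n →
      P (u ⊗ₜ[k] c)) (x : CoCH R) : P x := by
  induction x using TensorProduct.induction_on with
  | zero => exact zero
  | add x y hx hy => exact add x y hx hy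
  | tmul u c =>
    induction c using grading_coalg.induction with
    | hom n c hc => exact tmul n u c hc
    | add x y hx hy => rw [tmul_add]; exact add _ _ hx hy

/-- The decomposition of an element of `Ω(A^¡) ⊗ A^¡` by the degree of the second factor. -/
theorem exists_eq_sum_coalgPart (x : CoCH R) : ∃ s : Finset ℕ, x = ∑ n ∈ s, coalgPart R n x := by
  have hg : IsGrading (lsingle 0 : Cobar R →ₗ[k] ℕ →₀ Cobar R) := isGrading_lsingle
  have h := (hg.tmul (grading_coalg (R := R))).sum_comp x
  refine ⟨(tmulComp (lsingle 0 : Cobar R →ₗ[k] ℕ →₀ Cobar R) (coalgComp R) x).support, ?_⟩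
  conv_lhs => rw [← h, Finsupp.sum]
  refine Finset.sum_congr rfl fun n hn => ?_
  clear h hn
  induction x using coalgPart_induction with
  | zero => simp
  | add x y hx hy => simp only [map_add, Finsupp.add_apply, hx, hy]
  | tmul m u c hc =>
    have h1 := tmul_mem (mem_homog_lsingle (k := k) u) hc
    rw [mem_homog.1 h1, coalgPart_tmul_of_mem n u hc, zero_add, single_apply]

theorem coalgPart_coalgPart (n m : ℕ) (x : CoCH R) :
    coalgPart R n (coalgPart R m x) = if m = n then coalgPart R m x else 0 := by
  induction x using coalgPart_induction with
  | zero => simp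
  | add x y hx hy => simp only [map_add, hx, hy]; split_ifs <;> simp
  | tmul p u c hc =>
    rw [coalgPart_tmul_of_mem m u hc]
    by_cases hp : p = m
    · rw [if_pos hp, coalgPart_tmul_of_mem n u hc, hp]
    · simp [hp]

theorem exists_coalgPart_zero (x : CoCH R) : ∃ y, coalgPart R 0 x = y ⊗ₜ[k] coalgOne R := by
  induction x using coalgPart_induction with
  | zero => exact ⟨0, by simp⟩
  | add x y hx hy =>
    obtain ⟨a, ha⟩ := hx
    obtain ⟨b, hb⟩ := hy
    exact ⟨a + b, by rw [map_add, ha, hb, add_tmul]⟩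
  | tmul m u c hc =>
    rw [coalgPart_tmul_of_mem 0 u hc]
    split_ifs with hm
    · subst hm
      refine ⟨counit R c • u, ?_⟩
      conv_lhs => rw [counit_smul_of_mem hc]
      rw [TensorProduct.smul_tmul]
    · exact ⟨0, by simp⟩

theorem coalgPart_rTensor (n : ℕ) (f : Cobar R →ₗ[k] Cobar R) (x : CoCH R) :
    coalgPart R n (f.rTensor _ x) = f.rTensor _ (coalgPart R n x) := by
  rw [coalgPart, ← comp_apply, LinearMap.lTensor_comp_rTensor, ← comp_apply,
    LinearMap.rTensor_comp_lTensor]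

/-- The twisted part of the differential lowers the degree of the second factor. -/
theorem coalgPart_twistedPart {n m : ℕ} (h : m ≤ n) (x : CoCH R) :
    coalgPart R n (twistedPart R (coalgPart R m x)) = 0 := by
  induction x using coalgPart_induction with
  | zero => simp
  | add x y hx hy => simp only [map_add, hx, hy, add_zero]
  | tmul p u c hc =>
    rw [coalgPart_tmul_of_mem m u hc]
    split_ifs with hp
    · subst hp
      rw [twistedPart_tmul]
      refine comul_ext (F := coalgPart R n ∘ₗ LinearMap.rTensor _ _) (G := 0) hc
        fun i j hij y hy z hz => ?_
      rw [comp_apply, rTensor_tmul, coalgPart_tmul_of_mem n _ hz]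
      split_ifs with hj
      · obtain rfl : i = 0 := by omega
        rw [comp_apply, cobarLetter_of_zero hy, map_zero, zero_tmul]
        rfl
      · rfl
    · simp

theorem coalgPart_twistedPart_of_lt {n : ℕ} {x : CoCH R} (h : ∀ m, n < m → coalgPart R m x = 0) :
    coalgPart R n (twistedPart R x) = 0 := by
  obtain ⟨s, hs⟩ := exists_eq_sum_coalgPart x
  rw [hs, map_sum, map_sum]
  refine Finset.sum_eq_zero fun m _ => ?_
  rcases le_or_gt m n with hm | hm
  · exact coalgPart_twistedPart hm x
  · rw [h m hm, map_zero, map_zero]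

theorem coalgPart_twistedD_of_lt {n : ℕ} {x : CoCH R} (h : ∀ m, n < m → coalgPart R m x = 0) :
    coalgPart R n (twistedD R x) = (cobarD R).rTensor _ (coalgPart R n x) := by
  rw [twistedD, LinearMap.add_apply, map_add, coalgPart_twistedPart_of_lt h, add_zero,
    coalgPart_rTensor]

/-- In total weight `w`, the first factors of the component in `Ω(A^¡) ⊗ A^¡_n` have weight `w - n`.
-/
theorem coalgPart_of_totalWeight {w i n : ℕ} {x : CoCH R} (hx : x ∈ homog (totalWeight R) w)
    (h : i + n = w) : (lapply i ∘ₗ weightComp R).rTensor _ (coalgPart R n x) =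
      coalgPart R n x := by
  refine tmul_ext_of_mem grading_weight grading_coalg
    (F := (lapply i ∘ₗ weightComp R).rTensor _ ∘ₗ coalgPart R n) (G := coalgPart R n) hx ?_
  intro a b hab u hu c hc
  rw [comp_apply, coalgPart_tmul_of_mem n u hc]
  split_ifs with hb
  · obtain rfl : a = i := by omega
    rw [rTensor_tmul, comp_apply, mem_homog.1 hu, Finsupp.lapply_apply,
      single_eq_same]
  · rw [map_zero]

theorem coalgPart_eq_zero {w n : ℕ} {x : CoCH R} (hx : x ∈ homog (totalWeight R) w)
    (h : w < n) : coalgPart R n x = 0 := by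
  refine tmul_ext_of_mem grading_weight grading_coalg (F := coalgPart R n) (G := 0) hx ?_
  intro a b hab u _ c hc
  rw [coalgPart_tmul_of_mem n u hc, if_neg (by omega), LinearMap.zero_apply]

/-- The complex `0 ← A ← Ω(A^¡)` is exact in weight `w`. -/
def ExactInWeight (R : Submodule k (V ⊗[k] V)) (w : ℕ) : Prop :=
  ∀ x ∈ homog (weightComp R) w, cobarD R x = 0 → cobarProj R x = 0 →
    ∃ y ∈ homog (weightComp R) w, cobarProj R y = 0 ∧ cobarD R y = x

/-- Exactness is preserved by the tensor product with `A^¡`, as `k` is a field. -/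
theorem ExactInWeight.rTensor {w : ℕ} (hw : ExactInWeight R w) {T : CoCH R}
    (h1 : (cobarD R).rTensor _ T = 0) (h2 : (cobarProj R).toLinearMap.rTensor (Coalg R) T = 0)
    (h3 : (lapply w ∘ₗ weightComp R).rTensor _ T = T) :
    ∃ Z : CoCH R, (lapply w ∘ₗ weightComp R).rTensor _ Z = Z ∧
      (cobarProj R).toLinearMap.rTensor (Coalg R) Z = 0 ∧ (cobarD R).rTensor _ Z = T := by
  set P := homog (weightComp R) w ⊓ LinearMap.ker (cobarProj R).toLinearMap with hP
  set π : Cobar R →ₗ[k] Cobar R := lapply w ∘ₗ weightComp R with hπ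
  have hmem : ∀ x, x ∈ homog (weightComp R) w ↔ π x = x := by
    intro x
    constructor
    · intro hx
      rw [hπ, comp_apply, mem_homog.1 hx, Finsupp.lapply_apply, single_eq_same]
    · intro hx
      rw [← hx]
      exact grading_weight.comp_mem x w
  have hex : Function.Exact (cobarD R ∘ₗ P.subtype)
      ((cobarD R).prod ((cobarProj R).toLinearMap.prod (LinearMap.id - π))) := by
    intro x
    constructor
    · intro hx
      simp only [LinearMap.prod_apply, Function.prod, Prod.mk_eq_zero, LinearMap.sub_apply,
        id_apply, sub_eq_zero] at hx
      obtain ⟨y, hy, hq, hd⟩ := hw x ((hmem x).2 hx.2.2.symm) hx.1 hx.2.1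
      exact ⟨⟨y, hy, hq⟩, hd⟩
    · rintro ⟨⟨y, hy, hq⟩, rfl⟩
      simp only [LinearMap.prod_apply, Function.prod, Prod.mk_eq_zero, LinearMap.sub_apply,
        id_apply, sub_eq_zero]
      exact ⟨cobarD_cobarD y, cobarProj_d y, ((hmem _).1 (weight_cobarD hy)).symm⟩
  have hT : ((cobarD R).prod ((cobarProj R).toLinearMap.prod (LinearMap.id - π))).rTensor
      (Coalg R) T = 0 := by
    have e : (cobarD R).prod ((cobarProj R).toLinearMap.prod (LinearMap.id - π)) =
        LinearMap.inl k _ _ ∘ₗ cobarD R + LinearMap.inr k _ _ ∘ₗ LinearMap.inl k _ _ ∘ₗ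
          (cobarProj R).toLinearMap + LinearMap.inr k _ _ ∘ₗ LinearMap.inr k _ _ ∘ₗ
          (LinearMap.id - π) := by
      ext x <;> simp
    rw [e]
    simp only [LinearMap.rTensor_add, LinearMap.rTensor_comp, LinearMap.add_apply,
      comp_apply, h1, h2, LinearMap.rTensor_sub, LinearMap.sub_apply, h3,
      LinearMap.rTensor_id, id_apply, sub_self, map_zero, add_zero]
  obtain ⟨Z, hZ⟩ := (Module.Flat.rTensor_exact (Coalg R) hex T).1 hT
  rw [LinearMap.rTensor_comp] at hZ
  have e1 : π ∘ₗ P.subtype = P.subtype := by ext y; exact (hmem y).1 y.2.1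
  have e2 : (cobarProj R).toLinearMap ∘ₗ P.subtype = 0 := by ext y; exact y.2.2
  refine ⟨P.subtype.rTensor _ Z, ?_, ?_, hZ⟩
  · rw [← comp_apply, ← LinearMap.rTensor_comp, e1]
  · rw [← comp_apply, ← LinearMap.rTensor_comp, e2, LinearMap.rTensor_zero,
      LinearMap.zero_apply]

/-- A cycle `x` of the cobar construction which bounds a chain `U` of `Ω(A^¡) ⊗ A^¡` bounds in the
cobar construction: the components of `U` in `Ω(A^¡) ⊗ A^¡_n`, `n ≥ 1`, are removed by means of the
exactness in smaller weights. -/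
theorem exists_of_twistedD_eq {w : ℕ} (hw : ∀ i < w, ExactInWeight R i) (x : Cobar R) (N : ℕ) :
    N ≤ w → ∀ U ∈ homog (totalWeight R) w, (cobarProj R).toLinearMap.rTensor _ U = 0 →
      twistedD R U = x ⊗ₜ[k] coalgOne R → (∀ n, N < n → coalgPart R n U = 0) →
      ∃ y, cobarProj R y = 0 ∧ cobarD R y = x := by
  induction N with
  | zero =>
    intro _ U _ hU hd h0
    obtain ⟨y, hy⟩ : ∃ y, U = y ⊗ₜ[k] coalgOne R := by
      obtain ⟨y, hy⟩ := exists_coalgPart_zero U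
      refine ⟨y, hy ▸ ?_⟩
      obtain ⟨s, hs⟩ := exists_eq_sum_coalgPart U
      conv_rhs => rw [hs, map_sum]
      conv_lhs => rw [hs]
      refine Finset.sum_congr rfl fun n _ => ?_
      rw [coalgPart_coalgPart]
      split_ifs with hn
      · rfl
      · exact h0 n (by omega)
    rw [hy, rTensor_tmul] at hU
    rw [hy, twistedD_tmul_one] at hd
    refine ⟨y, ?_, ?_⟩
    · have := congrArg (fun z => TensorProduct.rid k _ ((counit R).lTensor _ z)) hU
      simpa [counit_coalgOne] using this
    · have := congrArg (fun z => TensorProduct.rid k _ ((counit R).lTensor _ z)) hd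
      simpa [counit_coalgOne] using this
  | succ N ih =>
    intro hN U hUw hU hd h0
    -- The top component `T` of `U` is a cycle for `d ⊗ 1` whose first factors have weight less than
    -- `w`. If `(d ⊗ 1) Z' = T`, then the top component of `U - twistedD Z'` vanishes.
    set T := coalgPart R (N + 1) U with hT
    have h1 : (cobarD R).rTensor _ T = 0 := by
      rw [hT, ← coalgPart_twistedD_of_lt h0, hd, coalgPart_tmul_of_mem _ _ coalgOne_mem,
        if_neg (by omega)]
    have h2 : (cobarProj R).toLinearMap.rTensor _ T = 0 := by
      rw [hT, coalgPart, ← comp_apply, LinearMap.rTensor_comp_lTensor,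
        ← LinearMap.lTensor_comp_rTensor, comp_apply, hU, map_zero]
    have hi : (w - (N + 1)) + (N + 1) = w := by omega
    obtain ⟨Z, hZ1, hZ2, hZ⟩ := (hw (w - (N + 1)) (by omega)).rTensor h1 h2
      (coalgPart_of_totalWeight hUw hi)
    set Z' : CoCH R := coalgPart R (N + 1) Z with hZ'
    have h3 : (cobarD R).rTensor _ Z' = T := by
      rw [hZ', ← coalgPart_rTensor, hZ, hT, coalgPart_coalgPart, if_pos rfl]
    have h4 : (cobarProj R).toLinearMap.rTensor _ Z' = 0 := by
      rw [hZ', coalgPart, ← comp_apply, LinearMap.rTensor_comp_lTensor,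
        ← LinearMap.lTensor_comp_rTensor, comp_apply, hZ2, map_zero]
    have h5 : Z' ∈ homog (totalWeight R) w := by
      rw [hZ', ← hZ1]
      clear_value Z'
      clear hZ' h3 h4 hZ hZ1 hZ2
      induction Z using TensorProduct.induction_on with
      | zero => simp
      | add y z hy hz => simp only [map_add]; exact add_mem hy hz
      | tmul y c =>
        rw [rTensor_tmul, coalgPart, lTensor_tmul]
        have := tmul_mem (grading_weight.comp_mem y (w - (N + 1)))
          (grading_coalg.comp_mem c (N + 1))
        rw [hi] at this
        exact this
    have h6 : ∀ n, N < n → coalgPart R n (twistedD R Z') = coalgPart R n U := by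
      intro n hn
      have h7 : ∀ m, n < m → coalgPart R m Z' = 0 := by
        intro m hm
        rw [hZ', coalgPart_coalgPart, if_neg (by omega)]
      rw [coalgPart_twistedD_of_lt h7]
      by_cases hn' : N + 1 = n
      · rw [hZ', ← hn', coalgPart_coalgPart, if_pos rfl]
        exact h3
      · rw [hZ', coalgPart_coalgPart, if_neg hn', map_zero, h0 n (by omega)]
    refine ih (by omega) (U - twistedD R Z') (sub_mem hUw (totalWeight_twistedD h5)) ?_ ?_ ?_
    · rw [map_sub, hU, rTensor_cobarProj_twistedD, h4, map_zero, sub_zero]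
    · rw [map_sub, twistedD_twistedD, sub_zero, hd]
    · intro n hn
      rw [map_sub, h6 n hn, sub_self]

theorem cobarProj_surjective : Function.Surjective (cobarProj R) := by
  have h : ∀ v, ∃ y, cobarProj R y = quadι R v := by
    intro v
    have hv : TensorAlgebra.ι k v ∈ wordPow k V 1 := by rw [wordPow, pow_one]; exact ⟨v, rfl⟩
    have hv' : TensorAlgebra.ι k v ∈ coalgSub R := by
      refine Submodule.mem_iSup_of_mem 1 (Submodule.mem_inf.2 ⟨hv, ?_⟩)
      simp only [Submodule.mem_iInf]
      intro i j hij
      omega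
    refine ⟨cobarLetter R ⟨_, hv'⟩, ?_⟩
    rw [cobarProj_letter, twisting_apply, wordComp_of_mem hv, single_eq_same]
    rfl
  intro a
  obtain ⟨a, rfl⟩ := quadMk_surjective a
  induction a using TensorAlgebra.induction with
  | algebraMap r => exact ⟨algebraMap k _ r, by rw [AlgHom.commutes, AlgHom.commutes]⟩
  | ι v => exact h v
  | mul a b ha hb =>
    obtain ⟨x, hx⟩ := ha
    obtain ⟨y, hy⟩ := hb
    exact ⟨x * y, by rw [map_mul, map_mul, hx, hy]⟩
  | add a b ha hb =>
    obtain ⟨x, hx⟩ := ha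
    obtain ⟨y, hy⟩ := hb
    exact ⟨x + y, by rw [map_add, map_add, hx, hy]⟩

/-- The Koszul complex is used to modify the primitive `openLast x` of `x ⊗ 1` so that it lies in
the kernel of `Ω(A^¡) ⊗ A^¡ → A ⊗ A^¡`. -/
theorem exactInWeight (hR : IsKoszul R) (w : ℕ) : ExactInWeight R w := by
  induction w using Nat.strong_induction_on with
  | _ w ih =>
  intro x hx hd hq
  have hε : cobarAug R x = 0 := by rw [← quadAug_cobarProj, hq, map_zero]
  have h1 : twistedD R (openLast R x) = x ⊗ₜ[k] coalgOne R := by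
    rw [twistedD_openLast, hε, hd, zero_smul, sub_zero, map_zero, sub_zero]
  set Q : CoCH R →ₗ[k] QuadAlg R ⊗[k] Coalg R := (cobarProj R).toLinearMap.rTensor _ with hQ
  have h2 : koszulD R (Q (openLast R x)) = 0 := by
    rw [hQ, ← rTensor_cobarProj_twistedD, h1, rTensor_tmul, AlgHom.toLinearMap_apply, hq,
      zero_tmul]
  have h3 : TensorProduct.lid k k (TensorProduct.map (quadAug R).toLinearMap (counit R)
      (Q (openLast R x))) = 0 := by
    rw [hQ, openLast, comp_apply]
    induction lastLetter x with
    | zero => simp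
    | add y z hy hz => simp only [map_add, hy, hz, add_zero]
    | tmul y z => simp [counit_coalgIncl]
  obtain ⟨Y, hY⟩ := hR _ h2 h3
  obtain ⟨Y', rfl⟩ := LinearMap.rTensor_surjective (Coalg R) (g := (cobarProj R).toLinearMap)
    cobarProj_surjective Y
  have h4 : Q (twistedD R (totalWeight R Y' w)) = Q (openLast R x) := by
    have hdeg : ∀ n, ∀ y ∈ homog (totalWeight R) n, (Q ∘ₗ twistedD R) y ∈
        homog (tmulComp (quadComp R) (coalgComp R)) n ∧
        Q y ∈ homog (tmulComp (quadComp R) (coalgComp R)) n := by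
      intro n y hy
      have key : ∀ y ∈ homog (totalWeight R) n,
          Q y ∈ homog (tmulComp (quadComp R) (coalgComp R)) n := by
        intro y hy
        refine tmul_mem_of_mem grading_weight grading_coalg Q _ hy ?_
        rintro i j rfl u hu c hc
        exact tmul_mem (weight_cobarProj hu) hc
      exact ⟨key _ (totalWeight_twistedD hy), key _ hy⟩
    have h5 := comp_apply_of_deg_zero grading_totalWeight (fun n y hy => (hdeg n y hy).1) Y' w
    rw [comp_apply, hQ, rTensor_cobarProj_twistedD, hY, ← hQ] at h5
    rw [← comp_apply, ← h5,
      mem_homog.1 (hdeg w _ (totalWeight_openLast hx)).2, single_eq_same]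
  have hYw : totalWeight R Y' w ∈ homog (totalWeight R) w := grading_totalWeight.comp_mem Y' w
  have hU := sub_mem (totalWeight_openLast hx) (totalWeight_twistedD hYw)
  obtain ⟨y, hqy, hdy⟩ := exists_of_twistedD_eq ih x w le_rfl _ hU
    (by rw [map_sub, sub_eq_zero]; exact h4.symm)
    (by rw [map_sub, twistedD_twistedD, sub_zero, h1]) (fun n hn => coalgPart_eq_zero hU hn)
  refine ⟨weightComp R y w, grading_weight.comp_mem y w, ?_, ?_⟩
  · have := comp_apply_of_deg_zero (f := (cobarProj R).toLinearMap) grading_weight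
      (fun n y hy => weight_cobarProj hy) y w
    rw [AlgHom.toLinearMap_apply, hqy] at this
    simpa using this.symm
  · rw [← comp_apply_of_deg_zero grading_weight (fun n y hy => weight_cobarD hy) y w, hdy,
      mem_homog.1 hx, single_eq_same]

/-- If `A` is Koszul, then the kernel of `q : Ω(A^¡) → A` is acyclic. -/
theorem exists_cobarD_eq (hR : IsKoszul R) {x : Cobar R} (hd : cobarD R x = 0)
    (hq : cobarProj R x = 0) : ∃ y, cobarProj R y = 0 ∧ cobarD R y = x := by
  have h : ∀ w, ∃ y, cobarProj R y = 0 ∧ cobarD R y = weightComp R x w := by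
    intro w
    have h1 := comp_apply_of_deg_zero grading_weight (fun n y hy => weight_cobarD hy) x w
    have h2 := comp_apply_of_deg_zero (f := (cobarProj R).toLinearMap) grading_weight
      (fun n y hy => weight_cobarProj hy) x w
    rw [hd, map_zero] at h1
    rw [AlgHom.toLinearMap_apply, hq, map_zero] at h2
    obtain ⟨y, -, hy⟩ := exactInWeight hR w _ (grading_weight.comp_mem x w) h1.symm h2.symm
    exact ⟨y, hy⟩
  choose y hy hy' using h
  refine ⟨∑ w ∈ (weightComp R x).support, y w, ?_, ?_⟩
  · rw [map_sum]; exact Finset.sum_eq_zero fun w _ => hy w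
  · rw [map_sum]
    simp only [hy']
    exact grading_weight.sum_comp x

end Exactness

/-! ### Contractions and Hochschild complexes -/

section Contraction

open TensorAlgebra

variable {k : Type u} [Field k] {E : Type v} [Ring E] [Algebra k E]
  {E' : Type w} [Ring E'] [Algebra k E']

/-- The map `i` is a section of the morphism `q : E → E'` of augmented dg algebras as a map of
complexes, and `H` is a homotopy from the identity to `i q`. Neither `i` nor `H` is required to be
compatible with the products. -/
structure IsContraction (c : E →ₗ[k] ℕ →₀ E) (d : E →ₗ[k] E) (c' : E' →ₗ[k] ℕ →₀ E')
    (d' : E' →ₗ[k] E') (q : E →ₐ[k] E') (i : E' →ₗ[k] E) (H : E →ₗ[k] E) : Prop where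
  q_i : ∀ y, q (i y) = y
  i_sign : ∀ y, i (signOp c' y) = signOp c (i y)
  i_d : ∀ y, i (d' y) = d (i y)
  d_H : ∀ x, d (H x) + H (d x) = x - i (q x)
  H_sign : ∀ x, H (signOp c x) = -signOp c (H x)
  q_H : ∀ x, q (H x) = 0

/-- The map `(a₀, a₁, …, aₙ) ↦ (i a₀, i a₁, …, i aₙ)` induced by a linear map. -/
def chLin (ε' : E' →ₐ[k] k) (ε : E →ₐ[k] k) (i : E' →ₗ[k] E) : CH ε' →ₗ[k] CH ε :=
  TensorProduct.map i (TensorAlgebra.lift k (barLetter ε ∘ₗ i ∘ₗ augIncl ε')).toLinearMap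

/-- The map `x₁ ⋯ xₙ ↦ ∑ j, f(x₁ ⋯ xⱼ₋₁) g(xⱼ) xⱼ₊₁ ⋯ xₙ`. -/
def wordInsert {M : Type*} [AddCommGroup M] [Module k M]
    (f : TensorAlgebra k M →ₗ[k] TensorAlgebra k M) (g : M →ₗ[k] TensorAlgebra k M) :
    TensorAlgebra k M →ₗ[k] TensorAlgebra k M :=
  mul' k _ ∘ₗ
    TensorProduct.map f (mul' k _ ∘ₗ TensorProduct.map g LinearMap.id) ∘ₗ split

theorem wordInsert_one {M : Type*} [AddCommGroup M] [Module k M]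
    (f : TensorAlgebra k M →ₗ[k] TensorAlgebra k M) (g : M →ₗ[k] TensorAlgebra k M) :
    wordInsert f g 1 = 0 := by
  simp [wordInsert, split_one]

theorem wordInsert_mul_ι {M : Type*} [AddCommGroup M] [Module k M]
    (f : TensorAlgebra k M →ₗ[k] TensorAlgebra k M) (g : M →ₗ[k] TensorAlgebra k M)
    (w : TensorAlgebra k M) (m : M) :
    wordInsert f g (w * ι k m) = wordInsert f g w * ι k m + f w * g m := by
  have key : ∀ s : TensorAlgebra k M ⊗[k] (M ⊗[k] TensorAlgebra k M), mul' k _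
      (TensorProduct.map f (mul' k _ ∘ₗ TensorProduct.map g LinearMap.id)
        (((mulRight k (ι k m)).lTensor M).lTensor _ s)) = mul' k _
      (TensorProduct.map f (mul' k _ ∘ₗ TensorProduct.map g LinearMap.id) s) * ι k m := by
    intro s
    induction s with
    | zero => simp
    | add y z hy hz => simp only [map_add, add_mul, hy, hz]
    | tmul y s =>
      induction s with
      | zero => simp
      | add y z hy hz => simp only [tmul_add, map_add, add_mul, hy, hz]
      | tmul m z => simp [mul_assoc]
  simp only [wordInsert, comp_apply, split_mul_ι, map_add, key]
  simp

/-- The homotopy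
`(a₀, …, aₙ) ↦ (H a₀, a₁, …, aₙ) - ∑ j ≥ 1, ± (i q a₀, …, i q aⱼ₋₁, H aⱼ, aⱼ₊₁, …, aₙ)` from the
identity to the map induced by `i q`, for the internal part of the differential. -/
def chHomotopy (c : E →ₗ[k] ℕ →₀ E) (ε : E →ₐ[k] k) (ε' : E' →ₐ[k] k) (q : E →ₐ[k] E')
    (i : E' →ₗ[k] E) (H : E →ₗ[k] E) : CH ε →ₗ[k] CH ε :=
  TensorProduct.map H LinearMap.id -
  TensorProduct.map (i ∘ₗ q.toLinearMap ∘ₗ signOp c)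
    (wordInsert ((TensorAlgebra.lift k (barLetter ε ∘ₗ i ∘ₗ augIncl ε')).toLinearMap ∘ₗ
      barMap ε ε' q ∘ₗ signOp (barComp c ε)) (barLetter ε ∘ₗ H ∘ₗ augIncl ε))

variable {c : E →ₗ[k] ℕ →₀ E} {d : E →ₗ[k] E} {ε : E →ₐ[k] k} {σ : E →ₐ[k] E}
  {c' : E' →ₗ[k] ℕ →₀ E'} {d' : E' →ₗ[k] E'} {ε' : E' →ₐ[k] k} {σ' : E' →ₐ[k] E'}
  {q : E →ₐ[k] E'} {i : E' →ₗ[k] E} {H : E →ₗ[k] E}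

theorem augIncl_toAug_of_aug_eq_zero {a : E} (ha : ε a = 0) : augIncl ε (toAug ε a) = a := by
  rw [augIncl_toAug, ha, zero_smul, sub_zero]

theorem chLin_tmul_one (y : E') : chLin ε' ε i (y ⊗ₜ[k] 1) = i y ⊗ₜ[k] 1 := by
  simp [chLin]

theorem chLin_letterMul {b : E'} (hb : ε' b = 0) (η : CH ε') :
    chLin ε' ε i (letterMul ε' b η) = letterMul ε (i b) (chLin ε' ε i η) := by
  induction η using TensorProduct.induction_on with
  | zero => simp
  | add x y hx hy => simp only [map_add, hx, hy]
  | tmul x w =>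
    rw [letterMul_tmul, chLin, map_tmul, map_tmul, letterMul_tmul]
    simp only [AlgHom.toLinearMap_apply, map_mul, barLetter, comp_apply, lift_ι_apply,
      augIncl_toAug_of_aug_eq_zero hb]

theorem IsContraction.chLin_chSign (hc : IsContraction c d c' d' q i H) (h : IsAugDGA c d ε σ)
    (h' : IsAugDGA c' d' ε' σ') (η : CH ε') :
    chLin ε' ε i (chSign c' ε' η) = chSign c ε (chLin ε' ε i η) := by
  induction η using h'.ch_induction with
  | add x y hx hy => simp only [map_add, hx, hy]
  | smul r x hx => simp only [map_smul, hx]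
  | base j x hx => simp only [chSign_tmul, barSign_one, chLin_tmul_one, hc.i_sign]
  | snoc e η j b _ _ h0 ih =>
    rw [h'.chSign_letterMul, map_neg, chLin_letterMul (by rw [h'.aug_signOp, h0]), ih,
      chLin_letterMul h0, h.chSign_letterMul, hc.i_sign]

theorem IsContraction.chLin_bInternal (hc : IsContraction c d c' d' q i H) (h : IsAugDGA c d ε σ)
    (h' : IsAugDGA c' d' ε' σ') (η : CH ε') :
    chLin ε' ε i (bInternal c' d' ε' η) = bInternal c d ε (chLin ε' ε i η) := by
  induction η using h'.ch_induction with
  | add x y hx hy => simp only [map_add, hx, hy]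
  | smul r x hx => simp only [map_smul, hx]
  | base j x hx => simp only [bInternal_tmul_one, chLin_tmul_one, hc.i_d]
  | snoc e η j b _ _ h0 ih =>
    rw [h'.bInternal_letterMul, map_sub, chLin_letterMul h0, chLin_letterMul (h'.aug_d b), ih,
      chLin_letterMul h0, h.bInternal_letterMul, hc.i_d, hc.chLin_chSign h h']

theorem IsContraction.chMap_chLin (hc : IsContraction c d c' d' q i H)
    (h' : IsAugDGA c' d' ε' σ') (η : CH ε') : chMap ε ε' q (chLin ε' ε i η) = η := by
  induction η using h'.ch_induction with
  | add x y hx hy => simp only [map_add, hx, hy]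
  | smul r x hx => simp only [map_smul, hx]
  | base j x hx => simp only [chLin_tmul_one, chMap_tmul, barMap_one, hc.q_i]
  | snoc e η j b _ _ h0 ih => rw [chLin_letterMul h0, chMap_letterMul, ih, hc.q_i]

theorem chHomotopy_tmul_one (x : E) : chHomotopy c ε ε' q i H (x ⊗ₜ[k] 1) = H x ⊗ₜ[k] 1 := by
  simp [chHomotopy, wordInsert_one]

theorem chHomotopy_letterMul {a : E} (ha : ε a = 0) (ω : CH ε) :
    chHomotopy c ε ε' q i H (letterMul ε a ω) =
      letterMul ε a (chHomotopy c ε ε' q i H ω) -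
        letterMul ε (H a) (chLin ε' ε i (chMap ε ε' q (chSign c ε ω))) := by
  induction ω using TensorProduct.induction_on with
  | zero => simp
  | add x y hx hy => simp only [map_add, hx, hy]; abel
  | tmul x w =>
    have h1 : barLetter ε a = ι k (toAug ε a) := rfl
    rw [letterMul_tmul, chHomotopy, LinearMap.sub_apply, LinearMap.sub_apply,
      map_tmul, map_tmul, map_tmul,
      map_tmul, h1, wordInsert_mul_ι, map_sub, letterMul_tmul, letterMul_tmul,
      chSign_tmul, chMap_tmul, chLin, map_tmul, letterMul_tmul,
      comp_apply (barLetter ε), comp_apply H, augIncl_toAug_of_aug_eq_zero ha,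
      tmul_add, ← h1, sub_sub]
    rfl

theorem chHomotopy_sign (hc : IsContraction c d c' d' q i H) (h : IsAugDGA c d ε σ)
    (h' : IsAugDGA c' d' ε' σ') (hf : IsAugDGAHom c d ε σ c' d' ε' σ' q) (ω : CH ε) :
    chHomotopy c ε ε' q i H (chSign c ε ω) = -chSign c ε (chHomotopy c ε ε' q i H ω) := by
  induction ω using h.ch_induction with
  | add x y hx hy => simp only [map_add, hx, hy, neg_add]
  | smul r x hx => simp only [map_smul, hx, smul_neg]
  | base j x hx =>
    simp only [chSign_tmul, barSign_one, chHomotopy_tmul_one, hc.H_sign, neg_tmul]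
  | snoc e ω j a _ _ h0 ih =>
    rw [h.chSign_letterMul, map_neg, chHomotopy_letterMul (by rw [h.aug_signOp, h0]), ih,
      chHomotopy_letterMul h0, map_sub, h.chSign_letterMul, h.chSign_letterMul, hc.H_sign,
      ← hc.chLin_chSign h h', ← hf.chMap_chSign h h', map_neg, map_neg, LinearMap.neg_apply]

/-- For the internal part of the differential, `chHomotopy` is a homotopy between the identity and
the map induced by `i q`. -/
theorem bInternal_chHomotopy (hc : IsContraction c d c' d' q i H) (h : IsAugDGA c d ε σ)
    (h' : IsAugDGA c' d' ε' σ') (hf : IsAugDGAHom c d ε σ c' d' ε' σ' q) (ω : CH ε) :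
    bInternal c d ε (chHomotopy c ε ε' q i H ω) + chHomotopy c ε ε' q i H (bInternal c d ε ω) =
      ω - chLin ε' ε i (chMap ε ε' q ω) := by
  induction ω using h.ch_induction with
  | add x y hx hy =>
    simp only [map_add]
    rw [add_add_add_comm, hx, hy]
    abel
  | smul r x hx => simp only [map_smul, ← smul_add, hx, smul_sub]
  | base j x hx =>
    rw [chHomotopy_tmul_one, bInternal_tmul_one, bInternal_tmul_one, chHomotopy_tmul_one,
      ← add_tmul, hc.d_H, sub_tmul, chMap_tmul, barMap_one,
      chLin_tmul_one]
  | snoc e ω j a _ _ h0 ih =>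
    have hq : ε' (q a) = 0 := by rw [hf.aug_map, h0]
    have h1 : letterMul ε (d (H a)) = letterMul ε a - letterMul ε (i (q a)) -
        letterMul ε (H (d a)) := by
      rw [← map_sub, ← map_sub, ← hc.d_H, add_sub_cancel_right]
    rw [chHomotopy_letterMul h0, map_sub, h.bInternal_letterMul, h.bInternal_letterMul,
      h.bInternal_letterMul, map_sub, chHomotopy_letterMul h0, chHomotopy_letterMul (h.aug_d a),
      h.chSign_chSign, chHomotopy_sign hc h h' hf, chMap_letterMul, chLin_letterMul hq,
      h.chSign_bInternal, ← hc.chLin_bInternal h h', ← hf.chMap_bInternal h h',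
      ← hc.chLin_chSign h h', ← hf.chMap_chSign h h', h.chSign_chSign, map_neg, map_neg, map_neg,
      map_neg, h1]
    have h2 := congrArg (letterMul ε a) ih
    simp only [map_add, map_sub] at h2
    simp only [LinearMap.sub_apply]
    linear_combination (norm := abel) h2

theorem chMap_chHomotopy (hc : IsContraction c d c' d' q i H) (h : IsAugDGA c d ε σ) (ω : CH ε) :
    chMap ε ε' q (chHomotopy c ε ε' q i H ω) = 0 := by
  induction ω using h.ch_induction with
  | add x y hx hy => rw [map_add, map_add, hx, hy, add_zero]
  | smul r x hx => rw [map_smul, map_smul, hx, smul_zero]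
  | base j x hx => rw [chHomotopy_tmul_one, chMap_tmul, hc.q_H, zero_tmul]
  | snoc e ω j a _ _ h0 ih =>
    rw [chHomotopy_letterMul h0, map_sub, chMap_letterMul, chMap_letterMul, ih, hc.q_H]
    simp

/-! ### The filtration by the number of bar letters -/

/-- The span of the Hochschild chains with at most `m` bar letters. -/
def barFil (ε : E →ₐ[k] k) : ℕ → Submodule k (CH ε)
  | 0 => LinearMap.range ((TensorProduct.mk k E (Bar ε)).flip 1)
  | m + 1 => barFil ε m ⊔ Submodule.map₂ (letterMul ε) ⊤ (barFil ε m)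

theorem barFil_le_succ (m : ℕ) : barFil ε m ≤ barFil ε (m + 1) := le_sup_left

theorem letterMul_mem_barFil {m : ℕ} (a : E) {ω : CH ε} (hω : ω ∈ barFil ε m) :
    letterMul ε a ω ∈ barFil ε (m + 1) :=
  Submodule.mem_sup_right (Submodule.apply_mem_map₂ _ Submodule.mem_top hω)

theorem tmul_one_mem_barFil (m : ℕ) (x : E) : x ⊗ₜ[k] 1 ∈ barFil ε m := by
  induction m with
  | zero => exact ⟨x, rfl⟩
  | succ m ih => exact barFil_le_succ m ih

theorem exists_mem_barFil (h : IsAugDGA c d ε σ) (ω : CH ε) : ∃ m, ω ∈ barFil ε m := by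
  have mono := monotone_nat_of_le_succ (f := barFil ε) barFil_le_succ
  induction ω using h.ch_induction with
  | add x y hx hy =>
    obtain ⟨m, hm⟩ := hx
    obtain ⟨n, hn⟩ := hy
    exact ⟨max m n, add_mem (mono (le_max_left m n) hm) (mono (le_max_right m n) hn)⟩
  | smul r x hx => obtain ⟨m, hm⟩ := hx; exact ⟨m, smul_mem _ r hm⟩
  | base j x hx => exact ⟨0, tmul_one_mem_barFil 0 x⟩
  | snoc e ω j a _ _ _ ih => obtain ⟨m, hm⟩ := ih; exact ⟨m + 1, letterMul_mem_barFil a hm⟩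

/-- An operator maps the filtration by the number of bar letters into another filtration if it does
so on the chains with a single entry and on those obtained by adding a homogeneous letter of
augmentation zero. -/
theorem barFil_induction (h : IsAugDGA c d ε σ) {P : ℕ → Submodule k (CH ε)}
    (hP : ∀ m, P m ≤ P (m + 1))
    (base : ∀ x, x ⊗ₜ[k] 1 ∈ P 0)
    (snoc : ∀ m (ω : CH ε) (j : ℕ) (a : E), ω ∈ barFil ε m → ω ∈ P m → a ∈ homog c j → ε a = 0 →
      letterMul ε a ω ∈ P (m + 1)) (m : ℕ) : barFil ε m ≤ P m := by
  induction m with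
  | zero => rintro _ ⟨x, rfl⟩; exact base x
  | succ m ih =>
    refine sup_le (ih.trans (hP m)) (Submodule.map₂_le.2 fun a ha ω hω => ?_)
    clear ha
    induction a using h.grading.induction with
    | add x y hx hy => rw [map_add]; exact add_mem hx hy
    | hom j a ha =>
      cases j with
      | succ j => exact snoc m ω _ a hω (ih hω) ha (h.aug_succ ha)
      | zero =>
        have h1 : letterMul ε a = letterMul ε (a - ε a • 1) := by
          rw [letterMul, comp_apply, comp_apply, map_sub, map_smul,
            barLetter_one, smul_zero, sub_zero]
        rw [h1]
        exact snoc m ω 0 _ hω (ih hω) (sub_mem ha (smul_mem _ _ h.one_mem))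
          (by rw [map_sub, map_smul, map_one, smul_eq_mul, mul_one, sub_self])

theorem chSign_mem_barFil (h : IsAugDGA c d ε σ) {m : ℕ} {ω : CH ε} (hω : ω ∈ barFil ε m) :
    chSign c ε ω ∈ barFil ε m := by
  refine barFil_induction h (P := fun m => (barFil ε m).comap (chSign c ε))
    (fun m x hx => barFil_le_succ m hx) (fun x => ?_) (fun m ω j a _ hω' _ _ => ?_) m hω
  · rw [mem_comap, chSign_tmul, barSign_one]; exact tmul_one_mem_barFil 0 _
  · rw [mem_comap, h.chSign_letterMul]
    exact neg_mem (letterMul_mem_barFil _ hω')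

theorem leftMul_mem_barFil (h : IsAugDGA c d ε σ) (b : E) {m : ℕ} {ω : CH ε}
    (hω : ω ∈ barFil ε m) : leftMul ε b ω ∈ barFil ε m := by
  refine barFil_induction h (P := fun m => (barFil ε m).comap (leftMul ε b))
    (fun m x hx => barFil_le_succ m hx) (fun x => ?_) (fun m ω j a _ hω' _ _ => ?_) m hω
  · rw [mem_comap, leftMul_tmul]; exact tmul_one_mem_barFil 0 _
  · rw [mem_comap, leftMul_letterMul]
    exact letterMul_mem_barFil _ hω'

theorem rightAct_mem_barFil (h : IsAugDGA c d ε σ) (b : E) {m : ℕ} {ω : CH ε}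
    (hω : ω ∈ barFil ε m) : rightAct c ε σ b ω ∈ barFil ε m := by
  have key := barFil_induction h
    (P := fun m => ⨅ b : E, (barFil ε m).comap (rightAct c ε σ b))
    (fun m x hx => by
      simp only [Submodule.mem_iInf] at hx ⊢
      exact fun b => barFil_le_succ m (hx b))
    (fun x => by
      simp only [Submodule.mem_iInf, mem_comap]
      intro b
      rw [h.rightAct_tmul_one]
      exact tmul_one_mem_barFil 0 _)
    (fun m ω j a hω hω' ha _ => by
      simp only [Submodule.mem_iInf, mem_comap] at hω' ⊢
      intro b
      rw [h.rightAct_letterMul ha]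
      exact sub_mem (letterMul_mem_barFil _ hω)
        (smul_mem _ _ (letterMul_mem_barFil _ (hω' a)))) m hω
  simp only [Submodule.mem_iInf, mem_comap] at key
  exact key b

theorem bExternal_mem_barFil (h : IsAugDGA c d ε σ) {m : ℕ} {ω : CH ε}
    (hω : ω ∈ barFil ε m) : bExternal c ε σ ω ∈ barFil ε (m - 1) := by
  refine barFil_induction h (P := fun m => (barFil ε (m - 1)).comap (bExternal c ε σ))
    (fun m x hx => monotone_nat_of_le_succ (f := barFil ε) barFil_le_succ (by omega) hx)
    (fun x => ?_) (fun m ω j a hω _ ha h0 => ?_) m hω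
  · rw [mem_comap, bExternal_tmul_one]; exact zero_mem _
  · have h1 : ∀ n, (chSign c ε ^ n) ω ∈ barFil ε m := by
      intro n
      induction n with
      | zero => exact hω
      | succ n ih => rw [pow_succ', Module.End.mul_apply]; exact chSign_mem_barFil h ih
    rw [mem_comap, bExternal, LinearMap.sub_apply, h.bOpen_letterMul, h.bLast_letterMul ha,
      h0]
    simp only [zero_smul, sub_zero]
    exact sub_mem (rightAct_mem_barFil h a (chSign_mem_barFil h hω))
      (leftMul_mem_barFil h a (h1 _))

theorem bExternal_eq_zero_of_mem {ω : CH ε} (hω : ω ∈ barFil ε 0) : bExternal c ε σ ω = 0 := by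
  obtain ⟨x, rfl⟩ := hω
  exact bExternal_tmul_one x

theorem chLin_chMap_mem_barFil (h : IsAugDGA c d ε σ) (hq : ∀ x, ε' (q x) = ε x) {m : ℕ}
    {ω : CH ε} (hω : ω ∈ barFil ε m) : chLin ε' ε i (chMap ε ε' q ω) ∈ barFil ε m := by
  refine barFil_induction h (P := fun m => (barFil ε m).comap (chLin ε' ε i ∘ₗ chMap ε ε' q))
    (fun m x hx => barFil_le_succ m hx) (fun x => ?_) (fun m ω j a _ hω' _ h0 => ?_) m hω
  · rw [mem_comap, comp_apply, chMap_tmul, barMap_one, chLin_tmul_one]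
    exact tmul_one_mem_barFil 0 _
  · rw [mem_comap, comp_apply, chMap_letterMul,
      chLin_letterMul (by rw [hq, h0])]
    exact letterMul_mem_barFil _ hω'

theorem chHomotopy_mem_barFil (h : IsAugDGA c d ε σ) (hq : ∀ x, ε' (q x) = ε x) {m : ℕ}
    {ω : CH ε} (hω : ω ∈ barFil ε m) : chHomotopy c ε ε' q i H ω ∈ barFil ε m := by
  refine barFil_induction h (P := fun m => (barFil ε m).comap (chHomotopy c ε ε' q i H))
    (fun m x hx => barFil_le_succ m hx) (fun x => ?_) (fun m ω j a hω hω' _ h0 => ?_) m hω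
  · rw [mem_comap, chHomotopy_tmul_one]; exact tmul_one_mem_barFil 0 _
  · rw [mem_comap, chHomotopy_letterMul h0]
    exact sub_mem (letterMul_mem_barFil _ hω')
      (letterMul_mem_barFil _ (chLin_chMap_mem_barFil h hq (chSign_mem_barFil h hω)))

/-- The kernel of the map of Hochschild complexes induced by `q` is acyclic: the homotopy for the
internal part of the differential inverts the differential up to terms with fewer bar letters. -/
theorem exists_hochB_eq (hc : IsContraction c d c' d' q i H) (h : IsAugDGA c d ε σ)
    (h' : IsAugDGA c' d' ε' σ') (hf : IsAugDGAHom c d ε σ c' d' ε' σ' q) {ω : CH ε}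
    (hb : hochB c d ε σ ω = 0) (hq : chMap ε ε' q ω = 0) :
    ∃ η, chMap ε ε' q η = 0 ∧ hochB c d ε σ η = ω := by
  obtain ⟨m, hm⟩ := exists_mem_barFil h ω
  -- The cycle `ω - b (𝓗 ω)`, where `𝓗` is the homotopy, has fewer bar letters than `ω`.
  have step : ∀ ω, hochB c d ε σ ω = 0 → chMap ε ε' q ω = 0 →
      ω - hochB c d ε σ (chHomotopy c ε ε' q i H ω) =
        -(bExternal c ε σ (chHomotopy c ε ε' q i H ω) +
          chHomotopy c ε ε' q i H (bExternal c ε σ ω)) := by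
    intro ω hb hq
    have h1 := bInternal_chHomotopy hc h h' hf ω
    have h2 : bInternal c d ε ω = -bExternal c ε σ ω := by
      rw [hochB_eq] at hb; exact eq_neg_of_add_eq_zero_left hb
    rw [hq, map_zero, sub_zero, h2, map_neg] at h1
    rw [hochB_eq]
    nth_rw 1 [← h1]
    abel
  induction m generalizing ω with
  | zero =>
    refine ⟨chHomotopy c ε ε' q i H ω, chMap_chHomotopy hc h ω, ?_⟩
    have h1 := step ω hb hq
    rw [bExternal_eq_zero_of_mem hm, map_zero,
      bExternal_eq_zero_of_mem (chHomotopy_mem_barFil h hf.aug_map hm), add_zero, neg_zero,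
      sub_eq_zero] at h1
    exact h1.symm
  | succ m ih =>
    obtain ⟨η, hη, hη'⟩ := ih (ω := ω - hochB c d ε σ (chHomotopy c ε ε' q i H ω))
      (by rw [map_sub, hb, h.hochB_hochB, sub_zero])
      (by rw [map_sub, hq, hf.chMap_hochB h h', chMap_chHomotopy hc h, map_zero, sub_zero])
      (by
        rw [step ω hb hq]
        exact neg_mem (add_mem (bExternal_mem_barFil h (chHomotopy_mem_barFil h hf.aug_map hm))
          (chHomotopy_mem_barFil h hf.aug_map (bExternal_mem_barFil h hm))))
    refine ⟨η + chHomotopy c ε ε' q i H ω, ?_, ?_⟩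
    · rw [map_add, hη, chMap_chHomotopy hc h, add_zero]
    · rw [map_add, hη', sub_add_cancel]

end Contraction

/-! ### The quasi-isomorphism `p₁` -/

section Resolution

variable {k : Type u} [Field k] {V : Type v} [AddCommGroup V] [Module k V]
variable {R : Submodule k (V ⊗[k] V)}
variable {σ : QuadAlg R →ₐ[k] QuadAlg R} {hσ : IsGradedEnd R σ}

theorem comp_cobarD (x : Cobar R) (n : ℕ) :
    cobarComp R (cobarD R x) n = cobarD R (cobarComp R x (n + 1)) :=
  comp_apply_of_lower grading_cobar (fun _ _ => cobarD_mem) x n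

theorem comp_cobarProj (x : Cobar R) (n : ℕ) :
    (lsingle 0 : QuadAlg R →ₗ[k] ℕ →₀ QuadAlg R) (cobarProj R x) n =
      cobarProj R (cobarComp R x n) :=
  comp_apply_of_deg_zero (f := (cobarProj R).toLinearMap) grading_cobar
    (fun _ _ => cobarProj_mem) x n

theorem cobarD_of_zero {x : Cobar R} (hx : x ∈ homog (cobarComp R) 0) : cobarD R x = 0 :=
  (mem_bot k).1 (cobarD_mem hx)

/-- A linear section of the differential on the kernel of `q`, homogeneous of degree one. -/
theorem exists_section_cobarD (hR : IsKoszul R) : ∃ g : Cobar R →ₗ[k] Cobar R,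
    (∀ n, ∀ x ∈ homog (cobarComp R) n, g x ∈ homog (cobarComp R) (n + 1)) ∧
    (∀ x, cobarProj R (g x) = 0) ∧
    ∀ x, cobarD R x = 0 → cobarProj R x = 0 → cobarD R (g x) = x := by
  set K := LinearMap.ker (cobarProj R).toLinearMap with hK
  set Z := LinearMap.ker (cobarD R) ⊓ K with hZ
  obtain ⟨s, hs⟩ := LinearMap.exists_rightInverse_of_surjective
    ((cobarD R ∘ₗ K.subtype).codRestrict Z fun x => ⟨cobarD_cobarD _, cobarProj_d _⟩) (by
      rw [LinearMap.range_eq_top]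
      rintro ⟨x, hx, hx'⟩
      obtain ⟨y, hy, hy'⟩ := exists_cobarD_eq hR hx hx'
      exact ⟨⟨y, hy⟩, Subtype.ext hy'⟩)
  obtain ⟨g, hg⟩ := LinearMap.exists_extend s
  have hg' : ∀ z, cobarD R z = 0 → cobarProj R z = 0 → cobarD R (g z) = z := by
    intro z h1 h2
    have h3 : g z = s ⟨z, h1, h2⟩ := LinearMap.congr_fun hg ⟨z, h1, h2⟩
    rw [h3]
    exact congrArg Subtype.val (LinearMap.congr_fun hs ⟨z, h1, h2⟩)
  refine ⟨Finsupp.lsum k (fun n : ℕ => lapply (n + 1) ∘ₗ cobarComp R ∘ₗ K.subtype ∘ₗ g) ∘ₗ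
    cobarComp R, ?_, ?_, ?_⟩
  · intro n x hx
    rw [comp_apply, mem_homog.1 hx, Finsupp.lsum_single]
    exact grading_cobar.comp_mem _ _
  · intro x
    rw [comp_apply, Finsupp.lsum_apply, Finsupp.sum, map_sum]
    refine Finset.sum_eq_zero fun n _ => ?_
    change cobarProj R (cobarComp R (g (cobarComp R x n)) (n + 1)) = 0
    rw [← comp_cobarProj]
    exact Finsupp.single_eq_of_ne (by omega)
  · intro x hd hq
    rw [comp_apply, Finsupp.lsum_apply, Finsupp.sum, map_sum]
    conv_rhs => rw [← grading_cobar.sum_comp x, Finsupp.sum]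
    refine Finset.sum_congr rfl fun n _ => ?_
    change cobarD R (cobarComp R (g (cobarComp R x n)) (n + 1)) = _
    have h1 : cobarD R (cobarComp R x n) = 0 := by
      cases n with
      | zero => exact cobarD_of_zero (grading_cobar.comp_mem x 0)
      | succ n => rw [← comp_cobarD, hd, map_zero, Finsupp.zero_apply]
    have h2 : cobarProj R (cobarComp R x n) = 0 := by
      rw [← comp_cobarProj, hq, map_zero, Finsupp.zero_apply]
    rw [← comp_cobarD, hg' _ h1 h2, mem_homog.1 (grading_cobar.comp_mem x n),
      single_eq_same]

theorem signOp_of_deg_one {g : Cobar R →ₗ[k] Cobar R}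
    (hg : ∀ n, ∀ x ∈ homog (cobarComp R) n, g x ∈ homog (cobarComp R) (n + 1)) (x : Cobar R) :
    g (signOp (cobarComp R) x) = -signOp (cobarComp R) (g x) := by
  induction x using grading_cobar.induction with
  | add x y hx hy => simp only [map_add, hx, hy, neg_add]
  | hom n x hx => rw [signOp_of_mem hx, map_smul, signOp_of_mem (hg n x hx), pow_succ]; simp

/-- If `A` is Koszul, then the cobar construction contracts onto `A`. -/
theorem exists_isContraction (hR : IsKoszul R) :
    ∃ (i : QuadAlg R →ₗ[k] Cobar R) (H : Cobar R →ₗ[k] Cobar R),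
      IsContraction (cobarComp R) (cobarD R) (lsingle 0) 0 (cobarProj R) i H := by
  obtain ⟨g, hg, hqg, hdg⟩ := exists_section_cobarD hR
  obtain ⟨s, hs⟩ := LinearMap.exists_rightInverse_of_surjective (cobarProj R).toLinearMap
    (LinearMap.range_eq_top.2 cobarProj_surjective)
  set i : QuadAlg R →ₗ[k] Cobar R := lapply 0 ∘ₗ cobarComp R ∘ₗ s with hi
  have hmem : ∀ y, i y ∈ homog (cobarComp R) 0 := fun y => grading_cobar.comp_mem _ 0
  have hqi : ∀ y, cobarProj R (i y) = y := by
    intro y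
    have h1 : cobarProj R (s y) = y := LinearMap.congr_fun hs y
    change cobarProj R (cobarComp R (s y) 0) = y
    rw [← comp_cobarProj, h1]
    exact single_eq_same
  have hdi : ∀ y, cobarD R (i y) = 0 := fun y => cobarD_of_zero (hmem y)
  have hsi : ∀ y, signOp (cobarComp R) (i y) = i y := by
    intro y
    rw [signOp_of_mem (hmem y), pow_zero, one_smul]
  have hsq : ∀ x, cobarProj R (signOp (cobarComp R) x) = cobarProj R x := by
    intro x
    have h1 := (isAugDGAHom_cobarProj (R := R) (σ := AlgHom.id k _)
      (hσ := fun _ _ h => h)).map_signOp isAugDGA_cobar x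
    rw [h1, signOp_of_mem (mem_homog_lsingle (cobarProj R x)), pow_zero, one_smul]
  have hgd : ∀ x, cobarD R (g (cobarD R x)) = cobarD R x :=
    fun x => hdg _ (cobarD_cobarD x) (cobarProj_d x)
  -- `x - i q x - g d x` is a cycle in the kernel of `q`, so `g` of it serves as the homotopy.
  have hz : ∀ x, cobarD R (x - i (cobarProj R x) - g (cobarD R x)) = 0 := by
    intro x
    rw [map_sub, map_sub, hdi, hgd, sub_zero, sub_self]
  have hz' : ∀ x, cobarProj R (x - i (cobarProj R x) - g (cobarD R x)) = 0 := by
    intro x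
    rw [map_sub, map_sub, hqi, hqg, sub_zero, sub_self]
  refine ⟨i, g ∘ₗ (LinearMap.id - i ∘ₗ (cobarProj R).toLinearMap - g ∘ₗ cobarD R), hqi, ?_, ?_, ?_,
    ?_, ?_⟩
  · intro y
    rw [hsi, signOp_of_mem (mem_homog_lsingle y), pow_zero, one_smul]
  · intro y
    rw [hdi, LinearMap.zero_apply, map_zero]
  · intro x
    change cobarD R (g (x - i (cobarProj R x) - g (cobarD R x))) +
      g (cobarD R x - i (cobarProj R (cobarD R x)) - g (cobarD R (cobarD R x))) = _
    rw [hdg _ (hz x) (hz' x), cobarProj_d, cobarD_cobarD, map_zero, map_zero, sub_zero, sub_zero,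
      sub_add_cancel]
  · intro x
    change g (signOp (cobarComp R) x - i (cobarProj R (signOp (cobarComp R) x)) -
      g (cobarD R (signOp (cobarComp R) x))) =
      -signOp (cobarComp R) (g (x - i (cobarProj R x) - g (cobarD R x)))
    rw [← signOp_of_deg_one hg, map_sub (signOp (cobarComp R)), map_sub (signOp (cobarComp R)), hsi,
      hsq]
    congr 2
    rw [← neg_eq_iff_eq_neg.2 (cobarSign_cobarD x), map_neg, signOp_of_deg_one hg, neg_neg]
  · exact fun x => hqg _

theorem isMixedComplex_alg (hσ : IsGradedEnd R σ)
    (hss : ⨆ μ : k, eigenspace σ.toLinearMap μ = ⊤) :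
    IsMixedComplex (degAlg R) (oneAlg R σ) (bAlg R σ) (BAlg R σ) :=
  (isAugDGA_quad hσ).isMixedComplex hss

/-- Primitives and cycles are found among all chains, as the kernel of `p₁` is acyclic, and then
replaced by their components in the given degree and in the fixed points of `σ`. -/
theorem isMixedQuasiIso_p₁ (hR : IsKoszul R)
    (hss : ⨆ μ : k, eigenspace σ.toLinearMap μ = ⊤) :
    IsMixedQuasiIso (degCobar R) (oneCobar R σ hσ) (bCobar R σ hσ) (BCobar R σ hσ)
      (degAlg R) (oneAlg R σ) (bAlg R σ) (BAlg R σ) (p₁ R) := by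
  have h := isAugDGA_cobar (R := R) (σ := σ) (hσ := hσ)
  have h' := isAugDGA_quad hσ
  have hf := isAugDGAHom_cobarProj (R := R) (σ := σ) (hσ := hσ)
  obtain ⟨i, H, hc⟩ := exists_isContraction hR
  set T := chMap (cobarAug R) (cobarAug R) (cobarMap R σ hσ) with hT
  set T' := chMap (quadAug R) (quadAug R) σ with hT'
  have hTe : ⨆ μ, eigenspace T μ = ⊤ :=
    iSup_eigenspace_chMap h.aug_σ (iSup_eigenspace_cobarMap hss)
  have e1 : degCobar R = homog (chComp (cobarComp R) (cobarAug R)) := funext h.chDeg_eq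
  have e2 : degAlg R = homog (chComp (lsingle 0) (quadAug R)) := funext h'.chDeg_eq
  have m1 : ∀ x, x ∈ oneCobar R σ hσ ↔ T x = x := by
    intro x
    rw [oneCobar, chOne_eq h.aug_σ (iSup_eigenspace_cobarMap hss), mem_eigenspace_iff,
      one_smul]
  have m2 : ∀ x, x ∈ oneAlg R σ ↔ T' x = x := by
    intro x
    rw [oneAlg, chOne_eq h'.aug_σ hss, mem_eigenspace_iff, one_smul]
  have hb : ∀ x, p₁ R (bCobar R σ hσ x) = bAlg R σ (p₁ R x) := hf.chMap_hochB h h'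
  have hB : ∀ x, p₁ R (BCobar R σ hσ x) = BAlg R σ (p₁ R x) := hf.chMap_connesB h h'
  have hpT : ∀ x, p₁ R (T x) = T' (p₁ R x) := by
    intro x
    induction x using h.ch_induction with
    | add x y hx hy => simp only [map_add, hx, hy]
    | smul r x hx => simp only [map_smul, hx]
    | base j x hx => simp only [p₁, hT, hT', chMap_tmul, barMap_one, cobarProj_cobarMap]
    | snoc e ω j a _ _ _ ih =>
      rw [p₁] at ih ⊢
      rw [hT, hT', chMap_letterMul, chMap_letterMul, chMap_letterMul, chMap_letterMul, ← hT, ← hT',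
        ih, cobarProj_cobarMap]
  have hbT : ∀ x, bCobar R σ hσ (T x) = T (bCobar R σ hσ x) :=
    fun x => (h.hom_self.chMap_hochB h h x).symm
  have hdeg : ∀ n, ∀ x ∈ homog (chComp (cobarComp R) (cobarAug R)) n,
      p₁ R x ∈ homog (chComp (lsingle 0) (quadAug R)) n := fun n x => hf.chMap_mem h h'
  have hlow : ∀ n, ∀ x ∈ homog (chComp (cobarComp R) (cobarAug R)) n,
      bCobar R σ hσ x ∈ lower (chComp (cobarComp R) (cobarAug R)) n := fun n x => h.hochB_mem
  have hsurj : ∀ y, ∃ x, p₁ R x = y := fun y => ⟨_, hc.chMap_chLin h' y⟩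
  have hacyc : ∀ x, bCobar R σ hσ x = 0 → p₁ R x = 0 →
      ∃ y, p₁ R y = 0 ∧ bCobar R σ hσ y = x := fun x => exists_hochB_eq hc h h' hf
  have hbb : ∀ x, bCobar R σ hσ (bCobar R σ hσ x) = 0 := h.hochB_hochB
  have hTdeg : ∀ n, ∀ x ∈ homog (chComp (cobarComp R) (cobarAug R)) n,
      T x ∈ homog (chComp (cobarComp R) (cobarAug R)) n := fun n x => h.hom_self.chMap_mem h h
  have hTcomp : ∀ x n, T x = x → T (chComp (cobarComp R) (cobarAug R) x n) =
      chComp (cobarComp R) (cobarAug R) x n := by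
    intro x n hx
    rw [← comp_apply_of_deg_zero h.grading_ch hTdeg, hx]
  rw [e1, e2]
  refine ⟨?_, fun n x hx => hdeg n x hx.2, fun x _ => hb x, fun x _ => hB x, ?_, ?_⟩
  · intro x hx
    rw [m2, ← hpT, (m1 x).1 hx]
  · rintro n x ⟨hx1, hx2⟩ hbx ⟨y, -, hy⟩
    obtain ⟨Y, rfl⟩ := hsurj y
    obtain ⟨z, -, hz⟩ := hacyc (x - bCobar R σ hσ Y) (by rw [map_sub, hbx, hbb, sub_zero])
      (by rw [map_sub, hb, hy, sub_self])
    have hW : bCobar R σ hσ (Y + z) = x := by rw [map_add, hz, add_sub_cancel]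
    obtain ⟨W, hW1, hW2⟩ := exists_fixed hTe hbT (Y + z) (by rw [hW, (m1 x).1 hx1])
    refine ⟨chComp (cobarComp R) (cobarAug R) W (n + 1), ⟨(m1 _).2 (hTcomp W _ hW1),
      h.grading_ch.comp_mem W _⟩, ?_⟩
    rw [← comp_apply_of_lower h.grading_ch hlow, hW2, hW, mem_homog.1 hx2, single_eq_same]
  · rintro n y ⟨hy1, hy2⟩ hby
    obtain ⟨Y, rfl⟩ := hsurj y
    obtain ⟨z, hz, hz'⟩ := hacyc (bCobar R σ hσ Y) (hbb Y) (by rw [hb, hby])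
    -- Being a cycle and lying over `y` are both preserved by the passage to fixed points if the two
    -- conditions are combined into one linear equation.
    have hX : ((bCobar R σ hσ).prod (p₁ R)) (Y - z) = (0, p₁ R Y) := by
      rw [LinearMap.prod_apply, Function.prod, map_sub, map_sub, hz, hz', sub_self, sub_zero]
    obtain ⟨X, hX1, hX2⟩ := exists_fixed hTe (T' := T.prodMap T')
      (f := (bCobar R σ hσ).prod (p₁ R)) (fun x => Prod.ext (hbT x) (hpT x)) (Y - z) (by
        rw [hX, LinearMap.prodMap_apply, map_zero, (m2 _).1 hy1])
    rw [hX] at hX2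
    have hX3 : bCobar R σ hσ X = 0 := congrArg Prod.fst hX2
    have hX4 : p₁ R X = p₁ R Y := congrArg Prod.snd hX2
    have hXn := h.grading_ch.comp_mem X n
    refine ⟨chComp (cobarComp R) (cobarAug R) X n, ⟨(m1 _).2 (hTcomp X n hX1), hXn⟩, ?_, 0,
      zero_mem _, ?_⟩
    · cases n with
      | zero => exact (mem_bot k).1 (hlow 0 _ hXn)
      | succ n => rw [← comp_apply_of_lower h.grading_ch hlow, hX3, map_zero, Finsupp.zero_apply]
    · rw [← comp_apply_of_deg_zero h.grading_ch hdeg, hX4, mem_homog.1 hy2, single_eq_same,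
        sub_self, map_zero]

end Resolution

end KoszulHH

end

theorem mainTheorem3 {k : Type*} [Field k] {V : Type*} [AddCommGroup V] [Module k V]
    [FiniteDimensional k V] (R : Submodule k (V ⊗[k] V)) (hR : IsKoszul R)
    (σ : QuadAlg R ≃ₐ[k] QuadAlg R) (hσ : IsGradedEnd R (σ : QuadAlg R →ₐ[k] QuadAlg R))
    (hss : ⨆ μ : k, Module.End.eigenspace (σ : QuadAlg R →ₐ[k] QuadAlg R).toLinearMap μ = ⊤) :
    -- the three mixed complexes
    IsMixedComplex (degAlg R) (oneAlg R σ) (bAlg R σ) (BAlg R σ) ∧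
    IsMixedComplex (degCobar R) (oneCobar R σ hσ) (bCobar R σ hσ) (BCobar R σ hσ) ∧
    IsMixedComplex (coDeg R) (coOne R σ hσ) (coB R σ hσ) (coConnesB R σ hσ) ∧
    -- the two quasi-isomorphisms
    IsMixedQuasiIso (degCobar R) (oneCobar R σ hσ) (bCobar R σ hσ) (BCobar R σ hσ)
      (degAlg R) (oneAlg R σ) (bAlg R σ) (BAlg R σ) (p₁ R) ∧
    IsMixedQuasiIso (degCobar R) (oneCobar R σ hσ) (bCobar R σ hσ) (BCobar R σ hσ)
      (coDeg R) (coOne R σ hσ) (coB R σ hσ) (coConnesB R σ hσ) (q₂ R σ hσ) ∧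
    -- `p₂` is a morphism of complexes
    (∀ x ∈ coOne R σ hσ, p₂ R x ∈ oneCobar R σ hσ) ∧
    (∀ n, ∀ x ∈ coDeg R n, p₂ R x ∈ degCobar R n) ∧
    (∀ x, p₂ R (coB R σ hσ x) = bCobar R σ hσ (p₂ R x)) ∧
    -- the homotopy `h` preserves the subspace and has degree one
    (∀ x ∈ oneCobar R σ hσ, homotopy R x ∈ oneCobar R σ hσ) ∧
    (∀ n, ∀ x ∈ degCobar R n, homotopy R x ∈ degCobar R (n + 1)) ∧
    -- `q₂` is a homotopy inverse of `p₂`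
    (∀ x, q₂ R σ hσ (p₂ R x) = x) ∧
    (∀ x, homotopy R (bCobar R σ hσ x) + bCobar R σ hσ (homotopy R x) =
      x - p₂ R (q₂ R σ hσ x)) := by
  refine ⟨isMixedComplex_alg hσ hss, isMixedComplex_cobar hss, isMixedComplex_co hss,
    isMixedQuasiIso_p₁ hR hss, isMixedQuasiIso_q₂ hss,
    fun x hx => p₂_mem_oneCobar hss hx, fun n x hx => ?_, p₂_coB,
    fun x hx => homotopy_mem_oneCobar hss hx, fun n x hx => ?_, q₂_p₂, homotopy_hochB⟩
  · rw [coDeg_eq] at hx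
    rw [degCobar_eq]
    exact p₂_mem hx
  · rw [degCobar_eq] at hx ⊢
    exact homotopy_mem hx
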